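/- **Setting.** Let $N\ge 2$, $k\ge 1$, $0<\delta<1$, and let $T_1$ be the regular rooted metric tree in which one edge leaves the root $O$, $k$ edges leave the upper end of every edge, every edge $e$ of generation $j$ ($j=0,1,2,\dots$) has length $\ell_j>0$, and the radius $\sum_j\ell_j$ is finite. Let $\Omega\subset\mathbb R^{N-1}$ and $V\subset\mathbb R^N$ be bounded Lipschitz domains that contain the origin (their center). Assume that $\partial V$ contains $k+1$ disjoint flat sections, $S_0$ isometric to $\Omega$ and $S_1,\dots,S_k$ isometric to $\delta\Omega$, such that the center of each section is the orthogonal projection of the center of $V$ to it; let $h_i>0$ be the distance from the center of $V$ to $S_i$, and assume $h_0\le\ell_0$ and $\delta^jh_i+\delta^{j+1}h_0\le\ell_{j+1}$ for all $j\ge0$, $1\le i\le k$. For $0<\varepsilon<1$ let $T_N^\varepsilon$ be the $N$-dimensional flat manifold obtained from $T_1$ as follows. The vertex at the upper end of an edge $e$ of generation $j$ is replaced by $\varepsilon\delta^jV$, whose section $S_0$ faces $e$ and whose sections $S_1,\dots,S_k$ face the $k$ edges that leave the vertex, and the remaining part $\overline E^\varepsilon(e)$ of $e$ is replaced by the cylinder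 $\overline E^\varepsilon(e)\times\varepsilon\delta^j\Omega$, attached perpendicularly to these sections. The part of $T_1$ replaced by an inflated vertex is its skeleton $\overline V^\varepsilon(v)$, a star with center $v$ whose legs have lengths $\varepsilon\delta^jh_0,\dots,\varepsilon\delta^jh_k$ and end at points $p_e$, one for each edge $e$ of the set $N(v)$ of edges that meet at $v$. Nothing is inserted at the root, where the first cylinder begins with the section $O\times\varepsilon\Omega$. Let $H_0^1(T_N^\varepsilon)$ be the closure in the $H^1$-norm of the $C^1$ functions on $T_N^\varepsilon$ that have finite $H^1$-norm and vanish on $O\times\varepsilon\Omega$. The Laplace operator on $T_N^\varepsilon$ is the nonnegative self-adjoint operator in $L^2(T_N^\varepsilon)$ associated with the form $\int\nabla u\cdot\nabla\overline w$ on $H_0^1(T_N^\varepsilon)$. Let $\rho^*=\delta^{(N-1)j}|\Omega|$ on the edges of generation $j$, and let $H^1_{0,*}(T_1)$ be the closure, in the norm $(\int_{T_1}(|f'|^2+|f|^2)\rho^*\,d\theta)^{1/2}$, of the continuous functions on $T_1$ that are $C^1$ on every closed edge, have finite norm and vanish at $O$. Let $L_*u=-(\rho^*)^{-1}(\rho^*u')'$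 be the self-adjoint operator in $L^2_{\rho^*}(T_1)$ associated with the form $\int_{T_1}u'\overline v'\rho^*\,d\theta$ on $H^1_{0,*}(T_1)$. Fix a partition of unity on the skeleton $\overline V$ of $V$ into nonnegative $C^1$ functions $\psi_{(e)}$, one for each leg, with $\psi_{(e)}=1$ at the end of the leg $e$ and $0$ at the ends of the other legs, and let $\psi_{(e)}^\varepsilon$ be its rescaling to $\overline V^\varepsilon(v)$. For $u\in H^1_0(T_N^\varepsilon)$ let $P^\varepsilon u$ be the function on $T_1$ whose value at $\theta\in\overline E^\varepsilon(e)$ is the average of $u$ over the cross-section at $\theta$ (in its continuous representative, end points included), and $P^\varepsilon u=\sum_{e\in N(v)}(P^\varepsilon u)(p_e)\,\psi_{(e)}^\varepsilon$ on $\overline V^\varepsilon(v)$. **Theorem.** Let $\varepsilon_n\in(0,1)$, $\varepsilon_n\to0$, and let $u_{\varepsilon_n}\in H_0^1(T_N^{\varepsilon_n})$ be eigenfunctions of the Laplace operator on $T_N^{\varepsilon_n}$ with eigenvalues $\lambda_{\varepsilon_n}$, such that $\|u_{\varepsilon_n}\|_{L^2(T_N^{\varepsilon_n})}=\varepsilon_n^{(N-1)/2}$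 and $\lambda_{\varepsilon_n}\to\lambda^*$. Then the functions $P^{\varepsilon_n}u_{\varepsilon_n}$ are well defined, and there is an eigenfunction $u^*\ne0$ of $L_*$ with eigenvalue $\lambda^*$ such that, along a subsequence, $P^{\varepsilon_n}u_{\varepsilon_n}\to u^*$ locally uniformly on $T_1$. Moreover, on every closed edge $u^*$ is twice continuously differentiable with $-(u^*)''=\lambda^*u^*$, $u^*(O)=0$, and $u^*$ satisfies the Kirchhoff conditions at every vertex $v\ne O$: it is continuous at $v$, and $\sum_{e\in N(v)}\rho^*_e\,(u^*_e)'(v)=0$, where the derivatives are taken in the direction away from $v$. -/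

import Mathlib

open MeasureTheory Set Filter Topology
open scoped Pointwise

noncomputable section

/-- A bounded Lipschitz domain: nonempty, open, connected, bounded, and near each boundary point it
is the region below the graph of a Lipschitz function. The graph is taken in the direction `e`; the
function `φ` does not change along `e`, so it is a function on the hyperplane orthogonal to `e`. -/
structure IsLipschitzDomain {n : ℕ} (U : Set (EuclideanSpace ℝ (Fin n))) : Prop where
  isOpen : IsOpen U
  isConnected : IsConnected U
  isBounded : Bornology.IsBounded U
  lipschitz_boundary : ∀ x ∈ frontier U, ∃ (e : EuclideanSpace ℝ (Fin n)) (K : NNReal)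
    (φ : EuclideanSpace ℝ (Fin n) → ℝ) (r : ℝ), ‖e‖ = 1 ∧ LipschitzWith K φ ∧
      (∀ y (t : ℝ), φ (y + t • e) = φ y) ∧ 0 < r ∧
      ∀ y ∈ Metric.ball x r, (y ∈ U ↔ inner ℝ e y < φ y)

/-- The point of `ℝ × ℝ^d = ℝ^(d+1)` with axial coordinate `θ` and transversal coordinate `s`. -/
def axialPoint {d : ℕ} (θ : ℝ) (s : EuclideanSpace ℝ (Fin d)) : EuclideanSpace ℝ (Fin (d + 1)) :=
  WithLp.toLp 2 (Fin.cons θ (fun i => s i))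

/-- The transversal part of a point of `ℝ^(d+1) = ℝ × ℝ^d`; the axial part is `x 0`. -/
def transversal {d : ℕ} (x : EuclideanSpace ℝ (Fin (d + 1))) : EuclideanSpace ℝ (Fin d) :=
  WithLp.toLp 2 (fun i => x i.succ)

/-- The edges of the rooted tree in which one edge leaves the root and `k` edges leave the upper
end of every edge. The word `w` is an edge of generation `w.length`, the empty word is the edge at
the root, and the edges that leave the upper end of `w` are `i :: w`. Every vertex other than the
root is the upper end of exactly one edge, so these vertices are labelled by words as well; the
vertex `w` has generation `w.length + 1`. -/
inductive Word (k : ℕ) : Type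
  | mk (w : List (Fin k)) : Word k

namespace Word

/-- The generation of an edge. -/
def gen {k : ℕ} : Word k → ℕ
  | mk w => w.length

/-- The edge at the root. -/
def root (k : ℕ) : Word k := mk []

/-- The `i`-th edge that leaves the upper end of an edge. -/
def child {k : ℕ} (i : Fin k) : Word k → Word k
  | mk w => mk (i :: w)

/-- The edges meeting at the vertex `w`: `none` stands for the edge `w` that leads to it from the
root, `some i` for the edge `child i w`. -/
def nbr {k : ℕ} (w : Word k) : Option (Fin k) → Word k
  | none => w
  | some i => child i w

instance (k : ℕ) : MeasurableSpace (Word k) := ⊤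

end Word

/-- The pieces of the inflated tree: the inflated edges, and the inflated vertices. -/
inductive Piece (k : ℕ) : Type
  | edge (w : Word k) : Piece k
  | vert (w : Word k) : Piece k

instance (k : ℕ) : MeasurableSpace (Piece k) := ⊤

/-- The shape of section `j` of the inflated vertex: `Ω` for the section that faces the root, `δ Ω`
for the others. -/
def sectionShape {d k : ℕ} (Ω : Set (EuclideanSpace ℝ (Fin d))) (δ : ℝ) :
    Option (Fin k) → Set (EuclideanSpace ℝ (Fin d))
  | none => Ω
  | some _ => δ • Ω

/-- The data from which the metric tree `T₁` and the inflated trees `T_N^ε`, `N = d + 1`, are built: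
the edge lengths, which depend on the generation only, the scaling factor `δ`, the cross-section
`Ω ⊆ ℝ^(N-1)`, and the inflated vertex `V ⊆ ℝ^N` with its `k + 1` flat sections. Section `j` is
`{frame j (height j, s) | s ∈ sectionShape Ω δ j}`: the isometric image of `Ω` (for `j = none`) or of
`δ Ω` (for `j = some i`), whose center is the orthogonal projection of the center `0` of `V`, at
distance `height j`. -/
structure TreeData (d k : ℕ) where
  len : ℕ → ℝ
  len_pos : ∀ j, 0 < len j
  δ : ℝ
  δ_pos : 0 < δ
  δ_lt_one : δ < 1
  Ω : Set (EuclideanSpace ℝ (Fin d))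
  Ω_lipschitz : IsLipschitzDomain Ω
  zero_mem_Ω : 0 ∈ Ω
  V : Set (EuclideanSpace ℝ (Fin (d + 1)))
  V_lipschitz : IsLipschitzDomain V
  zero_mem_V : 0 ∈ V
  height : Option (Fin k) → ℝ
  height_pos : ∀ j, 0 < height j
  frame : Option (Fin k) → EuclideanSpace ℝ (Fin (d + 1)) ≃ₗᵢ[ℝ] EuclideanSpace ℝ (Fin (d + 1))
  /-- Each section is a flat part of the boundary of `V`, with `V` on the side of the center, so
  that a cylinder over the section can be attached from the outside. -/
  section_boundary : ∀ j, ∀ s ∈ sectionShape Ω δ j,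
    ∀ᶠ x in 𝓝 (axialPoint (height j) s), (frame j x ∈ V ↔ x 0 < height j)
  section_disjoint : ∀ j j', j ≠ j' →
    Disjoint ((fun s => frame j (axialPoint (height j) s)) '' sectionShape Ω δ j)
      ((fun s => frame j' (axialPoint (height j') s)) '' sectionShape Ω δ j')
  /-- The inflated vertices at the two ends of an edge do not overlap, for `ε < 1`. -/
  fits_root : height none ≤ len 0
  fits : ∀ (n : ℕ) (i : Fin k), δ ^ n * height (some i) + δ ^ (n + 1) * height none ≤ len (n + 1)

namespace TreeData

variable {d k : ℕ} (T : TreeData d k)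

/-! ### The metric tree `T₁`

A point of `T₁` is a pair `(w, t)` with `0 ≤ t ≤ |w|`, where `t` is the distance to the lower end of
the edge `w`; a function on `T₁` is a function of `(w, t)`. -/

/-- The length of an edge. -/
def edgeLen (w : Word k) : ℝ := T.len w.gen

/-- The coordinate, on the edge `w.nbr j`, of the point at distance `r` from the vertex `w`. -/
def legPos (w : Word k) : Option (Fin k) → ℝ → ℝ
  | none, r => T.edgeLen w - r
  | some _, r => r

/-- The weight `ρ*`, which is constant on each edge. -/
def rho (w : Word k) : ℝ := T.δ ^ (d * w.gen) * (volume T.Ω).toReal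

/-- The measure `ρ* dθ` on `T₁`. -/
def treeMeasure : Measure (Word k × ℝ) :=
  Measure.sum fun w => ENNReal.ofReal (T.rho w) •
    (volume.restrict (Icc 0 (T.edgeLen w))).map (Prod.mk w)

/-- `C¹(T₁)`: continuous on `T₁` and continuously differentiable on every closed edge. -/
structure IsC1Tree (f : Word k × ℝ → ℂ) : Prop where
  contDiffOn : ∀ w, ContDiffOn ℝ 1 (fun t => f (w, t)) (Icc 0 (T.edgeLen w))
  continuous_vertex : ∀ w i, f (Word.child i w, 0) = f (w, T.edgeLen w)

/-- The edgewise derivative of a function on `T₁`. -/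
def treeDeriv (f : Word k × ℝ → ℂ) : Word k × ℝ → ℂ := fun q =>
  derivWithin (fun t => f (q.1, t)) (Icc 0 (T.edgeLen q.1)) q.2

/-- `u ∈ H¹_{0,ρ*}(T₁)` with derivative `g`: the pair `(u, g)` is a limit in `L²(ρ* dθ)` of pairs
`(f, f')` with `f ∈ C¹(T₁)` of finite norm that vanish at the root. -/
def MemH10Tree (u g : Word k × ℝ → ℂ) : Prop :=
  MemLp u 2 T.treeMeasure ∧ MemLp g 2 T.treeMeasure ∧
    ∀ η : ENNReal, 0 < η → ∃ f, T.IsC1Tree f ∧ f (Word.root k, 0) = 0 ∧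
      MemLp f 2 T.treeMeasure ∧ MemLp (T.treeDeriv f) 2 T.treeMeasure ∧
      eLpNorm (u - f) 2 T.treeMeasure < η ∧ eLpNorm (g - T.treeDeriv f) 2 T.treeMeasure < η

/-- `u` is an eigenfunction with eigenvalue `lam` of the limit operator
`u ↦ -(ρ*)⁻¹ (ρ* u')'`, the self-adjoint operator in `L²(ρ* dθ)` of the form `∫ u' v̄' ρ* dθ` with
form domain `H¹_{0,ρ*}(T₁)`. -/
def IsTreeEigenfunction (lam : ℝ) (u : Word k × ℝ → ℂ) : Prop :=
  ∃ g, T.MemH10Tree u g ∧ ¬ u =ᵐ[T.treeMeasure] 0 ∧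
    ∀ v h, T.MemH10Tree v h →
      ∫ q, inner ℂ (h q) (g q) ∂T.treeMeasure = lam * ∫ q, inner ℂ (v q) (u q) ∂T.treeMeasure

/-- The Kirchhoff conditions: continuity at the vertices, and balance of the weighted derivatives,
taken along all the edges that meet at a vertex in the direction away from it, at every vertex
except the root. The derivatives exist, as `u` is required to be `C¹` on every closed edge. -/
def Kirchhoff (u : Word k × ℝ → ℂ) : Prop :=
  T.IsC1Tree u ∧ ∀ w : Word k, ∑ j : Option (Fin k), (T.rho (w.nbr j) : ℂ) *
    derivWithin (fun r => u (w.nbr j, T.legPos w j r)) (Icc 0 (T.edgeLen (w.nbr j))) 0 = 0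

/-! ### The inflated tree `T_N^ε`

It is glued from the cylinders `E^ε(w)` and the scaled vertices `V^ε(w)`. A function on it is a
function of a piece and a point of `ℝ^N` in the coordinates of this piece. -/

/-- The scale of the inflated edge `w`, and of the inflated vertex at its upper end. -/
def scale (ε : ℝ) (w : Word k) : ℝ := ε * T.δ ^ w.gen

/-- The cross-section of the inflated edge `w`. -/
def crossSection (ε : ℝ) (w : Word k) : Set (EuclideanSpace ℝ (Fin d)) := T.scale ε w • T.Ω

/-- The axial coordinate at which the inflated edge begins: there is no inflated vertex at the
root, and on any other edge the skeleton of the lower vertex is cut off. -/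
def edgeStart (ε : ℝ) : Word k → ℝ
  | .mk [] => 0
  | .mk (i :: w) => T.scale ε (.mk w) * T.height (some i)

/-- The axial coordinate at which the inflated edge ends. -/
def edgeEnd (ε : ℝ) (w : Word k) : ℝ := T.edgeLen w - T.scale ε w * T.height none

/-- The inflated edges and vertices as open subsets of `ℝ^N`. -/
def piece (ε : ℝ) : Piece k → Set (EuclideanSpace ℝ (Fin (d + 1)))
  | .edge w => {x | T.edgeStart ε w < x 0 ∧ x 0 < T.edgeEnd ε w ∧
      transversal x ∈ T.crossSection ε w}
  | .vert w => T.scale ε w • T.V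

/-- Lebesgue measure on `T_N^ε`. -/
def inflatedMeasure (ε : ℝ) : Measure (Piece k × EuclideanSpace ℝ (Fin (d + 1))) :=
  Measure.sum fun i => (volume.restrict (T.piece ε i)).map (Prod.mk i)

/-- The coordinates, on the inflated edge `w.nbr j`, of the point `frame j x` that lies beyond
section `j` of the inflated vertex `w`. -/
def legCoord (w : Word k) :
    Option (Fin k) → EuclideanSpace ℝ (Fin (d + 1)) → EuclideanSpace ℝ (Fin (d + 1))
  | none, x => axialPoint (T.edgeLen w - x 0) (transversal x)
  | some _, x => x

/-- A function on `T_N^ε` near section `j` of the inflated vertex `w`, in a chart of the glued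
manifold: the section is at axial coordinate `scale * height`, the vertex before it and the edge
after it. -/
def glued (ε : ℝ) (f : Piece k × EuclideanSpace ℝ (Fin (d + 1)) → ℂ) (w : Word k)
    (j : Option (Fin k)) (x : EuclideanSpace ℝ (Fin (d + 1))) : ℂ :=
  if x 0 ≤ T.scale ε w * T.height j then f (.vert w, T.frame j x)
  else f (.edge (w.nbr j), T.legCoord w j x)

/-- `C¹` functions on `T_N^ε` (up to the root section) that vanish on the root section. -/
structure IsC1Root (ε : ℝ) (f : Piece k × EuclideanSpace ℝ (Fin (d + 1)) → ℂ) : Prop where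
  contDiffOn_piece : ∀ i, ContDiffOn ℝ 1 (fun x => f (i, x)) (T.piece ε i)
  contDiffAt_section : ∀ w j, ∀ s ∈ T.crossSection ε (w.nbr j),
    ContDiffAt ℝ 1 (T.glued ε f w j) (axialPoint (T.scale ε w * T.height j) s)
  contDiffOn_root : ContDiffOn ℝ 1 (fun x => f (.edge (Word.root k), x))
    {x | 0 ≤ x 0 ∧ x 0 < T.edgeEnd ε (Word.root k) ∧
      transversal x ∈ T.crossSection ε (Word.root k)}
  eq_zero_root : ∀ s ∈ T.crossSection ε (Word.root k),
    f (.edge (Word.root k), axialPoint 0 s) = 0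

/-- The gradient on each piece. -/
def grad (f : Piece k × EuclideanSpace ℝ (Fin (d + 1)) → ℂ) :
    Piece k × EuclideanSpace ℝ (Fin (d + 1)) → EuclideanSpace ℂ (Fin (d + 1)) := fun q =>
  WithLp.toLp 2 fun m => fderiv ℝ (fun x => f (q.1, x)) q.2 (EuclideanSpace.single m 1)

/-- `u ∈ H¹₀(T_N^ε)` with gradient `G`: the pair `(u, G)` is a limit in `L²` of pairs `(f, ∇f)` with
`f` a `C¹` function of finite norm that vanishes on the root section. -/
def MemH10 (ε : ℝ) (u : Piece k × EuclideanSpace ℝ (Fin (d + 1)) → ℂ)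
    (G : Piece k × EuclideanSpace ℝ (Fin (d + 1)) → EuclideanSpace ℂ (Fin (d + 1))) : Prop :=
  MemLp u 2 (T.inflatedMeasure ε) ∧ MemLp G 2 (T.inflatedMeasure ε) ∧
    ∀ η : ENNReal, 0 < η → ∃ f, T.IsC1Root ε f ∧
      MemLp f 2 (T.inflatedMeasure ε) ∧ MemLp (grad f) 2 (T.inflatedMeasure ε) ∧
      eLpNorm (u - f) 2 (T.inflatedMeasure ε) < η ∧
      eLpNorm (G - grad f) 2 (T.inflatedMeasure ε) < η

/-- `u` is an eigenfunction with eigenvalue `lam` of the Laplace operator on `T_N^ε`, the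
self-adjoint operator of the form `∫ ∇u · ∇w̄` with form domain `H¹₀(T_N^ε)`. -/
def IsEigenfunction (ε lam : ℝ) (u : Piece k × EuclideanSpace ℝ (Fin (d + 1)) → ℂ) : Prop :=
  ∃ G, T.MemH10 ε u G ∧ ¬ u =ᵐ[T.inflatedMeasure ε] 0 ∧
    ∀ w H, T.MemH10 ε w H →
      ∫ q, inner ℂ (H q) (G q) ∂T.inflatedMeasure ε =
        lam * ∫ q, inner ℂ (w q) (u q) ∂T.inflatedMeasure ε

/-! ### The projection `P^ε` -/

/-- A `C¹` partition of unity on the skeleton of `V`, the star with legs of lengths `height j`: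
`ψ j j' r` is the value of the function that belongs to leg `j` at the point of leg `j'` at distance
`r` from the center. -/
structure IsSkeletonPartition (ψ : Option (Fin k) → Option (Fin k) → ℝ → ℝ) : Prop where
  contDiffOn : ∀ j j', ContDiffOn ℝ 1 (ψ j j') (Icc 0 (T.height j'))
  continuous_center : ∀ j j' j'', ψ j j' 0 = ψ j j'' 0
  nonneg : ∀ j j', ∀ r ∈ Icc 0 (T.height j'), 0 ≤ ψ j j' r
  eq_one : ∀ j, ψ j j (T.height j) = 1
  eq_zero : ∀ j j', j ≠ j' → ψ j j' (T.height j') = 0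
  sum_eq_one : ∀ j', ∀ r ∈ Icc 0 (T.height j'), ∑ j, ψ j j' r = 1

/-- `p = P^ε u`. On the skeleton of each inflated edge, `p` is the average of `u` over the
cross-sections; as `u` is given up to null sets, this means the continuous representative, whose
values at the end points are the averages of the traces of `u` on the sections. On the skeleton of
each inflated vertex, `p` is the combination of the partition of unity with these end values. -/
structure IsProjection (ψ : Option (Fin k) → Option (Fin k) → ℝ → ℝ) (ε : ℝ)
    (u : Piece k × EuclideanSpace ℝ (Fin (d + 1)) → ℂ) (p : Word k × ℝ → ℂ) : Prop where
  continuousOn_edge : ∀ w,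
    ContinuousOn (fun θ => p (w, θ)) (Icc (T.edgeStart ε w) (T.edgeEnd ε w))
  average_edge : ∀ w, ∀ᵐ θ ∂volume.restrict (Icc (T.edgeStart ε w) (T.edgeEnd ε w)),
    p (w, θ) = ⨍ s in T.crossSection ε w, u (.edge w, axialPoint θ s)
  eq_vertex : ∀ w j', ∀ r ∈ Icc 0 (T.scale ε w * T.height j'),
    p (w.nbr j', T.legPos w j' r) = ∑ j : Option (Fin k),
      p (w.nbr j, T.legPos w j (T.scale ε w * T.height j)) * (ψ j j' (r / T.scale ε w) : ℂ)

end TreeData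

end

open scoped ComplexConjugate

/-! The limit is taken in a family of explicit functions. A function of the axial coordinate alone,
supported in one cylinder, is an admissible test function because nothing is prescribed on the
lateral boundary. Hence, for every fixed `ε`, the cross-section averages of an eigenfunction with
eigenvalue `ω²` solve `-P'' = ω² P` exactly on each cylinder (`IsEigenpair.exists_oscSol`). They are
determined by two complex numbers per edge, the value and the slope at the midpoint. The energy
identity `∫ |∇u|² = λ ∫ |u|²` and the normalisation bound these numbers edge by edge, uniformly in
`ε` (`IsProfile.norm_coeff_le`). By Tychonoff's theorem a subsequence converges on all edges at
once, so that the profiles and their derivatives converge and the limit solves the equation with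
`λ*` (`exists_isLimit`).

Continuity at the vertices rests on Poincaré inequalities on the scaled copies of `V`, on the
cross-sections, and on balls that straddle a section. Together they bound the difference between the
average over an inflated vertex and the end value of an adjacent profile by a power of the scale
times the local energy (`exists_average_sub_profile_le`,
`exists_rho_mul_vertAverage_sub_profile_le`). The difference tends to zero. The projection on the
skeleton of a vertex is a convex combination of the end values, so it converges to their common
limit (`IsLimit.eventually_vertex`). The Dirichlet condition already holds for each profile
(`IsProfile.profile_root_zero`).

The limit equation is tested through vertex data. Data on the vertices are interpolated by functions
that are constant near the inflated vertices. Integration by parts against a profile leaves boundary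
terms on the edges, and the integrals over the inflated vertices carry an extra factor `ε`. An `ℓ²`
domination allows termwise passage to the limit (`IsLimit.hasSum_nodal`). A `C¹` function on the
tree, integrated by parts against the limit profile, also enters only through its vertex values. The
identity for vertex data is therefore the weak equation for all `C¹` test functions, and data
concentrated at one vertex give the Kirchhoff condition there.

It remains to exclude that the mass escapes to the deep generations
(`exists_summable_generation_bound`). Let `X j` be the suitably normalised quadratic mean of the
vertex averages over generation `j`, and let `κ = k δ^d`, the ratio of the total weights of
consecutive generations. The energy controls the increments of `X` with weights `ℓ_j / κ^j`. If `∑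
κ^j ℓ_j` converges, the increments are summed from the root. If it diverges, then `κ > 1`, and
finiteness of the mass forces `X J` to be arbitrarily small for suitable large `J`, from which the
increments are summed backwards. In both cases the masses of the generations have a summable
majorant independent of `ε`, and dominated convergence shows that the limit is not zero
(`IsLimit.exists_profile_ne_zero`). -/

theorem enorm_sub_sq_le_lintegral_fderiv {E : Type*} [NormedAddCommGroup E] [NormedSpace ℝ E]
    {U : Set E} (hU : IsOpen U) {g : E → ℂ}
    (hg : ContDiffOn ℝ 1 g U) {x h : E} (hseg : ∀ t ∈ Icc (0 : ℝ) 1, x + t • h ∈ U) :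
    ‖g (x + h) - g x‖ₑ ^ 2 ≤
      ‖h‖ₑ ^ 2 * ∫⁻ t in Icc (0 : ℝ) 1, ‖fderiv ℝ g (x + t • h)‖ₑ ^ 2 := by
  have hcont : ContinuousOn (fun t : ℝ => fderiv ℝ g (x + t • h)) (Icc 0 1) :=
    (hg.continuousOn_fderiv_of_isOpen hU le_rfl).comp (by fun_prop) hseg
  have hder : ∀ t ∈ uIcc (0 : ℝ) 1,
      HasDerivAt (fun t : ℝ => g (x + t • h)) (fderiv ℝ g (x + t • h) h) t := by
    intro t ht
    rw [uIcc_of_le zero_le_one] at ht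
    have h1 : HasFDerivAt g (fderiv ℝ g (x + t • h)) (x + t • h) :=
      ((hg.contDiffAt (hU.mem_nhds (hseg t ht))).differentiableAt (by norm_num)).hasFDerivAt
    have h2 : HasDerivAt (fun t : ℝ => x + t • h) h t := by
      simpa using ((hasDerivAt_id t).smul_const h).const_add x
    exact h1.comp_hasDerivAt t h2
  have hftc := intervalIntegral.integral_eq_sub_of_hasDerivAt hder
    (ContinuousOn.intervalIntegrable (by
      rw [uIcc_of_le zero_le_one]; exact hcont.clm_apply continuousOn_const))
  have hle : ‖g (x + h) - g x‖ₑ ≤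
      ‖h‖ₑ * ∫⁻ t in Icc (0 : ℝ) 1, ‖fderiv ℝ g (x + t • h)‖ₑ := by
    have : g (x + h) - g x = ∫ t in (0 : ℝ)..1, fderiv ℝ g (x + t • h) h := by
      rw [hftc]; simp
    rw [this, intervalIntegral.integral_of_le zero_le_one, ← integral_Icc_eq_integral_Ioc]
    calc _ ≤ ∫⁻ t in Icc (0 : ℝ) 1, ‖fderiv ℝ g (x + t • h) h‖ₑ :=
          enorm_integral_le_lintegral_enorm _
      _ ≤ ∫⁻ t in Icc (0 : ℝ) 1, ‖h‖ₑ * ‖fderiv ℝ g (x + t • h)‖ₑ :=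
          lintegral_mono fun t => by
            rw [mul_comm]; exact ContinuousLinearMap.le_opENorm _ _
      _ = _ := lintegral_const_mul' _ _ (by simp)
  have hjensen : (∫⁻ t in Icc (0 : ℝ) 1, ‖fderiv ℝ g (x + t • h)‖ₑ) ^ 2 ≤
      ∫⁻ t in Icc (0 : ℝ) 1, ‖fderiv ℝ g (x + t • h)‖ₑ ^ 2 := by
    have hm : AEStronglyMeasurable (fun t : ℝ => fderiv ℝ g (x + t • h))
        (volume.restrict (Icc 0 1)) := hcont.aestronglyMeasurable measurableSet_Icc
    have hp : IsProbabilityMeasure (volume.restrict (Icc (0 : ℝ) 1)) := ⟨by simp⟩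
    have := eLpNorm_le_eLpNorm_of_exponent_le (p := 1) (q := 2) (by norm_num) hm
    rw [eLpNorm_one_eq_lintegral_enorm] at this
    calc _ ≤ (eLpNorm (fun t : ℝ => fderiv ℝ g (x + t • h)) 2
          (volume.restrict (Icc 0 1))) ^ 2 := by gcongr
      _ = _ := by
        rw [eLpNorm_eq_lintegral_rpow_enorm_toReal (by norm_num) (by norm_num)]
        rw [← ENNReal.rpow_natCast, ← ENNReal.rpow_mul]
        simp
  calc _ ≤ (‖h‖ₑ * ∫⁻ t in Icc (0 : ℝ) 1, ‖fderiv ℝ g (x + t • h)‖ₑ) ^ 2 := by gcongr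
    _ = ‖h‖ₑ ^ 2 * (∫⁻ t in Icc (0 : ℝ) 1, ‖fderiv ℝ g (x + t • h)‖ₑ) ^ 2 := mul_pow _ _ _
    _ ≤ _ := by gcongr

/-! ### Poincaré inequalities on convex sets and on bounded Lipschitz domains -/

section Poincare

variable {E : Type*} [NormedAddCommGroup E] [NormedSpace ℝ E] [FiniteDimensional ℝ E]
  [MeasurableSpace E] [BorelSpace E] {μ : Measure E} [μ.IsAddHaarMeasure]

/-- Translating a set inside `U` costs at most the Dirichlet energy. -/
theorem lintegral_translate_sub_sq_le {U A : Set E} (hU : IsOpen U) {g : E → ℂ}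
    (hg : ContDiffOn ℝ 1 g U) (hA : MeasurableSet A) {h : E}
    (hseg : ∀ x ∈ A, ∀ t ∈ Icc (0 : ℝ) 1, x + t • h ∈ U) :
    ∫⁻ x in A, ‖g (x + h) - g x‖ₑ ^ 2 ∂μ ≤ ‖h‖ₑ ^ 2 * ∫⁻ x in U, ‖fderiv ℝ g x‖ₑ ^ 2 ∂μ := by
  set D : E → ENNReal := U.indicator fun y => ‖fderiv ℝ g y‖ₑ ^ 2 with hD
  have hDm : Measurable D := ((measurable_fderiv ℝ g).enorm.pow_const 2).indicator hU.measurableSet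
  calc _ ≤ ∫⁻ x in A, ‖h‖ₑ ^ 2 * (∫⁻ t in Icc (0 : ℝ) 1, D (x + t • h)) ∂μ := by
        refine setLIntegral_mono' hA fun x hx => ?_
        refine (enorm_sub_sq_le_lintegral_fderiv hU hg (hseg x hx)).trans ?_
        refine mul_le_mul_right ?_ _
        refine setLIntegral_mono' (measurableSet_Icc (a := (0 : ℝ)) (b := 1)) fun t ht => ?_
        rw [hD, indicator_of_mem (hseg x hx t ht)]
    _ = ‖h‖ₑ ^ 2 * ∫⁻ x in A, (∫⁻ t in Icc (0 : ℝ) 1, D (x + t • h)) ∂μ :=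
        lintegral_const_mul' _ _ (by simp)
    -- Since `D` is cut off to `U`, enlarging `A` to the whole space is harmless. After Tonelli,
    -- translation invariance makes the inner integral independent of `t`.
    _ ≤ ‖h‖ₑ ^ 2 * ∫⁻ x, (∫⁻ t in Icc (0 : ℝ) 1, D (x + t • h)) ∂μ := by
        gcongr; exact Measure.restrict_le_self
    _ = ‖h‖ₑ ^ 2 * ∫⁻ t in Icc (0 : ℝ) 1, ∫⁻ x, D (x + t • h) ∂μ := by
        rw [lintegral_lintegral_swap]
        exact (hDm.comp (by fun_prop : Measurable fun p : E × ℝ => p.1 + p.2 • h)).aemeasurable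
    _ = ‖h‖ₑ ^ 2 * ∫⁻ x, D x ∂μ := by
        congr 1
        simp only [lintegral_add_right_eq_self D]
        simp
    _ = _ := by rw [hD, lintegral_indicator hU.measurableSet]

/-- The Poincaré inequality on a convex set, as a double integral. -/
theorem lintegral_lintegral_sub_sq_le_of_convex {U : Set E} (hU : IsOpen U) (hc : Convex ℝ U)
    {z : E} {r : ℝ} (hr : U ⊆ Metric.ball z r) {g : E → ℂ} (hg : ContDiffOn ℝ 1 g U) :
    ∫⁻ x in U, ∫⁻ y in U, ‖g y - g x‖ₑ ^ 2 ∂μ ∂μ ≤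
      μ (Metric.ball 0 (2 * r)) * ENNReal.ofReal (2 * r) ^ 2 *
        ∫⁻ x in U, ‖fderiv ℝ g x‖ₑ ^ 2 ∂μ := by
  set φ : E → ℂ := U.indicator g with hφ
  have hφm : Measurable φ := by
    classical
    rw [hφ, ← piecewise_eq_indicator]
    exact hg.continuousOn.measurable_piecewise continuousOn_const hU.measurableSet
  set J : E → E → ENNReal := fun x y =>
    U.indicator 1 x * (U.indicator 1 y * ‖φ y - φ x‖ₑ ^ 2) with hJ
  have hJm : Measurable (Function.uncurry J) := by
    have h1 : Measurable (U.indicator (1 : E → ENNReal)) :=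
      measurable_one.indicator hU.measurableSet
    have := (h1.comp measurable_fst).mul ((h1.comp measurable_snd).mul
      (((hφm.comp measurable_snd).sub (hφm.comp measurable_fst)).enorm.pow_const 2))
    exact this
  have h1 : ∫⁻ x in U, ∫⁻ y in U, ‖g y - g x‖ₑ ^ 2 ∂μ ∂μ = ∫⁻ x, ∫⁻ y, J x y ∂μ ∂μ := by
    rw [← lintegral_indicator hU.measurableSet]
    congr 1; ext x
    by_cases hx : x ∈ U
    · rw [indicator_of_mem hx, ← lintegral_indicator hU.measurableSet]
      congr 1; ext y
      by_cases hy : y ∈ U <;> simp [hJ, hx, hy, hφ]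
    · simp [hJ, hx]
  -- The substitution `y = x + h` turns the double integral into an integral over `h` of translation
  -- differences. Only `h` of norm less than `2 r` contribute, because `U` lies in a ball of radius
  -- `r`.
  have h2 : ∫⁻ x, ∫⁻ y, J x y ∂μ ∂μ = ∫⁻ h, ∫⁻ x, J x (x + h) ∂μ ∂μ := by
    rw [lintegral_lintegral_swap (f := fun h x => J x (x + h))]
    · congr 1; ext x
      exact (lintegral_add_left_eq_self (J x) x).symm
    · exact (hJm.comp (by fun_prop : Measurable fun p : E × E => (p.2, p.2 + p.1))).aemeasurable
  rw [h1, h2]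
  have h3 : ∀ h, ∫⁻ x, J x (x + h) ∂μ ≤ (Metric.ball (0 : E) (2 * r)).indicator
      (fun _ => ENNReal.ofReal (2 * r) ^ 2 * ∫⁻ x in U, ‖fderiv ℝ g x‖ₑ ^ 2 ∂μ) h := by
    intro h
    by_cases hh : h ∈ Metric.ball (0 : E) (2 * r)
    · rw [indicator_of_mem hh]
      set A : Set E := U ∩ (fun x => x + h) ⁻¹' U
      have hA : MeasurableSet A := (hU.inter (hU.preimage (by fun_prop))).measurableSet
      have h4 : ∫⁻ x, J x (x + h) ∂μ = ∫⁻ x in A, ‖g (x + h) - g x‖ₑ ^ 2 ∂μ := by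
        rw [← lintegral_indicator hA]
        congr 1; ext x
        by_cases hx : x ∈ U <;> by_cases hy : x + h ∈ U <;> simp [A, hJ, hx, hy, hφ]
      rw [h4]
      refine (lintegral_translate_sub_sq_le hU hg hA fun x hx t ht => ?_).trans ?_
      · have := hc hx.1 hx.2 (a := 1 - t) (b := t) (by linarith [ht.2]) ht.1 (by ring)
        convert this using 1
        module
      · gcongr
        rw [← ofReal_norm]
        exact ENNReal.ofReal_le_ofReal (by simpa using (mem_ball_zero_iff.1 hh).le)
    · rw [indicator_of_notMem hh]
      refine le_of_eq ?_
      rw [lintegral_eq_zero_iff (by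
        exact hJm.comp (by fun_prop : Measurable fun x : E => (x, x + h)))]
      refine Eventually.of_forall fun x => ?_
      by_cases hx : x ∈ U
      · have hy : x + h ∉ U := fun hy => hh (by
          have a := hr hx
          have b := hr hy
          rw [mem_ball_iff_norm] at a b
          rw [mem_ball_zero_iff]
          calc ‖h‖ = ‖(x + h - z) - (x - z)‖ := by congr 1; abel
            _ ≤ ‖x + h - z‖ + ‖x - z‖ := norm_sub_le _ _
            _ < _ := by linarith)
        simp [hJ, hy]
      · simp [hJ, hx]
  calc _ ≤ _ := lintegral_mono h3
    _ = _ := by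
      rw [lintegral_indicator Metric.isOpen_ball.measurableSet, setLIntegral_const]; ring

/-- The `L²`-norm over `A` of a `C¹` function on `U` is controlled by the norm over `B` and the
Dirichlet energy on `U`. -/
def L2Controlled (μ : Measure E) (U B A : Set E) : Prop :=
  ∃ C : NNReal, ∀ g : E → ℂ, ContDiffOn ℝ 1 g U →
    ∫⁻ x in A, ‖g x‖ₑ ^ 2 ∂μ ≤
      C * (∫⁻ x in B, ‖g x‖ₑ ^ 2 ∂μ + ∫⁻ x in U, ‖fderiv ℝ g x‖ₑ ^ 2 ∂μ)

theorem L2Controlled.mono {U B A A' : Set E} (h : L2Controlled μ U B A) (hA : A' ⊆ A) :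
    L2Controlled μ U B A' := by
  obtain ⟨C, hC⟩ := h
  exact ⟨C, fun g hg => (lintegral_mono_set hA).trans (hC g hg)⟩

theorem enorm_add_sq_le (a b : ℂ) : ‖a + b‖ₑ ^ 2 ≤ 2 * (‖a‖ₑ ^ 2 + ‖b‖ₑ ^ 2) := by
  have h1 : ‖a + b‖ ^ 2 ≤ 2 * (‖a‖ ^ 2 + ‖b‖ ^ 2) := by
    have := norm_add_le a b
    nlinarith [sq_nonneg (‖a‖ - ‖b‖), norm_nonneg (a + b), norm_nonneg a, norm_nonneg b]
  have h2 := ENNReal.ofReal_le_ofReal h1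
  rwa [ENNReal.ofReal_mul (by norm_num), ENNReal.ofReal_add (by positivity) (by positivity),
    ENNReal.ofReal_pow (by positivity), ENNReal.ofReal_pow (by positivity),
    ENNReal.ofReal_pow (by positivity), ofReal_norm, ofReal_norm, ofReal_norm,
    ENNReal.ofReal_ofNat] at h2

/-- Write `g x` as `g (x + v)` minus `g (x + v) - g x`: the first term lives on `A`, where control
is known, and the second costs only energy. Control thus travels along segments inside `U`. -/
theorem L2Controlled.translate {U B A A' : Set E} (h : L2Controlled μ U B A) (hU : IsOpen U)
    (hA : MeasurableSet A') {v : E} (hv : ∀ x ∈ A', x + v ∈ A)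
    (hseg : ∀ x ∈ A', ∀ t ∈ Icc (0 : ℝ) 1, x + t • v ∈ U) : L2Controlled μ U B A' := by
  obtain ⟨C, hC⟩ := h
  refine ⟨2 * (‖v‖₊ ^ 2 + C), fun g hg => ?_⟩
  have h1 : ∫⁻ x in A', ‖g (x + v)‖ₑ ^ 2 ∂μ ≤ ∫⁻ x in A, ‖g x‖ₑ ^ 2 ∂μ := by
    have hemb : MeasurableEmbedding fun x : E => x + v := measurableEmbedding_addRight v
    have := hemb.lintegral_map (μ := μ.restrict A') fun x => ‖g x‖ₑ ^ 2
    rw [← this]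
    have h2 : (μ.restrict A').map (fun x => x + v) ≤ μ.restrict A := by
      have h3 : MeasurePreserving (fun x : E => x + v) μ μ := measurePreserving_add_right μ v
      refine (Measure.map_mono (Measure.restrict_mono (fun x hx => hv x hx) le_rfl)
        hemb.measurable).trans (le_of_eq (?_ : _ = _))
      · exact (h3.restrict_preimage_emb hemb A).map_eq
    exact lintegral_mono' h2 le_rfl
  have hgm : AEMeasurable (fun x => ‖g (x + v) - g x‖ₑ ^ 2) (μ.restrict A') := by
    have hc : ContinuousOn (fun x => g (x + v) - g x) A' := by
      refine ContinuousOn.sub (hg.continuousOn.comp (by fun_prop) fun x hx => ?_)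
        (hg.continuousOn.mono fun x hx => ?_)
      · simpa using hseg x hx 1 (by simp)
      · simpa using hseg x hx 0 (by simp)
    exact (hc.aestronglyMeasurable hA).enorm.pow_const 2
  calc ∫⁻ x in A', ‖g x‖ₑ ^ 2 ∂μ
      ≤ ∫⁻ x in A', 2 * (‖g (x + v) - g x‖ₑ ^ 2 + ‖g (x + v)‖ₑ ^ 2) ∂μ := by
        refine lintegral_mono fun x => ?_
        have := enorm_add_sq_le (-(g (x + v) - g x)) (g (x + v))
        rw [enorm_neg] at this
        convert this using 3
        ring
    _ = 2 * (∫⁻ x in A', ‖g (x + v) - g x‖ₑ ^ 2 ∂μ + ∫⁻ x in A', ‖g (x + v)‖ₑ ^ 2 ∂μ) := by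
        rw [lintegral_const_mul' _ _ (by norm_num), lintegral_add_left' hgm]
    _ ≤ 2 * (‖v‖ₑ ^ 2 * ∫⁻ x in U, ‖fderiv ℝ g x‖ₑ ^ 2 ∂μ +
          C * (∫⁻ x in B, ‖g x‖ₑ ^ 2 ∂μ + ∫⁻ x in U, ‖fderiv ℝ g x‖ₑ ^ 2 ∂μ)) := by
        gcongr
        · exact lintegral_translate_sub_sq_le hU hg hA hseg
        · exact h1.trans (hC g hg)
    _ ≤ 2 * (‖v‖ₑ ^ 2 * (∫⁻ x in B, ‖g x‖ₑ ^ 2 ∂μ + ∫⁻ x in U, ‖fderiv ℝ g x‖ₑ ^ 2 ∂μ) +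
          C * (∫⁻ x in B, ‖g x‖ₑ ^ 2 ∂μ + ∫⁻ x in U, ‖fderiv ℝ g x‖ₑ ^ 2 ∂μ)) := by
        gcongr; exact le_add_self
    _ = _ := by push_cast; rw [enorm_eq_nnnorm]; ring

theorem L2Controlled.union {U B A A' : Set E} (h : L2Controlled μ U B A)
    (h' : L2Controlled μ U B A') : L2Controlled μ U B (A ∪ A') := by
  obtain ⟨C, hC⟩ := h
  obtain ⟨C', hC'⟩ := h'
  refine ⟨C + C', fun g hg => (lintegral_union_le _ _ _).trans ?_⟩
  push_cast
  rw [add_mul]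
  exact add_le_add (hC g hg) (hC' g hg)

theorem L2Controlled.biUnion {ι : Type*} {U B : Set E} {A : ι → Set E} (s : Finset ι)
    (h : ∀ i ∈ s, L2Controlled μ U B (A i)) : L2Controlled μ U B (⋃ i ∈ s, A i) := by
  classical
  induction s using Finset.induction_on with
  | empty => exact ⟨0, fun g _ => by simp⟩
  | insert i s hi ih =>
    rw [Finset.set_biUnion_insert]
    exact (h i (Finset.mem_insert_self i s)).union
      (ih fun j hj => h j (Finset.mem_insert_of_mem hj))

/-- Near every point of a connected open set, functions are controlled by their values near a
given point. -/
theorem exists_ball_L2Controlled {U : Set E} (hU : IsOpen U) (hconn : IsPreconnected U) {x₀ : E}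
    {r₀ : ℝ} (hr₀ : 0 < r₀) (hx₀ : x₀ ∈ U) (x : E) (hx : x ∈ U) :
    ∃ r > 0, L2Controlled μ U (Metric.ball x₀ r₀) (Metric.ball x r) := by
  -- A connectedness argument: the set of points with a controlled neighbourhood is open, contains
  -- `x₀`, and is closed relative to `U`, because a controlled ball close to `y` can be translated
  -- onto a ball around `y`.
  set S : Set E := {x | ∃ r > 0, L2Controlled μ U (Metric.ball x₀ r₀) (Metric.ball x r)} with hS
  have hopen : IsOpen S := by
    rw [Metric.isOpen_iff]
    rintro x ⟨r, hr, h⟩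
    refine ⟨r / 2, by positivity, fun y hy => ⟨r / 2, by positivity, h.mono ?_⟩⟩
    exact Metric.ball_subset_ball' (by rw [Metric.mem_ball] at hy; linarith)
  have hx₀S : x₀ ∈ S := ⟨r₀, hr₀, 1, fun g _ => by simp⟩
  have hsub : U ⊆ S := by
    refine hconn.subset_of_closure_inter_subset hopen ⟨x₀, hx₀, hx₀S⟩ ?_
    rintro y ⟨hyS, hyU⟩
    obtain ⟨ρ, hρ, hball⟩ := Metric.isOpen_iff.1 hU y hyU
    obtain ⟨z, ⟨r, hr, hz⟩, hyz⟩ := Metric.mem_closure_iff.1 hyS (ρ / 2) (by positivity)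
    refine ⟨min r (ρ / 2), by positivity, hz.translate hU Metric.isOpen_ball.measurableSet
      (v := z - y) (fun x hx => ?_) fun x hx t ht => hball ?_⟩
    · rw [mem_ball_iff_norm] at hx ⊢
      calc _ = ‖x - y‖ := by congr 1; abel
        _ < _ := hx.trans_le (min_le_left _ _)
    · rw [mem_ball_iff_norm] at hx ⊢
      rw [dist_comm, dist_eq_norm] at hyz
      calc ‖x + t • (z - y) - y‖ = ‖(x - y) + t • (z - y)‖ := by congr 1; abel
        _ ≤ ‖x - y‖ + ‖t • (z - y)‖ := norm_add_le _ _
        _ ≤ ‖x - y‖ + 1 * ‖z - y‖ := by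
          rw [norm_smul, Real.norm_of_nonneg ht.1]; gcongr; exact ht.2
        _ < ρ := by linarith [hx.trans_le (min_le_right r (ρ / 2))]
  exact hsub hx

end Poincare

/-- All that is needed of the graph condition is that `U` can be entered from the boundary by moving
along `-e`. By continuity of `φ` a boundary point satisfies `inner ℝ e x ≤ φ x`, so every point
strictly below it in the chart is inside. The value of the Lipschitz constant plays no role. -/
theorem IsLipschitzDomain.frontier_eq {n : ℕ} {U : Set (EuclideanSpace ℝ (Fin n))}
    (hU : IsLipschitzDomain U) {x : EuclideanSpace ℝ (Fin n)} (hx : x ∈ frontier U) :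
    ∃ (e : EuclideanSpace ℝ (Fin n)) (r : ℝ), 0 < r ∧ ‖e‖ = 1 ∧
      (∀ y ∈ Metric.ball x r, ∀ t ≥ (0 : ℝ), y - t • e ∈ Metric.ball x r → y ∈ U → y - t • e ∈ U) ∧
      ∀ t > (0 : ℝ), x - t • e ∈ Metric.ball x r → x - t • e ∈ U := by
  obtain ⟨e, K, φ, r, he, hφ, hinv, hr, h⟩ := hU.lipschitz_boundary x hx
  have hinv' : ∀ y (t : ℝ), φ (y - t • e) = φ y := fun y t => by
    rw [sub_eq_add_neg, ← neg_smul]; exact hinv y _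
  have hin : ∀ y (t : ℝ), inner ℝ e (y - t • e) = inner ℝ e y - t := fun y t => by
    rw [inner_sub_right, inner_smul_right, real_inner_self_eq_norm_sq, he]; ring
  have hle : inner ℝ e x ≤ φ x := by
    have hxc : x ∈ closure (Metric.ball x r ∩ U) := by
      have := Metric.isOpen_ball.inter_closure
        (show x ∈ Metric.ball x r ∩ closure U from
          ⟨Metric.mem_ball_self hr, frontier_subset_closure hx⟩)
      exact this
    refine closure_minimal (s := Metric.ball x r ∩ U) (t := {y | inner ℝ e y ≤ φ y}) ?_ ?_ hxc
    · rintro y ⟨hy, hyU⟩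
      exact ((h y hy).1 hyU).le
    · exact isClosed_le (by fun_prop) hφ.continuous
  refine ⟨e, r, hr, he, fun y hy t ht hyt hyU => ?_, fun t ht hxt => ?_⟩
  · rw [h _ hyt, hin, hinv']
    linarith [(h y hy).1 hyU]
  · rw [h _ hxt, hin, hinv']
    linarith

theorem IsLipschitzDomain.exists_L2Controlled {n : ℕ} {U : Set (EuclideanSpace ℝ (Fin n))}
    (hU : IsLipschitzDomain U) {x₀ : EuclideanSpace ℝ (Fin n)} {r₀ : ℝ} (hr₀ : 0 < r₀)
    (hx₀ : x₀ ∈ U) : L2Controlled volume U (Metric.ball x₀ r₀) U := by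
  have hloc : ∀ x ∈ closure U, ∃ r > 0,
      L2Controlled volume U (Metric.ball x₀ r₀) (Metric.ball x r ∩ U) := by
    intro x hx
    by_cases hxU : x ∈ U
    · obtain ⟨r, hr, h⟩ := exists_ball_L2Controlled (μ := volume) hU.isOpen
        hU.isConnected.isPreconnected hr₀ hx₀ x hxU
      exact ⟨r, hr, h.mono inter_subset_left⟩
    have hxf : x ∈ frontier U := by
      rw [hU.isOpen.frontier_eq]; exact ⟨hx, hxU⟩
    -- Near a boundary point, `U` is pushed inwards by `(r / 2) • e` onto a ball around an interior
    -- point that is already controlled. The graph chart keeps the segments inside `U`.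
    obtain ⟨e, r, hr, he, hdown, hpt⟩ := hU.frontier_eq hxf
    have hyU : x - (r / 2) • e ∈ U := by
      refine hpt _ (by positivity) ?_
      rw [mem_ball_iff_norm, sub_sub_cancel_left, norm_neg, norm_smul, he,
        Real.norm_of_nonneg (by positivity)]
      linarith
    obtain ⟨s, hs, h⟩ := exists_ball_L2Controlled (μ := volume) hU.isOpen
      hU.isConnected.isPreconnected hr₀ hx₀ _ hyU
    refine ⟨min s (r / 2), by positivity, h.translate hU.isOpen
      (Metric.isOpen_ball.inter hU.isOpen).measurableSet (v := -((r / 2) • e)) ?_ ?_⟩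
    · rintro z ⟨hz, -⟩
      rw [mem_ball_iff_norm] at hz ⊢
      calc _ = ‖z - x‖ := by congr 1; abel
        _ < _ := hz.trans_le (min_le_left _ _)
    · rintro z ⟨hz, hzU⟩ t ht
      rw [mem_ball_iff_norm] at hz
      have hz2 := hz.trans_le (min_le_right s (r / 2))
      have hrw : z + t • -((r / 2) • e) = z - (t * (r / 2)) • e := by module
      rw [hrw]
      refine hdown z (by rw [mem_ball_iff_norm]; linarith) _ (mul_nonneg ht.1 (by positivity)) ?_
        hzU
      rw [mem_ball_iff_norm]
      calc ‖z - (t * (r / 2)) • e - x‖ = ‖(z - x) - (t * (r / 2)) • e‖ := by congr 1; abel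
        _ ≤ ‖z - x‖ + ‖(t * (r / 2)) • e‖ := norm_sub_le _ _
        _ = ‖z - x‖ + t * (r / 2) := by
          rw [norm_smul, he, Real.norm_of_nonneg (mul_nonneg ht.1 (by positivity)), mul_one]
        _ < r := by nlinarith [ht.2]
  choose! ρ hρ hctrl using hloc
  have hK : IsCompact (closure U) := hU.isBounded.isCompact_closure
  obtain ⟨t, ht, hcov⟩ := hK.elim_nhds_subcover (fun x => Metric.ball x (ρ x))
    fun x hx => Metric.ball_mem_nhds x (hρ x hx)
  refine (L2Controlled.biUnion (μ := volume) (A := fun x => Metric.ball x (ρ x) ∩ U) t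
    fun x hx => hctrl x (ht x hx)).mono fun x hx => ?_
  obtain ⟨y, hy, hxy⟩ := mem_iUnion₂.1 (hcov (subset_closure hx))
  exact mem_iUnion₂.2 ⟨y, hy, hxy, hx⟩

/-- The Poincaré inequality on a bounded Lipschitz domain, as a double integral. -/
theorem IsLipschitzDomain.exists_lintegral_lintegral_sub_sq_le {n : ℕ}
    {U : Set (EuclideanSpace ℝ (Fin n))} (hU : IsLipschitzDomain U) :
    ∃ C : NNReal, ∀ g : EuclideanSpace ℝ (Fin n) → ℂ, ContDiffOn ℝ 1 g U →
      ∫⁻ x in U, ∫⁻ y in U, ‖g y - g x‖ₑ ^ 2 ≤ C * ∫⁻ x in U, ‖fderiv ℝ g x‖ₑ ^ 2 := by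
  obtain ⟨x₀, hx₀⟩ := hU.isConnected.nonempty
  obtain ⟨r₀, hr₀, hball⟩ := Metric.isOpen_iff.1 hU.isOpen x₀ hx₀
  obtain ⟨C, hC⟩ := hU.exists_L2Controlled hr₀ hx₀
  set B := Metric.ball x₀ r₀ with hB
  have hBfin : volume B ≠ ⊤ := measure_ball_lt_top.ne
  have hUfin : volume U ≠ ⊤ := hU.isBounded.measure_lt_top.ne
  set b : ENNReal := volume (Metric.ball (0 : EuclideanSpace ℝ (Fin n)) (2 * r₀)) *
    ENNReal.ofReal (2 * r₀) ^ 2 with hb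
  have hbfin : b ≠ ⊤ := ENNReal.mul_ne_top measure_ball_lt_top.ne (by finiteness)
  set K : ENNReal := C * (C * (b + volume B) + volume U) with hK
  have hKfin : K ≠ ⊤ := by finiteness
  refine ⟨K.toNNReal, fun g hg => ?_⟩
  rw [ENNReal.coe_toNNReal hKfin]
  set D := ∫⁻ x in U, ‖fderiv ℝ g x‖ₑ ^ 2 with hD
  -- Subtracting a constant does not change the gradient. With `c = g x`, integrated in `x`, this
  -- shrinks one variable of the double integral from `U` to the ball `B`. Used twice, with the
  -- symmetry of the integrand in between, it reduces the claim to the convex set `B`.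
  have hstep : ∀ c : ℂ, ∫⁻ x in U, ‖g x - c‖ₑ ^ 2 ≤ C * ((∫⁻ x in B, ‖g x - c‖ₑ ^ 2) + D) := by
    intro c
    have := hC (fun x => g x - c) (hg.sub contDiffOn_const)
    simpa only [fderiv_sub_const] using this
  have hBB : ∫⁻ x in B, ∫⁻ y in B, ‖g y - g x‖ₑ ^ 2 ≤ b * D := by
    refine (lintegral_lintegral_sub_sq_le_of_convex Metric.isOpen_ball (convex_ball x₀ r₀)
      subset_rfl (hg.mono hball)).trans ?_
    exact mul_le_mul_right (lintegral_mono_set hball) _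
  have hmeas : ∀ A ⊆ U, MeasurableSet A → AEMeasurable
      (Function.uncurry fun x y => ‖g y - g x‖ₑ ^ 2)
      ((volume.restrict A).prod (volume.restrict U)) := by
    intro A hA hAm
    rw [Measure.prod_restrict]
    have : ContinuousOn (fun p : EuclideanSpace ℝ (Fin n) × EuclideanSpace ℝ (Fin n) =>
        g p.2 - g p.1) (A ×ˢ U) :=
      (hg.continuousOn.comp continuousOn_snd fun p hp => hp.2).sub
        (hg.continuousOn.comp continuousOn_fst fun p hp => hA hp.1)
    exact (this.aestronglyMeasurable (hAm.prod hU.isOpen.measurableSet)).enorm.pow_const 2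
  have hBU : ∫⁻ x in B, ∫⁻ y in U, ‖g y - g x‖ₑ ^ 2 ≤ C * (b + volume B) * D := by
    calc _ ≤ ∫⁻ x in B, C * ((∫⁻ y in B, ‖g y - g x‖ₑ ^ 2) + D) :=
          lintegral_mono fun x => hstep (g x)
      _ = C * ((∫⁻ x in B, ∫⁻ y in B, ‖g y - g x‖ₑ ^ 2) + D * volume B) := by
          rw [lintegral_const_mul' _ _ (by simp), lintegral_add_right _ measurable_const,
            setLIntegral_const]
      _ ≤ C * (b * D + D * volume B) := by gcongr
      _ = _ := by ring
  calc _ ≤ ∫⁻ x in U, C * ((∫⁻ y in B, ‖g y - g x‖ₑ ^ 2) + D) :=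
        lintegral_mono fun x => hstep (g x)
    _ = C * ((∫⁻ x in U, ∫⁻ y in B, ‖g y - g x‖ₑ ^ 2) + D * volume U) := by
        rw [lintegral_const_mul' _ _ (by simp), lintegral_add_right _ measurable_const,
          setLIntegral_const]
    _ = C * ((∫⁻ x in B, ∫⁻ y in U, ‖g y - g x‖ₑ ^ 2) + D * volume U) := by
        rw [lintegral_lintegral_swap (hmeas B hball Metric.isOpen_ball.measurableSet)]
        simp only [enorm_sub_rev]
    _ ≤ C * (C * (b + volume B) * D + D * volume U) := by gcongr
    _ = K * D := by rw [hK]; ring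

theorem lintegral_sq_le {α : Type*} [MeasurableSpace α] {ν : Measure α} {a : α → ENNReal}
    (ha : AEMeasurable a ν) : (∫⁻ x, a x ∂ν) ^ 2 ≤ ν univ * ∫⁻ x, a x ^ 2 ∂ν := by
  have h := ENNReal.lintegral_mul_le_Lp_mul_Lq ν Real.HolderConjugate.two_two
    (f := fun _ => 1) (g := a) aemeasurable_const ha
  simp only [Pi.mul_apply, one_mul, ENNReal.one_rpow, lintegral_const] at h
  calc _ ≤ ((ν univ) ^ (1 / 2 : ℝ) * (∫⁻ x, a x ^ (2 : ℝ) ∂ν) ^ (1 / 2 : ℝ)) ^ 2 := by gcongr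
    _ = _ := by
      rw [mul_pow, ← ENNReal.rpow_natCast, ← ENNReal.rpow_mul, ← ENNReal.rpow_natCast,
        ← ENNReal.rpow_mul]
      norm_num

theorem enorm_integral_sq_le {α : Type*} [MeasurableSpace α] {ν : Measure α} {f : α → ℂ}
    (hf : AEStronglyMeasurable f ν) : ‖∫ x, f x ∂ν‖ₑ ^ 2 ≤ ν univ * ∫⁻ x, ‖f x‖ₑ ^ 2 ∂ν :=
  (pow_le_pow_left' (enorm_integral_le_lintegral_enorm f) 2).trans (lintegral_sq_le hf.enorm)

/-- Jensen's inequality for the distance to the mean. -/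
theorem measure_mul_enorm_sub_average_sq_le {α : Type*} [MeasurableSpace α] {ν : Measure α}
    [IsFiniteMeasure ν] {f : α → ℂ} (hf : Integrable f ν) (c : ℂ) :
    ν univ * ‖c - ⨍ x, f x ∂ν‖ₑ ^ 2 ≤ ∫⁻ x, ‖f x - c‖ₑ ^ 2 ∂ν := by
  by_cases h0 : ν univ = 0
  · simp [h0]
  have h1 : ∫ x, (f x - c) ∂ν = ((ν univ).toReal : ℂ) * ((⨍ x, f x ∂ν) - c) := by
    rw [integral_sub hf (integrable_const c), average_eq, integral_const, Measure.real,
      Complex.real_smul, Complex.real_smul, Complex.ofReal_inv, mul_sub, mul_inv_cancel_left₀]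
    exact_mod_cast (ENNReal.toReal_pos h0 (measure_ne_top _ _)).ne'
  have h2 := enorm_integral_sq_le (hf.sub (integrable_const c)).aestronglyMeasurable
  simp only [Pi.sub_apply] at h2
  rw [h1, enorm_mul, mul_pow] at h2
  have h3 : ‖((ν univ).toReal : ℂ)‖ₑ = ν univ := by
    rw [← ofReal_norm, Complex.norm_real, Real.norm_of_nonneg ENNReal.toReal_nonneg,
      ENNReal.ofReal_toReal (measure_ne_top _ _)]
  rw [h3, sq, mul_assoc] at h2
  have h4 := (ENNReal.mul_le_mul_iff_right h0 (measure_ne_top ν univ)).1 h2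
  rwa [enorm_sub_rev]

/-- The mean is, up to a factor, the best constant approximation. -/
theorem lintegral_sub_average_sq_le {α : Type*} [MeasurableSpace α] {ν : Measure α}
    [IsFiniteMeasure ν] {f : α → ℂ} (hf : Integrable f ν) (c : ℂ) :
    ∫⁻ x, ‖f x - ⨍ y, f y ∂ν‖ₑ ^ 2 ∂ν ≤ 4 * ∫⁻ x, ‖f x - c‖ₑ ^ 2 ∂ν := by
  calc _ ≤ ∫⁻ x, 2 * (‖f x - c‖ₑ ^ 2 + ‖c - ⨍ y, f y ∂ν‖ₑ ^ 2) ∂ν :=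
        lintegral_mono fun x => by
          have := enorm_add_sq_le (f x - c) (c - ⨍ y, f y ∂ν)
          rwa [sub_add_sub_cancel] at this
    _ = 2 * ((∫⁻ x, ‖f x - c‖ₑ ^ 2 ∂ν) + ν univ * ‖c - ⨍ y, f y ∂ν‖ₑ ^ 2) := by
        rw [lintegral_const_mul' _ _ (by norm_num), lintegral_add_right _ measurable_const,
          lintegral_const, mul_comm (ν univ)]
    _ ≤ 2 * ((∫⁻ x, ‖f x - c‖ₑ ^ 2 ∂ν) + ∫⁻ x, ‖f x - c‖ₑ ^ 2 ∂ν) := by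
        gcongr; exact measure_mul_enorm_sub_average_sq_le hf c
    _ = _ := by ring

/-! ### Behaviour of the Poincaré inequality under dilations -/

section Scaling

variable {n : ℕ}

theorem setLIntegral_smul_set {U : Set (EuclideanSpace ℝ (Fin n))}
    (F : EuclideanSpace ℝ (Fin n) → ENNReal) {s : ℝ} (hs : 0 < s) :
    ∫⁻ x in s • U, F x = ENNReal.ofReal (s ^ n) * ∫⁻ x in U, F (s • x) := by
  have hemb : MeasurableEmbedding (fun x : EuclideanSpace ℝ (Fin n) => s • x) :=
    (Homeomorph.smulOfNeZero s hs.ne').measurableEmbedding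
  have h1 : (volume.restrict U).map (fun x : EuclideanSpace ℝ (Fin n) => s • x) =
      ENNReal.ofReal (s ^ n)⁻¹ • volume.restrict (s • U) := by
    have h2 := Measure.map_addHaar_smul (volume : Measure (EuclideanSpace ℝ (Fin n))) hs.ne'
    rw [finrank_euclideanSpace_fin, abs_of_pos (by positivity)] at h2
    rw [← Measure.restrict_smul, ← h2, hemb.restrict_map, preimage_smul₀ hs.ne', smul_smul,
      inv_mul_cancel₀ hs.ne', one_smul]
  rw [← hemb.lintegral_map (μ := volume.restrict U) F, h1, lintegral_smul_measure, smul_eq_mul,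
    ← mul_assoc, ← ENNReal.ofReal_mul (by positivity), mul_inv_cancel₀ (by positivity)]
  simp

theorem volume_smul_set {U : Set (EuclideanSpace ℝ (Fin n))} {s : ℝ} (hs : 0 < s) :
    volume (s • U) = ENNReal.ofReal (s ^ n) * volume U := by
  rw [Measure.addHaar_smul_of_nonneg _ hs.le, finrank_euclideanSpace_fin]

/-- The Poincaré inequality on scaled copies of a bounded Lipschitz domain. -/
theorem IsLipschitzDomain.exists_poincare {U : Set (EuclideanSpace ℝ (Fin n))}
    (hU : IsLipschitzDomain U) :
    ∃ C : NNReal, ∀ s : ℝ, 0 < s → ∀ g : EuclideanSpace ℝ (Fin n) → ℂ,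
      ContDiffOn ℝ 1 g (s • U) → IntegrableOn g (s • U) →
      ∫⁻ x in s • U, ‖g x - ⨍ y in s • U, g y‖ₑ ^ 2 ≤
        C * ENNReal.ofReal s ^ 2 * ∫⁻ x in s • U, ‖fderiv ℝ g x‖ₑ ^ 2 := by
  obtain ⟨C, hC⟩ := hU.exists_lintegral_lintegral_sub_sq_le
  have hU0 : volume U ≠ 0 := (hU.isOpen.measure_pos _ hU.isConnected.nonempty).ne'
  have hU1 : volume U ≠ ⊤ := hU.isBounded.measure_lt_top.ne
  refine ⟨(volume U).toNNReal⁻¹ * C, fun s hs g hg hgi => ?_⟩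
  have hfin : IsFiniteMeasure (volume.restrict (s • U)) := by
    constructor
    rw [Measure.restrict_apply_univ, volume_smul_set hs]
    exact ENNReal.mul_lt_top ENNReal.ofReal_lt_top hU1.lt_top
  set gs : EuclideanSpace ℝ (Fin n) → ℂ := fun x => g (s • x)
  have hgs : ContDiffOn ℝ 1 gs U :=
    hg.comp (by fun_prop) fun x hx => smul_mem_smul_set hx
  have h1 := hC gs hgs
  have hder : ∀ x, ‖fderiv ℝ gs x‖ₑ ^ 2 = ENNReal.ofReal s ^ 2 * ‖fderiv ℝ g (s • x)‖ₑ ^ 2 := by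
    intro x
    rw [fderiv_comp_smul, enorm_smul, mul_pow, ← ofReal_norm, Real.norm_of_nonneg hs.le]
  simp only [hder] at h1
  rw [lintegral_const_mul' _ _ (by finiteness)] at h1
  set v := ENNReal.ofReal (s ^ n) with hv
  have hv0 : v ≠ 0 := by simp only [hv, ne_eq, ENNReal.ofReal_eq_zero, not_le]; positivity
  have hv1 : v ≠ ⊤ := by simp [hv]
  -- The prefactor is the volume of `s • U`, which lets Jensen's inequality replace the mean by an
  -- inner integral. The double integral scales with `v * v`. Cancelling the prefactor leaves one
  -- `v` for the single integral over `s • U`, and the chain rule supplies the factor `s ^ 2`.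
  have h2 : volume U * v * ∫⁻ x in s • U, ‖g x - ⨍ y in s • U, g y‖ₑ ^ 2 ≤
      v * v * ∫⁻ x in U, ∫⁻ y in U, ‖gs y - gs x‖ₑ ^ 2 := by
    calc _ = ∫⁻ x in s • U, volume (s • U) * ‖g x - ⨍ y in s • U, g y‖ₑ ^ 2 := by
          rw [lintegral_const_mul' _ _ (by rw [volume_smul_set hs]; finiteness),
            volume_smul_set hs]
          ring
      _ ≤ ∫⁻ x in s • U, ∫⁻ y in s • U, ‖g y - g x‖ₑ ^ 2 := by
          refine lintegral_mono fun x => ?_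
          have := measure_mul_enorm_sub_average_sq_le hgi (g x)
          rwa [Measure.restrict_apply_univ] at this
      _ = _ := by
          rw [setLIntegral_smul_set _ hs]
          simp_rw [setLIntegral_smul_set (U := U) (fun y => ‖g y - g _‖ₑ ^ 2) hs]
          rw [lintegral_const_mul' _ _ hv1]
          ring
  rw [setLIntegral_smul_set (fun x => ‖fderiv ℝ g x‖ₑ ^ 2) hs]
  have h3 : volume U * v * ∫⁻ x in s • U, ‖g x - ⨍ y in s • U, g y‖ₑ ^ 2 ≤
      volume U * v * ((volume U)⁻¹ * C * ENNReal.ofReal s ^ 2 *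
        (v * ∫⁻ x in U, ‖fderiv ℝ g (s • x)‖ₑ ^ 2)) := by
    refine h2.trans ?_
    calc _ ≤ v * v * (C * (ENNReal.ofReal s ^ 2 * ∫⁻ x in U, ‖fderiv ℝ g (s • x)‖ₑ ^ 2)) := by
          gcongr
      _ = (volume U * (volume U)⁻¹) *
          (v * v * (C * (ENNReal.ofReal s ^ 2 * ∫⁻ x in U, ‖fderiv ℝ g (s • x)‖ₑ ^ 2))) := by
          rw [ENNReal.mul_inv_cancel hU0 hU1, one_mul]
      _ = _ := by ring
  have h4 := (ENNReal.mul_le_mul_iff_right (mul_ne_zero hU0 hv0)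
    (ENNReal.mul_ne_top hU1 hv1)).1 h3
  convert h4 using 3
  rw [ENNReal.coe_mul, ENNReal.coe_inv, ENNReal.coe_toNNReal hU1]
  rw [ne_eq, ENNReal.toNNReal_eq_zero_iff]; simp [hU0, hU1]

end Scaling

/-! ### Axial and transversal coordinates; cylinders as product spaces -/

section Axial

variable {d : ℕ}

@[simp] theorem axialPoint_zero (θ : ℝ) (s : EuclideanSpace ℝ (Fin d)) : axialPoint θ s 0 = θ := rfl

@[simp] theorem transversal_axialPoint (θ : ℝ) (s : EuclideanSpace ℝ (Fin d)) :
    transversal (axialPoint θ s) = s := rfl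

@[simp] theorem axialPoint_transversal (x : EuclideanSpace ℝ (Fin (d + 1))) :
    axialPoint (x 0) (transversal x) = x := by
  ext i
  refine Fin.cases rfl (fun i => rfl) i

/-- The splitting of `ℝ^(d+1)` into axial and transversal coordinates. -/
noncomputable def axialEquiv (d : ℕ) :
    (ℝ × EuclideanSpace ℝ (Fin d)) ≃L[ℝ] EuclideanSpace ℝ (Fin (d + 1)) :=
  LinearEquiv.toContinuousLinearEquiv
    { toFun := fun q => axialPoint q.1 q.2
      invFun := fun x => (x 0, transversal x)
      left_inv := fun q => rfl
      right_inv := fun x => axialPoint_transversal x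
      map_add' := fun q q' => by
        ext i
        refine Fin.cases rfl (fun i => rfl) i
      map_smul' := fun c q => by
        ext i
        refine Fin.cases rfl (fun i => rfl) i }

@[simp] theorem axialEquiv_apply (q : ℝ × EuclideanSpace ℝ (Fin d)) :
    axialEquiv d q = axialPoint q.1 q.2 := rfl

theorem measurePreserving_axialEquiv : MeasurePreserving (axialEquiv d)
    ((volume : Measure ℝ).prod volume) volume := by
  have h1 := (volume_preserving_piFinSuccAbove (fun _ : Fin (d + 1) => ℝ) 0).symm
  have h2 := PiLp.volume_preserving_toLp (Fin (d + 1))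
  have h3 := (MeasurePreserving.id (volume : Measure ℝ)).prod
    (PiLp.volume_preserving_ofLp (Fin d))
  have h4 := h2.comp (h1.comp h3)
  have heq : ⇑(axialEquiv d) = WithLp.toLp 2 ∘
      (MeasurableEquiv.piFinSuccAbove (fun _ : Fin (d + 1) => ℝ) 0).symm ∘
        Prod.map id WithLp.ofLp := by
    ext q i
    refine Fin.cases rfl (fun i => ?_) i
    rfl
  rw [heq]
  exact h4

theorem measurableEmbedding_axialEquiv : MeasurableEmbedding (axialEquiv d) :=
  (axialEquiv d).toHomeomorph.measurableEmbedding

/-- A cylinder as a product. -/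
theorem measurePreserving_axialEquiv_restrict (I : Set ℝ) (S : Set (EuclideanSpace ℝ (Fin d))) :
    MeasurePreserving (axialEquiv d) ((volume.restrict I).prod (volume.restrict S))
      (volume.restrict {x | x 0 ∈ I ∧ transversal x ∈ S}) := by
  rw [Measure.prod_restrict]
  exact measurePreserving_axialEquiv.restrict_preimage_emb measurableEmbedding_axialEquiv
    {x | x 0 ∈ I ∧ transversal x ∈ S}

theorem continuous_transversal :
    Continuous (transversal : EuclideanSpace ℝ (Fin (d + 1)) → EuclideanSpace ℝ (Fin d)) :=
  continuous_snd.comp (axialEquiv d).symm.continuous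

theorem contDiff_axialPoint {n : WithTop ℕ∞} : ContDiff ℝ n
    (fun q : ℝ × EuclideanSpace ℝ (Fin d) => axialPoint q.1 q.2) :=
  (axialEquiv d).contDiff

theorem norm_axialPoint_zero_left (s : EuclideanSpace ℝ (Fin d)) : ‖axialPoint 0 s‖ = ‖s‖ := by
  rw [EuclideanSpace.norm_eq, EuclideanSpace.norm_eq, Fin.sum_univ_succ]
  simp [axialPoint]

end Axial

/-! ### Weak solutions of `P'' = -ω² P` on an interval -/

/-- Smooth functions with compact support in the interval `(a, b)`. -/
structure IsTestFunction (a b : ℝ) (φ : ℝ → ℝ) : Prop where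
  contDiff : ContDiff ℝ ((⊤ : ℕ∞) : WithTop ℕ∞) φ
  hasCompactSupport : HasCompactSupport φ
  tsupport_subset : tsupport φ ⊆ Ioo a b

theorem IsTestFunction.exists_subset_Icc {a b : ℝ} (hab : a < b) {φ : ℝ → ℝ}
    (h : IsTestFunction a b φ) : ∃ a' b', a < a' ∧ a' < b' ∧ b' < b ∧ tsupport φ ⊆ Icc a' b' := by
  by_cases hne : (tsupport φ).Nonempty
  · obtain ⟨x, hx, hxle⟩ := h.hasCompactSupport.isCompact.exists_isLeast hne
    obtain ⟨y, hy, hyle⟩ := h.hasCompactSupport.isCompact.exists_isGreatest hne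
    have hx' := h.tsupport_subset hx
    have hy' := h.tsupport_subset hy
    have hxy : x ≤ y := hxle hy
    -- The right end is taken beyond the maximum `y` of the support so that `a' < b'` holds even
    -- without `x < y`.
    refine ⟨x, (y + b) / 2, hx'.1, by linarith [hy'.2], by linarith [hy'.2], fun z hz =>
      ⟨hxle hz, ?_⟩⟩
    have := hyle hz
    linarith [hy'.2]
  · rw [not_nonempty_iff_eq_empty] at hne
    exact ⟨(2 * a + b) / 3, (a + 2 * b) / 3, by linarith, by linarith, by linarith, by simp [hne]⟩

theorem IsTestFunction.mul_left {a b : ℝ} {φ : ℝ → ℝ} (h : IsTestFunction a b φ) {c : ℝ → ℝ}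
    (hc : ContDiff ℝ ((⊤ : ℕ∞) : WithTop ℕ∞) c) : IsTestFunction a b fun x => c x * φ x :=
  ⟨hc.mul h.contDiff, h.hasCompactSupport.mul_left,
    (tsupport_mul_subset_right (f := c) (g := φ)).trans h.tsupport_subset⟩

/-- The primitive that starts to the left of the support vanishes to the right of it exactly because
the total integral is zero, so it is again a test function. -/
theorem IsTestFunction.integral {a b : ℝ} (hab : a < b) {φ : ℝ → ℝ} (h : IsTestFunction a b φ)
    (h0 : ∫ x, φ x = 0) : ∃ Φ : ℝ → ℝ, IsTestFunction a b Φ ∧ ∀ x, HasDerivAt Φ (φ x) x := by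
  obtain ⟨a', b', ha', hab', hb', hsub⟩ := h.exists_subset_Icc hab
  have hz : ∀ x ∉ Icc a' b', φ x = 0 := fun x hx =>
    image_eq_zero_of_notMem_tsupport fun hx' => hx (hsub hx')
  have hint : ∀ x y, IntervalIntegrable φ volume x y := fun x y =>
    h.contDiff.continuous.intervalIntegrable x y
  set Φ : ℝ → ℝ := fun x => ∫ t in a'..x, φ t with hΦ
  have hder : ∀ x, HasDerivAt Φ (φ x) x := fun x =>
    intervalIntegral.integral_hasDerivAt_right (hint _ _)
      (h.contDiff.continuous.stronglyMeasurableAtFilter _ _) h.contDiff.continuous.continuousAt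
  have hΦ0 : ∀ x ∉ Icc a' b', Φ x = 0 := by
    intro x hx
    by_cases hx1 : x < a'
    · simp only [hΦ]
      rw [intervalIntegral.integral_symm, intervalIntegral.integral_of_le hx1.le,
        integral_Ioc_eq_integral_Ioo,
        setIntegral_eq_zero_of_forall_eq_zero fun t ht => hz t fun ht' => absurd ht.2 (by
          simpa using ht'.1), neg_zero]
    · have hx2 : b' < x := by
        by_contra hx2; exact hx ⟨not_lt.1 hx1, not_lt.1 hx2⟩
      simp only [hΦ]
      rw [intervalIntegral.integral_of_le (by linarith : a' ≤ x), ← integral_Icc_eq_integral_Ioc,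
        setIntegral_eq_integral_of_forall_compl_eq_zero (s := Icc a' x) fun t ht =>
          hz t fun ht' => ht ⟨ht'.1, by linarith [ht'.2]⟩, h0]
  have hts : tsupport Φ ⊆ Icc a' b' :=
    closure_minimal (fun x hx => by_contra fun hx' => hx (hΦ0 x hx')) isClosed_Icc
  refine ⟨Φ, ⟨?_, ?_, ?_⟩, hder⟩
  · rw [contDiff_infty_iff_deriv]
    refine ⟨fun x => (hder x).differentiableAt, ?_⟩
    rw [show deriv Φ = φ from funext fun x => (hder x).deriv]
    exact h.contDiff
  · exact isCompact_Icc.of_isClosed_subset (isClosed_tsupport _) hts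
  · exact hts.trans fun x hx => ⟨ha'.trans_le hx.1, hx.2.trans_lt hb'⟩

/-- The lemma of du Bois-Reymond: a function whose weak derivative vanishes is constant. -/
theorem ae_eq_const_of_forall_integral_deriv_eq_zero {a b : ℝ} (hab : a < b) {f : ℝ → ℂ}
    (hf : IntegrableOn f (Ioo a b))
    (h : ∀ φ : ℝ → ℝ, IsTestFunction a b φ → ∫ x in Ioo a b, ((deriv φ x : ℝ) : ℂ) * f x = 0) :
    ∃ c, ∀ᵐ x ∂volume.restrict (Ioo a b), f x = c := by
  obtain ⟨χ, hχ, hχ1⟩ : ∃ χ : ℝ → ℝ, IsTestFunction a b χ ∧ ∫ x, χ x = 1 := by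
    let B : ContDiffBump ((a + b) / 2) :=
      ⟨(b - a) / 8, (b - a) / 4, by linarith, by linarith⟩
    refine ⟨B.normed volume, ⟨B.contDiff_normed, B.hasCompactSupport_normed, ?_⟩, B.integral_normed⟩
    rw [B.tsupport_normed_eq, Real.closedBall_eq_Icc]
    intro x hx
    have h1 := hx.1
    have h2 := hx.2
    simp only [B] at h1 h2
    exact ⟨by linarith, by linarith⟩
  set c : ℂ := ∫ x in Ioo a b, (χ x : ℂ) * f x with hc
  have hint : ∀ φ : ℝ → ℝ, IsTestFunction a b φ → IntegrableOn (fun x => (φ x : ℂ) * f x) (Ioo a b) := by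
    intro φ hφ
    obtain ⟨C, hC⟩ := hφ.hasCompactSupport.exists_bound_of_continuous hφ.contDiff.continuous
    refine hf.bdd_mul (c := C) ?_ ?_
    · exact (Complex.continuous_ofReal.comp hφ.contDiff.continuous).aestronglyMeasurable
    · exact Eventually.of_forall fun x => by simpa using hC x
  refine ⟨c, ?_⟩
  have hmain : ∀ᵐ x, x ∈ Ioo a b → f x - c = 0 := by
    refine isOpen_Ioo.ae_eq_zero_of_integral_contDiff_smul_eq_zero
      (hf.sub (integrable_const c)).locallyIntegrableOn fun φ hφ1 hφ2 hφ3 => ?_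
    have hφ : IsTestFunction a b φ := ⟨hφ1, hφ2, hφ3⟩
    have hI : ∀ φ : ℝ → ℝ, IsTestFunction a b φ → Integrable φ := fun φ hφ =>
      hφ.contDiff.continuous.integrable_of_hasCompactSupport hφ.hasCompactSupport
    -- Removing the multiple `∫ φ` of `χ` leaves a test function of integral zero. It is the
    -- derivative of a test function `Φ`, hence annihilated by `f`. This says that `∫ φ f = (∫ φ)
    -- c`, with `c` the pairing of `f` with `χ`.
    have hψ : IsTestFunction a b fun x => φ x - (∫ y, φ y) * χ x := by
      have h1 := hχ.mul_left (c := fun _ => ∫ y, φ y) contDiff_const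
      refine ⟨hφ1.sub h1.contDiff, hφ2.sub h1.hasCompactSupport, ?_⟩
      exact (tsupport_sub _ _).trans (union_subset hφ3 h1.tsupport_subset)
    obtain ⟨Φ, hΦ, hder⟩ := hψ.integral hab (by
      rw [integral_sub (hI φ hφ) ((hI χ hχ).const_mul _), integral_const_mul, hχ1]; ring)
    have h2 := h Φ hΦ
    simp only [fun x => (hder x).deriv] at h2
    have h3 : ∫ x, φ x • (f x - c) = ∫ x in Ioo a b, φ x • (f x - c) := by
      refine (setIntegral_eq_integral_of_forall_compl_eq_zero fun x hx => ?_).symm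
      rw [image_eq_zero_of_notMem_tsupport fun hx' => hx (hφ3 hx'), zero_smul]
    have h4 : ((∫ y, φ y : ℝ) : ℂ) = ∫ x in Ioo a b, (φ x : ℂ) := by
      rw [← integral_complex_ofReal]
      refine (setIntegral_eq_integral_of_forall_compl_eq_zero fun x hx => ?_).symm
      rw [image_eq_zero_of_notMem_tsupport fun hx' => hx (hφ3 hx'), Complex.ofReal_zero]
    have h5 : ∫ x in Ioo a b, φ x • (f x - c) =
        (∫ x in Ioo a b, (φ x : ℂ) * f x) - (∫ y, φ y : ℝ) * c := by
      rw [h4, ← integral_mul_const, ← integral_sub (hint φ hφ)]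
      · refine integral_congr_ae (Eventually.of_forall fun x => ?_)
        simp only [Complex.real_smul]; ring
      · exact ((hI φ hφ).ofReal.integrableOn).mul_const c
    have h6 : ∫ x in Ioo a b, ((φ x - (∫ y, φ y) * χ x : ℝ) : ℂ) * f x =
        (∫ x in Ioo a b, (φ x : ℂ) * f x) - (∫ y, φ y : ℝ) * c := by
      rw [hc, ← integral_const_mul, ← integral_sub (hint φ hφ) ((hint χ hχ).const_mul _)]
      refine integral_congr_ae (Eventually.of_forall fun x => ?_)
      push_cast; ring
    rw [h3, h5, ← h6, h2]
  rw [ae_restrict_iff' measurableSet_Ioo]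
  filter_upwards [hmain] with x hx hx'
  exact sub_eq_zero.1 (hx hx')

/-- The solution of `y'' = -ω² y`, `y 0 = 0`, `y' 0 = 1`. -/
noncomputable def sinSol (ω θ : ℝ) : ℝ := θ * Real.sinc (ω * θ)

theorem sinSol_of_ne_zero {ω : ℝ} (hω : ω ≠ 0) (θ : ℝ) : sinSol ω θ = Real.sin (ω * θ) / ω := by
  by_cases h : θ = 0
  · simp [sinSol, h]
  · rw [sinSol, Real.sinc_of_ne_zero (mul_ne_zero hω h)]; field_simp

theorem mul_sinSol (ω θ : ℝ) : ω * sinSol ω θ = Real.sin (ω * θ) := by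
  by_cases hω : ω = 0
  · simp [hω]
  · rw [sinSol_of_ne_zero hω]; field_simp

theorem hasDerivAt_sinSol (ω θ : ℝ) : HasDerivAt (sinSol ω) (Real.cos (ω * θ)) θ := by
  by_cases hω : ω = 0
  · subst hω
    have : sinSol 0 = id := by ext θ; simp [sinSol]
    rw [this]; simpa using hasDerivAt_id θ
  · have h1 : sinSol ω = fun θ => Real.sin (ω * θ) / ω := funext (sinSol_of_ne_zero hω)
    rw [h1]
    refine ((((hasDerivAt_id θ).const_mul ω).sin).div_const ω).congr_deriv ?_
    simp only [id_eq]; field_simp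

theorem hasDerivAt_cos_mul (ω θ : ℝ) :
    HasDerivAt (fun θ => Real.cos (ω * θ)) (-(ω ^ 2 * sinSol ω θ)) θ := by
  refine (((hasDerivAt_id θ).const_mul ω).cos).congr_deriv ?_
  simp only [id_eq, ← mul_sinSol]; ring

theorem cos_sq_add_sinSol (ω θ : ℝ) : Real.cos (ω * θ) ^ 2 + ω ^ 2 * sinSol ω θ ^ 2 = 1 := by
  rw [← mul_pow, mul_sinSol, Real.cos_sq_add_sin_sq]

theorem contDiff_sinSol (ω : ℝ) {n : WithTop ℕ∞} : ContDiff ℝ n (sinSol ω) := by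
  by_cases hω : ω = 0
  · subst hω
    have : sinSol 0 = id := by ext θ; simp [sinSol]
    rw [this]; exact contDiff_id
  · rw [funext (sinSol_of_ne_zero hω)]
    exact (Real.contDiff_sin.comp (contDiff_const.mul contDiff_id)).div_const ω

/-- The function `sinc` replaces `sin (ω θ) / ω` for the sake of this joint continuity, which
includes `ω = 0`. Limits of frequencies then need no case distinction. -/
theorem continuous_sinSol : Continuous fun q : ℝ × ℝ => sinSol q.1 q.2 :=
  continuous_snd.mul (Real.continuous_sinc.comp (continuous_fst.mul continuous_snd))

/-- The solution of `y'' = -ω² y` with `y 0 = c.1`, `y' 0 = c.2`. -/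
noncomputable def oscSol (ω : ℝ) (c : ℂ × ℂ) (θ : ℝ) : ℂ :=
  c.1 * Real.cos (ω * θ) + c.2 * sinSol ω θ

/-- The derivative of `oscSol`. -/
noncomputable def oscDeriv (ω : ℝ) (c : ℂ × ℂ) (θ : ℝ) : ℂ :=
  -(ω ^ 2 : ℝ) * c.1 * sinSol ω θ + c.2 * Real.cos (ω * θ)

theorem hasDerivAt_oscSol (ω : ℝ) (c : ℂ × ℂ) (θ : ℝ) :
    HasDerivAt (oscSol ω c) (oscDeriv ω c θ) θ := by
  have h1 := ((hasDerivAt_cos_mul ω θ).ofReal_comp.const_mul c.1).add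
    ((hasDerivAt_sinSol ω θ).ofReal_comp.const_mul c.2)
  refine h1.congr_deriv ?_
  rw [oscDeriv]; push_cast; ring

theorem hasDerivAt_oscDeriv (ω : ℝ) (c : ℂ × ℂ) (θ : ℝ) :
    HasDerivAt (oscDeriv ω c) (-(ω ^ 2 : ℝ) * oscSol ω c θ) θ := by
  have h1 := ((hasDerivAt_sinSol ω θ).ofReal_comp.const_mul (-(ω ^ 2 : ℝ) * c.1)).add
    ((hasDerivAt_cos_mul ω θ).ofReal_comp.const_mul c.2)
  refine h1.congr_deriv ?_
  rw [oscSol]; push_cast; ring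

theorem continuous_oscSol : Continuous fun q : ℝ × (ℂ × ℂ) × ℝ => oscSol q.1 q.2.1 q.2.2 := by
  have h1 : Continuous fun q : ℝ × (ℂ × ℂ) × ℝ => sinSol q.1 q.2.2 :=
    continuous_sinSol.comp (by fun_prop : Continuous fun q : ℝ × (ℂ × ℂ) × ℝ => (q.1, q.2.2))
  unfold oscSol
  fun_prop

theorem continuous_oscDeriv : Continuous fun q : ℝ × (ℂ × ℂ) × ℝ => oscDeriv q.1 q.2.1 q.2.2 := by
  have h1 : Continuous fun q : ℝ × (ℂ × ℂ) × ℝ => sinSol q.1 q.2.2 :=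
    continuous_sinSol.comp (by fun_prop : Continuous fun q : ℝ × (ℂ × ℂ) × ℝ => (q.1, q.2.2))
  unfold oscDeriv
  fun_prop

@[simp] theorem oscSol_zero_right (ω : ℝ) (c : ℂ × ℂ) : oscSol ω c 0 = c.1 := by
  simp [oscSol, sinSol]

@[simp] theorem oscDeriv_zero_right (ω : ℝ) (c : ℂ × ℂ) : oscDeriv ω c 0 = c.2 := by
  simp [oscDeriv, sinSol]

/-- A combination of `P` and `Q` that solves the adjoint system is a constant of motion of the weak
system `P' = Q`, `Q' = -ω² P`. -/
theorem exists_const_of_weak_system {a b ω : ℝ} (hab : a < b) {P Q : ℝ → ℂ} {A B : ℝ → ℝ}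
    (hP : IntegrableOn P (Ioo a b)) (hQ : IntegrableOn Q (Ioo a b))
    (h1 : ∀ φ : ℝ → ℝ, IsTestFunction a b φ →
      ∫ x in Ioo a b, ((deriv φ x : ℝ) : ℂ) * P x = -∫ x in Ioo a b, (φ x : ℂ) * Q x)
    (h2 : ∀ φ : ℝ → ℝ, IsTestFunction a b φ →
      ∫ x in Ioo a b, ((deriv φ x : ℝ) : ℂ) * Q x =
        (ω ^ 2 : ℝ) * ∫ x in Ioo a b, (φ x : ℂ) * P x)
    (hA : ContDiff ℝ ((⊤ : ℕ∞) : WithTop ℕ∞) A) (hB : ContDiff ℝ ((⊤ : ℕ∞) : WithTop ℕ∞) B)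
    (hAd : ∀ x, HasDerivAt A (ω ^ 2 * B x) x) (hBd : ∀ x, HasDerivAt B (-A x) x) :
    ∃ c, ∀ᵐ x ∂volume.restrict (Ioo a b), (A x : ℂ) * P x + (B x : ℂ) * Q x = c := by
  have hcont : ∀ {F : ℝ → ℂ}, IntegrableOn F (Ioo a b) → ∀ {c : ℝ → ℝ}, Continuous c →
      IntegrableOn (fun x => (c x : ℂ) * F x) (Ioo a b) := by
    intro F hF c hc
    obtain ⟨M, hM⟩ := (isCompact_Icc (a := a) (b := b)).exists_bound_of_continuousOn hc.continuousOn
    refine hF.bdd_mul (c := M) (Complex.continuous_ofReal.comp hc).aestronglyMeasurable ?_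
    filter_upwards [ae_restrict_mem measurableSet_Ioo] with x hx
    simpa using hM x (Ioo_subset_Icc_self hx)
  refine ae_eq_const_of_forall_integral_deriv_eq_zero hab
    ((hcont hP hA.continuous).add (hcont hQ hB.continuous)) fun φ hφ => ?_
  have hφd : ∀ x, HasDerivAt φ (deriv φ x) x := fun x =>
    (hφ.contDiff.differentiable (by norm_num) x).hasDerivAt
  -- The first equation is tested with `A φ`, the second with `B φ`. Because `A' = ω² B` and `B' =
  -- -A`, the terms that contain `φ` undifferentiated cancel in the sum.
  have e1 := h1 _ (hφ.mul_left hA)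
  have e2 := h2 _ (hφ.mul_left hB)
  simp only [fun x => ((hAd x).fun_mul (hφd x)).deriv] at e1
  simp only [fun x => ((hBd x).fun_mul (hφd x)).deriv] at e2
  have hc1 := hA.continuous
  have hc2 := hB.continuous
  have hc3 := hφ.contDiff.continuous
  have hc4 : Continuous (deriv φ) := hφ.contDiff.continuous_deriv (by norm_num)
  have i1 := hcont hP (c := fun x => A x * deriv φ x) (by fun_prop)
  have i2 := hcont hP (c := fun x => B x * φ x) (by fun_prop)
  have i3 := hcont hQ (c := fun x => B x * deriv φ x) (by fun_prop)
  have i4 := hcont hQ (c := fun x => A x * φ x) (by fun_prop)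
  have e1' : ∫ x in Ioo a b, ((ω ^ 2 * B x * φ x + A x * deriv φ x : ℝ) : ℂ) * P x =
      (ω ^ 2 : ℝ) * (∫ x in Ioo a b, ((B x * φ x : ℝ) : ℂ) * P x) +
        ∫ x in Ioo a b, ((A x * deriv φ x : ℝ) : ℂ) * P x := by
    rw [← integral_const_mul, ← integral_add (i2.const_mul _) i1]
    refine integral_congr_ae (Eventually.of_forall fun x => ?_)
    push_cast; ring
  have e2' : ∫ x in Ioo a b, ((-A x * φ x + B x * deriv φ x : ℝ) : ℂ) * Q x =
      -(∫ x in Ioo a b, ((A x * φ x : ℝ) : ℂ) * Q x) +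
        ∫ x in Ioo a b, ((B x * deriv φ x : ℝ) : ℂ) * Q x := by
    rw [neg_add_eq_sub, ← integral_sub i3 i4]
    refine integral_congr_ae (Eventually.of_forall fun x => ?_)
    push_cast; ring
  rw [e1'] at e1
  rw [e2'] at e2
  have e3 : ∫ x in Ioo a b, ((deriv φ x : ℝ) : ℂ) * ((A x : ℂ) * P x + (B x : ℂ) * Q x) =
      (∫ x in Ioo a b, ((A x * deriv φ x : ℝ) : ℂ) * P x) +
        ∫ x in Ioo a b, ((B x * deriv φ x : ℝ) : ℂ) * Q x := by
    rw [← integral_add i1 i3]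
    refine integral_congr_ae (Eventually.of_forall fun x => ?_)
    push_cast; ring
  rw [e3]
  linear_combination e1 + e2

/-- A weak solution of the system `P' = Q`, `Q' = -ω² P` is a classical one. -/
theorem exists_oscSol_of_weak {a b : ℝ} (hab : a < b) (ω θ₀ : ℝ) {P Q : ℝ → ℂ}
    (hP : IntegrableOn P (Ioo a b)) (hQ : IntegrableOn Q (Ioo a b))
    (h1 : ∀ φ : ℝ → ℝ, IsTestFunction a b φ →
      ∫ x in Ioo a b, ((deriv φ x : ℝ) : ℂ) * P x = -∫ x in Ioo a b, (φ x : ℂ) * Q x)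
    (h2 : ∀ φ : ℝ → ℝ, IsTestFunction a b φ →
      ∫ x in Ioo a b, ((deriv φ x : ℝ) : ℂ) * Q x =
        (ω ^ 2 : ℝ) * ∫ x in Ioo a b, (φ x : ℂ) * P x) :
    ∃ c, ∀ᵐ x ∂volume.restrict (Ioo a b),
      P x = oscSol ω c (x - θ₀) ∧ Q x = oscDeriv ω c (x - θ₀) := by
  set C : ℝ → ℝ := fun x => Real.cos (ω * (x - θ₀)) with hC
  set S : ℝ → ℝ := fun x => sinSol ω (x - θ₀) with hS
  have hCd : ∀ x, HasDerivAt C (-(ω ^ 2 * S x)) x := fun x =>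
    (hasDerivAt_cos_mul ω (x - θ₀)).comp_sub_const x θ₀
  have hSd : ∀ x, HasDerivAt S (C x) x := fun x =>
    (hasDerivAt_sinSol ω (x - θ₀)).comp_sub_const x θ₀
  have hCs : ContDiff ℝ ((⊤ : ℕ∞) : WithTop ℕ∞) C :=
    Real.contDiff_cos.comp (contDiff_const.mul (contDiff_id.sub contDiff_const))
  have hSs : ContDiff ℝ ((⊤ : ℕ∞) : WithTop ℕ∞) S :=
    (contDiff_sinSol ω).comp (contDiff_id.sub contDiff_const)
  -- For a classical solution `C P - S Q` is its value and `ω² S P + C Q` its slope at `θ₀`. Both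
  -- are constants of motion of the weak system as well. Since `C² + ω² S² = 1`, the two relations
  -- can be solved for `P` and `Q`.
  obtain ⟨α, hα⟩ := exists_const_of_weak_system hab hP hQ h1 h2 hCs hSs.neg
    (fun x => (hCd x).congr_deriv (by simp)) (fun x => (hSd x).neg)
  obtain ⟨β, hβ⟩ := exists_const_of_weak_system (A := fun x => ω ^ 2 * S x) hab hP hQ h1 h2
    (contDiff_const.mul hSs) hCs (fun x => (hSd x).const_mul _) hCd
  refine ⟨(α, β), ?_⟩
  filter_upwards [hα, hβ] with x hx1 hx2
  have h3 : (C x : ℂ) ^ 2 + (ω ^ 2 : ℝ) * (S x : ℂ) ^ 2 = 1 := by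
    exact_mod_cast cos_sq_add_sinSol ω (x - θ₀)
  constructor
  · change P x = α * C x + β * S x
    push_cast at hx1 hx2 h3 ⊢
    linear_combination (C x : ℂ) * hx1 + (S x : ℂ) * hx2 - P x * h3
  · change Q x = -(ω ^ 2 : ℝ) * α * S x + β * C x
    push_cast at hx1 hx2 h3 ⊢
    linear_combination (C x : ℂ) * hx2 - (ω ^ 2 : ℂ) * (S x : ℂ) * hx1 - Q x * h3

/-! ### Words, pieces, and integration over countable disjoint unions -/

instance (k : ℕ) : MeasurableSingletonClass (Word k) := ⟨fun _ => trivial⟩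
instance (k : ℕ) : MeasurableSingletonClass (Piece k) := ⟨fun _ => trivial⟩

namespace Word

variable {k : ℕ}

/-- Words and lists. -/
def equivList (k : ℕ) : Word k ≃ List (Fin k) where
  toFun := fun | mk w => w
  invFun := mk
  left_inv := fun | mk _ => rfl
  right_inv := fun _ => rfl

instance (k : ℕ) : Countable (Word k) := (equivList k).countable_iff.2 inferInstance

noncomputable instance (k : ℕ) : DecidableEq (Word k) := Classical.decEq _

@[simp] theorem gen_root (k : ℕ) : (root k).gen = 0 := rfl

@[simp] theorem gen_child (i : Fin k) (w : Word k) : (child i w).gen = w.gen + 1 := by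
  cases w; rfl

theorem child_injective : Function.Injective fun p : Fin k × Word k => child p.1 p.2 := by
  rintro ⟨i, ⟨w⟩⟩ ⟨j, ⟨v⟩⟩ h
  simp only [child, mk.injEq, List.cons.injEq] at h
  obtain ⟨rfl, rfl⟩ := h
  rfl

theorem eq_root_or_child (w : Word k) : w = root k ∨ ∃ i v, w = child i v := by
  obtain ⟨w⟩ := w
  cases w with
  | nil => exact Or.inl rfl
  | cons i w => exact Or.inr ⟨i, mk w, rfl⟩

theorem child_ne_root (i : Fin k) (w : Word k) : child i w ≠ root k := fun h => by
  simpa using congrArg gen h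

theorem child_ne_self (i : Fin k) (w : Word k) : child i w ≠ w := fun h => by
  simpa using congrArg gen h

theorem nbr_injective (w : Word k) : Function.Injective (nbr w) := by
  intro j j' h
  cases j with
  | none => cases j' with
    | none => rfl
    | some i => exact absurd h.symm (child_ne_self i w)
  | some i => cases j' with
    | none => exact absurd h (child_ne_self i w)
    | some i' =>
      have := child_injective (a₁ := (i, w)) (a₂ := (i', w)) h
      simp only [Prod.mk.injEq, and_true] at this
      rw [this]

/-- The words of a given generation. -/
noncomputable def ofGen (k : ℕ) : ℕ → Finset (Word k)
  | 0 => {root k}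
  | n + 1 => (Finset.univ ×ˢ ofGen k n).map ⟨fun p : Fin k × Word k => child p.1 p.2, child_injective⟩

@[simp] theorem mem_ofGen {w : Word k} {n : ℕ} : w ∈ ofGen k n ↔ w.gen = n := by
  induction n generalizing w with
  | zero =>
    simp only [ofGen, Finset.mem_singleton]
    refine ⟨fun h => h ▸ rfl, fun h => ?_⟩
    rcases eq_root_or_child w with h' | ⟨i, v, rfl⟩
    · exact h'
    · simp at h
  | succ n ih =>
    simp only [ofGen, Finset.mem_map, Finset.mem_product, Finset.mem_univ, true_and,
      Function.Embedding.coeFn_mk, Prod.exists]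
    constructor
    · rintro ⟨i, v, hv, rfl⟩
      rw [gen_child, ih.1 hv]
    · intro h
      rcases eq_root_or_child w with rfl | ⟨i, v, rfl⟩
      · simp at h
      · exact ⟨i, v, ih.2 (by simpa using h), rfl⟩

theorem sum_ofGen_succ {M : Type*} [AddCommMonoid M] (n : ℕ) (F : Word k → M) :
    ∑ w ∈ ofGen k (n + 1), F w = ∑ w ∈ ofGen k n, ∑ i, F (child i w) := by
  rw [ofGen, Finset.sum_map, Finset.sum_product_right]
  rfl

theorem hasSum_ofGen {F : Word k → ℝ} {a : ℝ} (h : HasSum F a) :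
    HasSum (fun n => ∑ w ∈ ofGen k n, F w) a := by
  have h1 := (Equiv.sigmaFiberEquiv (gen (k := k))).hasSum_iff.2 h
  refine h1.sigma fun n => ?_
  let e : {w : Word k // w.gen = n} ≃ {w : Word k // w ∈ ofGen k n} :=
    Equiv.subtypeEquivRight fun w => mem_ofGen.symm
  exact (e.hasSum_iff (f := F ∘ Subtype.val)).2 ((ofGen k n).hasSum F)

end Word

namespace Piece

/-- Pieces are indexed by two copies of the words. -/
def equivSum (k : ℕ) : Word k ⊕ Word k ≃ Piece k where
  toFun := Sum.elim edge vert
  invFun := fun | edge w => Sum.inl w | vert w => Sum.inr w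
  left_inv := fun p => by cases p <;> rfl
  right_inv := fun p => by cases p <;> rfl

instance (k : ℕ) : Countable (Piece k) := (equivSum k).symm.countable_iff.2 inferInstance

theorem hasSum_edge_add_vert {k : ℕ} {M : Type*} [NormedAddCommGroup M] [CompleteSpace M]
    {F : Piece k → M} {a : M}
    (h : HasSum F a) : HasSum (fun w => F (edge w)) (∑' w, F (edge w)) ∧
      HasSum (fun w => F (vert w)) (∑' w, F (vert w)) ∧
      a = ∑' w, F (edge w) + ∑' w, F (vert w) := by
  have he : Function.Injective (edge (k := k)) := fun a b h => by injection h
  have hv : Function.Injective (vert (k := k)) := fun a b h => by injection h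
  have h1 : Summable fun w => F (edge w) := h.summable.comp_injective he
  have h2 : Summable fun w => F (vert w) := h.summable.comp_injective hv
  refine ⟨h1.hasSum, h2.hasSum, ?_⟩
  have h3 : HasSum (F ∘ equivSum k) (∑' w, F (edge w) + ∑' w, F (vert w)) :=
    HasSum.sum (f := F ∘ equivSum k) h1.hasSum h2.hasSum
  exact h.unique ((equivSum k).hasSum_iff.1 h3)

end Piece

section SumMeasure

variable {ι X : Type*} [MeasurableSpace ι] [MeasurableSingletonClass ι] [MeasurableSpace X]

/-- The measure on `ι × X` that is `μ i` on the `i`-th copy of `X`. -/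
noncomputable def sumMeasure (μ : ι → Measure X) : Measure (ι × X) :=
  Measure.sum fun i => (μ i).map (Prod.mk i)

theorem lintegral_sumMeasure (μ : ι → Measure X) (F : ι × X → ENNReal) :
    ∫⁻ q, F q ∂sumMeasure μ = ∑' i, ∫⁻ x, F (i, x) ∂μ i := by
  rw [sumMeasure, lintegral_sum_measure]
  exact tsum_congr fun i => (measurableEmbedding_prodMk_left i).lintegral_map F

theorem map_prodMk_le_sumMeasure (μ : ι → Measure X) (i : ι) :
    (μ i).map (Prod.mk i) ≤ sumMeasure μ :=
  Measure.le_sum (fun i => (μ i).map (Prod.mk i)) i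

theorem aestronglyMeasurable_sumMeasure_iff [Countable ι] {β : Type*} [TopologicalSpace β]
    [TopologicalSpace.PseudoMetrizableSpace β] {μ : ι → Measure X} {F : ι × X → β} :
    AEStronglyMeasurable F (sumMeasure μ) ↔
      ∀ i, AEStronglyMeasurable (fun x => F (i, x)) (μ i) := by
  rw [sumMeasure, aestronglyMeasurable_sum_measure_iff]
  exact forall_congr' fun i => (measurableEmbedding_prodMk_left i).aestronglyMeasurable_map_iff

theorem ae_sumMeasure_iff [Countable ι] {μ : ι → Measure X} {p : ι × X → Prop} :
    (∀ᵐ q ∂sumMeasure μ, p q) ↔ ∀ i, ∀ᵐ x ∂μ i, p (i, x) := by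
  rw [sumMeasure, Measure.ae_sum_iff]
  exact forall_congr' fun i => (measurableEmbedding_prodMk_left i).ae_map_iff

theorem hasSum_integral_sumMeasure {E : Type*} [NormedAddCommGroup E] [NormedSpace ℝ E]
    {μ : ι → Measure X} {F : ι × X → E} (hF : Integrable F (sumMeasure μ)) :
    HasSum (fun i => ∫ x, F (i, x) ∂μ i) (∫ q, F q ∂sumMeasure μ) := by
  have := hasSum_integral_measure hF
  simp only [(measurableEmbedding_prodMk_left _).integral_map] at this
  exact this

theorem eLpNorm_sq_eq {α E : Type*} [MeasurableSpace α] [NormedAddCommGroup E] (f : α → E)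
    (μ : Measure α) : eLpNorm f 2 μ ^ 2 = ∫⁻ x, ‖f x‖ₑ ^ 2 ∂μ := by
  rw [eLpNorm_eq_lintegral_rpow_enorm_toReal (by norm_num) (by norm_num),
    ← ENNReal.rpow_natCast, ← ENNReal.rpow_mul]
  simp

theorem memLp_two_iff {α E : Type*} [MeasurableSpace α] [NormedAddCommGroup E] {f : α → E}
    {μ : Measure α} :
    MemLp f 2 μ ↔ AEStronglyMeasurable f μ ∧ ∫⁻ x, ‖f x‖ₑ ^ 2 ∂μ < ⊤ := by
  rw [← eLpNorm_sq_eq, MemLp, ENNReal.pow_lt_top_iff]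
  simp

theorem MeasureTheory.MemLp.prodMk_left {E : Type*} [NormedAddCommGroup E] {μ : ι → Measure X}
    {F : ι × X → E} (hF : MemLp F 2 (sumMeasure μ)) (i : ι) : MemLp (fun x => F (i, x)) 2 (μ i) :=
  (measurableEmbedding_prodMk_left i).memLp_map_measure_iff.1
    (hF.mono_measure (map_prodMk_le_sumMeasure μ i))

theorem lintegral_le_sumMeasure (μ : ι → Measure X) (F : ι × X → ENNReal) (i : ι) :
    ∫⁻ x, F (i, x) ∂μ i ≤ ∫⁻ q, F q ∂sumMeasure μ := by
  rw [lintegral_sumMeasure]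
  exact ENNReal.le_tsum i

theorem memLp_sumMeasure_iff [Countable ι] {E : Type*} [NormedAddCommGroup E] {μ : ι → Measure X}
    {F : ι × X → E} : MemLp F 2 (sumMeasure μ) ↔
      (∀ i, AEStronglyMeasurable (fun x => F (i, x)) (μ i)) ∧
        ∑' i, ∫⁻ x, ‖F (i, x)‖ₑ ^ 2 ∂μ i < ⊤ := by
  rw [memLp_two_iff, aestronglyMeasurable_sumMeasure_iff, lintegral_sumMeasure]

theorem MeasureTheory.MemLp.integral_sq_eq {α E : Type*} [MeasurableSpace α]
    [NormedAddCommGroup E] {f : α → E} {μ : Measure α} (hf : MemLp f 2 μ) :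
    ∫⁻ x, ‖f x‖ₑ ^ 2 ∂μ = ENNReal.ofReal (∫ x, ‖f x‖ ^ 2 ∂μ) := by
  rw [ofReal_integral_eq_lintegral_ofReal (hf.integrable_norm_pow two_ne_zero)
    (Eventually.of_forall fun x => by positivity)]
  congr 1; ext x
  rw [ENNReal.ofReal_pow (norm_nonneg _), ofReal_norm]

end SumMeasure

namespace TreeData

variable {d k : ℕ} (T : TreeData d k)

theorem inflatedMeasure_eq (ε : ℝ) :
    T.inflatedMeasure ε = sumMeasure fun i => volume.restrict (T.piece ε i) := rfl

theorem treeMeasure_eq : T.treeMeasure =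
    sumMeasure fun w => ENNReal.ofReal (T.rho w) • volume.restrict (Icc 0 (T.edgeLen w)) := by
  rw [treeMeasure, sumMeasure]
  simp only [Measure.map_smul]

/-- Applied to a real vector `v`, the differential is the inner product of the gradient with `v`
regarded as a complex vector, so Cauchy-Schwarz applies. Equality can fail for complex-valued
functions. This direction suffices: the Poincaré inequalities are stated with `fderiv`, the energies
with `grad`. -/
theorem norm_fderiv_le_norm_grad (f : Piece k × EuclideanSpace ℝ (Fin (d + 1)) → ℂ)
    (q : Piece k × EuclideanSpace ℝ (Fin (d + 1))) :
    ‖fderiv ℝ (fun x => f (q.1, x)) q.2‖ ≤ ‖grad f q‖ := by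
  refine ContinuousLinearMap.opNorm_le_bound _ (norm_nonneg _) fun v => ?_
  set L := fderiv ℝ (fun x => f (q.1, x)) q.2
  have h1 : L v = ∑ m, (v m : ℂ) * L (EuclideanSpace.single m 1) := by
    conv_lhs => rw [← (EuclideanSpace.basisFun (Fin (d + 1)) ℝ).sum_repr v]
    rw [map_sum]
    refine Finset.sum_congr rfl fun m _ => ?_
    rw [map_smul, Complex.real_smul]
    simp
  have h2 : L v = inner ℂ (WithLp.toLp 2 fun m => (v m : ℂ) : EuclideanSpace ℂ (Fin (d + 1)))
      (grad f q) := by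
    rw [h1, PiLp.inner_apply]
    refine Finset.sum_congr rfl fun m _ => ?_
    simp only [grad, RCLike.inner_apply, Complex.conj_ofReal, L]
    ring
  rw [h2, mul_comm]
  refine (norm_inner_le_norm _ _).trans (le_of_eq ?_)
  congr 1
  rw [EuclideanSpace.norm_eq, EuclideanSpace.norm_eq]
  simp

end TreeData

/-- Let `η` tend to zero. Inequalities pass in this way from `C¹` functions to `H¹₀`: an
approximation of accuracy `η` costs a finite multiple of `η`. -/
theorem ENNReal_le_of_forall_le_mul_add {a A B : ENNReal} (hA : A ≠ ⊤)
    (h : ∀ η : ENNReal, 0 < η → η ≠ ⊤ → a ≤ A * η + B) : a ≤ B := by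
  have h1 : Tendsto (fun η : ENNReal => A * η + B) (𝓝[>] 0) (𝓝 (A * 0 + B)) := by
    refine Tendsto.add_const _ (Tendsto.mono_left ?_ nhdsWithin_le_nhds)
    exact ENNReal.Tendsto.const_mul tendsto_id (Or.inr hA)
  rw [mul_zero, zero_add] at h1
  refine ge_of_tendsto h1 ?_
  filter_upwards [Ioo_mem_nhdsGT (show (0 : ENNReal) < 1 by norm_num)] with η hη
  exact h η hη.1 (hη.2.trans ENNReal.one_lt_top).ne

/-- The distance to the mean, for a function and its approximation. -/
theorem lintegral_sub_average_sq_le_of_approx {α : Type*} [MeasurableSpace α] {ν : Measure α}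
    [IsFiniteMeasure ν] {u f : α → ℂ} (hu : Integrable u ν) (hf : AEStronglyMeasurable f ν) :
    ∫⁻ x, ‖u x - ⨍ y, u y ∂ν‖ₑ ^ 2 ∂ν ≤
      8 * ∫⁻ x, ‖u x - f x‖ₑ ^ 2 ∂ν + 8 * ∫⁻ x, ‖f x - ⨍ y, f y ∂ν‖ₑ ^ 2 ∂ν := by
  set c := ⨍ y, f y ∂ν
  calc _ ≤ 4 * ∫⁻ x, ‖u x - c‖ₑ ^ 2 ∂ν := lintegral_sub_average_sq_le hu c
    _ ≤ 4 * ∫⁻ x, 2 * (‖u x - f x‖ₑ ^ 2 + ‖f x - c‖ₑ ^ 2) ∂ν := by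
        gcongr with x
        have := enorm_add_sq_le (u x - f x) (f x - c)
        rwa [sub_add_sub_cancel] at this
    _ = 4 * (2 * ((∫⁻ x, ‖u x - f x‖ₑ ^ 2 ∂ν) + ∫⁻ x, ‖f x - c‖ₑ ^ 2 ∂ν)) := by
        rw [lintegral_const_mul' _ _ (by norm_num), lintegral_add_left']
        exact (hu.aestronglyMeasurable.sub hf).enorm.pow_const 2
    _ = _ := by ring

theorem lintegral_sq_le_of_approx {α E : Type*} [MeasurableSpace α] [NormedAddCommGroup E]
    {ν : Measure α} {G H : α → E} (hG : AEStronglyMeasurable G ν)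
    (hH : AEStronglyMeasurable H ν) :
    ∫⁻ x, ‖H x‖ₑ ^ 2 ∂ν ≤ 2 * ∫⁻ x, ‖G x - H x‖ₑ ^ 2 ∂ν + 2 * ∫⁻ x, ‖G x‖ₑ ^ 2 ∂ν := by
  have key : ∀ a b : E, ‖b‖ₑ ^ 2 ≤ 2 * (‖a - b‖ₑ ^ 2 + ‖a‖ₑ ^ 2) := by
    intro a b
    have h1 : ‖b‖ ^ 2 ≤ 2 * (‖a - b‖ ^ 2 + ‖a‖ ^ 2) := by
      have : ‖b‖ ≤ ‖a - b‖ + ‖a‖ := by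
        calc ‖b‖ = ‖a - (a - b)‖ := by congr 1; abel
          _ ≤ ‖a‖ + ‖a - b‖ := norm_sub_le _ _
          _ = _ := add_comm _ _
      nlinarith [sq_nonneg (‖a - b‖ - ‖a‖), norm_nonneg (a - b), norm_nonneg a, norm_nonneg b]
    have h2 := ENNReal.ofReal_le_ofReal h1
    rwa [ENNReal.ofReal_mul (by norm_num), ENNReal.ofReal_add (by positivity) (by positivity),
      ENNReal.ofReal_pow (by positivity), ENNReal.ofReal_pow (by positivity),
      ENNReal.ofReal_pow (by positivity), ofReal_norm, ofReal_norm, ofReal_norm,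
      ENNReal.ofReal_ofNat] at h2
  calc _ ≤ ∫⁻ x, 2 * (‖G x - H x‖ₑ ^ 2 + ‖G x‖ₑ ^ 2) ∂ν :=
        lintegral_mono fun x => key (G x) (H x)
    _ = _ := by
        rw [lintegral_const_mul' _ _ (by norm_num), lintegral_add_left', mul_add]
        exact (hG.sub hH).enorm.pow_const 2

namespace TreeData

variable {d k : ℕ} (T : TreeData d k) {ε : ℝ}

/-! ### Geometry -/

theorem scale_pos (hε : 0 < ε) (w : Word k) : 0 < T.scale ε w := mul_pos hε (pow_pos T.δ_pos _)

theorem edgeLen_pos (w : Word k) : 0 < T.edgeLen w := T.len_pos _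

theorem scale_child (i : Fin k) (w : Word k) :
    T.scale ε (Word.child i w) = T.scale ε w * T.δ := by
  rw [scale, scale, Word.gen_child, pow_succ]; ring

@[simp] theorem edgeStart_root : T.edgeStart ε (Word.root k) = 0 := rfl

@[simp] theorem edgeStart_child (i : Fin k) (w : Word k) :
    T.edgeStart ε (Word.child i w) = T.scale ε w * T.height (some i) := by
  cases w; rfl

theorem edgeStart_nonneg (hε : 0 < ε) (w : Word k) : 0 ≤ T.edgeStart ε w := by
  rcases Word.eq_root_or_child w with rfl | ⟨i, v, rfl⟩
  · simp
  · rw [edgeStart_child]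
    exact mul_nonneg (T.scale_pos hε v).le (T.height_pos _).le

/-- The fitting conditions multiplied by `ε`: the two skeletons on an edge together occupy at most
the fraction `ε` of its length. All bounds on the position and length of the cylinders follow from
this. -/
theorem edgeStart_add_le (hε : 0 < ε) (w : Word k) :
    T.edgeStart ε w + T.scale ε w * T.height none ≤ ε * T.edgeLen w := by
  rcases Word.eq_root_or_child w with rfl | ⟨i, v, rfl⟩
  · simp only [edgeStart_root, scale, Word.gen_root, pow_zero, mul_one, zero_add]
    exact mul_le_mul_of_nonneg_left T.fits_root hε.le
  · rw [edgeStart_child, scale_child]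
    have := mul_le_mul_of_nonneg_left (T.fits v.gen i) hε.le
    rw [edgeLen, Word.gen_child]
    refine le_trans (le_of_eq ?_) this
    rw [scale, pow_succ]; ring

theorem scale_mul_height_none_le (hε : 0 < ε) (w : Word k) :
    T.scale ε w * T.height none ≤ ε * T.edgeLen w :=
  (le_add_of_nonneg_left (T.edgeStart_nonneg hε w)).trans (T.edgeStart_add_le hε w)

theorem edgeStart_le (hε : 0 < ε) (w : Word k) : T.edgeStart ε w ≤ ε * T.edgeLen w :=
  (le_add_of_nonneg_right (mul_nonneg (T.scale_pos hε w).le (T.height_pos _).le)).trans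
    (T.edgeStart_add_le hε w)

theorem edgeEnd_le (hε : 0 < ε) (w : Word k) : T.edgeEnd ε w ≤ T.edgeLen w :=
  sub_le_self _ (mul_nonneg (T.scale_pos hε w).le (T.height_pos _).le)

theorem le_edgeEnd (hε : 0 < ε) (w : Word k) : (1 - ε) * T.edgeLen w ≤ T.edgeEnd ε w := by
  rw [edgeEnd]; linarith [T.scale_mul_height_none_le hε w]

theorem edgeLen_le_edgeEnd_sub_edgeStart (hε : 0 < ε) (w : Word k) :
    (1 - ε) * T.edgeLen w ≤ T.edgeEnd ε w - T.edgeStart ε w := by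
  rw [edgeEnd]; linarith [T.edgeStart_add_le hε w]

theorem edgeStart_lt_edgeEnd (hε : 0 < ε) (hε1 : ε < 1) (w : Word k) :
    T.edgeStart ε w < T.edgeEnd ε w := by
  have := T.edgeLen_le_edgeEnd_sub_edgeStart hε w
  nlinarith [T.edgeLen_pos w]

theorem volume_Ω_pos : 0 < (volume T.Ω).toReal :=
  ENNReal.toReal_pos (T.Ω_lipschitz.isOpen.measure_pos _ T.Ω_lipschitz.isConnected.nonempty).ne'
    T.Ω_lipschitz.isBounded.measure_lt_top.ne

theorem volume_V_pos : 0 < (volume T.V).toReal :=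
  ENNReal.toReal_pos (T.V_lipschitz.isOpen.measure_pos _ T.V_lipschitz.isConnected.nonempty).ne'
    T.V_lipschitz.isBounded.measure_lt_top.ne

theorem rho_pos (w : Word k) : 0 < T.rho w := mul_pos (pow_pos T.δ_pos _) T.volume_Ω_pos

theorem isOpen_crossSection (hε : 0 < ε) (w : Word k) : IsOpen (T.crossSection ε w) :=
  T.Ω_lipschitz.isOpen.smul₀ (T.scale_pos hε w).ne'

/-- This identifies the weight `ρ*` as the cross-section measure without its factor `ε ^ d`. The
masses and energies below are normalised by the same factor. -/
theorem volume_crossSection (hε : 0 < ε) (w : Word k) :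
    volume (T.crossSection ε w) = ENNReal.ofReal (ε ^ d * T.rho w) := by
  rw [crossSection, volume_smul_set (T.scale_pos hε w), rho,
    ← ENNReal.ofReal_toReal T.Ω_lipschitz.isBounded.measure_lt_top.ne, ← ENNReal.ofReal_mul]
  · rw [scale, ENNReal.toReal_ofReal ENNReal.toReal_nonneg, mul_pow, pow_right_comm, ← pow_mul,
      pow_mul', ← pow_mul, mul_assoc]
  · exact pow_nonneg (T.scale_pos hε w).le _

theorem volume_piece_vert (hε : 0 < ε) (w : Word k) :
    volume (T.piece ε (.vert w)) =
      ENNReal.ofReal (T.scale ε w ^ (d + 1) * (volume T.V).toReal) := by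
  rw [piece, volume_smul_set (T.scale_pos hε w), ENNReal.ofReal_mul
    (pow_nonneg (T.scale_pos hε w).le _), ENNReal.ofReal_toReal
    T.V_lipschitz.isBounded.measure_lt_top.ne]

theorem isOpen_piece (hε : 0 < ε) (i : Piece k) : IsOpen (T.piece ε i) := by
  cases i with
  | edge w =>
    have h0 : Continuous fun x : EuclideanSpace ℝ (Fin (d + 1)) => x 0 := by fun_prop
    exact (isOpen_lt continuous_const h0).inter ((isOpen_lt h0 continuous_const).inter
      ((T.isOpen_crossSection hε w).preimage continuous_transversal))
  | vert w => exact T.V_lipschitz.isOpen.smul₀ (T.scale_pos hε w).ne'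

theorem measurePreserving_edge (ε : ℝ) (w : Word k) : MeasurePreserving (axialEquiv d)
    ((volume.restrict (Ioo (T.edgeStart ε w) (T.edgeEnd ε w))).prod
      (volume.restrict (T.crossSection ε w))) (volume.restrict (T.piece ε (.edge w))) := by
  have := measurePreserving_axialEquiv_restrict (Ioo (T.edgeStart ε w) (T.edgeEnd ε w))
    (T.crossSection ε w)
  have h : T.piece ε (.edge w) = {x | x 0 ∈ Ioo (T.edgeStart ε w) (T.edgeEnd ε w) ∧
      transversal x ∈ T.crossSection ε w} := by
    ext x; simp [piece, and_assoc]
  rwa [h]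

theorem isFiniteMeasure_crossSection (hε : 0 < ε) (w : Word k) :
    IsFiniteMeasure (volume.restrict (T.crossSection ε w)) :=
  ⟨by rw [Measure.restrict_apply_univ, T.volume_crossSection hε]; exact ENNReal.ofReal_lt_top⟩

theorem isFiniteMeasure_piece (hε : 0 < ε) (i : Piece k) :
    IsFiniteMeasure (volume.restrict (T.piece ε i)) := by
  cases i with
  | edge w =>
    have := T.isFiniteMeasure_crossSection hε w
    have h := (T.measurePreserving_edge ε w)
    rw [← h.map_eq]
    infer_instance
  | vert w =>
    exact ⟨by rw [Measure.restrict_apply_univ, T.volume_piece_vert hε]; exact ENNReal.ofReal_lt_top⟩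

/-! ### Approximation by `C¹` functions, on each piece -/

theorem MemH10.exists_approx {T : TreeData d k} {u : Piece k × EuclideanSpace ℝ (Fin (d + 1)) → ℂ}
    {G : Piece k × EuclideanSpace ℝ (Fin (d + 1)) → EuclideanSpace ℂ (Fin (d + 1))}
    (h : T.MemH10 ε u G) {η : ENNReal} (hη : 0 < η) :
    ∃ f, T.IsC1Root ε f ∧ MemLp f 2 (T.inflatedMeasure ε) ∧
      MemLp (grad f) 2 (T.inflatedMeasure ε) ∧
      ∀ i, ∫⁻ x in T.piece ε i, ‖u (i, x) - f (i, x)‖ₑ ^ 2 ≤ η ∧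
        ∫⁻ x in T.piece ε i, ‖G (i, x) - grad f (i, x)‖ₑ ^ 2 ≤ η := by
  -- A number below both `η` and `1` has its square below `η`, which converts norms into squared
  -- norms.
  have hη2 : 0 < min η 1 := lt_min hη one_pos
  obtain ⟨f, hf, hf1, hf2, h1, h2⟩ := h.2.2 _ hη2
  have hsq : ∀ a : ENNReal, a < min η 1 → a ^ 2 ≤ η := fun a ha => by
    calc a ^ 2 = a * a := sq a
      _ ≤ η * 1 := by
        gcongr
        · exact ha.le.trans (min_le_left _ _)
        · exact ha.le.trans (min_le_right _ _)
      _ = η := mul_one _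
  refine ⟨f, hf, hf1, hf2, fun i => ⟨?_, ?_⟩⟩
  · refine le_trans ?_ (hsq _ h1)
    rw [eLpNorm_sq_eq]
    exact lintegral_le_sumMeasure (fun i => volume.restrict (T.piece ε i))
      (fun q => ‖u q - f q‖ₑ ^ 2) i
  · refine le_trans ?_ (hsq _ h2)
    rw [eLpNorm_sq_eq]
    exact lintegral_le_sumMeasure (fun i => volume.restrict (T.piece ε i))
      (fun q => ‖G q - grad f q‖ₑ ^ 2) i

theorem lintegral_fderiv_le_grad (f : Piece k × EuclideanSpace ℝ (Fin (d + 1)) → ℂ) (i : Piece k)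
    (S : Set (EuclideanSpace ℝ (Fin (d + 1)))) :
    ∫⁻ x in S, ‖fderiv ℝ (fun x => f (i, x)) x‖ₑ ^ 2 ≤ ∫⁻ x in S, ‖grad f (i, x)‖ₑ ^ 2 :=
  lintegral_mono fun x => by
    gcongr
    rw [← ofReal_norm, ← ofReal_norm]
    exact ENNReal.ofReal_le_ofReal (norm_fderiv_le_norm_grad f (i, x))

/-- The Poincaré inequality on the inflated vertices. -/
theorem exists_poincare_vert : ∃ C : NNReal, ∀ {ε : ℝ}, 0 < ε →
    ∀ {u : Piece k × EuclideanSpace ℝ (Fin (d + 1)) → ℂ}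
      {G : Piece k × EuclideanSpace ℝ (Fin (d + 1)) → EuclideanSpace ℂ (Fin (d + 1))},
    T.MemH10 ε u G → ∀ w : Word k,
    ∫⁻ x in T.piece ε (.vert w), ‖u (.vert w, x) - ⨍ y in T.piece ε (.vert w), u (.vert w, y)‖ₑ ^ 2 ≤
      C * ENNReal.ofReal (T.scale ε w) ^ 2 *
        ∫⁻ x in T.piece ε (.vert w), ‖G (.vert w, x)‖ₑ ^ 2 := by
  obtain ⟨C, hC⟩ := T.V_lipschitz.exists_poincare
  -- The factor `8` comes from replacing `u` by its approximation in the deviation from the mean,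
  -- the factor `2` from replacing `grad f` by `G`.
  refine ⟨16 * C, fun {ε} hε {u G} h w => ?_⟩
  have hfin := T.isFiniteMeasure_piece hε (.vert w)
  set K : ENNReal := C * ENNReal.ofReal (T.scale ε w) ^ 2 with hK
  have hKt : K ≠ ⊤ := by finiteness
  have huL := (h.1.prodMk_left (.vert w)).integrable (by norm_num)
  refine ENNReal_le_of_forall_le_mul_add (A := 8 + 16 * K) (by finiteness) fun η hη _ => ?_
  obtain ⟨f, hf, hf1, hf2, hfi⟩ := h.exists_approx hη
  have hfL := (hf1.prodMk_left (.vert w)).integrable (by norm_num)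
  calc _ ≤ 8 * (∫⁻ x in T.piece ε (.vert w), ‖u (.vert w, x) - f (.vert w, x)‖ₑ ^ 2) +
        8 * ∫⁻ x in T.piece ε (.vert w), ‖f (.vert w, x) -
          ⨍ y in T.piece ε (.vert w), f (.vert w, y)‖ₑ ^ 2 :=
        lintegral_sub_average_sq_le_of_approx huL hfL.aestronglyMeasurable
    _ ≤ 8 * η + 8 * (K * (2 * η + 2 * ∫⁻ x in T.piece ε (.vert w), ‖G (.vert w, x)‖ₑ ^ 2)) := by
        gcongr
        · exact (hfi _).1
        · refine (hC _ (T.scale_pos hε w) _ (hf.contDiffOn_piece (.vert w)) hfL).trans ?_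
          rw [← hK]
          refine mul_le_mul_right ((lintegral_fderiv_le_grad f (.vert w) _).trans ?_) _
          refine (lintegral_sq_le_of_approx (h.2.1.prodMk_left (.vert w)).1
            (hf2.prodMk_left (.vert w)).1).trans ?_
          gcongr
          exact (hfi _).2
    _ = _ := by rw [hK]; push_cast; ring

end TreeData

/-! ### Cross-sections of the cylinders: Poincaré inequality and weak axial derivative -/

namespace TreeData

variable {d k : ℕ} (T : TreeData d k) {ε : ℝ}

theorem IsC1Root.contDiffOn_slice {T : TreeData d k}
    {f : Piece k × EuclideanSpace ℝ (Fin (d + 1)) → ℂ}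
    (hf : T.IsC1Root ε f) (w : Word k) {θ : ℝ} (hθ : θ ∈ Ioo (T.edgeStart ε w) (T.edgeEnd ε w)) :
    ContDiffOn ℝ 1 (fun s => f (.edge w, axialPoint θ s)) (T.crossSection ε w) := by
  refine (hf.contDiffOn_piece (.edge w)).comp (t := T.piece ε (.edge w))
    (g := fun x => f (.edge w, x))
    (contDiff_axialPoint.comp (contDiff_const.prodMk contDiff_id)).contDiffOn fun s hs => ?_
  exact ⟨hθ.1, hθ.2, hs⟩

theorem enorm_fderiv_slice_le (hε : 0 < ε) {T : TreeData d k}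
    {f : Piece k × EuclideanSpace ℝ (Fin (d + 1)) → ℂ}
    (hf : T.IsC1Root ε f) (w : Word k) {θ : ℝ} (hθ : θ ∈ Ioo (T.edgeStart ε w) (T.edgeEnd ε w))
    {s : EuclideanSpace ℝ (Fin d)} (hs : s ∈ T.crossSection ε w) :
    ‖fderiv ℝ (fun s => f (.edge w, axialPoint θ s)) s‖ₑ ≤ ‖grad f (.edge w, axialPoint θ s)‖ₑ := by
  rw [← ofReal_norm, ← ofReal_norm]
  refine ENNReal.ofReal_le_ofReal (le_trans ?_ (norm_fderiv_le_norm_grad f (.edge w, axialPoint θ s)))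
  have hmem : axialPoint θ s ∈ T.piece ε (.edge w) := ⟨hθ.1, hθ.2, hs⟩
  have h1 : HasFDerivAt (fun x => f (.edge w, x))
      (fderiv ℝ (fun x => f (.edge w, x)) (axialPoint θ s)) (axialPoint θ s) :=
    (((hf.contDiffOn_piece (.edge w)).contDiffAt
      ((T.isOpen_piece hε _).mem_nhds hmem)).differentiableAt (by norm_num)).hasFDerivAt
  set A : EuclideanSpace ℝ (Fin d) →L[ℝ] EuclideanSpace ℝ (Fin (d + 1)) :=
    (axialEquiv d : _ →L[ℝ] _).comp (ContinuousLinearMap.inr ℝ ℝ (EuclideanSpace ℝ (Fin d)))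
  have hA : ∀ v, A v = axialPoint 0 v := fun v => rfl
  have h2 : HasFDerivAt (fun s => axialPoint θ s) A s := by
    have h3 : (fun s : EuclideanSpace ℝ (Fin d) => axialPoint θ s) =
        fun s => axialPoint θ 0 + A s := by
      ext s i
      refine Fin.cases ?_ (fun i => ?_) i <;> simp [hA, axialPoint]
    rw [h3]
    exact A.hasFDerivAt.const_add _
  have h4 := h1.comp s h2
  rw [show (fun s => f (.edge w, axialPoint θ s)) = (fun x => f (.edge w, x)) ∘
    fun s => axialPoint θ s from rfl, h4.fderiv]
  refine (ContinuousLinearMap.opNorm_comp_le _ _).trans ?_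
  refine mul_le_of_le_one_right (norm_nonneg _) (ContinuousLinearMap.opNorm_le_bound _ zero_le_one
    fun v => ?_)
  rw [hA, norm_axialPoint_zero_left, one_mul]

/-- Functions on the inflated edge `w` in product coordinates. -/
theorem aestronglyMeasurable_edge {E : Type*} [TopologicalSpace E] {T : TreeData d k} {w : Word k}
    {F : EuclideanSpace ℝ (Fin (d + 1)) → E}
    (hF : AEStronglyMeasurable F (volume.restrict (T.piece ε (.edge w)))) :
    AEStronglyMeasurable (fun q : ℝ × EuclideanSpace ℝ (Fin d) => F (axialPoint q.1 q.2))
      ((volume.restrict (Ioo (T.edgeStart ε w) (T.edgeEnd ε w))).prod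
        (volume.restrict (T.crossSection ε w))) :=
  hF.comp_measurePreserving (T.measurePreserving_edge ε w)

theorem integrable_edge {E : Type*} [NormedAddCommGroup E] {T : TreeData d k} {w : Word k}
    {F : EuclideanSpace ℝ (Fin (d + 1)) → E}
    (hF : IntegrableOn F (T.piece ε (.edge w))) :
    Integrable (fun q : ℝ × EuclideanSpace ℝ (Fin d) => F (axialPoint q.1 q.2))
      ((volume.restrict (Ioo (T.edgeStart ε w) (T.edgeEnd ε w))).prod
        (volume.restrict (T.crossSection ε w))) :=
  (T.measurePreserving_edge ε w).integrable_comp_of_integrable hF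

theorem lintegral_edge {w : Word k} {F : EuclideanSpace ℝ (Fin (d + 1)) → ENNReal}
    (hε : 0 < ε) (hF : AEMeasurable F (volume.restrict (T.piece ε (.edge w)))) :
    ∫⁻ x in T.piece ε (.edge w), F x = ∫⁻ θ in Ioo (T.edgeStart ε w) (T.edgeEnd ε w),
      ∫⁻ s in T.crossSection ε w, F (axialPoint θ s) := by
  have := T.isFiniteMeasure_crossSection hε w
  rw [← (T.measurePreserving_edge ε w).lintegral_comp_emb measurableEmbedding_axialEquiv,
    lintegral_prod]
  · rfl
  · exact hF.comp_quasiMeasurePreserving (T.measurePreserving_edge ε w).quasiMeasurePreserving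

theorem integral_edge {w : Word k} {F : EuclideanSpace ℝ (Fin (d + 1)) → ℂ}
    (hε : 0 < ε) (hF : IntegrableOn F (T.piece ε (.edge w))) :
    ∫ x in T.piece ε (.edge w), F x = ∫ θ in Ioo (T.edgeStart ε w) (T.edgeEnd ε w),
      ∫ s in T.crossSection ε w, F (axialPoint θ s) := by
  have := T.isFiniteMeasure_crossSection hε w
  rw [← (T.measurePreserving_edge ε w).integral_comp measurableEmbedding_axialEquiv,
    integral_prod]
  · rfl
  · exact integrable_edge hF

/-- The Poincaré inequality on the cross-sections of the inflated edges. -/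
theorem exists_poincare_edge : ∃ C : NNReal, ∀ {ε : ℝ}, 0 < ε →
    ∀ {u : Piece k × EuclideanSpace ℝ (Fin (d + 1)) → ℂ}
      {G : Piece k × EuclideanSpace ℝ (Fin (d + 1)) → EuclideanSpace ℂ (Fin (d + 1))},
    T.MemH10 ε u G → ∀ w : Word k,
    ∫⁻ θ in Ioo (T.edgeStart ε w) (T.edgeEnd ε w), ∫⁻ s in T.crossSection ε w,
      ‖u (.edge w, axialPoint θ s) - ⨍ t in T.crossSection ε w, u (.edge w, axialPoint θ t)‖ₑ ^ 2 ≤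
      C * ENNReal.ofReal (T.scale ε w) ^ 2 *
        ∫⁻ x in T.piece ε (.edge w), ‖G (.edge w, x)‖ₑ ^ 2 := by
  obtain ⟨C, hC⟩ := T.Ω_lipschitz.exists_poincare
  refine ⟨16 * C, fun {ε} hε {u G} h w => ?_⟩
  have hfin := T.isFiniteMeasure_piece hε (.edge w)
  have hfin' := T.isFiniteMeasure_crossSection hε w
  set K : ENNReal := C * ENNReal.ofReal (T.scale ε w) ^ 2 with hK
  have hKt : K ≠ ⊤ := by finiteness
  have huL := h.1.prodMk_left (.edge w)
  have huI := integrable_edge (huL.integrable (by norm_num))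
  refine ENNReal_le_of_forall_le_mul_add (A := 8 + 16 * K) (by finiteness) fun η hη hη' => ?_
  obtain ⟨f, hf, hf1, hf2, hfi⟩ := h.exists_approx hη
  have hfL := hf1.prodMk_left (.edge w)
  have hfI := integrable_edge (hfL.integrable (by norm_num))
  -- The Poincaré inequality on a slice is applied only to the approximation `f`, which is `C¹` on
  -- every cross-section. Of `u` it is used that almost every slice is integrable.
  have hpt : ∀ᵐ θ ∂volume.restrict (Ioo (T.edgeStart ε w) (T.edgeEnd ε w)),
      ∫⁻ s in T.crossSection ε w, ‖u (.edge w, axialPoint θ s) -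
          ⨍ t in T.crossSection ε w, u (.edge w, axialPoint θ t)‖ₑ ^ 2 ≤
        8 * (∫⁻ s in T.crossSection ε w,
          ‖u (.edge w, axialPoint θ s) - f (.edge w, axialPoint θ s)‖ₑ ^ 2) +
        8 * (K * ∫⁻ s in T.crossSection ε w, ‖grad f (.edge w, axialPoint θ s)‖ₑ ^ 2) := by
    filter_upwards [huI.prod_right_ae, hfI.prod_right_ae, ae_restrict_mem measurableSet_Ioo]
      with θ hu1 hf1 hθ
    refine (lintegral_sub_average_sq_le_of_approx hu1 hf1.aestronglyMeasurable).trans ?_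
    gcongr
    refine (hC _ (T.scale_pos hε w) _ (hf.contDiffOn_slice w hθ) hf1).trans ?_
    rw [← hK]
    refine mul_le_mul_right ?_ _
    refine setLIntegral_mono' (T.isOpen_crossSection hε w).measurableSet fun s hs => ?_
    gcongr
    exact enorm_fderiv_slice_le hε hf w hθ hs
  have hm1 : AEMeasurable (fun x => ‖u (.edge w, x) - f (.edge w, x)‖ₑ ^ 2)
      (volume.restrict (T.piece ε (.edge w))) := (huL.1.sub hfL.1).enorm.pow_const 2
  have hm2 : AEMeasurable (fun x => ‖grad f (.edge w, x)‖ₑ ^ 2)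
      (volume.restrict (T.piece ε (.edge w))) := (hf2.prodMk_left (.edge w)).1.enorm.pow_const 2
  have hm3 : AEMeasurable (fun θ => ∫⁻ s in T.crossSection ε w,
      ‖u (.edge w, axialPoint θ s) - f (.edge w, axialPoint θ s)‖ₑ ^ 2)
      (volume.restrict (Ioo (T.edgeStart ε w) (T.edgeEnd ε w))) :=
    (hm1.comp_quasiMeasurePreserving
      (T.measurePreserving_edge ε w).quasiMeasurePreserving).lintegral_prod_right'
  refine (lintegral_mono_ae hpt).trans ?_
  rw [lintegral_add_left' (hm3.const_mul 8), lintegral_const_mul' _ _ (by norm_num),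
    lintegral_const_mul' _ _ (by norm_num), lintegral_const_mul' _ _ hKt,
    ← T.lintegral_edge hε hm1, ← T.lintegral_edge hε hm2]
  calc _ ≤ 8 * η + 8 * (K * (2 * η + 2 * ∫⁻ x in T.piece ε (.edge w), ‖G (.edge w, x)‖ₑ ^ 2)) := by
        gcongr
        · exact (hfi _).1
        · refine (lintegral_sq_le_of_approx (h.2.1.prodMk_left (.edge w)).1
            (hf2.prodMk_left (.edge w)).1).trans ?_
          gcongr
          exact (hfi _).2
    _ = _ := by rw [hK]; push_cast; ring

/-- The axial derivative of a `C¹` function. -/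
theorem IsC1Root.hasDerivAt_axial (hε : 0 < ε) {T : TreeData d k}
    {f : Piece k × EuclideanSpace ℝ (Fin (d + 1)) → ℂ}
    (hf : T.IsC1Root ε f) (w : Word k) {θ : ℝ} (hθ : θ ∈ Ioo (T.edgeStart ε w) (T.edgeEnd ε w))
    {s : EuclideanSpace ℝ (Fin d)} (hs : s ∈ T.crossSection ε w) :
    HasDerivAt (fun θ => f (.edge w, axialPoint θ s)) (grad f (.edge w, axialPoint θ s) 0) θ := by
  have hmem : axialPoint θ s ∈ T.piece ε (.edge w) := ⟨hθ.1, hθ.2, hs⟩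
  have h1 : HasFDerivAt (fun x => f (.edge w, x))
      (fderiv ℝ (fun x => f (.edge w, x)) (axialPoint θ s)) (axialPoint θ s) :=
    (((hf.contDiffOn_piece (.edge w)).contDiffAt
      ((T.isOpen_piece hε _).mem_nhds hmem)).differentiableAt (by norm_num)).hasFDerivAt
  have h2 : HasDerivAt (fun θ => axialPoint θ s) (EuclideanSpace.single 0 1) θ := by
    have h3 : (fun θ : ℝ => axialPoint θ s) =
        fun θ => axialPoint 0 s + θ • EuclideanSpace.single 0 1 := by
      ext θ i
      refine Fin.cases ?_ (fun i => ?_) i <;> simp [axialPoint]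
    rw [h3]
    simpa using ((hasDerivAt_id θ).smul_const
      (EuclideanSpace.single (0 : Fin (d + 1)) (1 : ℝ))).const_add (axialPoint 0 s)
  exact h1.comp_hasDerivAt θ h2

theorem IsC1Root.continuousOn_grad_axial (hε : 0 < ε) {T : TreeData d k}
    {f : Piece k × EuclideanSpace ℝ (Fin (d + 1)) → ℂ}
    (hf : T.IsC1Root ε f) (w : Word k) {s : EuclideanSpace ℝ (Fin d)}
    (hs : s ∈ T.crossSection ε w) :
    ContinuousOn (fun θ => grad f (.edge w, axialPoint θ s) 0)
      (Ioo (T.edgeStart ε w) (T.edgeEnd ε w)) := by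
  have h1 := (hf.contDiffOn_piece (.edge w)).continuousOn_fderiv_of_isOpen
    (T.isOpen_piece hε _) le_rfl
  have h2 : Continuous fun θ : ℝ => axialPoint θ s :=
    (contDiff_axialPoint (n := 0)).continuous.comp (by fun_prop : Continuous fun θ : ℝ => (θ, s))
  exact (h1.comp h2.continuousOn fun θ hθ => ⟨hθ.1, hθ.2, hs⟩).clm_apply continuousOn_const

/-- Nothing is known about `f` and `f'` at the ends of the interval. The support of `φ` leaves room
for a compact interval `[α, β]` inside `(a, b)` that contains it in its interior, and there the
fundamental theorem of calculus applies. -/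
theorem integral_testFunction_mul_deriv {a b : ℝ} (hab : a < b) {φ : ℝ → ℝ}
    (hφ : IsTestFunction a b φ) {f f' : ℝ → ℂ} (hf : ∀ x ∈ Ioo a b, HasDerivAt f (f' x) x)
    (hf' : ContinuousOn f' (Ioo a b)) :
    ∫ x in Ioo a b, (((deriv φ x : ℝ) : ℂ) * f x + (φ x : ℂ) * f' x) = 0 := by
  obtain ⟨a', b', ha', hab', hb', hsub⟩ := hφ.exists_subset_Icc hab
  set α := (a + a') / 2
  set β := (b' + b) / 2
  have hα : a < α ∧ α < a' := ⟨by simp only [α]; linarith, by simp only [α]; linarith⟩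
  have hβ : b' < β ∧ β < b := ⟨by simp only [β]; linarith, by simp only [β]; linarith⟩
  have hαβ : Icc α β ⊆ Ioo a b := fun x hx => ⟨hα.1.trans_le hx.1, hx.2.trans_lt hβ.2⟩
  have hz : ∀ x ∉ Icc a' b', φ x = 0 ∧ deriv φ x = 0 := fun x hx => by
    have hx' : x ∉ tsupport φ := fun h => hx (hsub h)
    exact ⟨image_eq_zero_of_notMem_tsupport hx', image_eq_zero_of_notMem_tsupport fun h =>
      hx' (tsupport_deriv_subset h)⟩
  have h1 : ∫ x in Ioo a b, (((deriv φ x : ℝ) : ℂ) * f x + (φ x : ℂ) * f' x) =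
      ∫ x in Icc α β, (((deriv φ x : ℝ) : ℂ) * f x + (φ x : ℂ) * f' x) := by
    refine (setIntegral_eq_of_subset_of_forall_sdiff_eq_zero measurableSet_Ioo hαβ
      fun x hx => ?_)
    have : x ∉ Icc a' b' := fun h => hx.2 ⟨by linarith [h.1, hα.2], by linarith [h.2, hβ.1]⟩
    simp [hz x this]
  have hαβ' : α ≤ β := by linarith
  rw [h1, integral_Icc_eq_integral_Ioc, ← intervalIntegral.integral_of_le hαβ']
  have hder : ∀ x ∈ uIcc α β, HasDerivAt (fun x => (φ x : ℂ) * f x)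
      (((deriv φ x : ℝ) : ℂ) * f x + (φ x : ℂ) * f' x) x := fun x hx => by
    rw [uIcc_of_le hαβ'] at hx
    exact (hφ.contDiff.differentiable (by norm_num) x).hasDerivAt.ofReal_comp.mul (hf x (hαβ hx))
  rw [intervalIntegral.integral_eq_sub_of_hasDerivAt hder]
  · rw [(hz β fun h => absurd h.2 (not_le.2 hβ.1)).1, (hz α fun h => absurd h.1 (not_le.2 hα.2)).1]
    simp
  · refine ContinuousOn.intervalIntegrable ?_
    rw [uIcc_of_le hαβ']
    have hc1 : Continuous (deriv φ) := hφ.contDiff.continuous_deriv (by norm_num)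
    have hc2 := hφ.contDiff.continuous
    refine ContinuousOn.add (ContinuousOn.mul (by fun_prop) fun x hx =>
      (hf x (hαβ hx)).continuousAt.continuousWithinAt) (ContinuousOn.mul (by fun_prop)
        (hf'.mono hαβ))

theorem _root_.IsTestFunction.exists_bound {a b : ℝ} {φ : ℝ → ℝ} (hφ : IsTestFunction a b φ) :
    ∃ C : ℝ, 0 ≤ C ∧ ∀ x, ‖φ x‖ ≤ C ∧ ‖deriv φ x‖ ≤ C := by
  obtain ⟨C1, h1⟩ := hφ.hasCompactSupport.exists_bound_of_continuous hφ.contDiff.continuous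
  obtain ⟨C2, h2⟩ := hφ.hasCompactSupport.deriv.exists_bound_of_continuous
    (hφ.contDiff.continuous_deriv (by norm_num))
  exact ⟨max C1 C2, (norm_nonneg _).trans ((h1 0).trans (le_max_left _ _)), fun x =>
    ⟨(h1 x).trans (le_max_left _ _), (h2 x).trans (le_max_right _ _)⟩⟩

theorem enorm_integral_mul_sq_le {α : Type*} [MeasurableSpace α] {ν : Measure α}
    [IsFiniteMeasure ν] {c : α → ℝ} {C : ℝ} (hc : ∀ x, ‖c x‖ ≤ C) {f : α → ℂ}
    (hcm : AEStronglyMeasurable c ν) (hf : AEStronglyMeasurable f ν) :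
    ‖∫ x, (c x : ℂ) * f x ∂ν‖ₑ ^ 2 ≤
      ν univ * ENNReal.ofReal C ^ 2 * ∫⁻ x, ‖f x‖ₑ ^ 2 ∂ν := by
  have hm : AEStronglyMeasurable (fun x => (c x : ℂ) * f x) ν :=
    (Complex.continuous_ofReal.comp_aestronglyMeasurable hcm).mul hf
  refine (enorm_integral_sq_le hm).trans ?_
  rw [mul_assoc]
  refine mul_le_mul_right ?_ _
  rw [← lintegral_const_mul' _ _ (by finiteness)]
  refine lintegral_mono fun x => ?_
  rw [enorm_mul, mul_pow]
  gcongr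
  rw [← ofReal_norm]
  exact ENNReal.ofReal_le_ofReal (by simpa using hc x)

/-- The axial component of the gradient is the weak axial derivative. -/
theorem MemH10.integral_deriv_mul (hε : 0 < ε) (hε1 : ε < 1) {T : TreeData d k}
    {u : Piece k × EuclideanSpace ℝ (Fin (d + 1)) → ℂ}
    {G : Piece k × EuclideanSpace ℝ (Fin (d + 1)) → EuclideanSpace ℂ (Fin (d + 1))}
    (h : T.MemH10 ε u G) (w : Word k) {φ : ℝ → ℝ}
    (hφ : IsTestFunction (T.edgeStart ε w) (T.edgeEnd ε w) φ) :
    ∫ x in T.piece ε (.edge w), ((deriv φ (x 0) : ℝ) : ℂ) * u (.edge w, x) =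
      -∫ x in T.piece ε (.edge w), (φ (x 0) : ℂ) * G (.edge w, x) 0 := by
  have hfin := T.isFiniteMeasure_piece hε (.edge w)
  have hfin' := T.isFiniteMeasure_crossSection hε w
  obtain ⟨C, hC0, hC⟩ := hφ.exists_bound
  set ν := volume.restrict (T.piece ε (.edge w)) with hν
  have hc1 : Continuous fun x : EuclideanSpace ℝ (Fin (d + 1)) => deriv φ (x 0) :=
    (hφ.contDiff.continuous_deriv (by norm_num)).comp (by fun_prop)
  have hc2 : Continuous fun x : EuclideanSpace ℝ (Fin (d + 1)) => φ (x 0) :=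
    hφ.contDiff.continuous.comp (by fun_prop)
  have hbdd : ∀ {F : EuclideanSpace ℝ (Fin (d + 1)) → ℂ}, MemLp F 2 ν →
      ∀ {c : EuclideanSpace ℝ (Fin (d + 1)) → ℝ}, Continuous c → (∀ x, ‖c x‖ ≤ C) →
      Integrable (fun x => (c x : ℂ) * F x) ν := fun {F} hF {c} hc hcC =>
    (hF.integrable (by norm_num)).bdd_mul (c := C)
      (Complex.continuous_ofReal.comp hc).aestronglyMeasurable
      (Eventually.of_forall fun x => by simpa using hcC x)
  have hcomp : ∀ {H : Piece k × EuclideanSpace ℝ (Fin (d + 1)) → EuclideanSpace ℂ (Fin (d + 1))},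
      MemLp H 2 (T.inflatedMeasure ε) → MemLp (fun x => H (.edge w, x) 0) 2 ν := by
    intro H hH
    exact (EuclideanSpace.proj (𝕜 := ℂ) (0 : Fin (d + 1))).comp_memLp' (hH.prodMk_left (.edge w))
  have huL := h.1.prodMk_left (.edge w)
  have hGL := hcomp h.2.1
  set D := ∫ x, ((deriv φ (x 0) : ℝ) : ℂ) * u (.edge w, x) ∂ν with hD
  set D' := ∫ x, (φ (x 0) : ℂ) * G (.edge w, x) 0 ∂ν with hD'
  -- For a `C¹` function the corresponding sum vanishes by integration by parts along the axial
  -- lines. Both terms depend continuously on the function and its gradient in `L²`, so `D + D'` is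
  -- bounded by the approximation error.
  suffices hs : ‖D + D'‖ₑ ^ 2 ≤ 0 by
    have h0 : D + D' = 0 := by simpa using hs
    exact eq_neg_of_add_eq_zero_left h0
  refine ENNReal_le_of_forall_le_mul_add
    (A := 2 * (ν univ * ENNReal.ofReal C ^ 2 + ν univ * ENNReal.ofReal C ^ 2)) (by finiteness)
    fun η hη _ => ?_
  obtain ⟨f, hf, hf1, hf2, hfi⟩ := h.exists_approx hη
  have hfL := hf1.prodMk_left (.edge w)
  have hgL := hcomp hf2
  have hzero : (∫ x, ((deriv φ (x 0) : ℝ) : ℂ) * f (.edge w, x) ∂ν) +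
      ∫ x, (φ (x 0) : ℂ) * grad f (.edge w, x) 0 ∂ν = 0 := by
    have hI : Integrable (fun x => ((deriv φ (x 0) : ℝ) : ℂ) * f (.edge w, x) +
        (φ (x 0) : ℂ) * grad f (.edge w, x) 0) ν :=
      (hbdd hfL hc1 fun x => (hC _).2).add (hbdd hgL hc2 fun x => (hC _).1)
    rw [← integral_add (hbdd hfL hc1 fun x => (hC _).2) (hbdd hgL hc2 fun x => (hC _).1),
      ← (T.measurePreserving_edge ε w).integral_comp measurableEmbedding_axialEquiv]
    refine (integral_prod_symm _ (integrable_edge hI)).trans ?_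
    refine setIntegral_eq_zero_of_forall_eq_zero fun s hs => ?_
    exact integral_testFunction_mul_deriv (T.edgeStart_lt_edgeEnd hε hε1 w) hφ
      (fun θ hθ => hf.hasDerivAt_axial hε w hθ hs) (hf.continuousOn_grad_axial hε w hs)
  have hrw : D + D' = (∫ x, ((deriv φ (x 0) : ℝ) : ℂ) * (u (.edge w, x) - f (.edge w, x)) ∂ν) +
      ∫ x, (φ (x 0) : ℂ) * (G (.edge w, x) 0 - grad f (.edge w, x) 0) ∂ν := by
    simp only [mul_sub]
    rw [integral_sub (hbdd huL hc1 fun x => (hC _).2) (hbdd hfL hc1 fun x => (hC _).2),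
      integral_sub (hbdd hGL hc2 fun x => (hC _).1) (hbdd hgL hc2 fun x => (hC _).1)]
    linear_combination hzero
  rw [hrw, add_zero]
  refine (enorm_add_sq_le _ _).trans ?_
  rw [mul_assoc, add_mul]
  gcongr
  · refine (enorm_integral_mul_sq_le (fun x => (hC _).2) hc1.aestronglyMeasurable
      (huL.1.sub hfL.1)).trans ?_
    gcongr
    exact (hfi _).1
  · refine (enorm_integral_mul_sq_le (fun x => (hC _).1) hc2.aestronglyMeasurable
      (hGL.1.sub hgL.1)).trans ?_
    gcongr
    refine (lintegral_mono fun x => ?_).trans (hfi (.edge w)).2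
    gcongr
    rw [← ofReal_norm, ← ofReal_norm]
    refine ENNReal.ofReal_le_ofReal ?_
    exact PiLp.norm_apply_le (G (.edge w, x) - grad f (.edge w, x)) 0

end TreeData

namespace TreeData

variable {d k : ℕ} (T : TreeData d k) {ε : ℝ}

/-! ### Functions that depend on the axial coordinate only -/

/-- The function on `T_N^ε` that is `g w` of the axial coordinate on the edge `w` and constant on
the inflated vertices. -/
def axialFun (g : Word k → ℝ → ℂ) (c : Word k → ℂ) :
    Piece k × EuclideanSpace ℝ (Fin (d + 1)) → ℂ
  | (.edge w, x) => g w (x 0)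
  | (.vert w, _) => c w

/-- Axial functions that are `C¹` on the edges, constant near the inflated vertices and zero at the
root. -/
structure IsAxialC1 (ε : ℝ) (g : Word k → ℝ → ℂ) (c : Word k → ℂ) : Prop where
  contDiff : ∀ w, ContDiff ℝ 1 (g w)
  eventually_end : ∀ w, ∀ᶠ θ in 𝓝 (T.edgeEnd ε w), g w θ = c w
  eventually_start : ∀ w i, ∀ᶠ θ in 𝓝 (T.edgeStart ε (Word.child i w)), g (Word.child i w) θ = c w
  root : g (Word.root k) 0 = 0

theorem contDiff_coord_zero {n : WithTop ℕ∞} :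
    ContDiff ℝ n fun x : EuclideanSpace ℝ (Fin (d + 1)) => x 0 :=
  (EuclideanSpace.proj (𝕜 := ℝ) (0 : Fin (d + 1))).contDiff

/-- Near each section the glued function is constant, since it is constant on the vertex and the
axial profile is constant near that end of the cylinder. Regularity across the sections is then
trivial. -/
theorem IsAxialC1.isC1Root {T : TreeData d k} {g : Word k → ℝ → ℂ} {c : Word k → ℂ}
    (h : T.IsAxialC1 ε g c) : T.IsC1Root ε (axialFun g c) := by
  have hedge : ∀ w, ContDiff ℝ 1 fun x : EuclideanSpace ℝ (Fin (d + 1)) => g w (x 0) := fun w =>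
    (h.contDiff w).comp contDiff_coord_zero
  refine ⟨fun i => ?_, fun w j s hs => ?_, (hedge _).contDiffOn, fun s hs => h.root⟩
  · cases i with
    | edge w => exact (hedge w).contDiffOn
    | vert w => exact contDiffOn_const
  · refine (contDiffAt_const (c := c w)).congr_of_eventuallyEq ?_
    have hlim : Tendsto (fun x : EuclideanSpace ℝ (Fin (d + 1)) => x 0)
        (𝓝 (axialPoint (T.scale ε w * T.height j) s)) (𝓝 (T.scale ε w * T.height j)) :=
      (contDiff_coord_zero (n := 0)).continuous.tendsto _
    cases j with
    | none =>
      have h1 : Tendsto (fun x : EuclideanSpace ℝ (Fin (d + 1)) => T.edgeLen w - x 0)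
          (𝓝 (axialPoint (T.scale ε w * T.height none) s)) (𝓝 (T.edgeEnd ε w)) :=
        hlim.const_sub _
      filter_upwards [h1.eventually (h.eventually_end w)] with x hx
      rw [glued]
      split_ifs
      · rfl
      · exact hx
    | some i =>
      have h1 := hlim
      rw [← edgeStart_child] at h1
      filter_upwards [h1.eventually (h.eventually_start w i)] with x hx
      rw [glued]
      split_ifs
      · rfl
      · exact hx

theorem grad_axialFun_edge {g : Word k → ℝ → ℂ} {c : Word k → ℂ} {w : Word k}
    (hg : ContDiff ℝ 1 (g w)) (x : EuclideanSpace ℝ (Fin (d + 1))) :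
    grad (axialFun g c) (.edge w, x) = EuclideanSpace.single 0 (deriv (g w) (x 0)) := by
  have h1 := HasFDerivAt.comp x (f := fun x : EuclideanSpace ℝ (Fin (d + 1)) => x 0)
    (hg.differentiable (by norm_num) (x 0)).hasDerivAt.hasFDerivAt
    (EuclideanSpace.proj (𝕜 := ℝ) (0 : Fin (d + 1))).hasFDerivAt
  ext m
  change fderiv ℝ (fun x : EuclideanSpace ℝ (Fin (d + 1)) => g w (x 0)) x
    (EuclideanSpace.single m 1) = _
  rw [show (fun x : EuclideanSpace ℝ (Fin (d + 1)) => g w (x 0)) = g w ∘ fun x => x 0 from rfl,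
    h1.fderiv]
  by_cases hm : m = 0
  · subst hm; simp
  · simp [hm, Ne.symm hm]

theorem grad_axialFun_vert {g : Word k → ℝ → ℂ} {c : Word k → ℂ} {w : Word k}
    (x : EuclideanSpace ℝ (Fin (d + 1))) : grad (axialFun g c) (.vert w, x) = 0 := by
  ext m
  change fderiv ℝ (fun _ : EuclideanSpace ℝ (Fin (d + 1)) => c w) x
    (EuclideanSpace.single m 1) = _
  rw [fderiv_const_apply]; rfl

theorem enorm_single_zero (z : ℂ) :
    ‖(EuclideanSpace.single 0 z : EuclideanSpace ℂ (Fin (d + 1)))‖ₑ = ‖z‖ₑ := by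
  rw [← ofReal_norm, ← ofReal_norm, PiLp.norm_single]

theorem lintegral_edge_axial (hε : 0 < ε) (w : Word k) {F : ℝ → ENNReal} (hF : Measurable F) :
    ∫⁻ x in T.piece ε (.edge w), F (x 0) =
      ENNReal.ofReal (ε ^ d * T.rho w) * ∫⁻ θ in Ioo (T.edgeStart ε w) (T.edgeEnd ε w), F θ := by
  rw [T.lintegral_edge (F := fun x => F (x 0)) hε
    (hF.comp (contDiff_coord_zero (n := 0)).continuous.measurable).aemeasurable]
  simp only [axialPoint_zero, setLIntegral_const, T.volume_crossSection hε]
  rw [lintegral_mul_const' _ _ ENNReal.ofReal_ne_top, mul_comm]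

theorem tsum_piece (F : Piece k → ENNReal) :
    ∑' i, F i = ∑' w, F (.edge w) + ∑' w, F (.vert w) := by
  rw [← (Piece.equivSum k).tsum_eq]
  exact ENNReal.summable.tsum_sum ENNReal.summable

/-- Axial functions of finite norm belong to `H¹₀`. -/
theorem IsAxialC1.memH10 {T : TreeData d k} (hε : 0 < ε) {g : Word k → ℝ → ℂ} {c : Word k → ℂ}
    (h : T.IsAxialC1 ε g c)
    (h1 : ∑' w, ENNReal.ofReal (ε ^ d * T.rho w) *
      ∫⁻ θ in Ioo (T.edgeStart ε w) (T.edgeEnd ε w), ‖g w θ‖ₑ ^ 2 < ⊤)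
    (h2 : ∑' w, ENNReal.ofReal (ε ^ d * T.rho w) *
      ∫⁻ θ in Ioo (T.edgeStart ε w) (T.edgeEnd ε w), ‖deriv (g w) θ‖ₑ ^ 2 < ⊤)
    (h3 : ∑' w, ‖c w‖ₑ ^ 2 * volume (T.piece ε (.vert w)) < ⊤) :
    T.MemH10 ε (axialFun g c) (grad (axialFun g c)) := by
  have hc0 : Continuous fun x : EuclideanSpace ℝ (Fin (d + 1)) => x 0 :=
    (contDiff_coord_zero (n := 0)).continuous
  have hm1 : MemLp (axialFun g c) 2 (T.inflatedMeasure ε) := by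
    rw [T.inflatedMeasure_eq, memLp_sumMeasure_iff, tsum_piece]
    refine ⟨fun i => ?_, ENNReal.add_lt_top.2 ⟨?_, ?_⟩⟩
    · cases i with
      | edge w => exact ((h.contDiff w).continuous.comp hc0).aestronglyMeasurable
      | vert w => exact aestronglyMeasurable_const
    · convert h1 using 3 with w
      exact T.lintegral_edge_axial hε w ((h.contDiff w).continuous.measurable.enorm.pow_const 2)
    · convert h3 using 3 with w
      simp [axialFun]
  have hm2 : MemLp (grad (axialFun g c)) 2 (T.inflatedMeasure ε) := by
    rw [T.inflatedMeasure_eq, memLp_sumMeasure_iff, tsum_piece]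
    refine ⟨fun i => ?_, ENNReal.add_lt_top.2 ⟨?_, ?_⟩⟩
    · cases i with
      | edge w =>
        simp only [grad_axialFun_edge (h.contDiff w)]
        have h5 := ((h.contDiff w).continuous_deriv le_rfl).comp hc0
        refine Continuous.aestronglyMeasurable ?_
        have h6 : (fun x : EuclideanSpace ℝ (Fin (d + 1)) =>
            (EuclideanSpace.single 0 (deriv (g w) (x 0)) : EuclideanSpace ℂ (Fin (d + 1)))) =
            fun x => deriv (g w) (x 0) • EuclideanSpace.single 0 1 := by
          ext x m; simp
        rw [h6]
        exact h5.smul continuous_const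
      | vert w =>
        simp only [grad_axialFun_vert]
        exact aestronglyMeasurable_const
    · convert h2 using 3 with w
      simp only [grad_axialFun_edge (h.contDiff w), enorm_single_zero]
      exact T.lintegral_edge_axial hε w
        (((h.contDiff w).continuous_deriv le_rfl).measurable.enorm.pow_const 2)
    · simp [grad_axialFun_vert]
  refine ⟨hm1, hm2, fun η hη => ⟨_, h.isC1Root, hm1, hm2, ?_, ?_⟩⟩ <;> simpa using hη

/-! ### Eigenfunctions -/

/-- A weak solution, with its gradient. -/
structure IsEigenpair (ε lam : ℝ) (u : Piece k × EuclideanSpace ℝ (Fin (d + 1)) → ℂ)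
    (G : Piece k × EuclideanSpace ℝ (Fin (d + 1)) → EuclideanSpace ℂ (Fin (d + 1))) : Prop where
  mem : T.MemH10 ε u G
  weak : ∀ w H, T.MemH10 ε w H →
      ∫ q, inner ℂ (H q) (G q) ∂T.inflatedMeasure ε =
        lam * ∫ q, inner ℂ (w q) (u q) ∂T.inflatedMeasure ε

theorem _root_.MeasureTheory.MemLp.integrable_inner_two {α E : Type*} [MeasurableSpace α]
    [NormedAddCommGroup E]
    [InnerProductSpace ℂ E] {μ : Measure α} {f g : α → E} (hf : MemLp f 2 μ) (hg : MemLp g 2 μ) :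
    Integrable (fun x => inner ℂ (f x) (g x)) μ := by
  have h := L2.integrable_inner (𝕜 := ℂ) (hf.toLp f) (hg.toLp g)
  refine h.congr ?_
  filter_upwards [hf.coeFn_toLp, hg.coeFn_toLp] with x h1 h2
  rw [h1, h2]

theorem integral_inner_self {α E : Type*} [MeasurableSpace α] [NormedAddCommGroup E]
    [InnerProductSpace ℂ E] (μ : Measure α) (f : α → E) :
    ∫ x, inner ℂ (f x) (f x) ∂μ = ((∫ x, ‖f x‖ ^ 2 ∂μ : ℝ) : ℂ) := by
  rw [← integral_complex_ofReal]
  refine integral_congr_ae (Eventually.of_forall fun x => ?_)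
  simp only [inner_self_eq_norm_sq_to_K]
  push_cast; rfl

theorem IsEigenpair.energy {T : TreeData d k} {lam : ℝ}
    {u : Piece k × EuclideanSpace ℝ (Fin (d + 1)) → ℂ}
    {G : Piece k × EuclideanSpace ℝ (Fin (d + 1)) → EuclideanSpace ℂ (Fin (d + 1))}
    (h : T.IsEigenpair ε lam u G) :
    ∫ q, ‖G q‖ ^ 2 ∂T.inflatedMeasure ε = lam * ∫ q, ‖u q‖ ^ 2 ∂T.inflatedMeasure ε := by
  have := h.weak u G h.mem
  rw [integral_inner_self, integral_inner_self] at this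
  exact_mod_cast this

/-- The sum form of the weak equation, for axial test functions. -/
theorem IsEigenpair.weak_axial {T : TreeData d k} {lam : ℝ}
    {u : Piece k × EuclideanSpace ℝ (Fin (d + 1)) → ℂ}
    {G : Piece k × EuclideanSpace ℝ (Fin (d + 1)) → EuclideanSpace ℂ (Fin (d + 1))}
    (h : T.IsEigenpair ε lam u G) {g : Word k → ℝ → ℂ} {c : Word k → ℂ}
    (hg : ∀ w, ContDiff ℝ 1 (g w))
    (hmem : T.MemH10 ε (axialFun g c) (grad (axialFun g c))) :
    Summable (fun w => ∫ x in T.piece ε (.edge w), conj (deriv (g w) (x 0)) * G (.edge w, x) 0) ∧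
    Summable (fun w => ∫ x in T.piece ε (.edge w), conj (g w (x 0)) * u (.edge w, x)) ∧
    Summable (fun w => conj (c w) * ∫ x in T.piece ε (.vert w), u (.vert w, x)) ∧
    ∑' w, ∫ x in T.piece ε (.edge w), conj (deriv (g w) (x 0)) * G (.edge w, x) 0 =
      lam * (∑' w, (∫ x in T.piece ε (.edge w), conj (g w (x 0)) * u (.edge w, x)) +
        ∑' w, conj (c w) * ∫ x in T.piece ε (.vert w), u (.vert w, x)) := by
  have e1 := Piece.hasSum_edge_add_vert
    (hasSum_integral_sumMeasure (hmem.2.1.integrable_inner_two h.mem.2.1))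
  have e2 := Piece.hasSum_edge_add_vert
    (hasSum_integral_sumMeasure (hmem.1.integrable_inner_two h.mem.1))
  have e3 : ∀ w, ∫ x in T.piece ε (.edge w),
      inner ℂ (grad (axialFun g c) (.edge w, x)) (G (.edge w, x)) =
      ∫ x in T.piece ε (.edge w), conj (deriv (g w) (x 0)) * G (.edge w, x) 0 := fun w => by
    refine integral_congr_ae (Eventually.of_forall fun x => ?_)
    simp only [grad_axialFun_edge (hg w), EuclideanSpace.inner_single_left]
  have e4 : ∀ w, ∫ x in T.piece ε (.vert w),
      inner ℂ (grad (axialFun g c) (.vert w, x)) (G (.vert w, x)) = 0 := fun w => by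
    simp [grad_axialFun_vert]
  have e5 : ∀ w, ∫ x in T.piece ε (.edge w),
      inner ℂ (axialFun g c (.edge w, x)) (u (.edge w, x)) =
      ∫ x in T.piece ε (.edge w), conj (g w (x 0)) * u (.edge w, x) := fun w => by
    refine integral_congr_ae (Eventually.of_forall fun x => ?_)
    simp only [axialFun, RCLike.inner_apply]; ring
  have e6 : ∀ w, ∫ x in T.piece ε (.vert w),
      inner ℂ (axialFun g c (.vert w, x)) (u (.vert w, x)) =
      conj (c w) * ∫ x in T.piece ε (.vert w), u (.vert w, x) := fun w => by
    rw [← integral_const_mul]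
    refine integral_congr_ae (Eventually.of_forall fun x => ?_)
    simp only [axialFun, RCLike.inner_apply]; ring
  simp only [e3, e4, tsum_zero, add_zero] at e1
  simp only [e5, e6] at e2
  refine ⟨e1.1.summable, e2.1.summable, e2.2.1.summable, ?_⟩
  have := h.weak _ _ hmem
  rw [T.inflatedMeasure_eq, e1.2.2, e2.2.2] at this
  exact this

end TreeData

/-! ### The equation for the cross-section averages, and the projection built from them -/

namespace TreeData

variable {d k : ℕ} (T : TreeData d k) {ε : ℝ}

theorem integral_edge_axial_mul (hε : 0 < ε) (w : Word k) {c : ℝ → ℂ}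
    {F : EuclideanSpace ℝ (Fin (d + 1)) → ℂ}
    (hF : IntegrableOn (fun x => c (x 0) * F x) (T.piece ε (.edge w))) :
    ∫ x in T.piece ε (.edge w), c (x 0) * F x =
      (ε ^ d * T.rho w : ℝ) * ∫ θ in Ioo (T.edgeStart ε w) (T.edgeEnd ε w),
        c θ * ⨍ s in T.crossSection ε w, F (axialPoint θ s) := by
  have hv : (0 : ℝ) < ε ^ d * T.rho w := mul_pos (pow_pos hε _) (T.rho_pos w)
  rw [T.integral_edge hε hF, ← integral_const_mul]
  refine integral_congr_ae (Eventually.of_forall fun θ => ?_)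
  simp only [axialPoint_zero]
  rw [integral_const_mul, setAverage_eq, Measure.real, T.volume_crossSection hε,
    ENNReal.toReal_ofReal hv.le, Complex.real_smul, Complex.ofReal_inv]
  have : ((ε ^ d * T.rho w : ℝ) : ℂ) ≠ 0 := by exact_mod_cast hv.ne'
  field_simp

theorem integrableOn_average_edge (hε : 0 < ε) {w : Word k}
    {F : EuclideanSpace ℝ (Fin (d + 1)) → ℂ} (hF : IntegrableOn F (T.piece ε (.edge w))) :
    IntegrableOn (fun θ => ⨍ s in T.crossSection ε w, F (axialPoint θ s))
      (Ioo (T.edgeStart ε w) (T.edgeEnd ε w)) := by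
  have := T.isFiniteMeasure_crossSection hε w
  simp only [setAverage_eq]
  exact (integrable_edge hF).integral_prod_left.smul _

theorem MemH10.memLp_grad_zero {T : TreeData d k}
    {G : Piece k × EuclideanSpace ℝ (Fin (d + 1)) → EuclideanSpace ℂ (Fin (d + 1))}
    (hG : MemLp G 2 (T.inflatedMeasure ε)) (w : Word k) :
    MemLp (fun x => G (.edge w, x) 0) 2 (volume.restrict (T.piece ε (.edge w))) :=
  (EuclideanSpace.proj (𝕜 := ℂ) (0 : Fin (d + 1))).comp_memLp' (hG.prodMk_left (.edge w))

theorem integrableOn_axial_mul (hε : 0 < ε) {i : Piece k}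
    {F : EuclideanSpace ℝ (Fin (d + 1)) → ℂ} (hF : MemLp F 2 (volume.restrict (T.piece ε i)))
    {c : ℝ → ℂ} (hc : Continuous c) {C : ℝ} (hC : ∀ x, ‖c x‖ ≤ C) :
    IntegrableOn (fun x => c (x 0) * F x) (T.piece ε i) := by
  have := T.isFiniteMeasure_piece hε i
  exact (hF.integrable (by norm_num)).bdd_mul (c := C)
    (hc.comp (contDiff_coord_zero (n := 0)).continuous).aestronglyMeasurable
    (Eventually.of_forall fun x => hC _)

/-- The function `φ` of the axial coordinate, on the edge `w` only. -/
noncomputable def edgeFun (w : Word k) (φ : ℝ → ℝ) (w' : Word k) (θ : ℝ) : ℂ :=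
  if w' = w then (φ θ : ℂ) else 0

theorem isAxialC1_edgeFun {w : Word k} {φ : ℝ → ℝ}
    (hφ : IsTestFunction (T.edgeStart ε w) (T.edgeEnd ε w) φ) :
    T.IsAxialC1 ε (edgeFun w φ) 0 := by
  have hz : ∀ θ ∉ Ioo (T.edgeStart ε w) (T.edgeEnd ε w), ∀ᶠ x in 𝓝 θ, φ x = 0 := fun θ hθ => by
    have h1 : θ ∈ (tsupport φ)ᶜ := fun h => hθ (hφ.tsupport_subset h)
    filter_upwards [(isClosed_tsupport φ).isOpen_compl.mem_nhds h1] with x hx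
    exact image_eq_zero_of_notMem_tsupport hx
  refine ⟨fun w' => ?_, fun w' => ?_, fun w' i => ?_, ?_⟩
  · by_cases h : w' = w
    · have : edgeFun w φ w' = fun θ => (φ θ : ℂ) := by ext θ; simp [edgeFun, h]
      rw [this]
      exact Complex.ofRealCLM.contDiff.comp (hφ.contDiff.of_le (by exact_mod_cast le_top))
    · have : edgeFun w φ w' = fun _ => 0 := by ext θ; simp [edgeFun, h]
      rw [this]; exact contDiff_const
  · by_cases h : w' = w
    · subst h
      filter_upwards [hz (T.edgeEnd ε w') (by simp)] with x hx
      simp [edgeFun, hx]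
    · simp [edgeFun, h]
  · by_cases h : Word.child i w' = w
    · subst h
      filter_upwards [hz (T.edgeStart ε (Word.child i w')) (by simp)] with x hx
      simp [edgeFun, hx]
    · simp [edgeFun, h]
  · by_cases h : Word.root k = w
    · subst h
      have := (hz (T.edgeStart ε (Word.root k)) (by simp)).self_of_nhds
      rw [edgeStart_root] at this
      simp [edgeFun, this]
    · simp [edgeFun, h]

theorem deriv_edgeFun {w : Word k} {φ : ℝ → ℝ} (hφ : Differentiable ℝ φ) (θ : ℝ) :
    deriv (edgeFun w φ w) θ = (deriv φ θ : ℝ) := by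
  have : edgeFun w φ w = fun θ => (φ θ : ℂ) := by ext θ; simp [edgeFun]
  rw [this]
  exact (hφ θ).hasDerivAt.ofReal_comp.deriv

theorem edgeFun_of_ne {w w' : Word k} (h : w' ≠ w) (φ : ℝ → ℝ) : edgeFun w φ w' = fun _ => 0 := by
  ext θ; simp [edgeFun, h]

/-- A test function of the axial coordinate on one cylinder, extended by zero to all other pieces,
is admissible: it need not vanish on the lateral boundary, where the Neumann condition is natural.
Only the axial component of the gradient is seen. -/
theorem IsEigenpair.integral_deriv_mul {T : TreeData d k} {lam : ℝ} (hε : 0 < ε)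
    {u : Piece k × EuclideanSpace ℝ (Fin (d + 1)) → ℂ}
    {G : Piece k × EuclideanSpace ℝ (Fin (d + 1)) → EuclideanSpace ℂ (Fin (d + 1))}
    (h : T.IsEigenpair ε lam u G) (w : Word k) {φ : ℝ → ℝ}
    (hφ : IsTestFunction (T.edgeStart ε w) (T.edgeEnd ε w) φ) :
    ∫ x in T.piece ε (.edge w), ((deriv φ (x 0) : ℝ) : ℂ) * G (.edge w, x) 0 =
      lam * ∫ x in T.piece ε (.edge w), (φ (x 0) : ℂ) * u (.edge w, x) := by
  have hax := T.isAxialC1_edgeFun hφ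
  obtain ⟨C, hC0, hC⟩ := hφ.exists_bound
  have hd : Differentiable ℝ φ := hφ.contDiff.differentiable (by norm_num)
  have hbd : ∀ {F : ℝ → ℂ}, (∀ θ, ‖F θ‖ ≤ C) → ENNReal.ofReal (ε ^ d * T.rho w) *
      ∫⁻ θ in Ioo (T.edgeStart ε w) (T.edgeEnd ε w), ‖F θ‖ₑ ^ 2 < ⊤ := fun {F} hF => by
    refine ENNReal.mul_lt_top ENNReal.ofReal_lt_top ?_
    refine (setLIntegral_mono' (g := fun _ => ENNReal.ofReal C ^ 2) measurableSet_Ioo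
      fun θ _ => ?_).trans_lt ?_
    · gcongr; rw [← ofReal_norm]; exact ENNReal.ofReal_le_ofReal (hF θ)
    · rw [setLIntegral_const, Real.volume_Ioo]; finiteness
  have hmem := hax.memH10 hε (by
      rw [tsum_eq_single w fun w' hw' => by simp [edgeFun, hw']]
      exact hbd fun θ => by simpa [edgeFun] using (hC θ).1) (by
      rw [tsum_eq_single w fun w' hw' => by simp [edgeFun_of_ne hw']]
      refine hbd fun θ => ?_
      rw [deriv_edgeFun hd]
      simpa using (hC θ).2) (by simp)
  have h1 := (h.weak_axial hax.contDiff hmem).2.2.2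
  rw [tsum_eq_single w fun w' hw' => by simp [edgeFun_of_ne hw'],
    tsum_eq_single w fun w' hw' => by simp [edgeFun_of_ne hw']] at h1
  simp only [deriv_edgeFun hd, Complex.conj_ofReal, Pi.zero_apply, map_zero, zero_mul, tsum_zero,
    add_zero] at h1
  simpa [edgeFun] using h1

/-- The cross-section averages of an eigenfunction solve the limit equation on every edge. -/
theorem IsEigenpair.exists_oscSol {T : TreeData d k} {ω : ℝ} (hε : 0 < ε) (hε1 : ε < 1)
    {u : Piece k × EuclideanSpace ℝ (Fin (d + 1)) → ℂ}
    {G : Piece k × EuclideanSpace ℝ (Fin (d + 1)) → EuclideanSpace ℂ (Fin (d + 1))}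
    (h : T.IsEigenpair ε (ω ^ 2) u G) (w : Word k) :
    ∃ c, ∀ᵐ θ ∂volume.restrict (Ioo (T.edgeStart ε w) (T.edgeEnd ε w)),
      ⨍ s in T.crossSection ε w, u (.edge w, axialPoint θ s) =
        oscSol ω c (θ - T.edgeLen w / 2) ∧
      ⨍ s in T.crossSection ε w, G (.edge w, axialPoint θ s) 0 =
        oscDeriv ω c (θ - T.edgeLen w / 2) := by
  have hfin := T.isFiniteMeasure_piece hε (.edge w)
  have huL := h.mem.1.prodMk_left (.edge w)
  have hGL := MemH10.memLp_grad_zero h.mem.2.1 w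
  have hv : ((ε ^ d * T.rho w : ℝ) : ℂ) ≠ 0 := by
    exact_mod_cast (mul_pos (pow_pos hε _) (T.rho_pos w)).ne'
  have hI : ∀ φ : ℝ → ℝ, IsTestFunction (T.edgeStart ε w) (T.edgeEnd ε w) φ →
      ∀ F : EuclideanSpace ℝ (Fin (d + 1)) → ℂ,
      MemLp F 2 (volume.restrict (T.piece ε (.edge w))) →
      ∫ x in T.piece ε (.edge w), ((deriv φ (x 0) : ℝ) : ℂ) * F x =
        (ε ^ d * T.rho w : ℝ) * ∫ θ in Ioo (T.edgeStart ε w) (T.edgeEnd ε w),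
        ((deriv φ θ : ℝ) : ℂ) * ⨍ s in T.crossSection ε w, F (axialPoint θ s) ∧
      ∫ x in T.piece ε (.edge w), (φ (x 0) : ℂ) * F x =
        (ε ^ d * T.rho w : ℝ) * ∫ θ in Ioo (T.edgeStart ε w) (T.edgeEnd ε w),
        (φ θ : ℂ) * ⨍ s in T.crossSection ε w, F (axialPoint θ s) := by
    intro φ hφ F hF
    obtain ⟨C, hC0, hC⟩ := hφ.exists_bound
    have hc1 : Continuous (deriv φ) := hφ.contDiff.continuous_deriv (by norm_num)
    have hc2 := hφ.contDiff.continuous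
    exact ⟨T.integral_edge_axial_mul (c := fun θ => ((deriv φ θ : ℝ) : ℂ)) hε w
      (T.integrableOn_axial_mul (c := fun θ => ((deriv φ θ : ℝ) : ℂ)) hε hF (by fun_prop) (C := C)
        fun x => by simpa using (hC x).2),
      T.integral_edge_axial_mul (c := fun θ => (φ θ : ℂ)) hε w
      (T.integrableOn_axial_mul (c := fun θ => (φ θ : ℂ)) hε hF (by fun_prop) (C := C)
        fun x => by simpa using (hC x).1)⟩
  -- The data are taken at the midpoint of the edge: it does not depend on `ε`, and it lies in the
  -- cylinder whenever `ε ≤ 1 / 2`.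
  refine exists_oscSol_of_weak (T.edgeStart_lt_edgeEnd hε hε1 w) ω (T.edgeLen w / 2)
    (T.integrableOn_average_edge hε (huL.integrable (by norm_num)))
    (T.integrableOn_average_edge hε (F := fun x => G (.edge w, x) 0)
      (hGL.integrable (by norm_num))) (fun φ hφ => ?_) fun φ hφ => ?_
  · have := h.mem.integral_deriv_mul hε hε1 w hφ
    rw [(hI φ hφ _ huL).1, (hI φ hφ _ hGL).2, ← mul_neg] at this
    exact mul_left_cancel₀ hv this
  · have := h.integral_deriv_mul hε w hφ
    rw [(hI φ hφ _ hGL).1, (hI φ hφ _ huL).2, mul_left_comm] at this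
    exact mul_left_cancel₀ hv this

/-! ### The projection -/

theorem legPos_end (w : Word k) (j : Option (Fin k)) :
    T.legPos w j (T.scale ε w * T.height j) =
      j.elim (T.edgeEnd ε w) fun i => T.edgeStart ε (Word.child i w) := by
  cases j with
  | none => rfl
  | some i => simp [legPos]

theorem legPos_end_mem (hε : 0 < ε) (hε1 : ε < 1) (w : Word k) (j : Option (Fin k)) :
    T.legPos w j (T.scale ε w * T.height j) ∈
      Icc (T.edgeStart ε (w.nbr j)) (T.edgeEnd ε (w.nbr j)) := by
  rw [legPos_end]
  cases j with
  | none => exact right_mem_Icc.2 (T.edgeStart_lt_edgeEnd hε hε1 w).le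
  | some i => exact left_mem_Icc.2 (T.edgeStart_lt_edgeEnd hε hε1 (Word.child i w)).le

/-- The extension of a function on the inflated edges to the skeleton of the vertex below. -/
noncomputable def lowerExtension (ψ : Option (Fin k) → Option (Fin k) → ℝ → ℝ) (ε : ℝ)
    (P : Word k → ℝ → ℂ) : Word k → ℝ → ℂ
  | .mk [], _ => 0
  | .mk (i :: v), t => ∑ j : Option (Fin k),
      P ((Word.mk v).nbr j) (T.legPos (.mk v) j (T.scale ε (.mk v) * T.height j)) *
        (ψ j (some i) (t / T.scale ε (.mk v)) : ℂ)

/-- The projection made from the functions `P w` on the inflated edges. -/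
noncomputable def projection (ψ : Option (Fin k) → Option (Fin k) → ℝ → ℝ) (ε : ℝ) (P : Word k → ℝ → ℂ)
    (q : Word k × ℝ) : ℂ :=
  if q.2 < T.edgeStart ε q.1 then T.lowerExtension ψ ε P q.1 q.2
  else if q.2 ≤ T.edgeEnd ε q.1 then P q.1 q.2
  else ∑ j : Option (Fin k),
      P (q.1.nbr j) (T.legPos q.1 j (T.scale ε q.1 * T.height j)) *
        (ψ j none ((T.edgeLen q.1 - q.2) / T.scale ε q.1) : ℂ)

theorem projection_of_mem {ψ : Option (Fin k) → Option (Fin k) → ℝ → ℝ} {P : Word k → ℝ → ℂ}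
    {w : Word k} {t : ℝ} (ht : t ∈ Icc (T.edgeStart ε w) (T.edgeEnd ε w)) :
    T.projection ψ ε P (w, t) = P w t := by
  rw [projection, if_neg (not_lt.2 ht.1), if_pos ht.2]

theorem projection_of_lt {ψ : Option (Fin k) → Option (Fin k) → ℝ → ℝ} {P : Word k → ℝ → ℂ}
    {w : Word k} {t : ℝ} (ht : t < T.edgeStart ε w) :
    T.projection ψ ε P (w, t) = T.lowerExtension ψ ε P w t := if_pos ht

theorem projection_of_gt {ψ : Option (Fin k) → Option (Fin k) → ℝ → ℝ} {P : Word k → ℝ → ℂ}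
    {w : Word k} {t : ℝ} (h : T.edgeStart ε w ≤ t) (ht : T.edgeEnd ε w < t) :
    T.projection ψ ε P (w, t) = ∑ j : Option (Fin k),
      P (w.nbr j) (T.legPos w j (T.scale ε w * T.height j)) *
        (ψ j none ((T.edgeLen w - t) / T.scale ε w) : ℂ) :=
  (if_neg (not_lt.2 h)).trans (if_neg (not_le.2 ht))

theorem isProjection_projection (hε : 0 < ε) (hε1 : ε < 1)
    {ψ : Option (Fin k) → Option (Fin k) → ℝ → ℝ} (hψ : T.IsSkeletonPartition ψ)
    {u : Piece k × EuclideanSpace ℝ (Fin (d + 1)) → ℂ} {P : Word k → ℝ → ℂ}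
    (hP : ∀ w, Continuous (P w))
    (hPu : ∀ w, ∀ᵐ θ ∂volume.restrict (Ioo (T.edgeStart ε w) (T.edgeEnd ε w)),
      ⨍ s in T.crossSection ε w, u (.edge w, axialPoint θ s) = P w θ) :
    T.IsProjection ψ ε u (T.projection ψ ε P) := by
  refine ⟨fun w => ?_, fun w => ?_, fun w j' r hr => ?_⟩
  · exact (hP w).continuousOn.congr fun t ht => T.projection_of_mem ht
  · rw [← restrict_Ioo_eq_restrict_Icc]
    filter_upwards [hPu w, ae_restrict_mem measurableSet_Ioo] with θ h1 h2
    rw [T.projection_of_mem (Ioo_subset_Icc_self h2), h1]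
  · have hs := T.scale_pos hε w
    have hend : ∀ j, T.projection ψ ε P (w.nbr j, T.legPos w j (T.scale ε w * T.height j)) =
        P (w.nbr j) (T.legPos w j (T.scale ε w * T.height j)) := fun j =>
      T.projection_of_mem (T.legPos_end_mem hε hε1 w j)
    simp only [hend]
    rcases hr.2.lt_or_eq with hlt | heq
    · cases j' with
      | none =>
        have h1 : T.edgeEnd ε w < T.edgeLen w - r := by rw [edgeEnd]; linarith
        have h2 := T.edgeStart_lt_edgeEnd hε hε1 w
        change T.projection ψ ε P (w, T.edgeLen w - r) = _
        rw [T.projection_of_gt (by linarith) h1, sub_sub_cancel]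
      | some i =>
        obtain ⟨v⟩ := w
        have h1 : r < T.edgeStart ε (Word.child i (.mk v)) := by rw [edgeStart_child]; exact hlt
        exact T.projection_of_lt h1
    -- At the end of leg `j'` the rescaled partition of unity is `1` for `j'` and `0` for the other
    -- legs, so the vertex formula agrees with the value prescribed by the edge.
    · rw [heq, hend, mul_div_cancel_left₀ _ hs.ne', Finset.sum_eq_single j']
      · rw [hψ.eq_one]; simp
      · intro j _ hj
        rw [hψ.eq_zero j j' hj]; simp
      · simp

/-- Two continuous functions that agree almost everywhere on a nondegenerate interval agree there.
Every projection is thus the profile on the cylinders, end points included. -/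
theorem IsProjection.eqOn_edge (hε : 0 < ε) (hε1 : ε < 1) {T : TreeData d k}
    {ψ : Option (Fin k) → Option (Fin k) → ℝ → ℝ}
    {u : Piece k × EuclideanSpace ℝ (Fin (d + 1)) → ℂ} {p : Word k × ℝ → ℂ}
    (hp : T.IsProjection ψ ε u p) {P : Word k → ℝ → ℂ} (hP : ∀ w, Continuous (P w))
    (hPu : ∀ w, ∀ᵐ θ ∂volume.restrict (Ioo (T.edgeStart ε w) (T.edgeEnd ε w)),
      ⨍ s in T.crossSection ε w, u (.edge w, axialPoint θ s) = P w θ) (w : Word k) :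
    EqOn (fun θ => p (w, θ)) (P w) (Icc (T.edgeStart ε w) (T.edgeEnd ε w)) := by
  refine Measure.eqOn_Icc_of_ae_eq (μ := volume) (T.edgeStart_lt_edgeEnd hε hε1 w).ne ?_
    (hp.continuousOn_edge w) (hP w).continuousOn
  have h1 := hp.average_edge w
  have h2 := hPu w
  rw [restrict_Ioo_eq_restrict_Icc] at h2
  filter_upwards [h1, h2] with θ h3 h4
  rw [h3, h4]

end TreeData

/-! ### Neighbourhoods of the sections: functions across the gluing -/

theorem poincare_ball {n : ℕ} {z : EuclideanSpace ℝ (Fin n)} {r : ℝ} (hr : 0 < r)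
    {g : EuclideanSpace ℝ (Fin n) → ℂ} (hg : ContDiffOn ℝ 1 g (Metric.ball z r))
    (hgi : IntegrableOn g (Metric.ball z r)) :
    ∫⁻ x in Metric.ball z r, ‖g x - ⨍ y in Metric.ball z r, g y‖ₑ ^ 2 ≤
      ENNReal.ofReal (2 ^ n * (2 * r) ^ 2) *
        ∫⁻ x in Metric.ball z r, ‖fderiv ℝ g x‖ₑ ^ 2 := by
  set B := Metric.ball z r with hB
  have h0 : volume B ≠ 0 := (Metric.measure_ball_pos volume z hr).ne'
  have h1 : volume B ≠ ⊤ := measure_ball_lt_top.ne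
  have hfin : IsFiniteMeasure (volume.restrict B) := ⟨by
    rw [Measure.restrict_apply_univ]; exact h1.lt_top⟩
  have hv : volume (Metric.ball (0 : EuclideanSpace ℝ (Fin n)) (2 * r)) =
      ENNReal.ofReal (2 ^ n) * volume B := by
    have h2 : Metric.ball (0 : EuclideanSpace ℝ (Fin n)) (2 * r) =
        (2 : ℝ) • Metric.ball (0 : EuclideanSpace ℝ (Fin n)) r := by
      rw [smul_ball two_ne_zero, smul_zero]; norm_num
    rw [h2, volume_smul_set two_pos, hB, Measure.addHaar_ball_center volume z r]
  have key : volume B * ∫⁻ x in B, ‖g x - ⨍ y in B, g y‖ₑ ^ 2 ≤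
      volume B * (ENNReal.ofReal (2 ^ n * (2 * r) ^ 2) * ∫⁻ x in B, ‖fderiv ℝ g x‖ₑ ^ 2) := by
    rw [← lintegral_const_mul' _ _ h1]
    calc _ ≤ ∫⁻ x in B, ∫⁻ y in B, ‖g y - g x‖ₑ ^ 2 := lintegral_mono fun x => by
            have := measure_mul_enorm_sub_average_sq_le hgi (g x)
            rwa [Measure.restrict_apply_univ] at this
      _ ≤ _ := lintegral_lintegral_sub_sq_le_of_convex Metric.isOpen_ball (convex_ball z r)
            subset_rfl hg
      _ = _ := by
            rw [hv, ENNReal.ofReal_mul (p := 2 ^ n) (by positivity),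
              ENNReal.ofReal_pow (p := 2 * r) (by positivity) 2]
            ring
  exact (ENNReal.mul_le_mul_iff_right h0 h1).1 key

/-- The reflection of the axial coordinate. -/
noncomputable def axialReflection (d : ℕ) :
    EuclideanSpace ℝ (Fin (d + 1)) ≃ₗᵢ[ℝ] EuclideanSpace ℝ (Fin (d + 1)) where
  toFun x := axialPoint (-x 0) (transversal x)
  invFun x := axialPoint (-x 0) (transversal x)
  map_add' x y := by
    ext i
    refine Fin.cases ?_ (fun i => ?_) i
    · simp [axialPoint, add_comm]
    · simp [axialPoint, transversal]
  map_smul' c x := by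
    ext i
    refine Fin.cases ?_ (fun i => ?_) i
    · simp [axialPoint]
    · simp [axialPoint, transversal]
  left_inv x := by
    ext i
    refine Fin.cases ?_ (fun i => ?_) i
    · simp [axialPoint]
    · simp [axialPoint, transversal]
  right_inv x := by
    ext i
    refine Fin.cases ?_ (fun i => ?_) i
    · simp [axialPoint]
    · simp [axialPoint, transversal]
  norm_map' x := by
    simp [EuclideanSpace.norm_eq, Fin.sum_univ_succ, axialPoint, transversal]

theorem volume_coord_zero_eq {d : ℕ} (c : ℝ) :
    volume {x : EuclideanSpace ℝ (Fin (d + 1)) | x 0 = c} = 0 := by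
  rw [← (measurePreserving_axialEquiv (d := d)).measure_preimage_emb
    measurableEmbedding_axialEquiv]
  have : axialEquiv d ⁻¹' {x | x 0 = c} = {c} ×ˢ univ := by ext; simp
  rw [this, Measure.prod_prod]
  simp

theorem fderiv_comp_isometry_norm_le {n : ℕ}
    (R : EuclideanSpace ℝ (Fin n) ≃ₗᵢ[ℝ] EuclideanSpace ℝ (Fin n))
    (b : EuclideanSpace ℝ (Fin n)) {g : EuclideanSpace ℝ (Fin n) → ℂ} {x : EuclideanSpace ℝ (Fin n)}
    (hg : DifferentiableAt ℝ g (R x + b)) :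
    ‖fderiv ℝ (fun x => g (R x + b)) x‖ ≤ ‖fderiv ℝ g (R x + b)‖ := by
  have h1 : HasFDerivAt (fun x => R x + b)
      (R.toContinuousLinearEquiv : EuclideanSpace ℝ (Fin n) →L[ℝ] EuclideanSpace ℝ (Fin n)) x :=
    R.toContinuousLinearEquiv.hasFDerivAt.add_const b
  have h2 := hg.hasFDerivAt.comp x h1
  rw [show (fun x => g (R x + b)) = g ∘ fun x => R x + b from rfl, h2.fderiv]
  refine (ContinuousLinearMap.opNorm_comp_le _ _).trans (mul_le_of_le_one_right (norm_nonneg _) ?_)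
  exact ContinuousLinearMap.opNorm_le_bound _ zero_le_one fun v => by simp

theorem measurePreserving_isometry_add {n : ℕ}
    (R : EuclideanSpace ℝ (Fin n) ≃ₗᵢ[ℝ] EuclideanSpace ℝ (Fin n))
    (b : EuclideanSpace ℝ (Fin n)) : MeasurePreserving (fun x => R x + b) volume volume ∧
      MeasurableEmbedding fun x => R x + b :=
  ⟨(measurePreserving_add_right volume b).comp R.measurePreserving,
    (measurableEmbedding_addRight b).comp R.toHomeomorph.measurableEmbedding⟩

namespace TreeData

variable {d k : ℕ} (T : TreeData d k) {ε : ℝ}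

/-- In both cases the change of coordinates is an affine isometry, with a reflection of the axis for
the edge that comes from the root. It preserves volume and does not increase the norm of
differentials. -/
theorem legCoord_eq (w : Word k) (j : Option (Fin k)) :
    ∃ (R : EuclideanSpace ℝ (Fin (d + 1)) ≃ₗᵢ[ℝ] EuclideanSpace ℝ (Fin (d + 1)))
      (b : EuclideanSpace ℝ (Fin (d + 1))), ∀ x, T.legCoord w j x = R x + b := by
  cases j with
  | none =>
    refine ⟨axialReflection d, axialPoint (T.edgeLen w) 0, fun x => ?_⟩
    ext i
    refine Fin.cases ?_ (fun i => ?_) i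
    · change T.edgeLen w - x 0 = -x 0 + T.edgeLen w
      ring
    · change x i.succ = x i.succ + 0
      ring
  | some i => exact ⟨LinearIsometryEquiv.refl ℝ _, 0, fun x => by simp [legCoord]⟩

/-- The neighbourhood of the center of section `j`, at the scale of the vertex `w`. -/
def sectionBall (ε r : ℝ) (w : Word k) (j : Option (Fin k)) :
    Set (EuclideanSpace ℝ (Fin (d + 1))) :=
  Metric.ball (axialPoint (T.scale ε w * T.height j) 0) (T.scale ε w * r)

/-- A radius below which the sections look like flat discs. -/
structure IsSectionRadius (r : ℝ) : Prop where
  pos : 0 < r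
  le_height : ∀ j, r ≤ T.height j
  section_boundary : ∀ j, ∀ x ∈ Metric.ball (axialPoint (T.height j) 0) r,
    (T.frame j x ∈ T.V ↔ x 0 < T.height j) ∧ transversal x ∈ sectionShape T.Ω T.δ j

theorem exists_isSectionRadius : ∃ r, T.IsSectionRadius r := by
  have h : ∀ j : Option (Fin k), ∃ r > 0, ∀ x ∈ Metric.ball (axialPoint (T.height j) 0) r,
      (T.frame j x ∈ T.V ↔ x 0 < T.height j) ∧ transversal x ∈ sectionShape T.Ω T.δ j := by
    intro j
    have h0 : (0 : EuclideanSpace ℝ (Fin d)) ∈ sectionShape T.Ω T.δ j := by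
      cases j with
      | none => exact T.zero_mem_Ω
      | some i => exact ⟨0, T.zero_mem_Ω, smul_zero _⟩
    have hopen : IsOpen (sectionShape T.Ω T.δ j) := by
      cases j with
      | none => exact T.Ω_lipschitz.isOpen
      | some i => exact T.Ω_lipschitz.isOpen.smul₀ T.δ_pos.ne'
    have h2 : ∀ᶠ x in 𝓝 (axialPoint (T.height j) 0), transversal x ∈ sectionShape T.Ω T.δ j :=
      continuous_transversal.continuousAt.eventually (hopen.mem_nhds h0)
    obtain ⟨r, hr, hsub⟩ := Metric.eventually_nhds_iff_ball.1
      ((T.section_boundary j 0 h0).and h2)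
    exact ⟨r, hr, hsub⟩
  choose ρ hρ hρ2 using h
  obtain ⟨j₀, hj₀⟩ := Finite.exists_min fun j => min (ρ j) (T.height j)
  refine ⟨min (ρ j₀) (T.height j₀), ⟨lt_min (hρ j₀) (T.height_pos j₀), fun j =>
    (hj₀ j).trans (min_le_right _ _), fun j x hx => hρ2 j x ?_⟩⟩
  exact Metric.ball_subset_ball ((hj₀ j).trans (min_le_left _ _)) hx

theorem sectionBall_eq_smul (hε : 0 < ε) (r : ℝ) (w : Word k) (j : Option (Fin k)) :
    T.sectionBall ε r w j = T.scale ε w • Metric.ball (axialPoint (T.height j) 0) r := by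
  have hs := T.scale_pos hε w
  rw [smul_ball hs.ne', Real.norm_of_nonneg hs.le, sectionBall]
  congr 1
  ext i
  refine Fin.cases ?_ (fun i => ?_) i <;> simp [axialPoint]

theorem IsSectionRadius.sectionBall {T : TreeData d k} {r : ℝ} (hr : T.IsSectionRadius r)
    (hε : 0 < ε) (w : Word k) (j : Option (Fin k)) {x : EuclideanSpace ℝ (Fin (d + 1))}
    (hx : x ∈ T.sectionBall ε r w j) :
    (T.frame j x ∈ T.piece ε (.vert w) ↔ x 0 < T.scale ε w * T.height j) ∧
      transversal x ∈ T.crossSection ε (w.nbr j) ∧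
      |x 0 - T.scale ε w * T.height j| < T.scale ε w * r := by
  have hs := T.scale_pos hε w
  have habs : |x 0 - T.scale ε w * T.height j| < T.scale ε w * r := by
    have h1 := mem_ball_iff_norm.1 hx
    exact (PiLp.norm_apply_le (x - axialPoint (T.scale ε w * T.height j) 0) 0).trans_lt h1
  rw [T.sectionBall_eq_smul hε] at hx
  obtain ⟨y, hy, rfl⟩ := hx
  obtain ⟨h1, h2⟩ := hr.section_boundary j y hy
  refine ⟨?_, ?_, habs⟩
  · change T.frame j (T.scale ε w • y) ∈ T.scale ε w • T.V ↔
      T.scale ε w * y 0 < T.scale ε w * T.height j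
    rw [map_smul, smul_mem_smul_set_iff₀ hs.ne', h1, mul_lt_mul_iff_right₀ hs]
  · change T.scale ε w • transversal y ∈ _
    cases j with
    | none => exact smul_mem_smul_set h2
    | some i =>
      change _ ∈ T.scale ε (Word.child i w) • T.Ω
      rw [scale_child, mul_smul]
      exact smul_mem_smul_set h2

/-- The radius is at most the height, so beyond the section the ball advances along the edge by less
than the leg of the skeleton. For `ε ≤ 1 / 2` the edge has room for this on top of both skeletons,
and the other end is not reached. -/
theorem IsSectionRadius.legCoord_mem {T : TreeData d k} {r : ℝ} (hr : T.IsSectionRadius r)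
    (hε : 0 < ε) (hε2 : ε ≤ 1 / 2) (w : Word k) (j : Option (Fin k))
    {x : EuclideanSpace ℝ (Fin (d + 1))}
    (hx : x ∈ T.sectionBall ε r w j) (hx0 : T.scale ε w * T.height j < x 0) :
    T.legCoord w j x ∈ T.piece ε (.edge (w.nbr j)) ∧
      |T.legCoord w j x 0 - T.legPos w j (T.scale ε w * T.height j)| ≤ T.scale ε w * r := by
  have hs := T.scale_pos hε w
  obtain ⟨-, h2, h3⟩ := hr.sectionBall hε w j hx
  have h4 := (abs_lt.1 h3).2
  have h5 : T.scale ε w * r ≤ T.scale ε w * T.height j :=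
    mul_le_mul_of_nonneg_left (hr.le_height j) hs.le
  cases j with
  | none =>
    have h6 := T.edgeStart_add_le hε w
    have h7 := T.edgeLen_pos w
    refine ⟨⟨?_, ?_, h2⟩, ?_⟩
    · change T.edgeStart ε w < T.edgeLen w - x 0
      have h8 := T.scale_mul_height_none_le hε w
      nlinarith
    · change T.edgeLen w - x 0 < T.edgeEnd ε w
      rw [edgeEnd]; linarith
    · change |T.edgeLen w - x 0 - (T.edgeLen w - T.scale ε w * T.height none)| ≤ _
      rw [sub_sub_sub_cancel_left, abs_sub_comm]
      exact h3.le
  | some i =>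
    have h6 := T.edgeStart_add_le hε (Word.child i w)
    have h6' := T.edgeStart_le hε (Word.child i w)
    have h7 := T.edgeLen_pos (Word.child i w)
    rw [edgeStart_child] at h6 h6'
    refine ⟨⟨?_, ?_, h2⟩, h3.le⟩
    · change T.edgeStart ε (Word.child i w) < x 0
      rw [edgeStart_child]; exact hx0
    · have h8 : 0 < T.scale ε (Word.child i w) * T.height none :=
        mul_pos (T.scale_pos hε _) (T.height_pos none)
      have h9 : ε * T.edgeLen (Word.child i w) ≤ T.edgeLen (Word.child i w) / 2 := by nlinarith
      have h10 : x 0 < T.edgeLen (Word.child i w) - T.scale ε (Word.child i w) * T.height none := by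
        linarith
      exact h10

theorem IsSectionRadius.subset_preimage {T : TreeData d k} {r : ℝ} (hr : T.IsSectionRadius r)
    (hε : 0 < ε) (hε2 : ε ≤ 1 / 2) (w : Word k) (j : Option (Fin k)) :
    T.sectionBall ε r w j ∩ {x | x 0 < T.scale ε w * T.height j} ⊆
        T.frame j ⁻¹' T.piece ε (.vert w) ∧
      T.sectionBall ε r w j ∩ {x | T.scale ε w * T.height j < x 0} ⊆
        T.legCoord w j ⁻¹' T.piece ε (.edge (w.nbr j)) :=
  ⟨fun _ hx => (hr.sectionBall hε w j hx.1).1.2 hx.2,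
    fun _ hx => (hr.legCoord_mem hε hε2 w j hx.1 hx.2).1⟩

/-- Gluing two functions on the pieces along a section. -/
theorem lintegral_glued_le {r : ℝ} (hr : T.IsSectionRadius r) (hε : 0 < ε) (hε2 : ε ≤ 1 / 2)
    (w : Word k) (j : Option (Fin k)) (F₁ F₂ F : EuclideanSpace ℝ (Fin (d + 1)) → ENNReal)
    (h1 : ∀ x ∈ T.sectionBall ε r w j, x 0 < T.scale ε w * T.height j → F x ≤ F₁ (T.frame j x))
    (h2 : ∀ x ∈ T.sectionBall ε r w j, T.scale ε w * T.height j < x 0 →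
      F x ≤ F₂ (T.legCoord w j x)) :
    ∫⁻ x in T.sectionBall ε r w j, F x ≤
      (∫⁻ x in T.piece ε (.vert w), F₁ x) + ∫⁻ x in T.piece ε (.edge (w.nbr j)), F₂ x := by
  obtain ⟨R, b, hR⟩ := T.legCoord_eq w j
  have hleg : T.legCoord w j = fun x => R x + b := funext hR
  obtain ⟨hmp, hme⟩ := measurePreserving_isometry_add R b
  rw [← hleg] at hmp hme
  -- The hyperplane of the section is a null set, so the ball may be replaced by its two open parts,
  -- each of which is mapped isometrically into one piece.
  have hplane : ∀ᵐ x : EuclideanSpace ℝ (Fin (d + 1)), x 0 ≠ T.scale ε w * T.height j := by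
    rw [ae_iff]
    simpa using volume_coord_zero_eq (d := d) (T.scale ε w * T.height j)
  have hO1 : MeasurableSet {x : EuclideanSpace ℝ (Fin (d + 1)) | x 0 < T.scale ε w * T.height j} :=
    (isOpen_lt (by fun_prop) continuous_const).measurableSet
  have hO2 : MeasurableSet {x : EuclideanSpace ℝ (Fin (d + 1)) | T.scale ε w * T.height j < x 0} :=
    (isOpen_lt continuous_const (by fun_prop)).measurableSet
  have hmB : MeasurableSet (T.sectionBall ε r w j) := Metric.isOpen_ball.measurableSet
  have hsub : T.sectionBall ε r w j ≤ᵐ[volume]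
      (T.sectionBall ε r w j ∩ {x | x 0 < T.scale ε w * T.height j} ∪
        T.sectionBall ε r w j ∩ {x | T.scale ε w * T.height j < x 0} : Set _) := by
    filter_upwards [hplane] with x hx hxB
    exact hx.lt_or_gt.imp (fun h => ⟨hxB, h⟩) fun h => ⟨hxB, h⟩
  refine (lintegral_mono_set' hsub).trans ((lintegral_union_le _ _ _).trans (add_le_add ?_ ?_))
  · refine le_trans ?_ ((T.frame j).measurePreserving.setLIntegral_comp_preimage_emb
      (T.frame j).toHomeomorph.measurableEmbedding F₁ (T.piece ε (.vert w))).le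
    exact (setLIntegral_mono' (hmB.inter hO1) fun x hx => h1 x hx.1 hx.2).trans
      (lintegral_mono_set (hr.subset_preimage hε hε2 w j).1)
  · refine le_trans ?_ (hmp.setLIntegral_comp_preimage_emb hme F₂ (T.piece ε (.edge (w.nbr j)))).le
    exact (setLIntegral_mono' (hmB.inter hO2) fun x hx => h2 x hx.1 hx.2).trans
      (lintegral_mono_set (hr.subset_preimage hε hε2 w j).2)

theorem glued_of_le {f : Piece k × EuclideanSpace ℝ (Fin (d + 1)) → ℂ} {w : Word k}
    {j : Option (Fin k)} {x : EuclideanSpace ℝ (Fin (d + 1))}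
    (h : x 0 ≤ T.scale ε w * T.height j) : T.glued ε f w j x = f (.vert w, T.frame j x) := if_pos h

theorem glued_of_lt {f : Piece k × EuclideanSpace ℝ (Fin (d + 1)) → ℂ} {w : Word k}
    {j : Option (Fin k)} {x : EuclideanSpace ℝ (Fin (d + 1))}
    (h : T.scale ε w * T.height j < x 0) :
    T.glued ε f w j x = f (.edge (w.nbr j), T.legCoord w j x) := if_neg h.not_ge

/-- Off the section the glued function is a `C¹` function on a piece composed with an isometry. On
the section its regularity is the matching condition that belongs to the definition of `C¹`
functions on the glued manifold. -/
theorem IsC1Root.contDiffOn_glued {T : TreeData d k} {r : ℝ} (hr : T.IsSectionRadius r)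
    (hε : 0 < ε) (hε2 : ε ≤ 1 / 2) (w : Word k) (j : Option (Fin k))
    {f : Piece k × EuclideanSpace ℝ (Fin (d + 1)) → ℂ} (hf : T.IsC1Root ε f) :
    ContDiffOn ℝ 1 (T.glued ε f w j) (T.sectionBall ε r w j) := by
  intro x hx
  obtain ⟨R, b, hR⟩ := T.legCoord_eq w j
  have hleg : T.legCoord w j = fun x => R x + b := funext hR
  have hc0 : Continuous fun x : EuclideanSpace ℝ (Fin (d + 1)) => x 0 := by fun_prop
  refine ContDiffAt.contDiffWithinAt ?_
  obtain ⟨h1, h2, -⟩ := hr.sectionBall hε w j hx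
  rcases lt_trichotomy (x 0) (T.scale ε w * T.height j) with hlt | heq | hgt
  · have h3 := ((hf.contDiffOn_piece (.vert w)).contDiffAt
      ((T.isOpen_piece hε _).mem_nhds (h1.2 hlt))).comp x (T.frame j).contDiff.contDiffAt
    refine h3.congr_of_eventuallyEq ?_
    filter_upwards [(isOpen_lt hc0 continuous_const).mem_nhds hlt] with y hy
    exact T.glued_of_le (le_of_lt hy)
  · have h3 := hf.contDiffAt_section w j (transversal x) h2
    rwa [← heq, axialPoint_transversal] at h3
  · have h4 : ContDiff ℝ 1 (T.legCoord w j) := by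
      rw [hleg]; exact R.contDiff.add contDiff_const
    have h3 := ((hf.contDiffOn_piece (.edge (w.nbr j))).contDiffAt
      ((T.isOpen_piece hε _).mem_nhds (hr.legCoord_mem hε hε2 w j hx hgt).1)).comp x h4.contDiffAt
    refine h3.congr_of_eventuallyEq ?_
    filter_upwards [(isOpen_lt continuous_const hc0).mem_nhds hgt] with y hy
    exact T.glued_of_lt hy

theorem lintegral_fderiv_glued_le {r : ℝ} (hr : T.IsSectionRadius r)
    (hε : 0 < ε) (hε2 : ε ≤ 1 / 2) (w : Word k) (j : Option (Fin k))
    {f : Piece k × EuclideanSpace ℝ (Fin (d + 1)) → ℂ} (hf : T.IsC1Root ε f) :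
    ∫⁻ x in T.sectionBall ε r w j, ‖fderiv ℝ (T.glued ε f w j) x‖ₑ ^ 2 ≤
      (∫⁻ x in T.piece ε (.vert w), ‖fderiv ℝ (fun x => f (.vert w, x)) x‖ₑ ^ 2) +
        ∫⁻ x in T.piece ε (.edge (w.nbr j)),
          ‖fderiv ℝ (fun x => f (.edge (w.nbr j), x)) x‖ₑ ^ 2 := by
  have hc0 : Continuous fun x : EuclideanSpace ℝ (Fin (d + 1)) => x 0 := by fun_prop
  refine T.lintegral_glued_le hr hε hε2 w j _ _ _ (fun x hx hlt => ?_) fun x hx hgt => ?_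
  · have h3 := ((hf.contDiffOn_piece (.vert w)).contDiffAt ((T.isOpen_piece hε _).mem_nhds
      ((hr.sectionBall hε w j hx).1.2 hlt))).differentiableAt one_ne_zero
    have h4 : T.glued ε f w j =ᶠ[𝓝 x] fun x => f (.vert w, T.frame j x + 0) := by
      filter_upwards [(isOpen_lt hc0 continuous_const).mem_nhds hlt] with y hy
      rw [add_zero]; exact T.glued_of_le (le_of_lt hy)
    rw [h4.fderiv_eq, ← ofReal_norm, ← ofReal_norm]
    gcongr
    simpa using fderiv_comp_isometry_norm_le (T.frame j) 0 (g := fun x => f (.vert w, x))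
      (x := x) (by simpa using h3)
  · obtain ⟨R, b, hR⟩ := T.legCoord_eq w j
    have h3 := ((hf.contDiffOn_piece (.edge (w.nbr j))).contDiffAt ((T.isOpen_piece hε _).mem_nhds
      (hr.legCoord_mem hε hε2 w j hx hgt).1)).differentiableAt one_ne_zero
    have h4 : T.glued ε f w j =ᶠ[𝓝 x] fun x => f (.edge (w.nbr j), R x + b) := by
      filter_upwards [(isOpen_lt continuous_const hc0).mem_nhds hgt] with y hy
      rw [← hR]; exact T.glued_of_lt hy
    rw [h4.fderiv_eq, hR, ← ofReal_norm, ← ofReal_norm]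
    rw [hR] at h3
    have h5 := fderiv_comp_isometry_norm_le R b (g := fun x => f (.edge (w.nbr j), x)) h3
    gcongr

theorem aestronglyMeasurable_glued {r : ℝ} (hr : T.IsSectionRadius r)
    (hε : 0 < ε) (hε2 : ε ≤ 1 / 2) (w : Word k) (j : Option (Fin k))
    {u : Piece k × EuclideanSpace ℝ (Fin (d + 1)) → ℂ}
    (hu : AEStronglyMeasurable u (T.inflatedMeasure ε)) :
    AEStronglyMeasurable (T.glued ε u w j) (volume.restrict (T.sectionBall ε r w j)) := by
  rw [inflatedMeasure_eq, aestronglyMeasurable_sumMeasure_iff] at hu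
  obtain ⟨R, b, hR⟩ := T.legCoord_eq w j
  have hleg : T.legCoord w j = fun x => R x + b := funext hR
  obtain ⟨hmp, hme⟩ := measurePreserving_isometry_add R b
  rw [← hleg] at hmp hme
  have hO1 : MeasurableSet {x : EuclideanSpace ℝ (Fin (d + 1)) | x 0 < T.scale ε w * T.height j} :=
    (isOpen_lt (by fun_prop) continuous_const).measurableSet
  have hO2 : MeasurableSet {x : EuclideanSpace ℝ (Fin (d + 1)) | T.scale ε w * T.height j < x 0} :=
    (isOpen_lt continuous_const (by fun_prop)).measurableSet
  have hmB : MeasurableSet (T.sectionBall ε r w j) := Metric.isOpen_ball.measurableSet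
  have hplane : ∀ᵐ x : EuclideanSpace ℝ (Fin (d + 1)), x 0 ≠ T.scale ε w * T.height j := by
    rw [ae_iff]
    simpa using volume_coord_zero_eq (d := d) (T.scale ε w * T.height j)
  have hsub : T.sectionBall ε r w j ≤ᵐ[volume]
      (T.sectionBall ε r w j ∩ {x | x 0 < T.scale ε w * T.height j} ∪
        T.sectionBall ε r w j ∩ {x | T.scale ε w * T.height j < x 0} : Set _) := by
    filter_upwards [hplane] with x hx hxB
    exact hx.lt_or_gt.imp (fun h => ⟨hxB, h⟩) fun h => ⟨hxB, h⟩
  refine AEStronglyMeasurable.mono_measure ?_ (Measure.restrict_mono' hsub le_rfl)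
  refine aestronglyMeasurable_union_iff.2 ⟨?_, ?_⟩
  · have h1 := ((hu (.vert w)).comp_measurePreserving
      ((T.frame j).measurePreserving.restrict_preimage_emb
        (T.frame j).toHomeomorph.measurableEmbedding _)).mono_measure
      (Measure.restrict_mono (hr.subset_preimage hε hε2 w j).1 le_rfl)
    refine h1.congr ((ae_restrict_iff' (hmB.inter hO1)).2 (.of_forall fun x hx => ?_))
    exact (T.glued_of_le (le_of_lt hx.2)).symm
  · have h1 := ((hu (.edge (w.nbr j))).comp_measurePreserving
      (hmp.restrict_preimage_emb hme _)).mono_measure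
      (Measure.restrict_mono (hr.subset_preimage hε hε2 w j).2 le_rfl)
    refine h1.congr ((ae_restrict_iff' (hmB.inter hO2)).2 (.of_forall fun x hx => ?_))
    exact (T.glued_of_lt hx.2).symm


/-- The Poincaré inequality on the neighbourhoods of the sections. -/
theorem IsSectionRadius.exists_poincare {T : TreeData d k} {r : ℝ} (hr : T.IsSectionRadius r) :
    ∃ C : NNReal, ∀ {ε : ℝ}, 0 < ε → ε ≤ 1 / 2 →
    ∀ {u : Piece k × EuclideanSpace ℝ (Fin (d + 1)) → ℂ}
      {G : Piece k × EuclideanSpace ℝ (Fin (d + 1)) → EuclideanSpace ℂ (Fin (d + 1))},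
    T.MemH10 ε u G → ∀ (w : Word k) (j : Option (Fin k)),
    IntegrableOn (T.glued ε u w j) (T.sectionBall ε r w j) ∧
    ∫⁻ x in T.sectionBall ε r w j,
        ‖T.glued ε u w j x - ⨍ y in T.sectionBall ε r w j, T.glued ε u w j y‖ₑ ^ 2 ≤
      C * ENNReal.ofReal (T.scale ε w) ^ 2 *
        ((∫⁻ x in T.piece ε (.vert w), ‖G (.vert w, x)‖ₑ ^ 2) +
          ∫⁻ x in T.piece ε (.edge (w.nbr j)), ‖G (.edge (w.nbr j), x)‖ₑ ^ 2) := by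
  -- `poincare_ball` on a ball of radius `scale * r` has the constant `2 ^ (d + 1) * (2 * scale * r)
  -- ^ 2`. The factor `scale ^ 2` is split off.
  set C : NNReal := Real.toNNReal (2 ^ (d + 1) * (2 * r) ^ 2) with hC
  refine ⟨16 * C, fun {ε} hε hε2 {u G} h w j => ?_⟩
  have hs := T.scale_pos hε w
  set B := T.sectionBall ε r w j with hB
  have hfin : IsFiniteMeasure (volume.restrict B) := ⟨by
    rw [Measure.restrict_apply_univ]; exact measure_ball_lt_top⟩
  set K : ENNReal := C * ENNReal.ofReal (T.scale ε w) ^ 2 with hK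
  have hKt : K ≠ ⊤ := by finiteness
  have hgl : ∀ {f : Piece k × EuclideanSpace ℝ (Fin (d + 1)) → ℂ},
      MemLp f 2 (T.inflatedMeasure ε) → IntegrableOn (T.glued ε f w j) B := fun {f} hf => by
    refine MemLp.integrable (q := 2) (by norm_num) (memLp_two_iff.2
      ⟨T.aestronglyMeasurable_glued hr hε hε2 w j hf.1, ?_⟩)
    refine (T.lintegral_glued_le hr hε hε2 w j (fun x => ‖f (.vert w, x)‖ₑ ^ 2)
      (fun x => ‖f (.edge (w.nbr j), x)‖ₑ ^ 2) _ (fun x _ hx => ?_) fun x _ hx => ?_).trans_lt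
      (ENNReal.add_lt_top.2 ⟨(memLp_two_iff.1 (hf.prodMk_left (.vert w))).2,
        (memLp_two_iff.1 (hf.prodMk_left (.edge (w.nbr j)))).2⟩)
    · rw [T.glued_of_le hx.le]
    · rw [T.glued_of_lt hx]
  refine ⟨hgl h.1, ?_⟩
  refine ENNReal_le_of_forall_le_mul_add (A := 16 + 32 * K) (by finiteness) fun η hη _ => ?_
  obtain ⟨f, hf, hf1, hf2, hfi⟩ := h.exists_approx hη
  have hpoi : ∫⁻ x in B, ‖T.glued ε f w j x - ⨍ y in B, T.glued ε f w j y‖ₑ ^ 2 ≤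
      K * ∫⁻ x in B, ‖fderiv ℝ (T.glued ε f w j) x‖ₑ ^ 2 := by
    refine (poincare_ball (mul_pos hs hr.pos) (hf.contDiffOn_glued hr hε hε2 w j)
      (hgl hf1)).trans_eq ?_
    congr 1
    rw [hK, hC, ← ENNReal.ofReal_pow hs.le, ENNReal.ofNNReal_toNNReal,
      ← ENNReal.ofReal_mul (by positivity)]
    congr 1
    ring
  have hgrad : ∀ i, ∫⁻ x in T.piece ε i, ‖fderiv ℝ (fun x => f (i, x)) x‖ₑ ^ 2 ≤
      2 * η + 2 * ∫⁻ x in T.piece ε i, ‖G (i, x)‖ₑ ^ 2 := fun i => by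
    refine (lintegral_fderiv_le_grad f i _).trans ?_
    refine (lintegral_sq_le_of_approx (h.2.1.prodMk_left i).1 (hf2.prodMk_left i).1).trans ?_
    gcongr
    exact (hfi i).2
  have hdiff : ∫⁻ x in B, ‖T.glued ε u w j x - T.glued ε f w j x‖ₑ ^ 2 ≤ η + η := by
    refine (T.lintegral_glued_le hr hε hε2 w j (fun x => ‖u (.vert w, x) - f (.vert w, x)‖ₑ ^ 2)
      (fun x => ‖u (.edge (w.nbr j), x) - f (.edge (w.nbr j), x)‖ₑ ^ 2) _ (fun x _ hx => ?_)
      fun x _ hx => ?_).trans (add_le_add (hfi _).1 (hfi _).1)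
    · rw [T.glued_of_le hx.le, T.glued_of_le hx.le]
    · rw [T.glued_of_lt hx, T.glued_of_lt hx]
  calc _ ≤ 8 * (∫⁻ x in B, ‖T.glued ε u w j x - T.glued ε f w j x‖ₑ ^ 2) +
        8 * ∫⁻ x in B, ‖T.glued ε f w j x - ⨍ y in B, T.glued ε f w j y‖ₑ ^ 2 :=
        lintegral_sub_average_sq_le_of_approx (hgl h.1) (hgl hf1).aestronglyMeasurable
    _ ≤ 8 * (η + η) + 8 * (K *
        ((2 * η + 2 * ∫⁻ x in T.piece ε (.vert w), ‖G (.vert w, x)‖ₑ ^ 2) +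
          (2 * η + 2 * ∫⁻ x in T.piece ε (.edge (w.nbr j)), ‖G (.edge (w.nbr j), x)‖ₑ ^ 2))) := by
        gcongr
        refine hpoi.trans (mul_le_mul_right ?_ _)
        exact (T.lintegral_fderiv_glued_le hr hε hε2 w j hf).trans (add_le_add (hgrad _) (hgrad _))
    _ = _ := by rw [hK]; push_cast; ring

end TreeData

/-! ### Profiles, and their end values compared with the vertex averages -/

theorem measure_mul_enorm_average_sq_le {α : Type*} [MeasurableSpace α] {ν : Measure α}
    [IsFiniteMeasure ν] {f : α → ℂ} (hf : Integrable f ν) :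
    ν univ * ‖⨍ x, f x ∂ν‖ₑ ^ 2 ≤ ∫⁻ x, ‖f x‖ₑ ^ 2 ∂ν := by
  simpa using measure_mul_enorm_sub_average_sq_le hf 0

theorem enorm_sub_sq_le (a b c : ℂ) : ‖a - c‖ₑ ^ 2 ≤ 2 * (‖a - b‖ₑ ^ 2 + ‖b - c‖ₑ ^ 2) := by
  simpa using enorm_add_sq_le (a - b) (b - c)

/-- Two constants that both approximate `f` on the same set are close to each other. Averages over
different regions are compared through a common set of positive measure. -/
theorem measure_mul_enorm_sub_sq_le {α : Type*} [MeasurableSpace α] {ν : Measure α} {f : α → ℂ}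
    (hf : AEStronglyMeasurable f ν) (c p : ℂ) :
    ν univ * ‖c - p‖ₑ ^ 2 ≤ 2 * ∫⁻ x, ‖f x - c‖ₑ ^ 2 ∂ν + 2 * ∫⁻ x, ‖f x - p‖ₑ ^ 2 ∂ν := by
  calc _ = ∫⁻ _, ‖c - p‖ₑ ^ 2 ∂ν := by rw [lintegral_const, mul_comm]
    _ ≤ ∫⁻ x, (2 * ‖f x - c‖ₑ ^ 2 + 2 * ‖f x - p‖ₑ ^ 2) ∂ν := by
        refine lintegral_mono fun x => (enorm_sub_sq_le c (f x) p).trans_eq ?_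
        rw [mul_add, enorm_sub_rev]
    _ = _ := by
        have hm : AEMeasurable (fun x => 2 * ‖f x - c‖ₑ ^ 2) ν :=
          ((hf.sub aestronglyMeasurable_const).enorm.pow_const 2).const_mul 2
        rw [lintegral_add_left' hm,
          lintegral_const_mul' _ _ ENNReal.ofNat_ne_top, lintegral_const_mul' _ _ ENNReal.ofNat_ne_top]

theorem enorm_sub_sq_le_of_hasDerivAt {f g : ℝ → ℂ} {a b : ℝ} (hf : ContinuousOn f (Icc a b))
    (hfg : ∀ x ∈ Ioo a b, HasDerivAt f (g x) x) (hg : ContinuousOn g (Icc a b)) {x y : ℝ}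
    (hx : x ∈ Icc a b) (hy : y ∈ Icc a b) :
    ‖f x - f y‖ₑ ^ 2 ≤ ENNReal.ofReal |x - y| * ∫⁻ t in Ioo a b, ‖g t‖ₑ ^ 2 := by
  wlog hle : y ≤ x generalizing x y
  · rw [enorm_sub_rev, abs_sub_comm]
    exact this hy hx (le_of_not_ge hle)
  have hsub : Icc y x ⊆ Icc a b := Icc_subset_Icc hy.1 hx.2
  have h1 : ∫ t in Ioc y x, g t = f x - f y := by
    rw [← intervalIntegral.integral_of_le hle]
    refine intervalIntegral.integral_eq_sub_of_hasDerivAt_of_le hle (hf.mono hsub)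
      (fun t ht => hfg t ⟨hy.1.trans_lt ht.1, ht.2.trans_le hx.2⟩) ?_
    exact ContinuousOn.intervalIntegrable (by rw [uIcc_of_le hle]; exact hg.mono hsub)
  rw [← h1]
  refine (enorm_integral_sq_le ((hg.mono (Ioc_subset_Icc_self.trans hsub)).aestronglyMeasurable
    measurableSet_Ioc)).trans ?_
  rw [Measure.restrict_apply_univ, Real.volume_Ioc, abs_of_nonneg (sub_nonneg.2 hle),
    ← restrict_Ioo_eq_restrict_Ioc]
  gcongr
  · exact hy.1
  · exact hx.2

/-- A pointwise bound by the `H¹` norm on an interval. -/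
theorem length_mul_enorm_sq_le {f g : ℝ → ℂ} {a b : ℝ} (hf : ContinuousOn f (Icc a b))
    (hfg : ∀ x ∈ Ioo a b, HasDerivAt f (g x) x) (hg : ContinuousOn g (Icc a b)) {x : ℝ}
    (hx : x ∈ Icc a b) :
    ENNReal.ofReal (b - a) * ‖f x‖ₑ ^ 2 ≤ 2 * (∫⁻ t in Ioo a b, ‖f t‖ₑ ^ 2) +
      2 * (ENNReal.ofReal (b - a) ^ 2 * ∫⁻ t in Ioo a b, ‖g t‖ₑ ^ 2) := by
  have h1 := measure_mul_enorm_sub_sq_le ((hf.mono Ioo_subset_Icc_self).aestronglyMeasurable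
    (μ := volume) measurableSet_Ioo) (f x) 0
  rw [Measure.restrict_apply_univ, Real.volume_Ioo, add_comm] at h1
  simp only [sub_zero] at h1
  refine h1.trans (add_le_add le_rfl (mul_le_mul_right ?_ _))
  calc _ ≤ ∫⁻ _ in Ioo a b, ENNReal.ofReal (b - a) * ∫⁻ t in Ioo a b, ‖g t‖ₑ ^ 2 := by
        refine setLIntegral_mono' measurableSet_Ioo fun y hy => ?_
        refine (enorm_sub_sq_le_of_hasDerivAt hf hfg hg (Ioo_subset_Icc_self hy) hx).trans ?_
        gcongr
        exact abs_le.2 ⟨by linarith [hy.1, hx.2], by linarith [hy.2, hx.1]⟩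
    _ = _ := by
        rw [lintegral_const, Measure.restrict_apply_univ, Real.volume_Ioo]; ring

namespace TreeData

variable {d k : ℕ} (T : TreeData d k) {ε ω : ℝ}

/-- The solution of `-P'' = ω² P` on the edge `w` with value and slope `a w` at the midpoint. -/
noncomputable def profile (ω : ℝ) (a : Word k → ℂ × ℂ) (w : Word k) (θ : ℝ) : ℂ :=
  oscSol ω (a w) (θ - T.edgeLen w / 2)

/-- The derivative of `profile`. -/
noncomputable def profileDeriv (ω : ℝ) (a : Word k → ℂ × ℂ) (w : Word k) (θ : ℝ) : ℂ :=
  oscDeriv ω (a w) (θ - T.edgeLen w / 2)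

theorem hasDerivAt_profile (ω : ℝ) (a : Word k → ℂ × ℂ) (w : Word k) (θ : ℝ) :
    HasDerivAt (T.profile ω a w) (T.profileDeriv ω a w θ) θ := 
  (hasDerivAt_oscSol ω (a w) (θ - T.edgeLen w / 2)).comp_sub_const θ _

theorem hasDerivAt_profileDeriv (ω : ℝ) (a : Word k → ℂ × ℂ) (w : Word k) (θ : ℝ) :
    HasDerivAt (T.profileDeriv ω a w) (-(ω ^ 2 : ℝ) * T.profile ω a w θ) θ := 
  (hasDerivAt_oscDeriv ω (a w) (θ - T.edgeLen w / 2)).comp_sub_const θ _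

theorem continuous_profile (ω : ℝ) (a : Word k → ℂ × ℂ) (w : Word k) :
    Continuous (T.profile ω a w) :=
  continuous_iff_continuousAt.2 fun θ => (T.hasDerivAt_profile ω a w θ).continuousAt

theorem continuous_profileDeriv (ω : ℝ) (a : Word k → ℂ × ℂ) (w : Word k) :
    Continuous (T.profileDeriv ω a w) :=
  continuous_iff_continuousAt.2 fun θ => (T.hasDerivAt_profileDeriv ω a w θ).continuousAt

/-- The cross-section averages of `u` and of the axial derivative are the profile with midpoint
data `a` and its derivative. -/
structure IsProfile (ε ω : ℝ) (u : Piece k × EuclideanSpace ℝ (Fin (d + 1)) → ℂ)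
    (G : Piece k × EuclideanSpace ℝ (Fin (d + 1)) → EuclideanSpace ℂ (Fin (d + 1)))
    (a : Word k → ℂ × ℂ) : Prop where
  mem : T.MemH10 ε u G
  average : ∀ w, ∀ᵐ θ ∂volume.restrict (Ioo (T.edgeStart ε w) (T.edgeEnd ε w)),
    ⨍ s in T.crossSection ε w, u (.edge w, axialPoint θ s) = T.profile ω a w θ
  average_grad : ∀ w, ∀ᵐ θ ∂volume.restrict (Ioo (T.edgeStart ε w) (T.edgeEnd ε w)),
    ⨍ s in T.crossSection ε w, G (.edge w, axialPoint θ s) 0 = T.profileDeriv ω a w θ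

theorem IsEigenpair.exists_isProfile {T : TreeData d k} (hε : 0 < ε) (hε1 : ε < 1)
    {u : Piece k × EuclideanSpace ℝ (Fin (d + 1)) → ℂ}
    {G : Piece k × EuclideanSpace ℝ (Fin (d + 1)) → EuclideanSpace ℂ (Fin (d + 1))}
    (h : T.IsEigenpair ε (ω ^ 2) u G) : ∃ a, T.IsProfile ε ω u G a := by
  choose a ha using h.exists_oscSol hε hε1
  exact ⟨a, h.mem, fun w => (ha w).mono fun _ h => h.1, fun w => (ha w).mono fun _ h => h.2⟩

/-- The energy of the profile on an inflated edge. -/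
noncomputable def profileEnergy (ε ω : ℝ) (a : Word k → ℂ × ℂ) (w : Word k) : ENNReal :=
  ∫⁻ θ in Ioo (T.edgeStart ε w) (T.edgeEnd ε w), ‖T.profileDeriv ω a w θ‖ₑ ^ 2

/-- The mass of the profile on an inflated edge. -/
noncomputable def profileMass (ε ω : ℝ) (a : Word k → ℂ × ℂ) (w : Word k) : ENNReal :=
  ∫⁻ θ in Ioo (T.edgeStart ε w) (T.edgeEnd ε w), ‖T.profile ω a w θ‖ₑ ^ 2

theorem lintegral_average_sq_le {F : EuclideanSpace ℝ (Fin (d + 1)) → ℂ} (hε : 0 < ε) {w : Word k}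
    (hF : MemLp F 2 (volume.restrict (T.piece ε (.edge w)))) {f : ℝ → ℂ}
    (hf : ∀ᵐ θ ∂volume.restrict (Ioo (T.edgeStart ε w) (T.edgeEnd ε w)),
      ⨍ s in T.crossSection ε w, F (axialPoint θ s) = f θ) :
    ENNReal.ofReal (ε ^ d * T.rho w) *
        ∫⁻ θ in Ioo (T.edgeStart ε w) (T.edgeEnd ε w), ‖f θ‖ₑ ^ 2 ≤
      ∫⁻ x in T.piece ε (.edge w), ‖F x‖ₑ ^ 2 := by
  have hfin := T.isFiniteMeasure_crossSection hε w
  have hfinp := T.isFiniteMeasure_piece hε (.edge w)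
  rw [lintegral_edge T hε (hF.1.enorm.pow_const 2),
    ← lintegral_const_mul' _ _ ENNReal.ofReal_ne_top]
  refine lintegral_mono_ae ?_
  filter_upwards [hf, (T.integrable_edge (hF.integrable (by norm_num))).prod_right_ae] with θ h1 h2
  have := measure_mul_enorm_average_sq_le h2
  rwa [Measure.restrict_apply_univ, T.volume_crossSection hε, h1] at this

section

variable {T} {u : Piece k × EuclideanSpace ℝ (Fin (d + 1)) → ℂ}
  {G : Piece k × EuclideanSpace ℝ (Fin (d + 1)) → EuclideanSpace ℂ (Fin (d + 1))}
  {a : Word k → ℂ × ℂ}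

theorem IsProfile.mass_le (hε : 0 < ε) (h : T.IsProfile ε ω u G a) (w : Word k) :
    ENNReal.ofReal (ε ^ d * T.rho w) * T.profileMass ε ω a w ≤
      ∫⁻ x in T.piece ε (.edge w), ‖u (.edge w, x)‖ₑ ^ 2 :=
  T.lintegral_average_sq_le hε (h.mem.1.prodMk_left (.edge w)) (h.average w)

theorem IsProfile.energy_le (hε : 0 < ε) (h : T.IsProfile ε ω u G a) (w : Word k) :
    ENNReal.ofReal (ε ^ d * T.rho w) * T.profileEnergy ε ω a w ≤
      ∫⁻ x in T.piece ε (.edge w), ‖G (.edge w, x)‖ₑ ^ 2 := by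
  refine (T.lintegral_average_sq_le hε (MemH10.memLp_grad_zero h.mem.2.1 w)
    (h.average_grad w)).trans (lintegral_mono fun x => ?_)
  rw [← ofReal_norm, ← ofReal_norm]
  gcongr
  exact PiLp.norm_apply_le _ _

end

theorem enorm_profile_sub_sq_le (ω : ℝ) (a : Word k → ℂ × ℂ) (w : Word k) {θ θ' : ℝ}
    (hθ : θ ∈ Icc (T.edgeStart ε w) (T.edgeEnd ε w))
    (hθ' : θ' ∈ Icc (T.edgeStart ε w) (T.edgeEnd ε w)) :
    ‖T.profile ω a w θ - T.profile ω a w θ'‖ₑ ^ 2 ≤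
      ENNReal.ofReal |θ - θ'| * T.profileEnergy ε ω a w := by
  exact enorm_sub_sq_le_of_hasDerivAt (T.continuous_profile ω a w).continuousOn
    (fun x _ => T.hasDerivAt_profile ω a w x) (T.continuous_profileDeriv ω a w).continuousOn hθ hθ'

theorem profileEnergy_ne_top (ε ω : ℝ) (a : Word k → ℂ × ℂ) (w : Word k) :
    T.profileEnergy ε ω a w ≠ ⊤ := by
  have h : ContinuousOn (fun θ => ‖T.profileDeriv ω a w θ‖ ^ 2)
      (Icc (T.edgeStart ε w) (T.edgeEnd ε w)) :=
    ((T.continuous_profileDeriv ω a w).norm.pow 2).continuousOn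
  have h2 := (h.integrableOn_compact (μ := volume) isCompact_Icc).mono_set Ioo_subset_Icc_self
  refine ne_of_lt (lt_of_eq_of_lt ?_ h2.2)
  refine lintegral_congr fun θ => ?_
  rw [enorm_pow, enorm_norm]

theorem profileMass_ne_top (ε ω : ℝ) (a : Word k → ℂ × ℂ) (w : Word k) :
    T.profileMass ε ω a w ≠ ⊤ := by
  have h : ContinuousOn (fun θ => ‖T.profile ω a w θ‖ ^ 2)
      (Icc (T.edgeStart ε w) (T.edgeEnd ε w)) :=
    ((T.continuous_profile ω a w).norm.pow 2).continuousOn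
  have h2 := (h.integrableOn_compact (μ := volume) isCompact_Icc).mono_set Ioo_subset_Icc_self
  refine ne_of_lt (lt_of_eq_of_lt ?_ h2.2)
  refine lintegral_congr fun θ => ?_
  rw [enorm_pow, enorm_norm]

/-- The mass on an inflated edge in terms of the profile. -/
theorem exists_edge_mass_le : ∃ C : NNReal, ∀ {ε ω : ℝ}, 0 < ε →
    ∀ {u : Piece k × EuclideanSpace ℝ (Fin (d + 1)) → ℂ}
      {G : Piece k × EuclideanSpace ℝ (Fin (d + 1)) → EuclideanSpace ℂ (Fin (d + 1))}
      {a : Word k → ℂ × ℂ}, T.IsProfile ε ω u G a → ∀ w : Word k, ∀ (b : ℝ → ENNReal) (p : ℂ),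
    Measurable b → (∀ θ, b θ ≤ 1) →
    ∫⁻ x in T.piece ε (.edge w), b (x 0) * ‖u (.edge w, x) - p‖ₑ ^ 2 ≤
      C * ENNReal.ofReal (T.scale ε w) ^ 2 * (∫⁻ x in T.piece ε (.edge w), ‖G (.edge w, x)‖ₑ ^ 2) +
      2 * (ENNReal.ofReal (ε ^ d * T.rho w) * ∫⁻ θ in Ioo (T.edgeStart ε w) (T.edgeEnd ε w),
        b θ * ‖T.profile ω a w θ - p‖ₑ ^ 2) := by
  obtain ⟨C, hC⟩ := T.exists_poincare_edge
  -- The weight `b` depends on the axial coordinate and is at most `1`. As an indicator function it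
  -- localises the estimate to an end of the cylinder; as the constant `1` it gives the total mass.
  refine ⟨2 * C, fun {ε ω} hε {u G a} h w b p hb hb1 => ?_⟩
  have hbx : Measurable fun x : EuclideanSpace ℝ (Fin (d + 1)) => b (x 0) := by fun_prop
  have hP := T.continuous_profile ω a w
  have hm : Measurable fun θ => 2 * (ENNReal.ofReal (ε ^ d * T.rho w) *
      (b θ * ‖T.profile ω a w θ - p‖ₑ ^ 2)) := by
    have h2 : Measurable fun θ => ‖T.profile ω a w θ - p‖ₑ :=
      (hP.sub continuous_const).measurable.enorm
    fun_prop
  have hbu : AEMeasurable (fun x => b (x 0) * ‖u (.edge w, x) - p‖ₑ ^ 2)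
      (volume.restrict (T.piece ε (.edge w))) := hbx.aemeasurable.mul
    (((h.mem.1.prodMk_left (.edge w)).1.sub aestronglyMeasurable_const).enorm.pow_const 2)
  rw [lintegral_edge T hε hbu]
  calc _ ≤ ∫⁻ θ in Ioo (T.edgeStart ε w) (T.edgeEnd ε w), (2 * (∫⁻ s in T.crossSection ε w,
      ‖u (.edge w, axialPoint θ s) - ⨍ t in T.crossSection ε w, u (.edge w, axialPoint θ t)‖ₑ ^ 2) +
        2 * (ENNReal.ofReal (ε ^ d * T.rho w) * (b θ * ‖T.profile ω a w θ - p‖ₑ ^ 2))) := by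
        refine lintegral_mono_ae ?_
        filter_upwards [h.average w] with θ hθ
        rw [hθ]
        calc _ ≤ ∫⁻ s in T.crossSection ε w, (2 * ‖u (.edge w, axialPoint θ s) -
              T.profile ω a w θ‖ₑ ^ 2 + 2 * (b θ * ‖T.profile ω a w θ - p‖ₑ ^ 2)) := by
              refine lintegral_mono fun s => ?_
              change b θ * _ ≤ _
              calc _ ≤ b θ * (2 * (‖u (.edge w, axialPoint θ s) - T.profile ω a w θ‖ₑ ^ 2 +
                    ‖T.profile ω a w θ - p‖ₑ ^ 2)) := by
                    gcongr; exact enorm_sub_sq_le _ _ _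
                _ = b θ * (2 * ‖u (.edge w, axialPoint θ s) - T.profile ω a w θ‖ₑ ^ 2) +
                    2 * (b θ * ‖T.profile ω a w θ - p‖ₑ ^ 2) := by ring
                _ ≤ _ := add_le_add (mul_le_of_le_one_left' (hb1 θ)) le_rfl
          _ = _ := by
              rw [lintegral_add_right _ measurable_const,
                lintegral_const_mul' _ _ ENNReal.ofNat_ne_top, lintegral_const,
                Measure.restrict_apply_univ, T.volume_crossSection hε]
              ring
    _ ≤ _ := by
        rw [lintegral_add_right _ hm, lintegral_const_mul' _ _ ENNReal.ofNat_ne_top,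
          lintegral_const_mul' _ _ ENNReal.ofNat_ne_top,
          lintegral_const_mul' _ _ ENNReal.ofReal_ne_top]
        refine add_le_add ?_ le_rfl
        refine (mul_le_mul_right (hC hε h.mem w) _).trans_eq ?_
        push_cast; ring


theorem scale_nbr_le (hε : 0 < ε) (w : Word k) (j : Option (Fin k)) :
    T.scale ε (w.nbr j) ≤ T.scale ε w := by
  cases j with
  | none => exact le_rfl
  | some i =>
    change T.scale ε (Word.child i w) ≤ _
    rw [scale_child]
    exact mul_le_of_le_one_right (T.scale_pos hε w).le T.δ_lt_one.le

/-- This provides, on the side of the section selected by the sign `σ`, a ball with a fixed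
proportion of the volume. There the glued function is given by a single piece. -/
theorem ball_axialPoint_subset {a s r : ℝ} (σ : ℝ) (hσ : |σ| = 1) :
    Metric.ball (axialPoint (a + σ * (s * r / 2)) (0 : EuclideanSpace ℝ (Fin d))) (s * r / 2) ⊆
      Metric.ball (axialPoint a 0) (s * r) ∩ {x | 0 < σ * (x 0 - a)} := by
  intro x hx
  rw [mem_ball_iff_norm] at hx
  have hpos : 0 < s * r / 2 := (norm_nonneg _).trans_lt hx
  have hσ2 : σ * σ = 1 := by rw [← abs_mul_abs_self, hσ, one_mul]
  constructor
  · rw [mem_ball_iff_norm]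
    have h1 : x - axialPoint a 0 = (x - axialPoint (a + σ * (s * r / 2)) 0) +
        EuclideanSpace.single 0 (σ * (s * r / 2)) := by
      ext i
      refine Fin.cases ?_ (fun i => ?_) i
      · simp [axialPoint]; ring
      · simp [axialPoint]
    rw [h1]
    refine (norm_add_le _ _).trans_lt ?_
    have h2 : ‖(EuclideanSpace.single 0 (σ * (s * r / 2)) : EuclideanSpace ℝ (Fin (d + 1)))‖ =
        s * r / 2 := by
      rw [PiLp.norm_single, Real.norm_eq_abs, abs_mul, hσ, one_mul, abs_of_pos hpos]
    linarith
  · have h1 := (PiLp.norm_apply_le (x - axialPoint (a + σ * (s * r / 2)) 0) 0).trans_lt hx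
    have h2 : |σ * (x 0 - (a + σ * (s * r / 2)))| < s * r / 2 := by
      rw [abs_mul, hσ, one_mul]; exact h1
    have h3 := (abs_lt.1 h2).1
    change 0 < σ * (x 0 - a)
    have h4 : σ * (x 0 - (a + σ * (s * r / 2))) = σ * (x 0 - a) - s * r / 2 := by
      linear_combination (-(s * r / 2)) * hσ2
    linarith

/-- The end value of the profile of an inflated edge is close to the average over the inflated
vertex. -/
theorem exists_average_sub_profile_le : ∃ C : NNReal, ∀ {ε ω : ℝ}, 0 < ε → ε ≤ 1 / 2 →
    ∀ {u : Piece k × EuclideanSpace ℝ (Fin (d + 1)) → ℂ}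
      {G : Piece k × EuclideanSpace ℝ (Fin (d + 1)) → EuclideanSpace ℂ (Fin (d + 1))}
      {a : Word k → ℂ × ℂ}, T.IsProfile ε ω u G a → ∀ (w : Word k) (j : Option (Fin k)),
    ENNReal.ofReal (T.scale ε w ^ (d + 1)) *
        ‖(⨍ x in T.piece ε (.vert w), u (.vert w, x)) -
          T.profile ω a (w.nbr j) (T.legPos w j (T.scale ε w * T.height j))‖ₑ ^ 2 ≤
      C * ENNReal.ofReal (T.scale ε w) ^ 2 *
        ((∫⁻ x in T.piece ε (.vert w), ‖G (.vert w, x)‖ₑ ^ 2) +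
          ∫⁻ x in T.piece ε (.edge (w.nbr j)), ‖G (.edge (w.nbr j), x)‖ₑ ^ 2) := by
  obtain ⟨r, hr⟩ := T.exists_isSectionRadius
  obtain ⟨C₁, hC₁⟩ := T.exists_poincare_vert
  obtain ⟨C₂, hC₂⟩ := T.exists_edge_mass_le
  obtain ⟨C₃, hC₃⟩ := hr.exists_poincare
  set β : ENNReal := volume (Metric.ball (0 : EuclideanSpace ℝ (Fin (d + 1))) (r / 2)) with hβ
  have hβ0 : β ≠ 0 := (Metric.measure_ball_pos volume _ (half_pos hr.pos)).ne'
  have hβt : β ≠ ⊤ := measure_ball_lt_top.ne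
  -- The vertex average `c` and the end value `p` are both compared with the average `b` over the
  -- straddling ball. The two comparisons, each with factor `2 + 2`, and the triangle inequality
  -- account for the factor `8`. `β` is the volume of a half-size ball before scaling.
  set L : ENNReal := β⁻¹ * (8 * (C₁ + (C₂ + 2 * ENNReal.ofReal (2 * r ^ 2)) + C₃)) with hL
  have hLt : L ≠ ⊤ := by
    have := ENNReal.inv_ne_top.2 hβ0
    finiteness
  refine ⟨L.toNNReal, fun {ε ω} hε hε2 {u G a} h w j => ?_⟩
  rw [ENNReal.coe_toNNReal hLt]
  have hs := T.scale_pos hε w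
  set s := T.scale ε w
  set EV := ∫⁻ x in T.piece ε (.vert w), ‖G (.vert w, x)‖ₑ ^ 2
  set EE := ∫⁻ x in T.piece ε (.edge (w.nbr j)), ‖G (.edge (w.nbr j), x)‖ₑ ^ 2 with hEE
  set c := ⨍ x in T.piece ε (.vert w), u (.vert w, x)
  set t₀ := T.legPos w j (s * T.height j) with ht₀
  have ht₀m := T.legPos_end_mem hε (by linarith) w j
  rw [← ht₀] at ht₀m
  set p := T.profile ω a (w.nbr j) t₀
  set B := T.sectionBall ε r w j with hB
  set b := ⨍ y in B, T.glued ε u w j y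
  obtain ⟨hgi, hg⟩ := hC₃ hε hε2 h.mem w j
  -- the two sides of the section
  set S : Set ℝ := Icc (t₀ - s * r) (t₀ + s * r) with hS
  set F : EuclideanSpace ℝ (Fin (d + 1)) → ENNReal := fun x =>
    if x 0 < s * T.height j then ‖T.glued ε u w j x - c‖ₑ ^ 2
    else ‖T.glued ε u w j x - p‖ₑ ^ 2
  have hF1 : ∀ x, x 0 < s * T.height j → F x = ‖T.glued ε u w j x - c‖ₑ ^ 2 := fun x hx => if_pos hx
  have hF2 : ∀ x, ¬x 0 < s * T.height j → F x = ‖T.glued ε u w j x - p‖ₑ ^ 2 := fun x hx => if_neg hx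
  have hFle : ∫⁻ x in B, F x ≤ C₁ * ENNReal.ofReal s ^ 2 * EV +
      (C₂ + 2 * ENNReal.ofReal (2 * r ^ 2)) * ENNReal.ofReal s ^ 2 * EE := by
    refine (T.lintegral_glued_le hr hε hε2 w j (fun x => ‖u (.vert w, x) - c‖ₑ ^ 2)
      (fun x => S.indicator 1 (x 0) * ‖u (.edge (w.nbr j), x) - p‖ₑ ^ 2) F
      (fun x _ hx => ?_) fun x hxB hx => ?_).trans (add_le_add (hC₁ hε h.mem w) ?_)
    · rw [hF1 x hx, T.glued_of_le hx.le]
    · have h1 := (hr.legCoord_mem hε hε2 w j hxB hx).2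
      have h2 : T.legCoord w j x 0 ∈ S := by
        rw [abs_le] at h1
        exact ⟨by linarith, by linarith⟩
      rw [hF2 x hx.not_gt, T.glued_of_lt hx, indicator_of_mem h2, Pi.one_apply, one_mul]
    · refine (hC₂ hε h (w.nbr j) (S.indicator 1) p (measurable_one.indicator measurableSet_Icc)
        (fun θ => indicator_le_self' (fun _ _ => zero_le) θ)).trans ?_
      rw [add_mul, add_mul]
      refine add_le_add ?_ ?_
      · gcongr
        exact T.scale_nbr_le hε w j
      · rw [mul_assoc, mul_assoc]
        refine mul_le_mul_right ?_ _
        -- Within distance `s r` of the end point the squared deviation of the profile from `p` is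
        -- at most `s r` times its energy. Integrated over an interval of length `2 s r` this gives
        -- `2 r² s²` times the energy, the same order in `s` as the Poincaré terms.
        calc _ ≤ ENNReal.ofReal (ε ^ d * T.rho (w.nbr j)) * ∫⁻ θ in S,
              (ENNReal.ofReal (s * r) * T.profileEnergy ε ω a (w.nbr j)) := by
              refine mul_le_mul_right ?_ _
              rw [← lintegral_indicator measurableSet_Ioo, ← lintegral_indicator measurableSet_Icc]
              refine lintegral_mono fun θ => ?_
              by_cases hθ : θ ∈ Ioo (T.edgeStart ε (w.nbr j)) (T.edgeEnd ε (w.nbr j))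
              · rw [indicator_of_mem hθ]
                by_cases hθS : θ ∈ S
                · rw [indicator_of_mem hθS, indicator_of_mem hθS, Pi.one_apply, one_mul]
                  refine (T.enorm_profile_sub_sq_le ω a _ (Ioo_subset_Icc_self hθ) ht₀m).trans ?_
                  gcongr
                  exact abs_le.2 ⟨by linarith [hθS.1], by linarith [hθS.2]⟩
                · rw [indicator_of_notMem hθS, zero_mul]; exact zero_le
              · rw [indicator_of_notMem hθ]; exact zero_le
          _ = ENNReal.ofReal (2 * r ^ 2) * (ENNReal.ofReal s ^ 2 *
              (ENNReal.ofReal (ε ^ d * T.rho (w.nbr j)) * T.profileEnergy ε ω a (w.nbr j))) := by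
              have h3 : ENNReal.ofReal (s * r) * ENNReal.ofReal (s * r + s * r) =
                  ENNReal.ofReal (2 * r ^ 2) * ENNReal.ofReal s ^ 2 := by
                rw [← ENNReal.ofReal_pow hs.le, ← ENNReal.ofReal_mul (mul_pos hs hr.pos).le,
                  ← ENNReal.ofReal_mul (by positivity)]
                congr 1; ring
              rw [lintegral_const, Measure.restrict_apply_univ, hS, Real.volume_Icc,
                show t₀ + s * r - (t₀ - s * r) = s * r + s * r by ring]
              calc _ = (ENNReal.ofReal (s * r) * ENNReal.ofReal (s * r + s * r)) *
                    (ENNReal.ofReal (ε ^ d * T.rho (w.nbr j)) *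
                      T.profileEnergy ε ω a (w.nbr j)) := by ring
                _ = _ := by rw [h3]; ring
          _ ≤ _ := by
              gcongr
              exact h.energy_le hε _
  -- comparison with the average over the ball
  have hhalf : ∀ (σ : ℝ) (q : ℂ), |σ| = 1 →
      (∀ x, 0 < σ * (x 0 - s * T.height j) → ‖T.glued ε u w j x - q‖ₑ ^ 2 ≤ F x) →
      ENNReal.ofReal (s ^ (d + 1)) * β * ‖q - b‖ₑ ^ 2 ≤
        2 * (∫⁻ x in B, F x) + 2 * ∫⁻ x in B, ‖T.glued ε u w j x - b‖ₑ ^ 2 := by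
    intro σ q hσ hq
    have hsub := ball_axialPoint_subset (d := d) (a := s * T.height j) (s := s) (r := r) σ hσ
    set A := Metric.ball (axialPoint (s * T.height j + σ * (s * r / 2))
      (0 : EuclideanSpace ℝ (Fin d))) (s * r / 2) with hA
    have hAB : A ⊆ B := fun x hx => (hsub hx).1
    have hvol : volume A = ENNReal.ofReal (s ^ (d + 1)) * β := by
      have h2 : Metric.ball (0 : EuclideanSpace ℝ (Fin (d + 1))) (s * r / 2) =
          s • Metric.ball (0 : EuclideanSpace ℝ (Fin (d + 1))) (r / 2) := by
        rw [smul_ball hs.ne', smul_zero, Real.norm_of_nonneg hs.le]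
        congr 1; ring
      rw [hA, Measure.addHaar_ball_center, h2, volume_smul_set hs]
    have h3 := measure_mul_enorm_sub_sq_le
      (hgi.aestronglyMeasurable.mono_measure (Measure.restrict_mono hAB le_rfl)) q b
    rw [Measure.restrict_apply_univ, hvol] at h3
    refine h3.trans (add_le_add (mul_le_mul_right ?_ _) (mul_le_mul_right ?_ _))
    · exact (setLIntegral_mono' Metric.isOpen_ball.measurableSet fun x hx =>
        hq x (hsub hx).2).trans (lintegral_mono_set hAB)
    · exact lintegral_mono_set hAB
  have hm := hhalf (-1) c (by simp) fun x hx => by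
    have : x 0 < s * T.height j := by linarith
    exact (hF1 x this).ge
  have hp := hhalf 1 p (by simp) fun x hx => by
    have : ¬ x 0 < s * T.height j := by linarith
    exact (hF2 x this).ge
  have hX : (∫⁻ x in B, F x) + ∫⁻ x in B, ‖T.glued ε u w j x - b‖ₑ ^ 2 ≤
      (C₁ + (C₂ + 2 * ENNReal.ofReal (2 * r ^ 2)) + C₃) * ENNReal.ofReal s ^ 2 * (EV + EE) := by
    calc _ ≤ (C₁ * ENNReal.ofReal s ^ 2 * EV +
          (C₂ + 2 * ENNReal.ofReal (2 * r ^ 2)) * ENNReal.ofReal s ^ 2 * EE) +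
          C₃ * ENNReal.ofReal s ^ 2 * (EV + EE) := add_le_add hFle hg
      _ ≤ (C₁ * ENNReal.ofReal s ^ 2 * (EV + EE) +
          (C₂ + 2 * ENNReal.ofReal (2 * r ^ 2)) * ENNReal.ofReal s ^ 2 * (EV + EE)) +
          C₃ * ENNReal.ofReal s ^ 2 * (EV + EE) := by
          gcongr
          · exact le_self_add
          · exact le_add_self
      _ = _ := by ring
  calc ENNReal.ofReal (s ^ (d + 1)) * ‖c - p‖ₑ ^ 2
      = β⁻¹ * (ENNReal.ofReal (s ^ (d + 1)) * β * ‖c - p‖ₑ ^ 2) := by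
        rw [mul_right_comm, mul_comm _ β, ← mul_assoc, ENNReal.inv_mul_cancel hβ0 hβt, one_mul]
    _ ≤ β⁻¹ * (ENNReal.ofReal (s ^ (d + 1)) * β * (2 * (‖c - b‖ₑ ^ 2 + ‖p - b‖ₑ ^ 2))) := by
        gcongr
        rw [enorm_sub_rev p b]
        exact enorm_sub_sq_le c b p
    _ = β⁻¹ * (2 * (ENNReal.ofReal (s ^ (d + 1)) * β * ‖c - b‖ₑ ^ 2 +
          ENNReal.ofReal (s ^ (d + 1)) * β * ‖p - b‖ₑ ^ 2)) := by ring
    _ ≤ β⁻¹ * (2 * ((2 * (∫⁻ x in B, F x) + 2 * ∫⁻ x in B, ‖T.glued ε u w j x - b‖ₑ ^ 2) +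
          (2 * (∫⁻ x in B, F x) + 2 * ∫⁻ x in B, ‖T.glued ε u w j x - b‖ₑ ^ 2))) := by
        gcongr
    _ ≤ β⁻¹ * (8 * ((C₁ + (C₂ + 2 * ENNReal.ofReal (2 * r ^ 2)) + C₃) * ENNReal.ofReal s ^ 2 *
          (EV + EE))) := by
        refine mul_le_mul_right (le_trans (le_of_eq ?_) (mul_le_mul_right hX 8)) _
        ring
    _ = _ := by rw [hL]; ring

end TreeData

/-! ### Normalised masses and energies; estimates edge by edge -/

theorem enorm_sq_eq_ofReal {E : Type*} [SeminormedAddCommGroup E] (z : E) :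
    ‖z‖ₑ ^ 2 = ENNReal.ofReal (‖z‖ ^ 2) := by
  rw [ENNReal.ofReal_pow (norm_nonneg _), ofReal_norm]

theorem ENNReal_two_mul (x : ENNReal) : 2 * x = ENNReal.ofReal 2 * x := by
  rw [ENNReal.ofReal_ofNat]

theorem norm_sub_sq_le (a b c : ℂ) : ‖a - c‖ ^ 2 ≤ 2 * (‖a - b‖ ^ 2 + ‖b - c‖ ^ 2) := by
  have h := norm_sub_le_norm_sub_add_norm_sub a b c
  nlinarith [norm_nonneg (a - c), sq_nonneg (‖a - b‖ - ‖b - c‖)]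

namespace TreeData

variable {d k : ℕ} (T : TreeData d k) {ε ω : ℝ}

/-- The mass of `F` on a piece of the inflated tree, normalised by `ε ^ d`. -/
noncomputable def pieceMass {E : Type*} [NormedAddCommGroup E] (ε : ℝ)
    (F : Piece k × EuclideanSpace ℝ (Fin (d + 1)) → E) (i : Piece k) : ℝ :=
  (ε ^ d)⁻¹ * ∫ x in T.piece ε i, ‖F (i, x)‖ ^ 2

section

variable {E : Type*} [NormedAddCommGroup E] {F : Piece k × EuclideanSpace ℝ (Fin (d + 1)) → E}

theorem pieceMass_nonneg (hε : 0 < ε) (i : Piece k) : 0 ≤ T.pieceMass ε F i :=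
  mul_nonneg (inv_nonneg.2 (pow_nonneg hε.le _)) (integral_nonneg fun _ => sq_nonneg _)

theorem lintegral_piece_eq (hε : 0 < ε) (hF : MemLp F 2 (T.inflatedMeasure ε)) (i : Piece k) :
    ∫⁻ x in T.piece ε i, ‖F (i, x)‖ₑ ^ 2 = ENNReal.ofReal (ε ^ d * T.pieceMass ε F i) := by
  rw [pieceMass, mul_inv_cancel_left₀ (pow_pos hε d).ne']
  exact (hF.prodMk_left i).integral_sq_eq

theorem hasSum_pieceMass (hF : MemLp F 2 (T.inflatedMeasure ε)) :
    HasSum (T.pieceMass ε F) ((ε ^ d)⁻¹ * ∫ q, ‖F q‖ ^ 2 ∂T.inflatedMeasure ε) := by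
  have h1 : Integrable (fun q => ‖F q‖ ^ 2) (T.inflatedMeasure ε) :=
    (memLp_two_iff_integrable_sq_norm hF.1).1 hF
  exact (hasSum_integral_sumMeasure h1).mul_left _

end

theorem scale_pow (ε : ℝ) (w : Word k) :
    T.scale ε w ^ d * (volume T.Ω).toReal = ε ^ d * T.rho w := by
  rw [scale, rho, mul_pow, ← pow_mul, mul_comm w.gen d]; ring

theorem rho_child (i : Fin k) (w : Word k) : T.rho (Word.child i w) = T.δ ^ d * T.rho w := by
  rw [rho, rho, Word.gen_child, mul_add, pow_add]; ring

theorem rho_nbr_le (w : Word k) (j : Option (Fin k)) : T.rho (w.nbr j) ≤ T.rho w := by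
  cases j with
  | none => exact le_rfl
  | some i =>
    change T.rho (Word.child i w) ≤ _
    rw [rho_child]
    exact mul_le_of_le_one_left (T.rho_pos w).le (pow_le_one₀ T.δ_pos.le T.δ_lt_one.le)

/-- The heights are bounded below, so the fitting conditions bound the scale of a vertex by `ε`
times the length of each adjacent edge. Errors measured by the scale become errors measured by the
summable edge lengths. -/
theorem exists_scale_le : ∃ C : ℝ, 0 < C ∧ ∀ {ε : ℝ}, 0 < ε → ∀ (w : Word k) (j : Option (Fin k)),
    T.scale ε w ≤ C * ε * T.edgeLen (w.nbr j) := by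
  obtain ⟨j₀, hj₀⟩ := Finite.exists_min T.height
  refine ⟨(T.height j₀)⁻¹, inv_pos.2 (T.height_pos _), fun {ε} hε w j => ?_⟩
  have h1 : T.scale ε w * T.height j ≤ ε * T.edgeLen (w.nbr j) := by
    cases j with
    | none => exact T.scale_mul_height_none_le hε w
    | some i =>
      have := T.edgeStart_le hε (Word.child i w)
      rwa [edgeStart_child] at this
  have h2 : T.scale ε w * T.height j₀ ≤ ε * T.edgeLen (w.nbr j) :=
    (mul_le_mul_of_nonneg_left (hj₀ j) (T.scale_pos hε w).le).trans h1
  rw [mul_assoc, inv_mul_eq_div, le_div_iff₀ (T.height_pos _)]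
  exact h2

/-- The average over an inflated vertex. -/
noncomputable def vertAverage (ε : ℝ) (u : Piece k × EuclideanSpace ℝ (Fin (d + 1)) → ℂ)
    (w : Word k) : ℂ :=
  ⨍ x in T.piece ε (.vert w), u (.vert w, x)

variable {T} {u : Piece k × EuclideanSpace ℝ (Fin (d + 1)) → ℂ}
  {G : Piece k × EuclideanSpace ℝ (Fin (d + 1)) → EuclideanSpace ℂ (Fin (d + 1))}
  {a : Word k → ℂ × ℂ}

theorem IsProfile.rho_mul_energy_le (hε : 0 < ε) (h : T.IsProfile ε ω u G a) (w : Word k) :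
    T.rho w * (T.profileEnergy ε ω a w).toReal ≤ T.pieceMass ε G (.edge w) := by
  have h1 := h.energy_le hε w
  have hp := pow_pos hε d
  rw [T.lintegral_piece_eq hε h.mem.2.1, ← ENNReal.ofReal_toReal (T.profileEnergy_ne_top ε ω a w),
    ← ENNReal.ofReal_mul (mul_pos hp (T.rho_pos w)).le,
    ENNReal.ofReal_le_ofReal_iff (mul_nonneg hp.le (T.pieceMass_nonneg hε _)), mul_assoc] at h1
  exact le_of_mul_le_mul_left h1 hp

theorem IsProfile.rho_mul_mass_le (hε : 0 < ε) (h : T.IsProfile ε ω u G a) (w : Word k) :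
    T.rho w * (T.profileMass ε ω a w).toReal ≤ T.pieceMass ε u (.edge w) := by
  have h1 := h.mass_le hε w
  have hp := pow_pos hε d
  rw [T.lintegral_piece_eq hε h.mem.1, ← ENNReal.ofReal_toReal (T.profileMass_ne_top ε ω a w),
    ← ENNReal.ofReal_mul (mul_pos hp (T.rho_pos w)).le,
    ENNReal.ofReal_le_ofReal_iff (mul_nonneg hp.le (T.pieceMass_nonneg hε _)), mul_assoc] at h1
  exact le_of_mul_le_mul_left h1 hp

theorem IsProfile.rho_mul_norm_profile_sub_sq_le (hε : 0 < ε) (h : T.IsProfile ε ω u G a)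
    (w : Word k) {θ θ' : ℝ} (hθ : θ ∈ Icc (T.edgeStart ε w) (T.edgeEnd ε w))
    (hθ' : θ' ∈ Icc (T.edgeStart ε w) (T.edgeEnd ε w)) :
    T.rho w * ‖T.profile ω a w θ - T.profile ω a w θ'‖ ^ 2 ≤
      |θ - θ'| * T.pieceMass ε G (.edge w) := by
  have h1 := T.enorm_profile_sub_sq_le ω a w hθ hθ'
  rw [enorm_sq_eq_ofReal, ← ENNReal.ofReal_toReal (T.profileEnergy_ne_top ε ω a w),
    ← ENNReal.ofReal_mul (abs_nonneg _), ENNReal.ofReal_le_ofReal_iff (by positivity)] at h1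
  calc _ ≤ T.rho w * (|θ - θ'| * (T.profileEnergy ε ω a w).toReal) :=
        mul_le_mul_of_nonneg_left h1 (T.rho_pos w).le
    _ = |θ - θ'| * (T.rho w * (T.profileEnergy ε ω a w).toReal) := by ring
    _ ≤ _ := mul_le_mul_of_nonneg_left (h.rho_mul_energy_le hε w) (abs_nonneg _)

/-- In `exists_average_sub_profile_le` the power `scale ^ d` on the left is `ε ^ d * ρ*` up to a
constant. After division by `ε ^ d` one factor `scale` remains on the right, and it makes the jump
at the vertex vanish in the limit. -/
theorem exists_rho_mul_vertAverage_sub_profile_le (T : TreeData d k) :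
    ∃ C : ℝ, 0 < C ∧ ∀ {ε ω : ℝ}, 0 < ε → ε ≤ 1 / 2 →
    ∀ {u : Piece k × EuclideanSpace ℝ (Fin (d + 1)) → ℂ}
      {G : Piece k × EuclideanSpace ℝ (Fin (d + 1)) → EuclideanSpace ℂ (Fin (d + 1))}
      {a : Word k → ℂ × ℂ}, T.IsProfile ε ω u G a → ∀ (w : Word k) (j : Option (Fin k)),
    T.rho w * ‖T.vertAverage ε u w -
        T.profile ω a (w.nbr j) (T.legPos w j (T.scale ε w * T.height j))‖ ^ 2 ≤
      C * T.scale ε w * (T.pieceMass ε G (.vert w) + T.pieceMass ε G (.edge (w.nbr j))) := by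
  obtain ⟨C, hC⟩ := T.exists_average_sub_profile_le
  have hΩ := T.volume_Ω_pos
  refine ⟨(C + 1) * (volume T.Ω).toReal, by positivity, fun {ε ω} hε hε2 {u G a} h w j => ?_⟩
  have h1 := hC hε hε2 h w j
  have hs := T.scale_pos hε w
  have hp := pow_pos hε d
  have hE1 := T.pieceMass_nonneg (F := G) hε (.vert w)
  have hE2 := T.pieceMass_nonneg (F := G) hε (.edge (w.nbr j))
  rw [T.lintegral_piece_eq hε h.mem.2.1, T.lintegral_piece_eq hε h.mem.2.1, enorm_sq_eq_ofReal,
    ← ENNReal.ofReal_mul (by positivity), ← ENNReal.ofReal_pow hs.le,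
    ← ENNReal.ofReal_add (by positivity) (by positivity), ← ENNReal.ofReal_coe_nnreal,
    ← ENNReal.ofReal_mul (by positivity), ← ENNReal.ofReal_mul (by positivity),
    ENNReal.ofReal_le_ofReal_iff (by positivity)] at h1
  change T.scale ε w ^ (d + 1) * ‖T.vertAverage ε u w - _‖ ^ 2 ≤ _ at h1
  set X := ‖T.vertAverage ε u w -
    T.profile ω a (w.nbr j) (T.legPos w j (T.scale ε w * T.height j))‖ ^ 2
  refine le_of_mul_le_mul_left (a := ε ^ d * T.scale ε w) ?_ (mul_pos hp hs)
  calc _ = (T.scale ε w ^ (d + 1) * X) * (volume T.Ω).toReal := by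
        rw [pow_succ]; linear_combination -(X * T.scale ε w) * T.scale_pow ε w
    _ ≤ (C * T.scale ε w ^ 2 * (ε ^ d * T.pieceMass ε G (.vert w) +
          ε ^ d * T.pieceMass ε G (.edge (w.nbr j)))) * (volume T.Ω).toReal :=
        mul_le_mul_of_nonneg_right h1 hΩ.le
    _ ≤ ((C + 1) * T.scale ε w ^ 2 * (ε ^ d * T.pieceMass ε G (.vert w) +
          ε ^ d * T.pieceMass ε G (.edge (w.nbr j)))) * (volume T.Ω).toReal := by
        gcongr; linarith
    _ = _ := by ring

/-- By the Poincaré inequality on the cross-sections, what the averages miss of the mass is of the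
order of `scale ^ 2` times the energy. -/
theorem exists_pieceMass_edge_le (T : TreeData d k) :
    ∃ C : ℝ, 0 < C ∧ ∀ {ε ω : ℝ}, 0 < ε →
    ∀ {u : Piece k × EuclideanSpace ℝ (Fin (d + 1)) → ℂ}
      {G : Piece k × EuclideanSpace ℝ (Fin (d + 1)) → EuclideanSpace ℂ (Fin (d + 1))}
      {a : Word k → ℂ × ℂ}, T.IsProfile ε ω u G a → ∀ w : Word k,
    T.pieceMass ε u (.edge w) ≤ C * T.scale ε w ^ 2 * T.pieceMass ε G (.edge w) +
      2 * T.rho w * (T.profileMass ε ω a w).toReal := by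
  obtain ⟨C, hC⟩ := T.exists_edge_mass_le
  refine ⟨C + 1, by positivity, fun {ε ω} hε {u G a} h w => ?_⟩
  have h1 := hC hε h w 1 0 measurable_one fun _ => le_rfl
  simp only [Pi.one_apply, one_mul, sub_zero] at h1
  have hs := T.scale_pos hε w
  have hp := pow_pos hε d
  have hρ := T.rho_pos w
  have hE1 := T.pieceMass_nonneg (F := G) hε (.edge w)
  change _ ≤ _ + 2 * (_ * T.profileMass ε ω a w) at h1
  rw [T.lintegral_piece_eq hε h.mem.1, T.lintegral_piece_eq hε h.mem.2.1,
    ← ENNReal.ofReal_toReal (T.profileMass_ne_top ε ω a w), ← ENNReal.ofReal_coe_nnreal,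
    ← ENNReal.ofReal_pow hs.le, ENNReal_two_mul,
    ← ENNReal.ofReal_mul (by positivity), ← ENNReal.ofReal_mul (by positivity),
    ← ENNReal.ofReal_mul (by positivity), ← ENNReal.ofReal_mul (by positivity),
    ← ENNReal.ofReal_add (by positivity) (by positivity),
    ENNReal.ofReal_le_ofReal_iff (by positivity)] at h1
  refine le_of_mul_le_mul_left (a := ε ^ d) (h1.trans ?_) hp
  have h2 : (0 : ℝ) ≤ T.scale ε w ^ 2 * (ε ^ d * T.pieceMass ε G (.edge w)) := by positivity
  nlinarith

/-- The volume of an inflated vertex has one factor `scale` more than the measure `ε ^ d * ρ*` of a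
cross-section. A bounded average therefore contributes little mass. -/
theorem exists_pieceMass_vert_le (T : TreeData d k) :
    ∃ C : ℝ, 0 < C ∧ ∀ {ε ω : ℝ}, 0 < ε →
    ∀ {u : Piece k × EuclideanSpace ℝ (Fin (d + 1)) → ℂ}
      {G : Piece k × EuclideanSpace ℝ (Fin (d + 1)) → EuclideanSpace ℂ (Fin (d + 1))}
      {a : Word k → ℂ × ℂ}, T.IsProfile ε ω u G a → ∀ w : Word k,
    T.pieceMass ε u (.vert w) ≤ C * T.scale ε w ^ 2 * T.pieceMass ε G (.vert w) +
      C * T.scale ε w * T.rho w * ‖T.vertAverage ε u w‖ ^ 2 := by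
  obtain ⟨C, hC⟩ := T.exists_poincare_vert
  have hΩ := T.volume_Ω_pos
  have hV := T.volume_V_pos
  set K : ℝ := max (2 * (C + 1)) (2 * ((volume T.V).toReal / (volume T.Ω).toReal)) with hK
  have hK1 : 2 * ((C : ℝ) + 1) ≤ K := le_max_left _ _
  have hK2 : 2 * ((volume T.V).toReal / (volume T.Ω).toReal) ≤ K := le_max_right _ _
  refine ⟨K, lt_of_lt_of_le (by positivity) hK1, fun {ε ω} hε {u G a} h w => ?_⟩
  have h1 := hC hε h.mem w
  have hs := T.scale_pos hε w
  have hp := pow_pos hε d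
  have hρ := T.rho_pos w
  have hE1 := T.pieceMass_nonneg (F := G) hε (.vert w)
  have huL := (h.mem.1.prodMk_left (.vert w)).1
  have h2 := lintegral_sq_le_of_approx (ν := volume.restrict (T.piece ε (.vert w)))
    (G := fun _ => T.vertAverage ε u w) aestronglyMeasurable_const huL
  rw [lintegral_const, Measure.restrict_apply_univ, T.volume_piece_vert hε] at h2
  have h3 : ∀ x, ‖T.vertAverage ε u w - u (.vert w, x)‖ₑ ^ 2 =
      ‖u (.vert w, x) - T.vertAverage ε u w‖ₑ ^ 2 := fun x => by rw [enorm_sub_rev]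
  simp only [h3] at h2
  have h4 := h2.trans (add_le_add (mul_le_mul_right h1 2) le_rfl)
  rw [T.lintegral_piece_eq hε h.mem.1, T.lintegral_piece_eq hε h.mem.2.1,
    ← ENNReal.ofReal_coe_nnreal, enorm_sq_eq_ofReal,
    ← ENNReal.ofReal_pow hs.le, ENNReal_two_mul (_ * _), ENNReal_two_mul (_ * _),
    ← ENNReal.ofReal_mul (by positivity), ← ENNReal.ofReal_mul (by positivity),
    ← ENNReal.ofReal_mul (by positivity), ← ENNReal.ofReal_mul (by positivity),
    ← ENNReal.ofReal_mul (by positivity),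
    ← ENNReal.ofReal_add (by positivity) (by positivity),
    ENNReal.ofReal_le_ofReal_iff (by positivity)] at h4
  refine le_of_mul_le_mul_left (a := ε ^ d) (h4.trans ?_) hp
  have h5 : T.scale ε w ^ (d + 1) * (volume T.V).toReal = ε ^ d * (T.scale ε w * T.rho w *
      ((volume T.V).toReal / (volume T.Ω).toReal)) := by
    field_simp
    rw [pow_succ]
    linear_combination T.scale ε w * T.scale_pow ε w
  rw [h5]
  set X := ‖T.vertAverage ε u w‖ ^ 2
  calc _ = (2 * (C : ℝ)) * (T.scale ε w ^ 2 * (ε ^ d * T.pieceMass ε G (.vert w))) +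
        (2 * ((volume T.V).toReal / (volume T.Ω).toReal)) * (ε ^ d * (T.scale ε w * T.rho w * X)) := by
        ring
    _ ≤ K * (T.scale ε w ^ 2 * (ε ^ d * T.pieceMass ε G (.vert w))) +
        K * (ε ^ d * (T.scale ε w * T.rho w * X)) := by
        gcongr; linarith
    _ = _ := by ring

end TreeData

theorem integral_Ioo_le_of_le {f : ℝ → ℝ} (hf : Continuous f) {a b B : ℝ} (hab : a ≤ b)
    (h : ∀ x ∈ Ioo a b, f x ≤ B) : ∫ x in Ioo a b, f x ≤ (b - a) * B := by
  calc _ ≤ ∫ _ in Ioo a b, B := setIntegral_mono_on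
        (((hf.continuousOn).integrableOn_compact isCompact_Icc).mono_set Ioo_subset_Icc_self)
        (integrableOn_const (by simp)) measurableSet_Ioo h
    _ = _ := by simp [Measure.real, hab]

theorem le_integral_Ioo_of_le {f : ℝ → ℝ} (hf : Continuous f) {a b B : ℝ} (hab : a ≤ b)
    (h : ∀ x ∈ Ioo a b, B ≤ f x) : (b - a) * B ≤ ∫ x in Ioo a b, f x := by
  calc _ = ∫ _ in Ioo a b, B := by simp [Measure.real, hab]
    _ ≤ _ := setIntegral_mono_on (integrableOn_const (by simp))
        (((hf.continuousOn).integrableOn_compact isCompact_Icc).mono_set Ioo_subset_Icc_self)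
        measurableSet_Ioo h

namespace TreeData

variable {d k : ℕ} (T : TreeData d k) {ε ω : ℝ}

theorem toReal_profileMass (ε ω : ℝ) (a : Word k → ℂ × ℂ) (w : Word k) :
    (T.profileMass ε ω a w).toReal =
      ∫ θ in Ioo (T.edgeStart ε w) (T.edgeEnd ε w), ‖T.profile ω a w θ‖ ^ 2 := by
  rw [integral_eq_lintegral_of_nonneg_ae (.of_forall fun _ => sq_nonneg _)
    ((T.continuous_profile ω a w).norm.pow 2).aestronglyMeasurable]
  simp only [profileMass, enorm_sq_eq_ofReal]

theorem toReal_profileEnergy (ε ω : ℝ) (a : Word k → ℂ × ℂ) (w : Word k) :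
    (T.profileEnergy ε ω a w).toReal =
      ∫ θ in Ioo (T.edgeStart ε w) (T.edgeEnd ε w), ‖T.profileDeriv ω a w θ‖ ^ 2 := by
  rw [integral_eq_lintegral_of_nonneg_ae (.of_forall fun _ => sq_nonneg _)
    ((T.continuous_profileDeriv ω a w).norm.pow 2).aestronglyMeasurable]
  simp only [profileEnergy, enorm_sq_eq_ofReal]

/-- The normalised mass of `F` on an inflated edge and the inflated vertex at its upper end. -/
noncomputable def wordMass {E : Type*} [NormedAddCommGroup E] (ε : ℝ)
    (F : Piece k × EuclideanSpace ℝ (Fin (d + 1)) → E) (w : Word k) : ℝ :=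
  T.pieceMass ε F (.edge w) + T.pieceMass ε F (.vert w)

section

variable {E : Type*} [NormedAddCommGroup E] {F : Piece k × EuclideanSpace ℝ (Fin (d + 1)) → E}

theorem wordMass_nonneg (hε : 0 < ε) (w : Word k) : 0 ≤ T.wordMass ε F w :=
  add_nonneg (T.pieceMass_nonneg hε _) (T.pieceMass_nonneg hε _)

theorem pieceMass_edge_le_wordMass (hε : 0 < ε) (w : Word k) :
    T.pieceMass ε F (.edge w) ≤ T.wordMass ε F w :=
  le_add_of_nonneg_right (T.pieceMass_nonneg hε _)

theorem pieceMass_vert_le_wordMass (hε : 0 < ε) (w : Word k) :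
    T.pieceMass ε F (.vert w) ≤ T.wordMass ε F w :=
  le_add_of_nonneg_left (T.pieceMass_nonneg hε _)

theorem hasSum_wordMass (hF : MemLp F 2 (T.inflatedMeasure ε)) :
    HasSum (T.wordMass ε F) ((ε ^ d)⁻¹ * ∫ q, ‖F q‖ ^ 2 ∂T.inflatedMeasure ε) := by
  obtain ⟨h1, h2, h3⟩ := Piece.hasSum_edge_add_vert (T.hasSum_pieceMass hF)
  rw [h3]
  exact h1.add h2

end

/-- The profile varies along its edge by at most the square root of length times energy, and the
jumps at its two ends are controlled. For the increment from a vertex to its child the smaller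
weight of the child is used on both parts. -/
theorem exists_rho_mul_profile_sub_vertAverage_le (T : TreeData d k) :
    ∃ C : ℝ, 0 < C ∧ ∀ {ε ω : ℝ}, 0 < ε → ε ≤ 1 / 2 →
    ∀ {u : Piece k × EuclideanSpace ℝ (Fin (d + 1)) → ℂ}
      {G : Piece k × EuclideanSpace ℝ (Fin (d + 1)) → EuclideanSpace ℂ (Fin (d + 1))}
      {a : Word k → ℂ × ℂ}, T.IsProfile ε ω u G a → ∀ w : Word k,
    (∀ θ ∈ Icc (T.edgeStart ε w) (T.edgeEnd ε w),
      T.rho w * ‖T.profile ω a w θ - T.vertAverage ε u w‖ ^ 2 ≤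
        C * T.edgeLen w * T.wordMass ε G w) ∧
    ∀ i, T.rho (Word.child i w) *
        ‖T.vertAverage ε u (Word.child i w) - T.vertAverage ε u w‖ ^ 2 ≤
      C * T.edgeLen (Word.child i w) * (T.wordMass ε G w + T.wordMass ε G (Word.child i w)) := by
  obtain ⟨C₁, hC₁p, hC₁⟩ := T.exists_rho_mul_vertAverage_sub_profile_le
  obtain ⟨C₂, hC₂p, hC₂⟩ := T.exists_scale_le
  set A : ℝ := 2 * (1 + C₁ * C₂) with hA
  have hAp : 0 < A := by positivity
  refine ⟨2 * (A + C₁ * C₂), by positivity, fun {ε ω} hε hε2 {u G a} h => ?_⟩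
  have hscale : ∀ (w : Word k) j, T.scale ε w ≤ C₂ * T.edgeLen (w.nbr j) := fun w j => by
    refine (hC₂ hε w j).trans ?_
    have := (T.edgeLen_pos (w.nbr j)).le
    nlinarith [mul_nonneg hC₂p.le this]
  have hend : ∀ (w : Word k) j, T.rho w * ‖T.vertAverage ε u w -
      T.profile ω a (w.nbr j) (T.legPos w j (T.scale ε w * T.height j))‖ ^ 2 ≤
      C₁ * C₂ * T.edgeLen (w.nbr j) *
        (T.pieceMass ε G (.vert w) + T.pieceMass ε G (.edge (w.nbr j))) := fun w j => by
    refine (hC₁ hε hε2 h w j).trans (mul_le_mul_of_nonneg_right ?_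
      (add_nonneg (T.pieceMass_nonneg hε _) (T.pieceMass_nonneg hε _)))
    rw [mul_assoc]
    exact mul_le_mul_of_nonneg_left (hscale w j) hC₁p.le
  have hup : ∀ w, ∀ θ ∈ Icc (T.edgeStart ε w) (T.edgeEnd ε w),
      T.rho w * ‖T.profile ω a w θ - T.vertAverage ε u w‖ ^ 2 ≤
        A * T.edgeLen w * T.wordMass ε G w := by
    intro w θ hθ
    have hl := T.edgeLen_pos w
    have h1 := hend w none
    rw [norm_sub_rev] at h1
    have hm := T.legPos_end_mem hε (by linarith) w none
    change _ ∈ Icc (T.edgeStart ε w) (T.edgeEnd ε w) at hm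
    change T.rho w * ‖T.profile ω a w _ - _‖ ^ 2 ≤ C₁ * C₂ * T.edgeLen w *
      (_ + T.pieceMass ε G (.edge w)) at h1
    set t := T.legPos w none (T.scale ε w * T.height none)
    have h2 := h.rho_mul_norm_profile_sub_sq_le hε w hθ hm
    have h3 : |θ - t| ≤ T.edgeLen w := by
      have := T.edgeStart_nonneg hε w
      have := T.edgeEnd_le hε w
      exact abs_le.2 ⟨by linarith [hθ.1, hm.2], by linarith [hθ.2, hm.1]⟩
    have h4 : |θ - t| * T.pieceMass ε G (.edge w) ≤ T.edgeLen w * T.wordMass ε G w :=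
      mul_le_mul h3 (T.pieceMass_edge_le_wordMass hε w) (T.pieceMass_nonneg hε _) hl.le
    have h5 := mul_le_mul_of_nonneg_left
      (norm_sub_sq_le (T.profile ω a w θ) (T.profile ω a w t) (T.vertAverage ε u w)) (T.rho_pos w).le
    have h6 : T.wordMass ε G w = T.pieceMass ε G (.vert w) + T.pieceMass ε G (.edge w) :=
      add_comm _ _
    rw [← h6] at h1
    rw [hA]
    linarith
  intro w
  refine ⟨fun θ hθ => (hup w θ hθ).trans ?_, fun i => ?_⟩
  · have := mul_nonneg (T.edgeLen_pos w).le (T.wordMass_nonneg (F := G) hε w)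
    nlinarith [mul_pos hC₁p hC₂p]
  · have h1 := hend w (some i)
    have hm := T.legPos_end_mem hε (by linarith) w (some i)
    change _ ∈ Icc (T.edgeStart ε (Word.child i w)) (T.edgeEnd ε (Word.child i w)) at hm
    change T.rho w * ‖_ - T.profile ω a (Word.child i w) _‖ ^ 2 ≤
      C₁ * C₂ * T.edgeLen (Word.child i w) * (_ + T.pieceMass ε G (.edge (Word.child i w))) at h1
    set t := T.legPos w (some i) (T.scale ε w * T.height (some i))
    have h2 := hup (Word.child i w) t hm
    rw [norm_sub_rev] at h1 h2
    set x := T.vertAverage ε u (Word.child i w)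
    set y := T.profile ω a (Word.child i w) t
    set z := T.vertAverage ε u w
    have h3 : T.rho (Word.child i w) * ‖y - z‖ ^ 2 ≤ T.rho w * ‖y - z‖ ^ 2 :=
      mul_le_mul_of_nonneg_right (T.rho_nbr_le w (some i)) (sq_nonneg _)
    have h4 := mul_le_mul_of_nonneg_left (norm_sub_sq_le x y z) (T.rho_pos (Word.child i w)).le
    have h5 := T.pieceMass_vert_le_wordMass (F := G) hε w
    have h6 := T.pieceMass_edge_le_wordMass (F := G) hε (Word.child i w)
    have hl := T.edgeLen_pos (Word.child i w)
    have h7 : C₁ * C₂ * T.edgeLen (Word.child i w) *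
        (T.pieceMass ε G (.vert w) + T.pieceMass ε G (.edge (Word.child i w))) ≤
        C₁ * C₂ * T.edgeLen (Word.child i w) *
          (T.wordMass ε G w + T.wordMass ε G (Word.child i w)) := by gcongr
    have h8 : A * T.edgeLen (Word.child i w) * T.wordMass ε G (Word.child i w) ≤
        A * T.edgeLen (Word.child i w) * (T.wordMass ε G w + T.wordMass ε G (Word.child i w)) := by
      gcongr
      exact le_add_of_nonneg_left (T.wordMass_nonneg hε w)
    calc _ ≤ 2 * (T.rho (Word.child i w) * ‖x - y‖ ^ 2 + T.rho w * ‖y - z‖ ^ 2) := by linarith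
      _ ≤ 2 * (A * T.edgeLen (Word.child i w) * (T.wordMass ε G w + T.wordMass ε G (Word.child i w)) +
          C₁ * C₂ * T.edgeLen (Word.child i w) *
          (T.wordMass ε G w + T.wordMass ε G (Word.child i w))) := by linarith
      _ = _ := by ring

/-- On an edge and the vertex at its upper end, `u` is close to the vertex average `c` up to an
error governed by the energy. The mass and `ρ* ℓ |c|²` are therefore equivalent up to `ℓ²` times the
energy. The bound of `|c|` uses that the cylinder keeps at least half of the edge. -/
theorem exists_wordMass_le (T : TreeData d k) :
    ∃ C : ℝ, 0 < C ∧ ∀ {ε ω : ℝ}, 0 < ε → ε ≤ 1 / 2 →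
    ∀ {u : Piece k × EuclideanSpace ℝ (Fin (d + 1)) → ℂ}
      {G : Piece k × EuclideanSpace ℝ (Fin (d + 1)) → EuclideanSpace ℂ (Fin (d + 1))}
      {a : Word k → ℂ × ℂ}, T.IsProfile ε ω u G a → ∀ w : Word k,
    T.wordMass ε u w ≤ C * (T.rho w * T.edgeLen w * ‖T.vertAverage ε u w‖ ^ 2 +
        T.edgeLen w ^ 2 * T.wordMass ε G w) ∧
      T.rho w * T.edgeLen w * ‖T.vertAverage ε u w‖ ^ 2 ≤
        C * (T.wordMass ε u w + T.edgeLen w ^ 2 * T.wordMass ε G w) := by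
  obtain ⟨C₁, hC₁p, hC₁⟩ := T.exists_rho_mul_profile_sub_vertAverage_le
  obtain ⟨C₂, hC₂p, hC₂⟩ := T.exists_scale_le
  obtain ⟨C₃, hC₃p, hC₃⟩ := T.exists_pieceMass_edge_le
  obtain ⟨C₄, hC₄p, hC₄⟩ := T.exists_pieceMass_vert_le
  refine ⟨(C₃ + C₄) * C₂ ^ 2 + C₄ * C₂ + 4 * C₁ + 4, by positivity,
    fun {ε ω} hε hε2 {u G a} h w => ?_⟩
  have hl := T.edgeLen_pos w
  have hρ := T.rho_pos w
  have hs := T.scale_pos hε w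
  have hs2 : T.scale ε w ≤ C₂ * T.edgeLen w := by
    refine (hC₂ hε w none).trans ?_
    change C₂ * ε * T.edgeLen w ≤ _
    nlinarith [mul_pos hC₂p hl]
  have hs3 : T.scale ε w ^ 2 ≤ C₂ ^ 2 * T.edgeLen w ^ 2 := by
    rw [← mul_pow]; exact pow_le_pow_left₀ hs.le hs2 2
  have hP := fun θ hθ => (hC₁ hε hε2 h w).1 θ (Ioo_subset_Icc_self hθ)
  have he1 := T.pieceMass_edge_le_wordMass (F := G) hε w
  have he2 := T.pieceMass_vert_le_wordMass (F := G) hε w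
  have he0 := T.wordMass_nonneg (F := G) hε w
  have hm0 := T.wordMass_nonneg (F := u) hε w
  have hm1 := T.pieceMass_edge_le_wordMass (F := u) hε w
  have hle : T.edgeStart ε w ≤ T.edgeEnd ε w := (T.edgeStart_lt_edgeEnd hε (by linarith) w).le
  have hcont : Continuous fun θ => T.rho w * ‖T.profile ω a w θ‖ ^ 2 :=
    continuous_const.mul ((T.continuous_profile ω a w).norm.pow 2)
  have hI : ∫ θ in Ioo (T.edgeStart ε w) (T.edgeEnd ε w), T.rho w * ‖T.profile ω a w θ‖ ^ 2 =
      T.rho w * (T.profileMass ε ω a w).toReal := by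
    rw [integral_const_mul, toReal_profileMass]
  have hI1 : T.edgeEnd ε w - T.edgeStart ε w ≤ T.edgeLen w := by
    linarith [T.edgeStart_nonneg hε w, T.edgeEnd_le hε w]
  have hI2 : T.edgeLen w / 2 ≤ T.edgeEnd ε w - T.edgeStart ε w := by
    have := T.edgeLen_le_edgeEnd_sub_edgeStart hε w
    nlinarith
  set c := T.vertAverage ε u w
  set e := T.wordMass ε G w
  set X := ‖c‖ ^ 2
  have hX : 0 ≤ X := sq_nonneg _
  constructor
  · have h1 : T.rho w * (T.profileMass ε ω a w).toReal ≤
        T.edgeLen w * (2 * (T.rho w * X + C₁ * T.edgeLen w * e)) := by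
      rw [← hI]
      refine (integral_Ioo_le_of_le hcont hle (B := 2 * (T.rho w * X + C₁ * T.edgeLen w * e))
        fun θ hθ => ?_).trans (mul_le_mul_of_nonneg_right hI1 (by positivity))
      have h2 := mul_le_mul_of_nonneg_left (norm_sub_sq_le (T.profile ω a w θ) c 0) hρ.le
      rw [sub_zero, sub_zero] at h2
      linarith [hP θ hθ]
    have h2 := hC₃ hε h w
    have h3 := hC₄ hε h w
    have h4 : T.scale ε w ^ 2 * T.pieceMass ε G (.edge w) ≤ C₂ ^ 2 * T.edgeLen w ^ 2 * e :=
      mul_le_mul hs3 he1 (T.pieceMass_nonneg hε _) (by positivity)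
    have h5 : T.scale ε w ^ 2 * T.pieceMass ε G (.vert w) ≤ C₂ ^ 2 * T.edgeLen w ^ 2 * e :=
      mul_le_mul hs3 he2 (T.pieceMass_nonneg hε _) (by positivity)
    have h6 : T.scale ε w * (T.rho w * X) ≤ C₂ * T.edgeLen w * (T.rho w * X) :=
      mul_le_mul_of_nonneg_right hs2 (by positivity)
    calc T.wordMass ε u w ≤ (C₃ * T.scale ε w ^ 2 * T.pieceMass ε G (.edge w) +
          2 * (T.edgeLen w * (2 * (T.rho w * X + C₁ * T.edgeLen w * e)))) +
          (C₄ * T.scale ε w ^ 2 * T.pieceMass ε G (.vert w) +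
            C₄ * T.scale ε w * T.rho w * X) := by
          rw [wordMass]; exact add_le_add (by linarith) h3
      _ = C₃ * (T.scale ε w ^ 2 * T.pieceMass ε G (.edge w)) +
          C₄ * (T.scale ε w ^ 2 * T.pieceMass ε G (.vert w)) +
          C₄ * (T.scale ε w * (T.rho w * X)) +
          2 * (T.edgeLen w * (2 * (T.rho w * X + C₁ * T.edgeLen w * e))) := by ring
      _ ≤ C₃ * (C₂ ^ 2 * T.edgeLen w ^ 2 * e) + C₄ * (C₂ ^ 2 * T.edgeLen w ^ 2 * e) +
          C₄ * (C₂ * T.edgeLen w * (T.rho w * X)) +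
          2 * (T.edgeLen w * (2 * (T.rho w * X + C₁ * T.edgeLen w * e))) := by gcongr
      _ = (C₄ * C₂ + 4) * (T.rho w * T.edgeLen w * X) +
          ((C₃ + C₄) * C₂ ^ 2 + 4 * C₁) * (T.edgeLen w ^ 2 * e) := by ring
      _ ≤ ((C₃ + C₄) * C₂ ^ 2 + C₄ * C₂ + 4 * C₁ + 4) * (T.rho w * T.edgeLen w * X) +
          ((C₃ + C₄) * C₂ ^ 2 + C₄ * C₂ + 4 * C₁ + 4) * (T.edgeLen w ^ 2 * e) := by
          have : 0 < C₄ * C₂ := by positivity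
          have : 0 < (C₃ + C₄) * C₂ ^ 2 := by positivity
          exact add_le_add (mul_le_mul_of_nonneg_right (by linarith) (by positivity))
            (mul_le_mul_of_nonneg_right (by linarith) (by positivity))
      _ = _ := by ring
  · have h1 : (T.edgeEnd ε w - T.edgeStart ε w) * (T.rho w * X / 2 - C₁ * T.edgeLen w * e) ≤
        T.rho w * (T.profileMass ε ω a w).toReal := by
      rw [← hI]
      refine le_integral_Ioo_of_le hcont hle fun θ hθ => ?_
      have h2 := mul_le_mul_of_nonneg_left (norm_sub_sq_le c (T.profile ω a w θ) 0) hρ.le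
      rw [sub_zero, sub_zero, norm_sub_rev c] at h2
      linarith [hP θ hθ]
    have h2 := (h.rho_mul_mass_le hε w).trans hm1
    have h3 : T.edgeLen w / 2 * (T.rho w * X / 2) ≤
        (T.edgeEnd ε w - T.edgeStart ε w) * (T.rho w * X / 2) :=
      mul_le_mul_of_nonneg_right hI2 (by positivity)
    have h4 : (T.edgeEnd ε w - T.edgeStart ε w) * (C₁ * T.edgeLen w * e) ≤
        T.edgeLen w * (C₁ * T.edgeLen w * e) := mul_le_mul_of_nonneg_right hI1 (by positivity)
    calc _ ≤ 4 * T.wordMass ε u w + 4 * C₁ * (T.edgeLen w ^ 2 * e) := by nlinarith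
      _ ≤ ((C₃ + C₄) * C₂ ^ 2 + C₄ * C₂ + 4 * C₁ + 4) * T.wordMass ε u w +
          ((C₃ + C₄) * C₂ ^ 2 + C₄ * C₂ + 4 * C₁ + 4) * (T.edgeLen w ^ 2 * e) := by
          have : 0 < C₄ * C₂ := by positivity
          have : 0 < (C₃ + C₄) * C₂ ^ 2 := by positivity
          exact add_le_add (mul_le_mul_of_nonneg_right (by linarith) (by positivity))
            (mul_le_mul_of_nonneg_right (by linarith) (by positivity))
      _ = _ := by ring

end TreeData

/-! ### Uniform summability of the masses of the generations -/

theorem sub_sq_le_of_increments {κ K Λ : ℝ} (hκ : 0 < κ) (hK : 0 < K) {len : ℕ → ℝ}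
    (hlen : ∀ j, 0 < len j) {X e : ℕ → ℝ} (he : ∀ j, 0 ≤ e j)
    (h : ∀ j, κ ^ (j + 1) * (X (j + 1) - X j) ^ 2 ≤ K * len (j + 1) * (e j + e (j + 1)))
    (hes : Summable e) (heΛ : ∑' j, e j ≤ Λ) {i j : ℕ} (hij : i ≤ j) :
    (X j - X i) ^ 2 ≤ 2 * Λ * K * ∑ l ∈ Finset.Ico i j, len (l + 1) / κ ^ (l + 1) := by
  have h1 : X j - X i = ∑ l ∈ Finset.Ico i j, (X (l + 1) - X l) := (Finset.sum_Ico_sub X hij).symm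
  have h2 : ∀ l, (X (l + 1) - X l) ^ 2 ≤ (K * (len (l + 1) / κ ^ (l + 1))) * (e l + e (l + 1)) := by
    intro l
    have hp := pow_pos hκ (l + 1)
    rw [← mul_le_mul_iff_right₀ hp]
    refine (h l).trans_eq ?_
    field_simp
  have h3 : ∑ l ∈ Finset.Ico i j, (e l + e (l + 1)) ≤ 2 * Λ := by
    rw [Finset.sum_add_distrib, two_mul, Finset.sum_Ico_add' e i j 1]
    exact add_le_add ((hes.sum_le_tsum _ fun _ _ => he _).trans heΛ)
      ((hes.sum_le_tsum _ fun _ _ => he _).trans heΛ)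
  have hnn : ∀ l, 0 ≤ K * (len (l + 1) / κ ^ (l + 1)) := fun l =>
    mul_nonneg hK.le (div_nonneg (hlen _).le (pow_pos hκ _).le)
  -- Cauchy-Schwarz on the telescoping sum, with the weights `len / κ ^ l` on one side and the
  -- energies on the other. Each energy occurs at most twice, whence `2 * Λ`.
  calc (X j - X i) ^ 2 = (∑ l ∈ Finset.Ico i j, (X (l + 1) - X l)) ^ 2 := by rw [h1]
    _ ≤ (∑ l ∈ Finset.Ico i j, K * (len (l + 1) / κ ^ (l + 1))) *
        ∑ l ∈ Finset.Ico i j, (e l + e (l + 1)) :=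
        Finset.sum_sq_le_sum_mul_sum_of_sq_le_mul _ (fun l _ => hnn l)
          (fun l _ => add_nonneg (he _) (he _)) fun l _ => h2 l
    _ ≤ (∑ l ∈ Finset.Ico i j, K * (len (l + 1) / κ ^ (l + 1))) * (2 * Λ) :=
        mul_le_mul_of_nonneg_left h3 (Finset.sum_nonneg fun l _ => hnn l)
    _ = _ := by rw [← Finset.mul_sum]; ring

/-- A uniform summable bound for the masses of the generations. -/
theorem exists_summable_bound {κ K Λ : ℝ} (hκ : 0 < κ) (hK : 0 < K) (hΛ : 0 ≤ Λ) {len : ℕ → ℝ}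
    (hlen : ∀ j, 0 < len j) (hs : Summable len) :
    ∃ b : ℕ → ℝ, Summable b ∧ ∀ X m e : ℕ → ℝ, (∀ j, 0 ≤ m j) → (∀ j, 0 ≤ e j) →
      (∀ j, κ ^ (j + 1) * (X (j + 1) - X j) ^ 2 ≤ K * len (j + 1) * (e j + e (j + 1))) →
      (∀ j, m j ≤ K * (κ ^ j * len j * X j ^ 2 + len j ^ 2 * e j)) →
      (∀ j, κ ^ j * len j * X j ^ 2 ≤ K * (m j + len j ^ 2 * e j)) →
      Summable m → ∑' j, m j ≤ 1 → Summable e → ∑' j, e j ≤ Λ → ∀ j, m j ≤ b j := by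
  set R := ∑' j, len j with hR
  have hlR : ∀ j, len j ≤ R := fun j => hs.le_tsum j fun _ _ => (hlen _).le
  have hR0 : 0 < R := (hlen 0).trans_le (hlR 0)
  have hsum1 : ∀ i j : ℕ, ∑ l ∈ Finset.Ico i j, len (l + 1) ≤ R := fun i j => by
    rw [Finset.sum_Ico_add' len i j 1]
    exact hs.sum_le_tsum _ fun _ _ => (hlen _).le
  have hlen2 : ∀ j, len j ^ 2 ≤ R * len j := fun j => by
    rw [sq]; exact mul_le_mul_of_nonneg_right (hlR j) (hlen j).le
  -- it suffices to bound `κ ^ j * len j * X j ^ 2`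
  suffices hB : ∃ B : ℕ → ℝ, Summable B ∧ ∀ X m e : ℕ → ℝ, (∀ j, 0 ≤ m j) → (∀ j, 0 ≤ e j) →
      (∀ j, κ ^ (j + 1) * (X (j + 1) - X j) ^ 2 ≤ K * len (j + 1) * (e j + e (j + 1))) →
      (∀ j, κ ^ j * len j * X j ^ 2 ≤ K * (m j + len j ^ 2 * e j)) →
      Summable m → ∑' j, m j ≤ 1 → Summable e → ∑' j, e j ≤ Λ →
      ∀ j, κ ^ j * len j * X j ^ 2 ≤ B j by
    obtain ⟨B, hBs, hB⟩ := hB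
    refine ⟨fun j => K * (B j + R * Λ * len j), (hBs.add (hs.mul_left _)).mul_left K,
      fun X m e hm he h1 h2 h3 hms hm1 hes heΛ j => (h2 j).trans ?_⟩
    refine mul_le_mul_of_nonneg_left (add_le_add (hB X m e hm he h1 h3 hms hm1 hes heΛ j) ?_) hK.le
    have hej : e j ≤ Λ := (hes.le_tsum j fun _ _ => he _).trans heΛ
    calc len j ^ 2 * e j ≤ R * len j * Λ := mul_le_mul (hlen2 j) hej (he j)
          (mul_pos hR0 (hlen j)).le
      _ = _ := by ring
  -- If the tree has finite total weight, `X 0` is an admissible reference and constants have finite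
  -- mass. Otherwise only functions that decay along a sequence of generations have finite mass, and
  -- this decay replaces the reference value at the root.
  by_cases hG : Summable fun j => κ ^ j * len j
  · set A := K * (1 + len 0 ^ 2 * Λ) / len 0 with hA
    refine ⟨fun j => 2 * A * (κ ^ j * len j) + 4 * Λ * K * R * (len j + κ ^ j * len j),
      (hG.mul_left _).add ((hs.add hG).mul_left _),
      fun X m e hm he h1 h3 hms hm1 hes heΛ j => ?_⟩
    have hX0 : X 0 ^ 2 ≤ A := by
      rw [hA, le_div_iff₀ (hlen 0)]
      have h4 := h3 0
      have hm0 : m 0 ≤ 1 := (hms.le_tsum 0 fun _ _ => hm _).trans hm1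
      have he0 : e 0 ≤ Λ := (hes.le_tsum 0 fun _ _ => he _).trans heΛ
      calc X 0 ^ 2 * len 0 = κ ^ 0 * len 0 * X 0 ^ 2 := by ring
        _ ≤ _ := h4
        _ ≤ _ := by gcongr
    have hinc := sub_sq_le_of_increments hκ hK hlen he h1 hes heΛ (Nat.zero_le j)
    have hκj := pow_pos hκ j
    have hsum : κ ^ j * ∑ l ∈ Finset.Ico 0 j, len (l + 1) / κ ^ (l + 1) ≤ (1 + κ ^ j) * R := by
      refine le_trans ?_ (mul_le_mul_of_nonneg_left (hsum1 0 j) (by positivity))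
      rw [Finset.mul_sum, Finset.mul_sum]
      refine Finset.sum_le_sum fun l hl => ?_
      have hlj : l + 1 ≤ j := (Finset.mem_Ico.1 hl).2
      -- One bound for both regimes: the quotient is at most `1` if `κ ≤ 1`, and at most `κ ^ j` if
      -- `κ ≥ 1`.
      have hle : κ ^ j / κ ^ (l + 1) ≤ 1 + κ ^ j := by
        rcases le_total κ 1 with hκ1 | hκ1
        · have : κ ^ j / κ ^ (l + 1) ≤ 1 :=
            div_le_one_of_le₀ (pow_le_pow_of_le_one hκ.le hκ1 hlj) (pow_pos hκ _).le
          linarith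
        · have : κ ^ j / κ ^ (l + 1) ≤ κ ^ j := div_le_self hκj.le (one_le_pow₀ hκ1)
          linarith
      calc κ ^ j * (len (l + 1) / κ ^ (l + 1)) = κ ^ j / κ ^ (l + 1) * len (l + 1) := by ring
        _ ≤ _ := mul_le_mul_of_nonneg_right hle (hlen _).le
    have hXj : X j ^ 2 ≤ 2 * A + 2 * (X j - X 0) ^ 2 := by nlinarith [sq_nonneg (X j - 2 * X 0)]
    calc κ ^ j * len j * X j ^ 2 ≤ κ ^ j * len j * (2 * A + 2 * (2 * Λ * K *
          ∑ l ∈ Finset.Ico 0 j, len (l + 1) / κ ^ (l + 1))) :=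
          mul_le_mul_of_nonneg_left (by linarith) (mul_pos hκj (hlen j)).le
      _ = 2 * A * (κ ^ j * len j) + 4 * Λ * K * len j *
          (κ ^ j * ∑ l ∈ Finset.Ico 0 j, len (l + 1) / κ ^ (l + 1)) := by ring
      _ ≤ 2 * A * (κ ^ j * len j) + 4 * Λ * K * len j * ((1 + κ ^ j) * R) := by
          have := hlen j
          gcongr
      _ = _ := by ring
  -- For `κ ≤ 1` the series would be dominated by the finite radius.
  · have hκ1 : 1 < κ := by
      by_contra hle
      refine hG (hs.of_nonneg_of_le (fun j => (mul_pos (pow_pos hκ j) (hlen j)).le) fun j => ?_)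
      exact mul_le_of_le_one_left (hlen j).le (pow_le_one₀ hκ.le (not_lt.1 hle))
    refine ⟨fun j => 4 * Λ * K * R * len j, hs.mul_left _,
      fun X m e hm he h1 h3 hms hm1 hes heΛ j => ?_⟩
    have hκj := pow_pos hκ j
    have hGX : Summable fun j => κ ^ j * len j * X j ^ 2 := by
      refine Summable.of_nonneg_of_le (fun j => mul_nonneg (mul_pos (pow_pos hκ j) (hlen j)).le
        (sq_nonneg _)) h3 ((hms.add ?_).mul_left K)
      refine (hes.mul_left (R ^ 2)).of_nonneg_of_le
        (fun j => mul_nonneg (sq_nonneg _) (he j)) fun j => ?_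
      exact mul_le_mul_of_nonneg_right (pow_le_pow_left₀ (hlen j).le (hlR j) 2) (he j)
    -- If `X J ^ 2` stayed above `η` for all `J ≥ j`, the series `∑ κ ^ J * len J` would be
    -- dominated by `η⁻¹` times the convergent series `hGX`. The index `J` depends on the function,
    -- but the bound obtained from it does not.
    have hsmall : ∀ η : ℝ, 0 < η → ∃ J, j ≤ J ∧ X J ^ 2 < η := by
      intro η hη
      by_contra! hcon
      refine hG ?_
      have hsh := (summable_nat_add_iff j).2 hGX
      rw [← summable_nat_add_iff j]
      refine (hsh.mul_left η⁻¹).of_nonneg_of_le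
        (fun i => (mul_pos (pow_pos hκ _) (hlen _)).le) fun i => ?_
      rw [inv_mul_eq_div, le_div_iff₀ hη]
      exact mul_le_mul_of_nonneg_left (hcon (i + j) (Nat.le_add_left _ _))
        (mul_pos (pow_pos hκ _) (hlen _)).le
    have hXj : κ ^ j * X j ^ 2 ≤ 4 * Λ * K * R := by
      refine le_of_forall_pos_le_add fun η hη => ?_
      obtain ⟨J, hJ, hXJ⟩ := hsmall (η / (2 * κ ^ j)) (by positivity)
      have hinc := sub_sq_le_of_increments hκ hK hlen he h1 hes heΛ hJ
      -- Summing outwards from `j`, the factors `κ ^ j / κ ^ (l + 1)` are at most `1` because `κ >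
      -- 1`. The bound is independent of `J`, which may now be as large as necessary.
      have hsum : κ ^ j * ∑ l ∈ Finset.Ico j J, len (l + 1) / κ ^ (l + 1) ≤ R := by
        refine le_trans ?_ (hsum1 j J)
        rw [Finset.mul_sum]
        refine Finset.sum_le_sum fun l hl => ?_
        have hlj : j ≤ l + 1 := (Finset.mem_Ico.1 hl).1.trans (Nat.le_succ l)
        rw [mul_div_assoc', div_le_iff₀ (pow_pos hκ _), mul_comm]
        exact mul_le_mul_of_nonneg_left (pow_le_pow_right₀ hκ1.le hlj) (hlen _).le
      have h5 : X j ^ 2 ≤ 2 * X J ^ 2 + 2 * (X J - X j) ^ 2 := by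
        nlinarith [sq_nonneg (X j - 2 * X J)]
      rw [lt_div_iff₀ (by positivity)] at hXJ
      calc κ ^ j * X j ^ 2 ≤ κ ^ j * (2 * X J ^ 2 + 2 * (2 * Λ * K *
            ∑ l ∈ Finset.Ico j J, len (l + 1) / κ ^ (l + 1))) :=
            mul_le_mul_of_nonneg_left (by linarith) hκj.le
        _ = X J ^ 2 * (2 * κ ^ j) + 4 * Λ * K *
            (κ ^ j * ∑ l ∈ Finset.Ico j J, len (l + 1) / κ ^ (l + 1)) := by ring
        _ ≤ η + 4 * Λ * K * R := add_le_add hXJ.le (mul_le_mul_of_nonneg_left hsum (by positivity))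
        _ = _ := add_comm _ _
    calc κ ^ j * len j * X j ^ 2 = κ ^ j * X j ^ 2 * len j := by ring
      _ ≤ _ := mul_le_mul_of_nonneg_right hXj (hlen j).le

/-- The reverse triangle inequality in a Euclidean space. It transfers bounds for the individual
increments of the vertex averages to their quadratic means. -/
theorem abs_sqrt_sum_sub_le {ι : Type*} (s : Finset ι) (f g : ι → ℂ) :
    (√(∑ i ∈ s, ‖f i‖ ^ 2) - √(∑ i ∈ s, ‖g i‖ ^ 2)) ^ 2 ≤ ∑ i ∈ s, ‖f i - g i‖ ^ 2 := by
  set F : EuclideanSpace ℂ s := WithLp.toLp 2 fun i => f i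
  set H : EuclideanSpace ℂ s := WithLp.toLp 2 fun i => g i
  have h1 : ‖F‖ = √(∑ i ∈ s, ‖f i‖ ^ 2) := by
    rw [EuclideanSpace.norm_eq, ← Finset.sum_coe_sort s]
  have h2 : ‖H‖ = √(∑ i ∈ s, ‖g i‖ ^ 2) := by
    rw [EuclideanSpace.norm_eq, ← Finset.sum_coe_sort s]
  have h3 : ‖F - H‖ ^ 2 = ∑ i ∈ s, ‖f i - g i‖ ^ 2 := by
    rw [EuclideanSpace.norm_sq_eq, ← Finset.sum_coe_sort s]
    rfl
  rw [← h1, ← h2, ← h3]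
  exact sq_le_sq' (by linarith [(abs_le.1 (abs_norm_sub_norm_le F H)).1])
    (abs_le.1 (abs_norm_sub_norm_le F H)).2

namespace TreeData

variable {d k : ℕ} (T : TreeData d k) {ε ω : ℝ}

theorem edgeLen_of_mem {n : ℕ} {w : Word k} (hw : w ∈ Word.ofGen k n) : T.edgeLen w = T.len n := by
  rw [edgeLen, Word.mem_ofGen.1 hw]

theorem rho_of_mem {n : ℕ} {w : Word k} (hw : w ∈ Word.ofGen k n) :
    T.rho w = (T.δ ^ d) ^ n * (volume T.Ω).toReal := by
  rw [rho, Word.mem_ofGen.1 hw, pow_mul]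

/-- The masses of the generations have a summable bound, uniformly in `ε`. -/
theorem exists_summable_generation_bound (T : TreeData d k) (hk : 1 ≤ k) (hs : Summable T.len)
    {Λ : ℝ} (hΛ : 0 ≤ Λ) :
    ∃ b : ℕ → ℝ, Summable b ∧ ∀ {ε ω : ℝ}, 0 < ε → ε ≤ 1 / 2 →
    ∀ {u : Piece k × EuclideanSpace ℝ (Fin (d + 1)) → ℂ}
      {G : Piece k × EuclideanSpace ℝ (Fin (d + 1)) → EuclideanSpace ℂ (Fin (d + 1))}
      {a : Word k → ℂ × ℂ}, T.IsProfile ε ω u G a → ∑' w, T.wordMass ε u w ≤ 1 →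
      ∑' w, T.wordMass ε G w ≤ Λ → ∀ j, ∑ w ∈ Word.ofGen k j, T.wordMass ε u w ≤ b j := by
  obtain ⟨C₁, hC₁p, hC₁⟩ := T.exists_rho_mul_profile_sub_vertAverage_le
  obtain ⟨C₂, hC₂p, hC₂⟩ := T.exists_wordMass_le
  have hk0 : (0 : ℝ) < k := by exact_mod_cast hk
  have hδ := pow_pos T.δ_pos d
  have hΩ := T.volume_Ω_pos
  -- The ratio of the total weights of consecutive generations: `k` times as many edges, each with
  -- `δ ^ d` times the weight.
  set κ : ℝ := k * T.δ ^ d with hκ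
  set v := (volume T.Ω).toReal
  have hκp : 0 < κ := by positivity
  set K : ℝ := C₁ * (k + 1) + C₂ with hK
  have hKp : 0 < K := by positivity
  obtain ⟨b, hb, hbound⟩ := exists_summable_bound hκp hKp hΛ T.len_pos hs
  refine ⟨b, hb, fun {ε ω} hε hε2 {u G a} h hm he j => ?_⟩
  have hMs := T.hasSum_wordMass h.mem.1
  have hEs := T.hasSum_wordMass h.mem.2.1
  have hM0 := fun w => T.wordMass_nonneg (F := u) hε w
  have hE0 := fun w => T.wordMass_nonneg (F := G) hε w
  set c := T.vertAverage ε u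
  have hrho : ∀ {n w}, w ∈ Word.ofGen k n → T.rho w = (T.δ ^ d) ^ n * v := fun hw =>
    T.rho_of_mem hw
  -- `X n ^ 2` is `v` times the mean of `‖c‖ ^ 2` over generation `n`
  set X : ℕ → ℝ := fun n => √(∑ w ∈ Word.ofGen k n, ‖c w‖ ^ 2) * √(v / k ^ n) with hX
  have hXsq : ∀ n, κ ^ n * X n ^ 2 = ∑ w ∈ Word.ofGen k n, T.rho w * ‖c w‖ ^ 2 := fun n => by
    have e : X n ^ 2 = (∑ w ∈ Word.ofGen k n, ‖c w‖ ^ 2) * (v / k ^ n) := by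
      rw [hX]
      simp only
      rw [mul_pow, Real.sq_sqrt (Finset.sum_nonneg fun _ _ => sq_nonneg _),
        Real.sq_sqrt (by positivity)]
    have e2 : ∑ w ∈ Word.ofGen k n, T.rho w * ‖c w‖ ^ 2 =
        ∑ w ∈ Word.ofGen k n, (T.δ ^ d) ^ n * v * ‖c w‖ ^ 2 :=
      Finset.sum_congr rfl fun w hw => by rw [hrho hw]
    rw [e, e2, hκ, mul_pow, ← Finset.mul_sum]
    field_simp
  have hlen : ∀ n (f : Word k → ℝ), ∑ w ∈ Word.ofGen k n, T.edgeLen w * f w =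
      T.len n * ∑ w ∈ Word.ofGen k n, f w := fun n f => by
    rw [Finset.mul_sum]
    exact Finset.sum_congr rfl fun w hw => by rw [T.edgeLen_of_mem hw]
  refine hbound X (fun n => ∑ w ∈ Word.ofGen k n, T.wordMass ε u w)
    (fun n => ∑ w ∈ Word.ofGen k n, T.wordMass ε G w)
    (fun n => Finset.sum_nonneg fun w _ => hM0 w) (fun n => Finset.sum_nonneg fun w _ => hE0 w)
    (fun n => ?_) (fun n => ?_) (fun n => ?_) (Word.hasSum_ofGen hMs).summable ?_
    (Word.hasSum_ofGen hEs).summable ?_ j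
  -- Each value of generation `n` is repeated once for every child. Both means then become norms
  -- over the same index set of pairs, to which the reverse triangle inequality applies.
  · have h1 : √(∑ w ∈ Word.ofGen k n, ‖c w‖ ^ 2) * √(v / k ^ n) =
        √(∑ q ∈ Word.ofGen k n ×ˢ Finset.univ (α := Fin k), ‖c q.1‖ ^ 2) * √(v / k ^ (n + 1)) := by
      rw [← Real.sqrt_mul (Finset.sum_nonneg fun _ _ => sq_nonneg _),
        ← Real.sqrt_mul (Finset.sum_nonneg fun _ _ => sq_nonneg _), Finset.sum_product]
      congr 1
      simp only [Finset.sum_const, Finset.card_univ, Fintype.card_fin, nsmul_eq_mul]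
      rw [← Finset.mul_sum, pow_succ]
      field_simp
    have h2 : ∑ w ∈ Word.ofGen k (n + 1), ‖c w‖ ^ 2 =
        ∑ q ∈ Word.ofGen k n ×ˢ Finset.univ (α := Fin k), ‖c (Word.child q.2 q.1)‖ ^ 2 := by
      rw [Word.sum_ofGen_succ, Finset.sum_product]
    have h3 := abs_sqrt_sum_sub_le (Word.ofGen k n ×ˢ Finset.univ (α := Fin k))
      (fun q => c (Word.child q.2 q.1)) fun q => c q.1
    have h4 : (X (n + 1) - X n) ^ 2 ≤ v / k ^ (n + 1) *
        ∑ q ∈ Word.ofGen k n ×ˢ Finset.univ (α := Fin k), ‖c (Word.child q.2 q.1) - c q.1‖ ^ 2 := by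
      rw [hX]
      simp only
      rw [h1, h2, ← sub_mul, mul_pow, Real.sq_sqrt (by positivity), mul_comm]
      exact mul_le_mul_of_nonneg_left h3 (by positivity)
    have hmemc : ∀ w ∈ Word.ofGen k n, ∀ i, Word.child i w ∈ Word.ofGen k (n + 1) :=
      fun w hw i => by rw [Word.mem_ofGen, Word.gen_child, Word.mem_ofGen.1 hw]
    calc κ ^ (n + 1) * (X (n + 1) - X n) ^ 2 ≤ κ ^ (n + 1) * (v / k ^ (n + 1) *
          ∑ q ∈ Word.ofGen k n ×ˢ Finset.univ (α := Fin k),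
            ‖c (Word.child q.2 q.1) - c q.1‖ ^ 2) :=
          mul_le_mul_of_nonneg_left h4 (pow_pos hκp _).le
      _ = ∑ w ∈ Word.ofGen k n, ∑ i,
            T.rho (Word.child i w) * ‖c (Word.child i w) - c w‖ ^ 2 := by
          rw [Finset.sum_product, hκ, mul_pow, Finset.mul_sum, Finset.mul_sum]
          refine Finset.sum_congr rfl fun w hw => ?_
          rw [Finset.mul_sum, Finset.mul_sum]
          refine Finset.sum_congr rfl fun i _ => ?_
          rw [hrho (hmemc w hw i)]
          field_simp
      _ ≤ ∑ w ∈ Word.ofGen k n, ∑ i, C₁ * T.len (n + 1) *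
            (T.wordMass ε G w + T.wordMass ε G (Word.child i w)) := by
          refine Finset.sum_le_sum fun w hw => Finset.sum_le_sum fun i _ => ?_
          rw [← T.edgeLen_of_mem (hmemc w hw i)]
          exact (hC₁ hε hε2 h w).2 i
      _ = C₁ * T.len (n + 1) * (k * ∑ w ∈ Word.ofGen k n, T.wordMass ε G w +
            ∑ w ∈ Word.ofGen k (n + 1), T.wordMass ε G w) := by
          rw [Word.sum_ofGen_succ]
          simp only [← Finset.mul_sum, Finset.sum_add_distrib, Finset.sum_const, Finset.card_univ,
            Fintype.card_fin, nsmul_eq_mul]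
      _ ≤ _ := by
          have hx : 0 ≤ ∑ w ∈ Word.ofGen k n, T.wordMass ε G w :=
            Finset.sum_nonneg fun w _ => hE0 w
          have hy : 0 ≤ ∑ w ∈ Word.ofGen k (n + 1), T.wordMass ε G w :=
            Finset.sum_nonneg fun w _ => hE0 w
          have hl := T.len_pos (n + 1)
          have h5 : C₁ * (k * ∑ w ∈ Word.ofGen k n, T.wordMass ε G w +
              ∑ w ∈ Word.ofGen k (n + 1), T.wordMass ε G w) ≤
              K * (∑ w ∈ Word.ofGen k n, T.wordMass ε G w +
              ∑ w ∈ Word.ofGen k (n + 1), T.wordMass ε G w) := by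
            rw [hK]
            have e1 := mul_nonneg hC₁p.le hx
            have e2 := mul_nonneg (mul_pos hC₁p hk0).le hy
            have e3 := mul_nonneg hC₂p.le hx
            have e4 := mul_nonneg hC₂p.le hy
            nlinarith
          calc _ = T.len (n + 1) * (C₁ * (k * ∑ w ∈ Word.ofGen k n, T.wordMass ε G w +
              ∑ w ∈ Word.ofGen k (n + 1), T.wordMass ε G w)) := by ring
            _ ≤ _ := mul_le_mul_of_nonneg_left h5 hl.le
            _ = _ := by ring
  · have hC2K : C₂ ≤ K := by
      rw [hK]; have := mul_pos hC₁p (by positivity : (0 : ℝ) < k + 1); linarith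
    calc _ ≤ ∑ w ∈ Word.ofGen k n, C₂ * (T.rho w * T.edgeLen w * ‖c w‖ ^ 2 +
          T.edgeLen w ^ 2 * T.wordMass ε G w) :=
          Finset.sum_le_sum fun w _ => (hC₂ hε hε2 h w).1
      _ = C₂ * (κ ^ n * T.len n * X n ^ 2 +
          T.len n ^ 2 * ∑ w ∈ Word.ofGen k n, T.wordMass ε G w) := by
          rw [← Finset.mul_sum, Finset.sum_add_distrib]
          congr 2
          · rw [mul_right_comm, hXsq, mul_comm, ← hlen]
            exact Finset.sum_congr rfl fun w _ => by ring
          · rw [sq (T.len n), mul_assoc, ← hlen, ← hlen]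
            exact Finset.sum_congr rfl fun w _ => by ring
      _ ≤ _ := mul_le_mul_of_nonneg_right hC2K (add_nonneg (mul_nonneg (mul_pos (pow_pos hκp n)
          (T.len_pos n)).le (sq_nonneg _)) (mul_nonneg (sq_nonneg _)
            (Finset.sum_nonneg fun w _ => hE0 w)))
  · have hC2K : C₂ ≤ K := by
      rw [hK]; have := mul_pos hC₁p (by positivity : (0 : ℝ) < k + 1); linarith
    calc κ ^ n * T.len n * X n ^ 2
        = ∑ w ∈ Word.ofGen k n, T.rho w * T.edgeLen w * ‖c w‖ ^ 2 := by
          rw [mul_right_comm, hXsq, mul_comm, ← hlen]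
          exact Finset.sum_congr rfl fun w _ => by ring
      _ ≤ ∑ w ∈ Word.ofGen k n, C₂ * (T.wordMass ε u w + T.edgeLen w ^ 2 * T.wordMass ε G w) :=
          Finset.sum_le_sum fun w _ => (hC₂ hε hε2 h w).2
      _ = C₂ * (∑ w ∈ Word.ofGen k n, T.wordMass ε u w +
          T.len n ^ 2 * ∑ w ∈ Word.ofGen k n, T.wordMass ε G w) := by
          rw [← Finset.mul_sum, Finset.sum_add_distrib]
          congr 2
          rw [sq (T.len n), mul_assoc, ← hlen, ← hlen]
          exact Finset.sum_congr rfl fun w _ => by ring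
      _ ≤ _ := mul_le_mul_of_nonneg_right hC2K (add_nonneg (Finset.sum_nonneg fun w _ => hM0 w)
          (mul_nonneg (sq_nonneg _) (Finset.sum_nonneg fun w _ => hE0 w)))
  · rw [(Word.hasSum_ofGen hMs).tsum_eq, ← hMs.tsum_eq]; exact hm
  · rw [(Word.hasSum_ofGen hEs).tsum_eq, ← hEs.tsum_eq]; exact he

end TreeData

/-! ### The Dirichlet condition at the root -/

namespace TreeData

variable {d k : ℕ} (T : TreeData d k) {ε ω : ℝ}

/-- A `C¹` function that vanishes on the root section is controlled by its axial derivative. -/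
theorem IsC1Root.enorm_sq_le_root (hε : 0 < ε) {T : TreeData d k}
    {f : Piece k × EuclideanSpace ℝ (Fin (d + 1)) → ℂ} (hf : T.IsC1Root ε f) {t θ : ℝ}
    (hθ0 : 0 < θ) (hθt : θ < t) (hθ : θ < T.edgeEnd ε (Word.root k))
    {s : EuclideanSpace ℝ (Fin d)} (hs : s ∈ T.crossSection ε (Word.root k)) :
    ‖f (.edge (Word.root k), axialPoint θ s)‖ₑ ^ 2 ≤
      ENNReal.ofReal t * ∫⁻ τ in Ioo (T.edgeStart ε (Word.root k)) (T.edgeEnd ε (Word.root k)),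
        ‖grad f (.edge (Word.root k), axialPoint τ s)‖ₑ ^ 2 := by
  set h : ℝ → ℂ := fun τ => f (.edge (Word.root k), axialPoint τ s)
  have hc : ContDiffOn ℝ 1 h (Icc 0 θ) :=
    hf.contDiffOn_root.comp (t := {x | 0 ≤ x 0 ∧ x 0 < T.edgeEnd ε (Word.root k) ∧
        transversal x ∈ T.crossSection ε (Word.root k)})
      ((contDiff_axialPoint.comp (contDiff_id.prodMk contDiff_const)).contDiffOn
        (s := Icc 0 θ)) fun τ hτ =>
      ⟨hτ.1, hτ.2.trans_lt hθ, by simpa [transversal_axialPoint] using hs⟩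
  have h1 := intervalIntegral.integral_derivWithin_Icc_of_contDiffOn_Icc hc hθ0.le
  have h0 : h 0 = 0 := hf.eq_zero_root s hs
  rw [h0, sub_zero, intervalIntegral.integral_of_le hθ0.le, ← integral_Icc_eq_integral_Ioc] at h1
  change ‖h θ‖ₑ ^ 2 ≤ _
  rw [← h1]
  have hm : AEStronglyMeasurable (derivWithin h (Icc 0 θ)) (volume.restrict (Icc 0 θ)) :=
    (hc.continuousOn_derivWithin (uniqueDiffOn_Icc hθ0) le_rfl).aestronglyMeasurable
      measurableSet_Icc
  refine (enorm_integral_sq_le hm).trans ?_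
  rw [Measure.restrict_apply_univ, Real.volume_Icc, sub_zero, ← restrict_Ioo_eq_restrict_Icc,
    edgeStart_root]
  refine mul_le_mul' (ENNReal.ofReal_le_ofReal hθt.le) ?_
  refine (setLIntegral_mono' measurableSet_Ioo fun τ hτ => ?_).trans
    (lintegral_mono_set (Ioo_subset_Ioo le_rfl hθ.le))
  have h2 := hf.hasDerivAt_axial hε (Word.root k) (θ := τ) ⟨hτ.1, hτ.2.trans hθ⟩ hs
  rw [h2.hasDerivWithinAt.derivWithin (uniqueDiffOn_Icc hθ0 τ (Ioo_subset_Icc_self hτ)),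
    ← ofReal_norm, ← ofReal_norm]
  gcongr
  exact PiLp.norm_apply_le _ _

/-- The profile on the edge at the root vanishes at the root. -/
theorem IsProfile.profile_root_zero (hε : 0 < ε) (hε1 : ε < 1) {T : TreeData d k}
    {u : Piece k × EuclideanSpace ℝ (Fin (d + 1)) → ℂ}
    {G : Piece k × EuclideanSpace ℝ (Fin (d + 1)) → EuclideanSpace ℂ (Fin (d + 1))}
    {a : Word k → ℂ × ℂ} (h : T.IsProfile ε ω u G a) : T.profile ω a (Word.root k) 0 = 0 := by
  set r := Word.root k
  set b := T.edgeEnd ε r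
  have hb : 0 < b := T.edgeStart_lt_edgeEnd hε hε1 r
  set E := ∫⁻ x in T.piece ε (.edge r), ‖G (.edge r, x)‖ₑ ^ 2 with hE
  have hEt : E ≠ ⊤ := (memLp_two_iff.1 (h.mem.2.1.prodMk_left (.edge r))).2.ne
  set cut : ℝ → (EuclideanSpace ℝ (Fin (d + 1)) → ℂ) → EuclideanSpace ℝ (Fin (d + 1)) → ℂ :=
    fun t F => {x | x 0 < t}.indicator F with hcut
  have hmeas : ∀ t : ℝ, MeasurableSet {x : EuclideanSpace ℝ (Fin (d + 1)) | x 0 < t} := fun t =>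
    (isOpen_lt (by fun_prop) continuous_const).measurableSet
  have hu := h.mem.1.prodMk_left (.edge r)
  have hfin := T.isFiniteMeasure_crossSection hε r
  -- The squared norm of `u` on the slab of height `t` above the root is of order `t ^ 2`. This
  -- holds for `C¹` functions that vanish on the root section and survives the closure. A nonzero
  -- value of the profile at the root would make it at least of order `t`, a contradiction as `t →
  -- 0`.
  have key : ∀ t, 0 < t → t < b →
      ∫⁻ x in T.piece ε (.edge r), ‖cut t (fun x => u (.edge r, x)) x‖ₑ ^ 2 ≤
        4 * ENNReal.ofReal t ^ 2 * E := by
    intro t ht htb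
    refine ENNReal_le_of_forall_le_mul_add (A := 2 + 4 * ENNReal.ofReal t ^ 2) (by finiteness)
      fun η hη _ => ?_
    obtain ⟨f, hf, hf1, hf2, hfi⟩ := h.mem.exists_approx hη
    have hfu := hf1.prodMk_left (.edge r)
    have hgm : AEMeasurable (fun x => ‖grad f (.edge r, x)‖ₑ ^ 2)
        (volume.restrict (T.piece ε (.edge r))) := (hf2.prodMk_left (.edge r)).1.enorm.pow_const 2
    have h1 : ∫⁻ x in T.piece ε (.edge r), ‖cut t (fun x => f (.edge r, x)) x‖ₑ ^ 2 ≤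
        ENNReal.ofReal t ^ 2 * ∫⁻ x in T.piece ε (.edge r), ‖grad f (.edge r, x)‖ₑ ^ 2 := by
      have hcm : AEMeasurable (fun x => ‖cut t (fun x => f (.edge r, x)) x‖ₑ ^ 2)
          (volume.restrict (T.piece ε (.edge r))) :=
        (hfu.1.indicator (hmeas t)).enorm.pow_const 2
      have hswap := lintegral_lintegral_swap
        (f := fun τ s => ‖grad f (.edge r, axialPoint τ s)‖ₑ ^ 2)
        ((aestronglyMeasurable_edge (hf2.prodMk_left (.edge r)).1).enorm.pow_const 2)
      rw [lintegral_edge T hε hcm, lintegral_edge T hε hgm, hswap]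
      set D := ∫⁻ s in T.crossSection ε r, ∫⁻ τ in Ioo (T.edgeStart ε r) (T.edgeEnd ε r),
        ‖grad f (.edge r, axialPoint τ s)‖ₑ ^ 2
      calc _ ≤ ∫⁻ θ in Ioo (T.edgeStart ε r) (T.edgeEnd ε r),
            (Iio t).indicator (fun _ => ENNReal.ofReal t * D) θ := by
            refine setLIntegral_mono' measurableSet_Ioo fun θ hθ => ?_
            by_cases hθt : θ < t
            · rw [indicator_of_mem (s := Iio t) hθt, ← lintegral_const_mul' _ _ ENNReal.ofReal_ne_top]
              refine setLIntegral_mono' (T.isOpen_crossSection hε r).measurableSet fun s hs => ?_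
              refine le_trans (le_of_eq ?_) (hf.enorm_sq_le_root hε hθ.1 hθt hθ.2 hs)
              congr 2
              exact indicator_of_mem (s := {x : EuclideanSpace ℝ (Fin (d + 1)) | x 0 < t}) hθt _
            · rw [indicator_of_notMem (s := Iio t) hθt]
              refine le_of_eq ((lintegral_congr fun s => ?_).trans lintegral_zero)
              have : cut t (fun x => f (.edge r, x)) (axialPoint θ s) = 0 :=
                indicator_of_notMem (s := {x : EuclideanSpace ℝ (Fin (d + 1)) | x 0 < t}) hθt _
              rw [this]; simp
        _ = ENNReal.ofReal t * D * volume (Iio t ∩ Ioo (T.edgeStart ε r) (T.edgeEnd ε r)) := by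
            rw [lintegral_indicator measurableSet_Iio, lintegral_const, Measure.restrict_apply_univ,
              Measure.restrict_apply measurableSet_Iio]
        _ ≤ ENNReal.ofReal t * D * volume (Ioo 0 t) := by
            gcongr
            exact fun θ hθ => ⟨hθ.2.1, hθ.1⟩
        _ = _ := by rw [Real.volume_Ioo, sub_zero]; ring
    calc _ ≤ 2 * (∫⁻ x in T.piece ε (.edge r), ‖cut t (fun x => f (.edge r, x)) x -
          cut t (fun x => u (.edge r, x)) x‖ₑ ^ 2) +
          2 * ∫⁻ x in T.piece ε (.edge r), ‖cut t (fun x => f (.edge r, x)) x‖ₑ ^ 2 :=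
          lintegral_sq_le_of_approx (hfu.1.indicator (hmeas t)) (hu.1.indicator (hmeas t))
      _ ≤ 2 * η + 2 * (ENNReal.ofReal t ^ 2 * (2 * η + 2 * E)) := by
          gcongr
          · refine le_trans (lintegral_mono fun x => ?_) (hfi (.edge r)).1
            rw [hcut]
            simp only
            by_cases hx : x ∈ {x : EuclideanSpace ℝ (Fin (d + 1)) | x 0 < t}
            · rw [indicator_of_mem hx, indicator_of_mem hx, enorm_sub_rev]
            · rw [indicator_of_notMem hx, indicator_of_notMem hx]; simp
          · refine h1.trans (mul_le_mul_right ?_ _)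
            refine (lintegral_sq_le_of_approx (h.mem.2.1.prodMk_left (.edge r)).1
              (hf2.prodMk_left (.edge r)).1).trans ?_
            gcongr
            exact (hfi _).2
      _ = _ := by ring
  by_contra hne
  have hP := T.continuous_profile ω a r
  set p := ‖T.profile ω a r 0‖ with hp
  have hp0 : 0 < p := norm_pos_iff.2 hne
  obtain ⟨t₀, ht₀, hball⟩ := Metric.continuousAt_iff.1 hP.norm.continuousAt (p / 2) (half_pos hp0)
  have hpow := pow_pos hε d
  have hρ := T.rho_pos r
  have hbound : ∀ t, 0 < t → t < b → t ≤ t₀ →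
      ε ^ d * T.rho r * (p / 2) ^ 2 ≤ 4 * t * E.toReal := by
    intro t ht htb htt
    have hav : ∀ᵐ θ ∂volume.restrict (Ioo (T.edgeStart ε r) (T.edgeEnd ε r)),
        ⨍ s in T.crossSection ε r, cut t (fun x => u (.edge r, x)) (axialPoint θ s) =
          (Iio t).indicator (T.profile ω a r) θ := by
      filter_upwards [h.average r] with θ hθ
      by_cases hθt : θ < t
      · rw [indicator_of_mem (s := Iio t) hθt, ← hθ]
        have : ∀ s, cut t (fun x => u (.edge r, x)) (axialPoint θ s) =
            u (.edge r, axialPoint θ s) := fun s =>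
          indicator_of_mem (s := {x : EuclideanSpace ℝ (Fin (d + 1)) | x 0 < t}) hθt _
        simp only [this]
      · rw [indicator_of_notMem (s := Iio t) hθt]
        have : ∀ s, cut t (fun x => u (.edge r, x)) (axialPoint θ s) = 0 := fun s =>
          indicator_of_notMem (s := {x : EuclideanSpace ℝ (Fin (d + 1)) | x 0 < t}) hθt _
        simp [this]
    have h2 := (T.lintegral_average_sq_le hε (hu.indicator (hmeas t)) hav).trans (key t ht htb)
    have h3 : ENNReal.ofReal t * ENNReal.ofReal ((p / 2) ^ 2) ≤
        ∫⁻ θ in Ioo (T.edgeStart ε r) (T.edgeEnd ε r),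
          ‖(Iio t).indicator (T.profile ω a r) θ‖ₑ ^ 2 := by
      calc _ = ∫⁻ _ in Ioo 0 t, ENNReal.ofReal ((p / 2) ^ 2) := by
            rw [lintegral_const, Measure.restrict_apply_univ, Real.volume_Ioo, sub_zero, mul_comm]
        _ ≤ ∫⁻ θ in Ioo 0 t, ‖(Iio t).indicator (T.profile ω a r) θ‖ₑ ^ 2 := by
            refine setLIntegral_mono' measurableSet_Ioo fun θ hθ => ?_
            rw [indicator_of_mem (s := Iio t) hθ.2, enorm_sq_eq_ofReal]
            have h4 := hball (x := θ) (by
              rw [Real.dist_eq, sub_zero, abs_of_pos hθ.1]; exact hθ.2.trans_le htt)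
            rw [Real.dist_eq] at h4
            gcongr
            linarith [(abs_lt.1 h4).1]
        _ ≤ _ := lintegral_mono_set (Ioo_subset_Ioo (by simp [r]) htb.le)
    have h4 := (mul_le_mul_right h3 _).trans h2
    rw [← ENNReal.ofReal_toReal hEt, ← ENNReal.ofReal_pow ht.le, ← ENNReal.ofReal_mul ht.le,
      ← ENNReal.ofReal_mul (by positivity), ← ENNReal.ofReal_ofNat 4,
      ← ENNReal.ofReal_mul (by norm_num), ← ENNReal.ofReal_mul (by positivity),
      ENNReal.ofReal_le_ofReal_iff (by positivity)] at h4
    refine le_of_mul_le_mul_left (a := t) ?_ ht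
    calc _ = ε ^ d * T.rho r * (t * (p / 2) ^ 2) := by ring
      _ ≤ _ := h4
      _ = _ := by ring
  have hlim : Tendsto (fun t : ℝ => 4 * t * E.toReal) (𝓝[>] 0) (𝓝 (4 * 0 * E.toReal)) :=
    ((continuous_const.mul continuous_id).mul continuous_const).continuousWithinAt.tendsto
  have h5 := ge_of_tendsto hlim (b := ε ^ d * T.rho r * (p / 2) ^ 2) (by
    filter_upwards [Ioo_mem_nhdsGT (lt_min hb ht₀)] with t ht
    exact hbound t ht.1 (ht.2.trans_le (min_le_left _ _)) (ht.2.le.trans (min_le_right _ _)))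
  have h6 : 0 < ε ^ d * T.rho r * (p / 2) ^ 2 := by positivity
  simp at h5
  linarith

end TreeData

/-! ### Bounds for the profiles and convergence of the projections -/

theorem tendsto_oscSol {ω t : ℕ → ℝ} {c : ℕ → ℂ × ℂ} {ω₀ t₀ : ℝ} {c₀ : ℂ × ℂ}
    (hω : Tendsto ω atTop (𝓝 ω₀)) (hc : Tendsto c atTop (𝓝 c₀)) (ht : Tendsto t atTop (𝓝 t₀)) :
    Tendsto (fun n => oscSol (ω n) (c n) (t n)) atTop (𝓝 (oscSol ω₀ c₀ t₀)) := by
  have h1 := hω.prodMk_nhds (hc.prodMk_nhds ht)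
  have h2 := continuous_oscSol.tendsto (ω₀, c₀, t₀)
  have h3 := h2.comp h1
  exact h3

theorem tendsto_oscDeriv {ω t : ℕ → ℝ} {c : ℕ → ℂ × ℂ} {ω₀ t₀ : ℝ} {c₀ : ℂ × ℂ}
    (hω : Tendsto ω atTop (𝓝 ω₀)) (hc : Tendsto c atTop (𝓝 c₀)) (ht : Tendsto t atTop (𝓝 t₀)) :
    Tendsto (fun n => oscDeriv (ω n) (c n) (t n)) atTop (𝓝 (oscDeriv ω₀ c₀ t₀)) := by
  have h1 := hω.prodMk_nhds (hc.prodMk_nhds ht)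
  have h2 := continuous_oscDeriv.tendsto (ω₀, c₀, t₀)
  have h3 := h2.comp h1
  exact h3

namespace TreeData

variable {d k : ℕ} (T : TreeData d k) {ε ω : ℝ}

theorem half_mem (hε : 0 < ε) (hε2 : ε ≤ 1 / 2) (w : Word k) :
    T.edgeLen w / 2 ∈ Icc (T.edgeStart ε w) (T.edgeEnd ε w) := by
  have h1 := T.edgeStart_le hε w
  have h2 := T.le_edgeEnd hε w
  have h3 := T.edgeLen_pos w
  constructor <;> nlinarith

theorem profile_half (ω : ℝ) (a : Word k → ℂ × ℂ) (w : Word k) :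
    T.profile ω a w (T.edgeLen w / 2) = (a w).1 := by
  rw [profile, sub_self, oscSol_zero_right]

theorem profileDeriv_half (ω : ℝ) (a : Word k → ℂ × ℂ) (w : Word k) :
    T.profileDeriv ω a w (T.edgeLen w / 2) = (a w).2 := by
  rw [profileDeriv, sub_self, oscDeriv_zero_right]

theorem norm_sq_le_of_length_mul_le {b c ρ A B : ℝ} {l : ℝ} (hl : l / 2 ≤ c - b) (hcl : c - b ≤ l)
    (hl0 : 0 < l) (hρ : 0 < ρ) {z : ℂ} {x y : ENNReal} (hx : x ≠ ⊤) (hy : y ≠ ⊤)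
    (h : ENNReal.ofReal (c - b) * ‖z‖ₑ ^ 2 ≤ 2 * x + 2 * (ENNReal.ofReal (c - b) ^ 2 * y))
    (hA : ρ * x.toReal ≤ A) (hB : ρ * y.toReal ≤ B) :
    ‖z‖ ^ 2 ≤ 4 / (ρ * l) * (A + l ^ 2 * B) := by
  have hcb : 0 < c - b := by linarith
  rw [← ENNReal.ofReal_toReal hx, ← ENNReal.ofReal_toReal hy, enorm_sq_eq_ofReal,
    ← ENNReal.ofReal_mul hcb.le, ← ENNReal.ofReal_pow hcb.le, ← ENNReal.ofReal_mul (sq_nonneg _),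
    ENNReal_two_mul, ENNReal_two_mul (ENNReal.ofReal ((c - b) ^ 2 * _)),
    ← ENNReal.ofReal_mul zero_le_two, ← ENNReal.ofReal_mul zero_le_two,
    ← ENNReal.ofReal_add (by positivity) (by positivity),
    ENNReal.ofReal_le_ofReal_iff (by positivity)] at h
  rw [div_mul_eq_mul_div, le_div_iff₀ (by positivity)]
  have hB0 : 0 ≤ ρ * y.toReal := by positivity
  have hsq : (c - b) ^ 2 ≤ l ^ 2 := pow_le_pow_left₀ hcb.le hcl 2
  calc ‖z‖ ^ 2 * (ρ * l) = 2 * ρ * (l / 2 * ‖z‖ ^ 2) := by ring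
    _ ≤ 2 * ρ * ((c - b) * ‖z‖ ^ 2) := by gcongr
    _ ≤ 2 * ρ * (2 * x.toReal + 2 * ((c - b) ^ 2 * y.toReal)) := by gcongr
    _ = 4 * (ρ * x.toReal + (c - b) ^ 2 * (ρ * y.toReal)) := by ring
    _ ≤ 4 * (A + l ^ 2 * B) := by gcongr

/-- Bounds for the midpoint data of a profile. -/
theorem IsProfile.norm_coeff_le (hε : 0 < ε) (hε2 : ε ≤ 1 / 2) {T : TreeData d k}
    {u : Piece k × EuclideanSpace ℝ (Fin (d + 1)) → ℂ}
    {G : Piece k × EuclideanSpace ℝ (Fin (d + 1)) → EuclideanSpace ℂ (Fin (d + 1))}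
    {a : Word k → ℂ × ℂ} (h : T.IsProfile ε ω u G a) {Λ : ℝ} (hω : ω ^ 2 ≤ Λ) (w : Word k)
    (hm : T.wordMass ε u w ≤ 1) (he : T.wordMass ε G w ≤ Λ) :
    ‖(a w).1‖ ^ 2 ≤ 4 / (T.rho w * T.edgeLen w) * (1 + T.edgeLen w ^ 2 * Λ) ∧
      ‖(a w).2‖ ^ 2 ≤ 4 / (T.rho w * T.edgeLen w) * (Λ + T.edgeLen w ^ 2 * Λ ^ 2) := by
  have hl := T.edgeLen_pos w
  have hI1 : T.edgeEnd ε w - T.edgeStart ε w ≤ T.edgeLen w := by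
    linarith [T.edgeStart_nonneg hε w, T.edgeEnd_le hε w]
  have hI2 : T.edgeLen w / 2 ≤ T.edgeEnd ε w - T.edgeStart ε w := by
    have := T.edgeLen_le_edgeEnd_sub_edgeStart hε w
    nlinarith
  have hM := ((h.rho_mul_mass_le hε w).trans (T.pieceMass_edge_le_wordMass hε w)).trans hm
  have hE := ((h.rho_mul_energy_le hε w).trans (T.pieceMass_edge_le_wordMass hε w)).trans he
  have hMt := T.profileMass_ne_top ε ω a w
  have hEt := T.profileEnergy_ne_top ε ω a w
  have h1 := length_mul_enorm_sq_le (T.continuous_profile ω a w).continuousOn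
    (fun x _ => T.hasDerivAt_profile ω a w x) (T.continuous_profileDeriv ω a w).continuousOn
    (T.half_mem hε hε2 w)
  -- The same pointwise bound applied to the derivative, whose own derivative is `-ω²` times the
  -- profile. Its energy term is therefore the mass times `ω ^ 4`, which explains `Λ ^ 2` in the
  -- bound of the slope.
  have h2 := length_mul_enorm_sq_le (T.continuous_profileDeriv ω a w).continuousOn
    (fun x _ => T.hasDerivAt_profileDeriv ω a w x)
    (continuous_const.mul (T.continuous_profile ω a w)).continuousOn (T.half_mem hε hε2 w)
  rw [profile_half] at h1
  rw [profileDeriv_half] at h2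
  have h3 : ∫⁻ t in Ioo (T.edgeStart ε w) (T.edgeEnd ε w),
      ‖-(ω ^ 2 : ℝ) * T.profile ω a w t‖ₑ ^ 2 =
      ENNReal.ofReal ((ω ^ 2) ^ 2) * T.profileMass ε ω a w := by
    rw [profileMass, ← lintegral_const_mul' _ _ ENNReal.ofReal_ne_top]
    refine lintegral_congr fun t => ?_
    rw [enorm_mul, mul_pow, enorm_sq_eq_ofReal (-((ω ^ 2 : ℝ) : ℂ)), norm_neg, Complex.norm_real,
      Real.norm_eq_abs, sq_abs]
  rw [h3] at h2
  refine ⟨norm_sq_le_of_length_mul_le hI2 hI1 hl (T.rho_pos w) hMt hEt h1 hM hE,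
    norm_sq_le_of_length_mul_le hI2 hI1 hl (T.rho_pos w) hEt (by finiteness) h2 hE ?_⟩
  rw [ENNReal.toReal_mul, ENNReal.toReal_ofReal (by positivity)]
  calc _ = (ω ^ 2) ^ 2 * (T.rho w * (T.profileMass ε ω a w).toReal) := by ring
    _ ≤ Λ ^ 2 * 1 := mul_le_mul (pow_le_pow_left₀ (sq_nonneg ω) hω 2) hM
        (mul_nonneg (T.rho_pos w).le ENNReal.toReal_nonneg) (sq_nonneg _)
    _ = _ := mul_one _

/-- A normalised sequence of eigenpairs on the inflated trees, with `ε n → 0`, whose profiles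
converge. -/
structure IsLimit (ε ω : ℕ → ℝ) (u : ℕ → Piece k × EuclideanSpace ℝ (Fin (d + 1)) → ℂ)
    (G : ℕ → Piece k × EuclideanSpace ℝ (Fin (d + 1)) → EuclideanSpace ℂ (Fin (d + 1)))
    (a : ℕ → Word k → ℂ × ℂ) (Λ ωStar : ℝ) (aStar : Word k → ℂ × ℂ) : Prop where
  eps_pos : ∀ n, 0 < ε n
  eps_le : ∀ n, ε n ≤ 1 / 16
  eps_lim : Tendsto ε atTop (𝓝 0)
  eigen : ∀ n, T.IsEigenpair (ε n) (ω n ^ 2) (u n) (G n)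
  profile : ∀ n, T.IsProfile (ε n) (ω n) (u n) (G n) (a n)
  mass : ∀ n, ∑' w, T.wordMass (ε n) (u n) w = 1
  energy : ∀ n, ∑' w, T.wordMass (ε n) (G n) w ≤ Λ
  omega_lim : Tendsto ω atTop (𝓝 ωStar)
  coeff_lim : ∀ w, Tendsto (fun n => a n w) atTop (𝓝 (aStar w))

namespace IsLimit

variable {T} {ε ω : ℕ → ℝ} {u : ℕ → Piece k × EuclideanSpace ℝ (Fin (d + 1)) → ℂ}
  {G : ℕ → Piece k × EuclideanSpace ℝ (Fin (d + 1)) → EuclideanSpace ℂ (Fin (d + 1))}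
  {a : ℕ → Word k → ℂ × ℂ} {Λ ωStar : ℝ} {aStar : Word k → ℂ × ℂ}

theorem eps_le_half (h : T.IsLimit ε ω u G a Λ ωStar aStar) (n : ℕ) : ε n ≤ 1 / 2 :=
  (h.eps_le n).trans (by norm_num)

theorem hasSum_mass (h : T.IsLimit ε ω u G a Λ ωStar aStar) (n : ℕ) :
    HasSum (T.wordMass (ε n) (u n)) 1 := by
  have h1 := T.hasSum_wordMass (h.profile n).mem.1
  rwa [← h1.tsum_eq, h.mass n] at h1

theorem summable_energy (h : T.IsLimit ε ω u G a Λ ωStar aStar) (n : ℕ) :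
    Summable (T.wordMass (ε n) (G n)) :=
  (T.hasSum_wordMass (h.profile n).mem.2.1).summable

theorem wordMass_energy_le (h : T.IsLimit ε ω u G a Λ ωStar aStar) (n : ℕ) (w : Word k) :
    T.wordMass (ε n) (G n) w ≤ Λ :=
  ((h.summable_energy n).le_tsum w fun _ _ => T.wordMass_nonneg (h.eps_pos n) _).trans (h.energy n)

theorem tendsto_scale (h : T.IsLimit ε ω u G a Λ ωStar aStar) (w : Word k) :
    Tendsto (fun n => T.scale (ε n) w) atTop (𝓝 0) := by
  simpa [scale] using h.eps_lim.mul_const (T.δ ^ w.gen)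

theorem tendsto_edgeStart (h : T.IsLimit ε ω u G a Λ ωStar aStar) (w : Word k) :
    Tendsto (fun n => T.edgeStart (ε n) w) atTop (𝓝 0) := by
  refine squeeze_zero (fun n => T.edgeStart_nonneg (h.eps_pos n) w)
    (fun n => T.edgeStart_le (h.eps_pos n) w) ?_
  simpa using h.eps_lim.mul_const (T.edgeLen w)

theorem tendsto_edgeEnd (h : T.IsLimit ε ω u G a Λ ωStar aStar) (w : Word k) :
    Tendsto (fun n => T.edgeEnd (ε n) w) atTop (𝓝 (T.edgeLen w)) := by
  simpa [edgeEnd] using ((h.tendsto_scale w).mul_const (T.height none)).const_sub (T.edgeLen w)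

theorem tendsto_profile (h : T.IsLimit ε ω u G a Λ ωStar aStar) (w : Word k) {t : ℕ → ℝ} {t₀ : ℝ}
    (ht : Tendsto t atTop (𝓝 t₀)) :
    Tendsto (fun n => T.profile (ω n) (a n) w (t n)) atTop (𝓝 (T.profile ωStar aStar w t₀)) :=
  tendsto_oscSol h.omega_lim (h.coeff_lim w) (ht.sub_const _)

theorem tendsto_profileDeriv (h : T.IsLimit ε ω u G a Λ ωStar aStar) (w : Word k) {t : ℕ → ℝ}
    {t₀ : ℝ} (ht : Tendsto t atTop (𝓝 t₀)) :
    Tendsto (fun n => T.profileDeriv (ω n) (a n) w (t n)) atTop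
      (𝓝 (T.profileDeriv ωStar aStar w t₀)) :=
  tendsto_oscDeriv h.omega_lim (h.coeff_lim w) (ht.sub_const _)

/-- Solutions depend jointly continuously on frequency, data and position, and the position runs
over a compact interval. Convergence of the parameters is therefore enough for uniform convergence.
-/
theorem tendstoUniformlyOn_profile (h : T.IsLimit ε ω u G a Λ ωStar aStar) (w : Word k) :
    TendstoUniformlyOn (fun n => T.profile (ω n) (a n) w) (T.profile ωStar aStar w) atTop
      (Icc 0 (T.edgeLen w)) := by
  rw [tendstoUniformlyOn_iff_tendstoUniformly_comp_coe]
  have h1 := Continuous.tendstoUniformly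
    (fun (x : ℝ × ℂ × ℂ) (t : Icc 0 (T.edgeLen w)) => oscSol x.1 x.2 (t - T.edgeLen w / 2))
    (continuous_oscSol.comp (by fun_prop :
      Continuous fun q : (ℝ × ℂ × ℂ) × Icc 0 (T.edgeLen w) =>
        (q.1.1, q.1.2, (q.2 : ℝ) - T.edgeLen w / 2))) (ωStar, aStar w)
  exact fun v hv => (h.omega_lim.prodMk_nhds (h.coeff_lim w)).eventually (h1 v hv)

theorem tendsto_vertAverage_sub_profile (h : T.IsLimit ε ω u G a Λ ωStar aStar) (w : Word k)
    (j : Option (Fin k)) : Tendsto (fun n => T.vertAverage (ε n) (u n) w -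
      T.profile (ω n) (a n) (w.nbr j) (T.legPos w j (T.scale (ε n) w * T.height j))) atTop (𝓝 0) := by
  obtain ⟨C, hCp, hC⟩ := T.exists_rho_mul_vertAverage_sub_profile_le
  have hρ := T.rho_pos w
  have hsq : Tendsto (fun n => ‖T.vertAverage (ε n) (u n) w - T.profile (ω n) (a n) (w.nbr j)
      (T.legPos w j (T.scale (ε n) w * T.height j))‖ ^ 2) atTop (𝓝 0) := by
    refine squeeze_zero (fun n => sq_nonneg _) (fun n => ?_)
      (g := fun n => (T.rho w)⁻¹ * (C * T.scale (ε n) w * (Λ + Λ))) ?_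
    · rw [inv_mul_eq_div, le_div_iff₀ hρ, mul_comm]
      have hs := T.scale_pos (h.eps_pos n) w
      refine (hC (h.eps_pos n) (h.eps_le_half n) (h.profile n) w j).trans ?_
      gcongr
      · exact (T.pieceMass_vert_le_wordMass (h.eps_pos n) w).trans (h.wordMass_energy_le n _)
      · exact (T.pieceMass_edge_le_wordMass (h.eps_pos n) _).trans (h.wordMass_energy_le n _)
    · simpa using (((h.tendsto_scale w).const_mul C).mul_const (Λ + Λ)).const_mul (T.rho w)⁻¹
  rw [tendsto_zero_iff_norm_tendsto_zero]
  simpa [Real.sqrt_sq] using hsq.sqrt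

theorem tendsto_vertAverage (h : T.IsLimit ε ω u G a Λ ωStar aStar) (w : Word k) :
    Tendsto (fun n => T.vertAverage (ε n) (u n) w) atTop
      (𝓝 (T.profile ωStar aStar w (T.edgeLen w))) := by
  have h1 := (h.tendsto_vertAverage_sub_profile w none).add
    (h.tendsto_profile w (h.tendsto_edgeEnd w))
  rw [zero_add] at h1
  refine h1.congr fun n => ?_
  rw [legPos_end]
  exact sub_add_cancel _ _

/-- The vertex averages have a single limit, and it is the limit of the end values on every adjacent
edge. -/
theorem profile_child_zero (h : T.IsLimit ε ω u G a Λ ωStar aStar) (w : Word k) (i : Fin k) :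
    T.profile ωStar aStar (Word.child i w) 0 = T.profile ωStar aStar w (T.edgeLen w) := by
  have h1 := (h.tendsto_vertAverage_sub_profile w (some i)).add
    (h.tendsto_profile (Word.child i w) (h.tendsto_edgeStart (Word.child i w)))
  rw [zero_add] at h1
  refine tendsto_nhds_unique (h1.congr fun n => ?_) (h.tendsto_vertAverage w)
  rw [legPos_end]
  exact sub_add_cancel _ _

theorem profile_root_zero (h : T.IsLimit ε ω u G a Λ ωStar aStar) :
    T.profile ωStar aStar (Word.root k) 0 = 0 :=
  tendsto_nhds_unique (h.tendsto_profile (Word.root k) tendsto_const_nhds) <|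
    tendsto_const_nhds.congr fun n => ((h.profile n).profile_root_zero (h.eps_pos n)
      ((h.eps_le n).trans_lt (by norm_num))).symm

theorem profile_nbr (h : T.IsLimit ε ω u G a Λ ωStar aStar) (w : Word k) (j : Option (Fin k)) :
    T.profile ωStar aStar (w.nbr j) (T.legPos w j 0) =
      T.profile ωStar aStar w (T.edgeLen w) := by
  cases j with
  | none => simp [legPos, Word.nbr]
  | some i => exact h.profile_child_zero w i

/-- On the skeleton of an inflated vertex the projections converge uniformly. -/
theorem eventually_vertex (h : T.IsLimit ε ω u G a Λ ωStar aStar)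
    {ψ : Option (Fin k) → Option (Fin k) → ℝ → ℝ} (hψ : T.IsSkeletonPartition ψ)
    {p : ℕ → Word k × ℝ → ℂ} (hp : ∀ n, T.IsProjection ψ (ε n) (u n) (p n)) (w : Word k)
    (j' : Option (Fin k)) {η : ℝ} (hη : 0 < η) :
    ∀ᶠ n in atTop, ∀ r ∈ Icc 0 (T.scale (ε n) w * T.height j'),
      ‖p n (w.nbr j', T.legPos w j' r) -
        T.profile ωStar aStar (w.nbr j') (T.legPos w j' r)‖ < η := by
  set z := T.profile ωStar aStar w (T.edgeLen w)
  have hz : ∀ j, Tendsto (fun n => T.profile (ω n) (a n) (w.nbr j)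
      (T.legPos w j (T.scale (ε n) w * T.height j))) atTop (𝓝 z) := fun j => by
    have := (h.tendsto_vertAverage w).sub (h.tendsto_vertAverage_sub_profile w j)
    simpa using this
  have h1 : Tendsto (fun n => ∑ j, ‖T.profile (ω n) (a n) (w.nbr j)
      (T.legPos w j (T.scale (ε n) w * T.height j)) - z‖) atTop (𝓝 0) := by
    have := tendsto_finsetSum (Finset.univ : Finset (Option (Fin k)))
      fun j _ => ((hz j).sub_const z).norm
    simpa using this
  have hleg : Continuous (T.legPos w j') := by
    cases j' with
    | none => exact continuous_const.sub continuous_id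
    | some i => exact continuous_id
  have hc : ContinuousAt (fun r => T.profile ωStar aStar (w.nbr j') (T.legPos w j' r)) 0 :=
    ((T.continuous_profile _ _ _).comp hleg).continuousAt
  obtain ⟨r₀, hr₀, hball⟩ := Metric.continuousAt_iff.1 hc (η / 2) (half_pos hη)
  have h2 : Tendsto (fun n => T.scale (ε n) w * T.height j') atTop (𝓝 0) := by
    simpa using (h.tendsto_scale w).mul_const (T.height j')
  filter_upwards [h1.eventually_lt_const (half_pos hη), h2.eventually_lt_const hr₀] with n hn1 hn2
    r hr
  have hs := T.scale_pos (h.eps_pos n) w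
  have hε1 : ε n < 1 := (h.eps_le n).trans_lt (by norm_num)
  have h3 : ‖T.profile ωStar aStar (w.nbr j') (T.legPos w j' r) - z‖ < η / 2 := by
    have := hball (x := r) (by rw [Real.dist_eq, sub_zero, abs_of_nonneg hr.1]; linarith [hr.2])
    rwa [dist_eq_norm, h.profile_nbr] at this
  have hrs : r / T.scale (ε n) w ∈ Icc 0 (T.height j') :=
    ⟨div_nonneg hr.1 hs.le, (div_le_iff₀' hs).2 hr.2⟩
  have hsum : ((∑ j, ψ j j' (r / T.scale (ε n) w) : ℝ) : ℂ) = 1 := by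
    rw [hψ.sum_eq_one j' _ hrs]; simp
  -- On the skeleton the projection is a convex combination of the end values of the adjacent
  -- profiles, all of which converge to `z`. Its error is at most the sum of their errors, whatever
  -- the partition of unity.
  have h4 : ‖p n (w.nbr j', T.legPos w j' r) - z‖ < η / 2 := by
    refine lt_of_le_of_lt ?_ hn1
    have e : z = ∑ j, z * (ψ j j' (r / T.scale (ε n) w) : ℂ) := by
      rw [← Finset.mul_sum, ← Complex.ofReal_sum, hsum, mul_one]
    rw [(hp n).eq_vertex w j' r hr]
    conv_lhs => rw [e]
    rw [← Finset.sum_sub_distrib]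
    refine (norm_sum_le _ _).trans (Finset.sum_le_sum fun j _ => ?_)
    have hψj := hψ.nonneg j j' _ hrs
    have hψ1 : ψ j j' (r / T.scale (ε n) w) ≤ 1 := by
      rw [← hψ.sum_eq_one j' _ hrs]
      exact Finset.single_le_sum (f := fun j => ψ j j' (r / T.scale (ε n) w))
        (fun j _ => hψ.nonneg j j' _ hrs) (Finset.mem_univ j)
    have e2 := (hp n).eqOn_edge (h.eps_pos n) hε1 (fun v => T.continuous_profile (ω n) (a n) v)
      (h.profile n).average (w.nbr j) (T.legPos_end_mem (h.eps_pos n) hε1 w j)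
    simp only at e2
    rw [← sub_mul, norm_mul, Complex.norm_real, Real.norm_of_nonneg hψj, e2]
    exact mul_le_of_le_one_right (norm_nonneg _) hψ1
  calc _ = ‖(p n (w.nbr j', T.legPos w j' r) - z) -
        (T.profile ωStar aStar (w.nbr j') (T.legPos w j' r) - z)‖ := by congr 1; ring
    _ ≤ _ := norm_sub_le _ _
    _ < η := by linarith

/-- The projections converge uniformly on every edge. -/
theorem tendstoUniformlyOn_projection (h : T.IsLimit ε ω u G a Λ ωStar aStar)
    {ψ : Option (Fin k) → Option (Fin k) → ℝ → ℝ} (hψ : T.IsSkeletonPartition ψ)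
    {p : ℕ → Word k × ℝ → ℂ} (hp : ∀ n, T.IsProjection ψ (ε n) (u n) (p n)) (w : Word k) :
    TendstoUniformlyOn (fun n t => p n (w, t)) (T.profile ωStar aStar w) atTop
      (Icc 0 (T.edgeLen w)) := by
  rw [Metric.tendstoUniformlyOn_iff]
  intro η hη
  -- The part of an edge below its cylinder belongs to the skeleton of the parent vertex; at the
  -- root edge it is empty. The remaining cases are the cylinder and the skeleton of the upper
  -- vertex.
  have hlow : ∀ᶠ n in atTop, ∀ t, 0 ≤ t → t < T.edgeStart (ε n) w →
      ‖p n (w, t) - T.profile ωStar aStar w t‖ < η := by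
    rcases Word.eq_root_or_child w with rfl | ⟨i, v, rfl⟩
    · refine .of_forall fun n t h0 h1 => ?_
      rw [edgeStart_root] at h1
      linarith
    · filter_upwards [h.eventually_vertex hψ hp v (some i) hη] with n hn t h0 h1
      rw [edgeStart_child] at h1
      exact hn t ⟨h0, h1.le⟩
  filter_upwards [hlow, h.eventually_vertex hψ hp w none hη,
    Metric.tendstoUniformlyOn_iff.1 (h.tendstoUniformlyOn_profile w) η hη] with n h1 h2 h3 t ht
  rw [dist_comm, dist_eq_norm]
  rcases lt_or_ge t (T.edgeStart (ε n) w) with hlt | hge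
  · exact h1 t ht.1 hlt
  rcases lt_or_ge (T.edgeEnd (ε n) w) t with hgt | hle
  · have h4 := h2 (T.edgeLen w - t) ⟨by linarith [ht.2], by rw [edgeEnd] at hgt; linarith⟩
    have e : T.legPos w none (T.edgeLen w - t) = t := sub_sub_cancel _ _
    rwa [e] at h4
  · have h4 := (hp n).eqOn_edge (h.eps_pos n) ((h.eps_le n).trans_lt (by norm_num))
      (fun v => T.continuous_profile (ω n) (a n) v) (h.profile n).average w ⟨hge, hle⟩
    simp only at h4
    rw [h4, ← dist_eq_norm, dist_comm]
    exact h3 t ht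

end IsLimit

end TreeData

/-! ### Extraction of a convergent subsequence, and nontriviality of the limit -/

namespace TreeData

variable {d k : ℕ} (T : TreeData d k)

/-- The eigenfunction as its own test function gives the energy identity. It shows that the
eigenvalue is nonnegative, so that the frequency `√lam` is available, and that after division by `ε
^ d` the mass is `1` and the energy is `lam`. -/
theorem IsEigenfunction.exists_isEigenpair {T : TreeData d k} {ε lam : ℝ}
    {u : Piece k × EuclideanSpace ℝ (Fin (d + 1)) → ℂ} (hu : T.IsEigenfunction ε lam u)
    (hε : 0 < ε)
    (hnorm : eLpNorm u 2 (T.inflatedMeasure ε) = ENNReal.ofReal (ε ^ ((d : ℝ) / 2))) :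
    0 ≤ lam ∧ ∃ G, T.IsEigenpair ε (√lam ^ 2) u G ∧ ∑' w, T.wordMass ε u w = 1 ∧
      ∑' w, T.wordMass ε G w = lam := by
  obtain ⟨G, hmem, -, hweak⟩ := hu
  have hG : T.IsEigenpair ε lam u G := ⟨hmem, hweak⟩
  have hp := pow_pos hε d
  have h1 : ∫ q, ‖u q‖ ^ 2 ∂T.inflatedMeasure ε = ε ^ d := by
    have h2 := hmem.1.integral_sq_eq
    rw [← eLpNorm_sq_eq, hnorm, ← ENNReal.ofReal_pow (by positivity)] at h2
    have h3 := (ENNReal.ofReal_eq_ofReal_iff (by positivity)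
      (integral_nonneg fun _ => sq_nonneg _)).1 h2
    rw [← h3, ← Real.rpow_natCast, ← Real.rpow_mul hε.le]
    norm_num
  have hen := hG.energy
  rw [h1] at hen
  have hlam : 0 ≤ lam := by
    refine nonneg_of_mul_nonneg_left ?_ hp
    rw [← hen]
    exact integral_nonneg fun _ => sq_nonneg _
  refine ⟨hlam, G, by rwa [Real.sq_sqrt hlam], ?_, ?_⟩
  · rw [(T.hasSum_wordMass hmem.1).tsum_eq, h1, inv_mul_cancel₀ hp.ne']
  · rw [(T.hasSum_wordMass hmem.2.1).tsum_eq, hen, mul_comm, mul_assoc, mul_inv_cancel₀ hp.ne',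
      mul_one]

/-- A subsequence of normalised eigenfunctions has convergent profiles. -/
theorem exists_isLimit {ε lam : ℕ → ℝ} {lamStar : ℝ}
    {u : ℕ → Piece k × EuclideanSpace ℝ (Fin (d + 1)) → ℂ}
    (hε : ∀ n, 0 < ε n ∧ ε n < 1) (hε_lim : Tendsto ε atTop (𝓝 0))
    (hu : ∀ n, T.IsEigenfunction (ε n) (lam n) (u n))
    (hu_norm : ∀ n, eLpNorm (u n) 2 (T.inflatedMeasure (ε n)) =
      ENNReal.ofReal (ε n ^ ((d : ℝ) / 2)))
    (hlam : Tendsto lam atTop (𝓝 lamStar)) :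
    0 ≤ lamStar ∧ ∃ (ns : ℕ → ℕ) (G : ℕ → Piece k × EuclideanSpace ℝ (Fin (d + 1)) →
        EuclideanSpace ℂ (Fin (d + 1))) (a : ℕ → Word k → ℂ × ℂ) (aStar : Word k → ℂ × ℂ),
      StrictMono ns ∧ T.IsLimit (fun n => ε (ns n)) (fun n => √(lam (ns n))) (fun n => u (ns n))
        G a (lamStar + 1) √lamStar aStar := by
  have h0 := fun n => (hu n).exists_isEigenpair (hε n).1 (hu_norm n)
  choose hlam0 G hG hmass henergy using h0
  have hlamStar : 0 ≤ lamStar := ge_of_tendsto' hlam hlam0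
  refine ⟨hlamStar, ?_⟩
  have h1 := fun n => (hG n).exists_isProfile (hε n).1 (hε n).2
  choose a ha using h1
  obtain ⟨N, hN⟩ := eventually_atTop.1
    ((hε_lim.eventually_le_const (by norm_num : (0 : ℝ) < 1 / 16)).and
      (hlam.eventually_le_const (lt_add_one lamStar)))
  set Λ := lamStar + 1
  set R : Word k → ℝ := fun w => 1 + 4 / (T.rho w * T.edgeLen w) * (1 + T.edgeLen w ^ 2 * Λ) +
    4 / (T.rho w * T.edgeLen w) * (Λ + T.edgeLen w ^ 2 * Λ ^ 2)
  -- The data on all edges at once form a point of a product of compact balls, with radii that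
  -- depend on the edge but not on `n`. As there are countably many edges, one subsequence serves
  -- all of them.
  have hK : IsCompact (univ.pi fun w : Word k => Metric.closedBall (0 : ℂ × ℂ) (R w)) :=
    isCompact_univ_pi fun w => isCompact_closedBall _ _
  have hmem : ∀ n, a (n + N) ∈ univ.pi fun w : Word k => Metric.closedBall (0 : ℂ × ℂ) (R w) := by
    intro n w _
    obtain ⟨h2, h3⟩ := hN (n + N) (Nat.le_add_left _ _)
    have hε' := (hε (n + N)).1
    have hm : T.wordMass (ε (n + N)) (u (n + N)) w ≤ 1 := by
      rw [← hmass (n + N)]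
      exact (T.hasSum_wordMass (ha (n + N)).mem.1).summable.le_tsum w
        fun _ _ => T.wordMass_nonneg hε' _
    have he : T.wordMass (ε (n + N)) (G (n + N)) w ≤ Λ := by
      refine le_trans ?_ h3
      rw [← henergy (n + N)]
      exact (T.hasSum_wordMass (ha (n + N)).mem.2.1).summable.le_tsum w
        fun _ _ => T.wordMass_nonneg hε' _
    obtain ⟨h4, h5⟩ := (ha (n + N)).norm_coeff_le hε' (h2.trans (by norm_num))
      (by rwa [Real.sq_sqrt (hlam0 _)]) w hm he
    rw [mem_closedBall_zero_iff, Prod.norm_def]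
    -- The bounds are for squares of norms. This avoids square roots in the radius `R`.
    have hle : ∀ x : ℝ, x ≤ 1 + x ^ 2 := fun x => by nlinarith [sq_nonneg (x - 1)]
    have e4 := hle ‖(a (n + N) w).1‖
    have e5 := hle ‖(a (n + N) w).2‖
    have e6 := sq_nonneg ‖(a (n + N) w).1‖
    have e7 := sq_nonneg ‖(a (n + N) w).2‖
    refine max_le ?_ ?_ <;> simp only [R] <;> linarith
  obtain ⟨aStar, -, φ, hφ, hlim⟩ := hK.tendsto_subseq hmem
  have hns : StrictMono fun n => φ n + N := fun m n hmn => Nat.add_lt_add_right (hφ hmn) N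
  refine ⟨fun n => φ n + N, fun n => G (φ n + N), fun n => a (φ n + N), aStar, hns,
    fun n => (hε _).1, fun n => (hN _ (Nat.le_add_left _ _)).1, hε_lim.comp hns.tendsto_atTop,
    fun n => hG _, fun n => ha _, fun n => hmass _, fun n => ?_,
    (hlam.sqrt).comp hns.tendsto_atTop, fun w => (tendsto_pi_nhds.1 hlim) w⟩
  rw [henergy]
  exact (hN _ (Nat.le_add_left _ _)).2

namespace IsLimit

variable {T} {ε ω : ℕ → ℝ} {u : ℕ → Piece k × EuclideanSpace ℝ (Fin (d + 1)) → ℂ}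
  {G : ℕ → Piece k × EuclideanSpace ℝ (Fin (d + 1)) → EuclideanSpace ℂ (Fin (d + 1))}
  {a : ℕ → Word k → ℂ × ℂ} {Λ ωStar : ℝ} {aStar : Word k → ℂ × ℂ}

/-- No mass is lost in the limit. -/
theorem exists_profile_ne_zero (h : T.IsLimit ε ω u G a Λ ωStar aStar) (hk : 1 ≤ k)
    (hs : Summable T.len) : ∃ w, ∃ t ∈ Icc 0 (T.edgeLen w), T.profile ωStar aStar w t ≠ 0 := by
  by_contra! hzero
  have hΛ : 0 ≤ Λ := (tsum_nonneg fun w => T.wordMass_nonneg (h.eps_pos 0) w).trans (h.energy 0)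
  obtain ⟨b, hb, hbound⟩ := T.exists_summable_generation_bound hk hs hΛ
  obtain ⟨C₁, hC₁p, hC₁⟩ := T.exists_pieceMass_edge_le
  obtain ⟨C₂, hC₂p, hC₂⟩ := T.exists_pieceMass_vert_le
  -- If the limit profile vanishes, the mass of each single edge and vertex tends to zero: the
  -- profile mass by uniform convergence, the remainder by the factors `scale`.
  have hword : ∀ w, Tendsto (fun n => T.wordMass (ε n) (u n) w) atTop (𝓝 0) := by
    intro w
    have hl := T.edgeLen_pos w
    have hρ := T.rho_pos w
    have hsc := h.tendsto_scale w
    have he := h.wordMass_energy_le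
    have hmass : Tendsto (fun n => (T.profileMass (ε n) (ω n) (a n) w).toReal) atTop (𝓝 0) := by
      have hu0 := Metric.tendstoUniformlyOn_iff.1 (h.tendstoUniformlyOn_profile w)
      rw [Metric.tendsto_atTop]
      intro η hη
      obtain ⟨N, hN⟩ := eventually_atTop.1 (hu0 (√(η / (2 * T.edgeLen w))) (by positivity))
      refine ⟨N, fun n hn => ?_⟩
      rw [Real.dist_0_eq_abs, abs_of_nonneg ENNReal.toReal_nonneg, toReal_profileMass]
      have h1 : T.edgeEnd (ε n) w - T.edgeStart (ε n) w ≤ T.edgeLen w := by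
        linarith [T.edgeStart_nonneg (h.eps_pos n) w, T.edgeEnd_le (h.eps_pos n) w]
      refine (integral_Ioo_le_of_le (B := η / (2 * T.edgeLen w))
        ((T.continuous_profile (ω n) (a n) w).norm.pow 2)
        (T.edgeStart_lt_edgeEnd (h.eps_pos n) ((h.eps_le n).trans_lt (by norm_num)) w).le
        fun θ hθ => ?_).trans_lt (lt_of_le_of_lt (mul_le_mul_of_nonneg_right h1 (by positivity)) ?_)
      · have hθ' : θ ∈ Icc 0 (T.edgeLen w) :=
          ⟨(T.edgeStart_nonneg (h.eps_pos n) w).trans hθ.1.le,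
            hθ.2.le.trans (T.edgeEnd_le (h.eps_pos n) w)⟩
        have h2 := hN n hn θ hθ'
        rw [hzero w θ hθ', dist_zero_left] at h2
        rw [← Real.sq_sqrt (by positivity : 0 ≤ η / (2 * T.edgeLen w))]
        exact pow_le_pow_left₀ (norm_nonneg _) h2.le 2
      · field_simp
        linarith
    have hav : Tendsto (fun n => ‖T.vertAverage (ε n) (u n) w‖ ^ 2) atTop (𝓝 0) := by
      have := (h.tendsto_vertAverage w).norm.pow 2
      rwa [hzero w _ ⟨hl.le, le_rfl⟩, norm_zero, zero_pow two_ne_zero] at this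
    refine squeeze_zero (fun n => T.wordMass_nonneg (h.eps_pos n) w) (fun n => ?_)
      (g := fun n => (C₁ * T.scale (ε n) w ^ 2 * Λ +
        2 * T.rho w * (T.profileMass (ε n) (ω n) (a n) w).toReal) +
        (C₂ * T.scale (ε n) w ^ 2 * Λ +
          C₂ * T.scale (ε n) w * T.rho w * ‖T.vertAverage (ε n) (u n) w‖ ^ 2)) ?_
    · refine add_le_add ((hC₁ (h.eps_pos n) (h.profile n) w).trans ?_)
        ((hC₂ (h.eps_pos n) (h.profile n) w).trans ?_)
      · gcongr
        exact (T.pieceMass_edge_le_wordMass (h.eps_pos n) w).trans (he n w)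
      · gcongr
        exact (T.pieceMass_vert_le_wordMass (h.eps_pos n) w).trans (he n w)
    · simpa using ((((hsc.pow 2).const_mul C₁).mul_const Λ).add (hmass.const_mul (2 * T.rho w))).add
        ((((hsc.pow 2).const_mul C₂).mul_const Λ).add
          (((hsc.const_mul C₂).mul_const (T.rho w)).mul hav))
  have hgen : ∀ j, Tendsto (fun n => ∑ w ∈ Word.ofGen k j, T.wordMass (ε n) (u n) w) atTop
      (𝓝 0) := fun j => by
    simpa using tendsto_finsetSum (Word.ofGen k j) fun w _ => hword w
  -- A generation is finite, so its mass tends to zero too. The uniform majorant makes the total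
  -- mass tend to zero, although it is always `1`.
  have hlim := tendsto_tsum_of_dominated_convergence hb hgen (.of_forall fun n j => by
    rw [Real.norm_of_nonneg (Finset.sum_nonneg fun w _ => T.wordMass_nonneg (h.eps_pos n) w)]
    exact hbound (h.eps_pos n) (h.eps_le_half n) (h.profile n) (h.mass n).le (h.energy n) j)
  rw [tsum_zero] at hlim
  refine zero_ne_one (tendsto_nhds_unique hlim (tendsto_const_nhds.congr fun n => ?_))
  exact (Word.hasSum_ofGen (h.hasSum_mass n)).tsum_eq.symm

end IsLimit

end TreeData

/-! ### Test functions interpolating vertex data, and passage to the limit -/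

/-- Series dominated by products `α w * β n w`, with `α` and `β n` bounded in `ℓ²`, may be summed
termwise in the limit. -/
theorem tendsto_tsum_of_l2_bound {ι : Type*} {t : ℕ → ι → ℂ} {t₀ : ι → ℂ} {α : ι → ℝ}
    {β : ℕ → ι → ℝ} {Λ : ℝ} (hα : Summable fun w => α w ^ 2)
    (hβ : ∀ n, Summable fun w => β n w ^ 2) (hβΛ : ∀ n, ∑' w, β n w ^ 2 ≤ Λ)
    (hle : ∀ᶠ n in atTop, ∀ w, ‖t n w‖ ≤ α w * β n w)
    (hlim : ∀ w, Tendsto (fun n => t n w) atTop (𝓝 (t₀ w))) :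
    Summable t₀ ∧ Tendsto (fun n => ∑' w, t n w) atTop (𝓝 (∑' w, t₀ w)) := by
  classical
  have hΛ : 0 ≤ Λ := (tsum_nonneg fun w => sq_nonneg _).trans (hβΛ 0)
  -- Young's inequality with a free parameter. A large `κ` makes the contribution of `β` small,
  -- although `β n` is only bounded in `ℓ²`; a finite set `S` is then chosen outside which `κ ∑ α²`
  -- is small.
  have hfin : ∀ κ : ℝ, 0 < κ → ∀ᶠ n in atTop, ∀ S : Finset ι,
      ∑ w ∈ S, ‖t n w‖ ≤ κ * ∑ w ∈ S, α w ^ 2 + κ⁻¹ * Λ := by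
    intro κ hκ
    filter_upwards [hle] with n hn S
    have h1 : ∀ w, ‖t n w‖ ≤ κ * α w ^ 2 + κ⁻¹ * β n w ^ 2 := fun w => by
      refine (hn w).trans ?_
      have h2 : 0 ≤ κ⁻¹ * (κ * α w - β n w) ^ 2 := by positivity
      have h3 : κ⁻¹ * (κ * α w - β n w) ^ 2 =
          κ * α w ^ 2 + κ⁻¹ * β n w ^ 2 - 2 * (α w * β n w) := by field_simp; ring
      have h4 : 0 ≤ α w * β n w := (norm_nonneg _).trans (hn w)
      linarith
    calc _ ≤ ∑ w ∈ S, (κ * α w ^ 2 + κ⁻¹ * β n w ^ 2) := Finset.sum_le_sum fun w _ => h1 w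
      _ = κ * ∑ w ∈ S, α w ^ 2 + κ⁻¹ * ∑ w ∈ S, β n w ^ 2 := by
          rw [Finset.sum_add_distrib, Finset.mul_sum, Finset.mul_sum]
      _ ≤ _ := by
          gcongr
          exact ((hβ n).sum_le_tsum S fun _ _ => sq_nonneg _).trans (hβΛ n)
  have hsummable : ∀ s : ι → ℂ, (∀ S : Finset ι,
      ∑ w ∈ S, ‖s w‖ ≤ 1 * ∑ w ∈ S, α w ^ 2 + 1⁻¹ * Λ) → Summable fun w => ‖s w‖ := fun s h => by
    refine summable_of_sum_le (fun _ => norm_nonneg _) (c := 1 * ∑' w, α w ^ 2 + 1⁻¹ * Λ)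
      fun S => (h S).trans ?_
    gcongr
    exact hα.sum_le_tsum S fun _ _ => sq_nonneg _
  have hfin0 : ∀ κ : ℝ, 0 < κ → ∀ S : Finset ι,
      ∑ w ∈ S, ‖t₀ w‖ ≤ κ * ∑ w ∈ S, α w ^ 2 + κ⁻¹ * Λ := fun κ hκ S =>
    le_of_tendsto (tendsto_finsetSum S fun w _ => (hlim w).norm) ((hfin κ hκ).mono fun n h => h S)
  have hs0 := hsummable t₀ (hfin0 1 one_pos)
  refine ⟨hs0.of_norm, ?_⟩
  rw [Metric.tendsto_atTop']
  intro η hη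
  -- Chosen so that `κ⁻¹ * Λ ≤ η / 8`; the summand `1` keeps `κ` positive when `Λ = 0`.
  set κ : ℝ := (8 * (Λ + 1)) / η with hκ
  have hκp : 0 < κ := by positivity
  have hκΛ : κ⁻¹ * Λ ≤ η / 8 := by
    rw [hκ, inv_div, div_mul_eq_mul_div, div_le_iff₀ (by positivity)]
    nlinarith
  obtain ⟨S, hS⟩ := ((tendsto_order.1 (tendsto_tsum_compl_atTop_zero fun w => α w ^ 2)).2
    (η / (8 * κ)) (by positivity)).exists
  have htail : ∀ S' : Finset ι, Disjoint S' S → κ * ∑ w ∈ S', α w ^ 2 + κ⁻¹ * Λ ≤ η / 4 := by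
    intro S' hd
    have h1 : ∑ w ∈ S', α w ^ 2 ≤ ∑' w : {w // w ∉ S}, α w ^ 2 := by
      rw [← Finset.sum_subtype_of_mem (fun w => α w ^ 2) (p := fun w => w ∉ S)
        fun w hw => Finset.disjoint_left.1 hd hw]
      exact (hα.subtype fun w => w ∉ S).sum_le_tsum _ fun _ _ => sq_nonneg _
    have h2 : κ * ∑ w ∈ S', α w ^ 2 ≤ κ * (η / (8 * κ)) :=
      mul_le_mul_of_nonneg_left (h1.trans hS.le) hκp.le
    have h3 : κ * (η / (8 * κ)) = η / 8 := by field_simp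
    linarith
  have htsum : ∀ s : ι → ℂ, (Summable fun w => ‖s w‖) →
      (∀ S' : Finset ι, Disjoint S' S → ∑ w ∈ S', ‖s w‖ ≤ η / 4) →
      ‖∑' w, s w - ∑ w ∈ S, s w‖ ≤ η / 4 := by
    intro s hs h
    rw [← hs.of_norm.sum_add_tsum_subtype_compl S, add_sub_cancel_left]
    have hs' := hs.subtype fun w => w ∉ S
    refine (norm_tsum_le_tsum_norm hs').trans (hs'.tsum_le_of_sum_le fun S' => ?_)
    have := h (S'.map (Function.Embedding.subtype _)) (Finset.disjoint_left.2 fun w hw => by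
      obtain ⟨x, -, rfl⟩ := Finset.mem_map.1 hw
      exact x.2)
    rwa [Finset.sum_map] at this
  have hsum : Tendsto (fun n => ∑ w ∈ S, t n w) atTop (𝓝 (∑ w ∈ S, t₀ w)) :=
    tendsto_finsetSum S fun w _ => hlim w
  obtain ⟨N, hN⟩ := eventually_atTop.1 ((hfin κ hκp).and ((hfin 1 one_pos).and
    (Metric.tendsto_nhds.1 hsum (η / 4) (by positivity))))
  refine ⟨N, fun n hn => ?_⟩
  obtain ⟨hn1, hn2, hn3⟩ := hN n hn.le
  have h1 := htsum (t n) (hsummable (t n) hn2) fun S' hd => (hn1 S').trans (htail S' hd)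
  have h2 := htsum t₀ hs0 fun S' hd => (hfin0 κ hκp S').trans (htail S' hd)
  rw [dist_eq_norm] at hn3 ⊢
  calc _ = ‖(∑' w, t n w - ∑ w ∈ S, t n w) + (∑ w ∈ S, t n w - ∑ w ∈ S, t₀ w) -
        (∑' w, t₀ w - ∑ w ∈ S, t₀ w)‖ := by congr 1; ring
    _ ≤ η / 4 + η / 4 + η / 4 := (norm_sub_le _ _).trans
        (add_le_add ((norm_add_le _ _).trans (add_le_add h1 hn3.le)) h2)
    _ < η := by linarith

/-- A smooth function that is `0` near `(-∞, 1/8]` and `1` near `[7/8, ∞)`. -/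
noncomputable def ramp (x : ℝ) : ℝ := Real.smoothTransition (2 * x - 1 / 2)

theorem contDiff_ramp {n : ℕ∞} : ContDiff ℝ n ramp :=
  Real.smoothTransition.contDiff.comp ((contDiff_const.mul contDiff_id).sub contDiff_const)

theorem ramp_of_le {x : ℝ} (h : x ≤ 1 / 4) : ramp x = 0 :=
  Real.smoothTransition.zero_of_nonpos (by linarith)

theorem ramp_of_ge {x : ℝ} (h : 3 / 4 ≤ x) : ramp x = 1 :=
  Real.smoothTransition.one_of_one_le (by linarith)

theorem ramp_mem (x : ℝ) : ramp x ∈ Icc (0 : ℝ) 1 :=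
  ⟨Real.smoothTransition.nonneg _, Real.smoothTransition.le_one _⟩

theorem exists_abs_deriv_ramp_le : ∃ M : ℝ, 0 < M ∧ ∀ x, |deriv ramp x| ≤ M := by
  obtain ⟨M, hM⟩ := (isCompact_Icc (a := (0 : ℝ)) (b := 1)).exists_bound_of_continuousOn
    ((contDiff_ramp (n := 1)).continuous_deriv le_rfl).continuousOn
  refine ⟨max M 1, lt_max_of_lt_right one_pos, fun x => ?_⟩
  by_cases hx : x ∈ Icc (0 : ℝ) 1
  · exact (hM x hx).trans (le_max_left _ _)
  have h0 : deriv ramp x = 0 := by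
    have hc : ∃ c : ℝ, ramp =ᶠ[𝓝 x] fun _ => c := by
      rcases lt_or_ge x 0 with h | h
      · exact ⟨0, (eventually_lt_nhds h).mono fun y hy => ramp_of_le (by linarith)⟩
      · have : 1 < x := by
          by_contra! h1
          exact hx ⟨h, h1⟩
        exact ⟨1, (eventually_gt_nhds this).mono fun y hy => ramp_of_ge (by linarith)⟩
    obtain ⟨c, hc⟩ := hc
    rw [hc.deriv_eq, deriv_const]
  rw [h0, abs_zero]
  positivity

/-- The Cauchy-Schwarz inequality. -/
theorem norm_integral_mul_sq_le {α : Type*} [MeasurableSpace α] {ν : Measure α} [IsFiniteMeasure ν]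
    {φ f : α → ℂ} (hφ : AEStronglyMeasurable φ ν) (hf : MemLp f 2 ν) {M : ℝ}
    (hM : ∀ᵐ x ∂ν, ‖φ x‖ ≤ M) :
    ‖∫ x, φ x * f x ∂ν‖ ^ 2 ≤ ν.real univ * (M ^ 2 * ∫ x, ‖f x‖ ^ 2 ∂ν) := by
  have h1 := enorm_integral_sq_le (hφ.mul hf.1)
  have h2 : ∫⁻ x, ‖φ x * f x‖ₑ ^ 2 ∂ν ≤ ENNReal.ofReal (M ^ 2 * ∫ x, ‖f x‖ ^ 2 ∂ν) := by
    rw [ENNReal.ofReal_mul (sq_nonneg M), ← hf.integral_sq_eq,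
      ← lintegral_const_mul' _ _ ENNReal.ofReal_ne_top]
    refine lintegral_mono_ae (hM.mono fun x hx => ?_)
    rw [enorm_mul, mul_pow, enorm_sq_eq_ofReal (φ x)]
    gcongr
  have h3 := h1.trans (mul_le_mul_right h2 _)
  rw [enorm_sq_eq_ofReal, ← ENNReal.ofReal_toReal (measure_ne_top ν univ),
    ← ENNReal.ofReal_mul ENNReal.toReal_nonneg,
    ENNReal.ofReal_le_ofReal_iff (by positivity)] at h3
  exact h3

namespace TreeData

variable {d k : ℕ} (T : TreeData d k)

/-- The size of vertex data: on the edge `w` they are `A w` at the lower and `B w` at the upper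
end. -/
noncomputable def nodalEnergy (A B : Word k → ℂ) (w : Word k) : ℝ :=
  T.rho w * ((T.edgeLen w)⁻¹ * ‖B w - A w‖ ^ 2 + T.edgeLen w * (‖A w‖ ^ 2 + ‖B w‖ ^ 2))

/-- The smooth interpolation of vertex data. -/
noncomputable def nodalFun (A B : Word k → ℂ) (w : Word k) (θ : ℝ) : ℂ :=
  A w + (B w - A w) * (ramp (θ / T.edgeLen w) : ℂ)

noncomputable def nodalDeriv (A B : Word k → ℂ) (w : Word k) (θ : ℝ) : ℂ :=
  (B w - A w) * ((deriv ramp (θ / T.edgeLen w) / T.edgeLen w : ℝ) : ℂ)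

variable {A B : Word k → ℂ}

theorem nodalEnergy_nonneg (w : Word k) : 0 ≤ T.nodalEnergy A B w := by
  have := T.rho_pos w
  have := T.edgeLen_pos w
  rw [nodalEnergy]
  positivity

theorem contDiff_nodalFun (w : Word k) : ContDiff ℝ 1 (T.nodalFun A B w) :=
  contDiff_const.add (contDiff_const.mul (Complex.ofRealCLM.contDiff.comp
    ((contDiff_ramp (n := 1)).comp (contDiff_id.div_const _))))

theorem hasDerivAt_nodalFun (w : Word k) (θ : ℝ) :
    HasDerivAt (T.nodalFun A B w) (T.nodalDeriv A B w θ) θ := by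
  have h1 : HasDerivAt ramp (deriv ramp (θ / T.edgeLen w)) (θ / T.edgeLen w) :=
    ((contDiff_ramp (n := 1)).differentiable one_ne_zero).differentiableAt.hasDerivAt
  have h2 : HasDerivAt (fun θ => ramp (θ / T.edgeLen w))
      (deriv ramp (θ / T.edgeLen w) / T.edgeLen w) θ := by
    have := h1.comp θ ((hasDerivAt_id θ).div_const (T.edgeLen w))
    rwa [← div_eq_mul_one_div] at this
  exact (h2.ofReal_comp.const_mul (B w - A w)).const_add (A w)

theorem deriv_nodalFun (w : Word k) : deriv (T.nodalFun A B w) = T.nodalDeriv A B w :=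
  funext fun θ => (T.hasDerivAt_nodalFun w θ).deriv

theorem continuous_nodalDeriv (w : Word k) : Continuous (T.nodalDeriv A B w) := by
  rw [← deriv_nodalFun]
  exact (T.contDiff_nodalFun w).continuous_deriv le_rfl

theorem nodalFun_of_le {w : Word k} {θ : ℝ} (h : θ ≤ 1 / 4 * T.edgeLen w) :
    T.nodalFun A B w θ = A w := by
  rw [nodalFun, ramp_of_le ((div_le_iff₀ (T.edgeLen_pos w)).2 h)]
  simp

theorem nodalFun_of_ge {w : Word k} {θ : ℝ} (h : 3 / 4 * T.edgeLen w ≤ θ) :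
    T.nodalFun A B w θ = B w := by
  rw [nodalFun, ramp_of_ge ((le_div_iff₀ (T.edgeLen_pos w)).2 h)]
  simp

theorem norm_nodalFun_sq_le (w : Word k) (θ : ℝ) :
    ‖T.nodalFun A B w θ‖ ^ 2 ≤ 2 * (‖A w‖ ^ 2 + ‖B w‖ ^ 2) := by
  obtain ⟨h0, h1⟩ := ramp_mem (θ / T.edgeLen w)
  set r := ramp (θ / T.edgeLen w)
  have e : T.nodalFun A B w θ = A w * ((1 - r : ℝ) : ℂ) + B w * (r : ℂ) := by
    rw [nodalFun]; push_cast; ring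
  have h2 : ‖T.nodalFun A B w θ‖ ≤ ‖A w‖ + ‖B w‖ := by
    rw [e]
    refine (norm_add_le _ _).trans (add_le_add ?_ ?_) <;>
    rw [norm_mul, Complex.norm_real, Real.norm_of_nonneg (by linarith)] <;>
    exact mul_le_of_le_one_right (norm_nonneg _) (by linarith)
  nlinarith [norm_nonneg (T.nodalFun A B w θ), sq_nonneg (‖A w‖ - ‖B w‖)]

theorem norm_nodalDeriv_le {M : ℝ} (hM : ∀ x, |deriv ramp x| ≤ M) (w : Word k) (θ : ℝ) :
    ‖T.nodalDeriv A B w θ‖ ≤ ‖B w - A w‖ * (M / T.edgeLen w) := by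
  have hl := T.edgeLen_pos w
  rw [nodalDeriv, norm_mul, Complex.norm_real, Real.norm_eq_abs, abs_div, abs_of_pos hl]
  gcongr
  exact hM _

/-- The interpolation is constant on the outer quarters of each edge, and for `ε ≤ 1 / 16` the
skeletons stay well inside these quarters. It is therefore constant near the inflated vertices. -/
theorem isAxialC1_nodalFun {ε : ℝ} (hε : 0 < ε) (hε' : ε ≤ 1 / 16) (hA : A (Word.root k) = 0)
    (hAB : ∀ w i, A (Word.child i w) = B w) : T.IsAxialC1 ε (T.nodalFun A B) B := by
  refine ⟨T.contDiff_nodalFun, fun w => ?_, fun w i => ?_, ?_⟩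
  · have h1 := T.le_edgeEnd hε w
    have hl := T.edgeLen_pos w
    have h2 : 3 / 4 * T.edgeLen w < T.edgeEnd ε w := by nlinarith
    exact (eventually_gt_nhds h2).mono fun θ hθ => T.nodalFun_of_ge hθ.le
  · have h1 := T.edgeStart_le hε (Word.child i w)
    have hl := T.edgeLen_pos (Word.child i w)
    have h2 : T.edgeStart ε (Word.child i w) < 1 / 4 * T.edgeLen (Word.child i w) := by nlinarith
    refine (eventually_lt_nhds h2).mono fun θ hθ => ?_
    rw [T.nodalFun_of_le hθ.le, hAB]
  · rw [T.nodalFun_of_le (by have := T.edgeLen_pos (Word.root k); positivity), hA]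

theorem lintegral_edge_sq_le {ε : ℝ} (hε : 0 < ε) {g : ℝ → ℂ} {C X : ℝ} {w : Word k}
    (hg : ∀ θ, ‖g θ‖ ^ 2 ≤ C) (hX : T.rho w * (T.edgeLen w * C) ≤ X) :
    ENNReal.ofReal (ε ^ d * T.rho w) *
      ∫⁻ θ in Ioo (T.edgeStart ε w) (T.edgeEnd ε w), ‖g θ‖ₑ ^ 2 ≤ ENNReal.ofReal (ε ^ d * X) := by
  have hp := pow_pos hε d
  have hρ := T.rho_pos w
  have h1 : ∫⁻ θ in Ioo (T.edgeStart ε w) (T.edgeEnd ε w), ‖g θ‖ₑ ^ 2 ≤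
      ENNReal.ofReal (T.edgeLen w * C) := by
    calc _ ≤ ∫⁻ _ in Ioo (T.edgeStart ε w) (T.edgeEnd ε w), ENNReal.ofReal C :=
          lintegral_mono fun θ => by
            rw [enorm_sq_eq_ofReal]; exact ENNReal.ofReal_le_ofReal (hg θ)
      _ ≤ _ := by
          rw [lintegral_const, Measure.restrict_apply_univ, Real.volume_Ioo,
            ENNReal.ofReal_mul (T.edgeLen_pos w).le, mul_comm]
          gcongr
          linarith [T.edgeStart_nonneg hε w, T.edgeEnd_le hε w]
  refine (mul_le_mul_right h1 _).trans ?_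
  rw [← ENNReal.ofReal_mul (by positivity), mul_assoc]
  exact ENNReal.ofReal_le_ofReal (mul_le_mul_of_nonneg_left hX hp.le)

theorem tsum_lt_top_of_le {f : Word k → ENNReal} {X : Word k → ℝ} (hX : Summable X)
    (h : ∀ w, f w ≤ ENNReal.ofReal (X w)) : ∑' w, f w < ⊤ :=
  (ENNReal.tsum_le_tsum h).trans_lt hX.tsum_ofReal_lt_top

/-- Upper bounds for the volume of the inflated vertices. -/
theorem exists_volume_vert_le : ∃ C : ℝ, 0 < C ∧ ∀ {ε : ℝ}, 0 < ε → ∀ w : Word k,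
    volume.real (T.piece ε (.vert w)) ≤ ε ^ d * (C * ε * (T.rho w * T.edgeLen w)) := by
  obtain ⟨C, hCp, hC⟩ := T.exists_scale_le
  have hV := T.volume_V_pos
  have hΩ := T.volume_Ω_pos
  refine ⟨C * ((volume T.V).toReal / (volume T.Ω).toReal), by positivity, fun {ε} hε w => ?_⟩
  have hs := T.scale_pos hε w
  rw [Measure.real, T.volume_piece_vert hε, ENNReal.toReal_ofReal (by positivity)]
  have h1 := T.scale_pow ε w
  have h2 : T.scale ε w ^ (d + 1) * (volume T.V).toReal =
      ε ^ d * T.rho w * ((volume T.V).toReal / (volume T.Ω).toReal) * T.scale ε w := by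
    rw [← h1, pow_succ]; field_simp
  rw [h2]
  have hp := pow_pos hε d
  have hρ := T.rho_pos w
  calc _ ≤ ε ^ d * T.rho w * ((volume T.V).toReal / (volume T.Ω).toReal) *
        (C * ε * T.edgeLen (w.nbr none)) := by gcongr; exact hC hε w none
    _ = _ := by rw [Word.nbr]; ring

/-- On each edge with its upper vertex, the squared norms of the interpolation and of its gradient
are at most `ε ^ d` times a constant multiple of the nodal energy. Finite nodal energy makes the
interpolation admissible. -/
theorem memH10_nodalFun {ε : ℝ} (hε : 0 < ε) (hε' : ε ≤ 1 / 16) (hA : A (Word.root k) = 0)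
    (hAB : ∀ w i, A (Word.child i w) = B w) (hS : Summable (T.nodalEnergy A B)) :
    T.MemH10 ε (axialFun (T.nodalFun A B) B) (grad (axialFun (T.nodalFun A B) B)) := by
  obtain ⟨M, hMp, hM⟩ := exists_abs_deriv_ramp_le
  obtain ⟨C, hCp, hC⟩ := T.exists_volume_vert_le
  refine (T.isAxialC1_nodalFun hε hε' hA hAB).memH10 hε
    (tsum_lt_top_of_le ((hS.mul_left 2).mul_left (ε ^ d)) fun w => ?_)
    (tsum_lt_top_of_le ((hS.mul_left (M ^ 2)).mul_left (ε ^ d)) fun w => ?_)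
    (tsum_lt_top_of_le ((hS.mul_left (C * ε)).mul_left (ε ^ d)) fun w => ?_)
  all_goals have hρ := T.rho_pos w
  all_goals have hl := T.edgeLen_pos w
  · refine T.lintegral_edge_sq_le hε (T.norm_nodalFun_sq_le w) ?_
    rw [nodalEnergy]
    have : 0 ≤ T.rho w * ((T.edgeLen w)⁻¹ * ‖B w - A w‖ ^ 2) := by positivity
    linarith
  · rw [deriv_nodalFun]
    refine T.lintegral_edge_sq_le hε (C := (‖B w - A w‖ * (M / T.edgeLen w)) ^ 2)
      (fun θ => pow_le_pow_left₀ (norm_nonneg _) (T.norm_nodalDeriv_le hM w θ) 2) ?_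
    have h1 : T.rho w * (T.edgeLen w * (‖B w - A w‖ * (M / T.edgeLen w)) ^ 2) =
        M ^ 2 * (T.rho w * ((T.edgeLen w)⁻¹ * ‖B w - A w‖ ^ 2)) := by field_simp
    rw [h1, nodalEnergy]
    gcongr
    exact le_add_of_nonneg_right (by positivity)
  · have hv := hC hε w
    have := T.isFiniteMeasure_piece hε (.vert w)
    have hfin : volume (T.piece ε (.vert w)) ≠ ⊤ := by
      rw [T.volume_piece_vert hε]; exact ENNReal.ofReal_ne_top
    rw [enorm_sq_eq_ofReal, ← ENNReal.ofReal_toReal hfin, ← ENNReal.ofReal_mul (sq_nonneg _)]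
    refine ENNReal.ofReal_le_ofReal ((mul_le_mul_of_nonneg_left hv (sq_nonneg _)).trans ?_)
    calc _ = ε ^ d * (C * ε * (T.rho w * (T.edgeLen w * ‖B w‖ ^ 2))) := by ring
      _ ≤ _ := by
        rw [nodalEnergy]
        gcongr
        have : 0 ≤ (T.edgeLen w)⁻¹ * ‖B w - A w‖ ^ 2 + T.edgeLen w * ‖A w‖ ^ 2 := by positivity
        linarith

end TreeData

theorem norm_le_sqrt_mul_sqrt {E : Type*} [SeminormedAddCommGroup E] {z : E} {x y : ℝ} (hx : 0 ≤ x)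
    (h : ‖z‖ ^ 2 ≤ x * y) : ‖z‖ ≤ √x * √y := by
  rw [← Real.sqrt_mul hx]
  exact Real.le_sqrt_of_sq_le h

namespace TreeData

variable {d k : ℕ} (T : TreeData d k) {A B : Word k → ℂ}

theorem conj_nodalFun (w : Word k) (θ : ℝ) : conj (T.nodalFun A B w θ) =
    T.nodalFun (fun v => conj (A v)) (fun v => conj (B v)) w θ := by
  simp [nodalFun]

theorem conj_nodalDeriv (w : Word k) (θ : ℝ) : conj (T.nodalDeriv A B w θ) =
    T.nodalDeriv (fun v => conj (A v)) (fun v => conj (B v)) w θ := by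
  simp only [nodalDeriv, map_mul, map_sub, Complex.conj_ofReal]

theorem continuous_conj_nodalFun (w : Word k) : Continuous fun θ => conj (T.nodalFun A B w θ) :=
  Complex.continuous_conj.comp (T.contDiff_nodalFun w).continuous

theorem continuous_conj_nodalDeriv (w : Word k) :
    Continuous fun θ => conj (T.nodalDeriv A B w θ) :=
  Complex.continuous_conj.comp (T.continuous_nodalDeriv w)

/-- Integration by parts for an interpolated function and a profile. -/
theorem integral_nodalFun_mul_profile {ε : ℝ} (hε : 0 < ε) (hε' : ε ≤ 1 / 16) (ω : ℝ)
    (a : Word k → ℂ × ℂ) (w : Word k) :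
    (∫ θ in Ioo (T.edgeStart ε w) (T.edgeEnd ε w),
        conj (T.nodalDeriv A B w θ) * T.profileDeriv ω a w θ) -
      (ω ^ 2 : ℝ) * ∫ θ in Ioo (T.edgeStart ε w) (T.edgeEnd ε w),
        conj (T.nodalFun A B w θ) * T.profile ω a w θ =
    conj (B w) * T.profileDeriv ω a w (T.edgeEnd ε w) -
      conj (A w) * T.profileDeriv ω a w (T.edgeStart ε w) := by
  have hle := (T.edgeStart_lt_edgeEnd hε (by linarith) w).le
  have hl := T.edgeLen_pos w
  have hc1 : Continuous fun θ => conj (T.nodalDeriv A B w θ) * T.profileDeriv ω a w θ :=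
    (T.continuous_conj_nodalDeriv w).mul (T.continuous_profileDeriv ω a w)
  have hc2 : Continuous fun θ => conj (T.nodalFun A B w θ) * T.profile ω a w θ :=
    (T.continuous_conj_nodalFun w).mul (T.continuous_profile ω a w)
  have hc3 : Continuous fun θ => ((ω ^ 2 : ℝ) : ℂ) * (conj (T.nodalFun A B w θ) *
      T.profile ω a w θ) := continuous_const.mul hc2
  have h1 : ∀ θ ∈ uIcc (T.edgeStart ε w) (T.edgeEnd ε w),
      HasDerivAt (fun θ => conj (T.nodalFun A B w θ) * T.profileDeriv ω a w θ)
        (conj (T.nodalDeriv A B w θ) * T.profileDeriv ω a w θ -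
          (ω ^ 2 : ℝ) * (conj (T.nodalFun A B w θ) * T.profile ω a w θ)) θ := fun θ _ => by
    simp only [conj_nodalFun, conj_nodalDeriv]
    refine ((T.hasDerivAt_nodalFun w θ).mul (T.hasDerivAt_profileDeriv ω a w θ)).congr_deriv ?_
    ring
  have h2 := intervalIntegral.integral_eq_sub_of_hasDerivAt h1
    ((hc1.sub hc3).intervalIntegrable _ _)
  have e1 : T.nodalFun A B w (T.edgeEnd ε w) = B w :=
    T.nodalFun_of_ge (by have := T.le_edgeEnd hε w; nlinarith)
  have e2 : T.nodalFun A B w (T.edgeStart ε w) = A w :=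
    T.nodalFun_of_le (by have := T.edgeStart_le hε w; nlinarith)
  rw [e1, e2, intervalIntegral.integral_sub (hc1.intervalIntegrable _ _)
    (hc3.intervalIntegrable _ _), intervalIntegral.integral_const_mul,
    intervalIntegral.integral_of_le hle, intervalIntegral.integral_of_le hle,
    integral_Ioc_eq_integral_Ioo, integral_Ioc_eq_integral_Ioo] at h2
  exact h2

section

variable {T} {ε ω : ℝ} {u : Piece k × EuclideanSpace ℝ (Fin (d + 1)) → ℂ}
  {G : Piece k × EuclideanSpace ℝ (Fin (d + 1)) → EuclideanSpace ℂ (Fin (d + 1))}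
  {a : Word k → ℂ × ℂ}

theorem memLp_Ioo_of_continuous {f : ℝ → ℂ} (hf : Continuous f) (b c : ℝ) :
    MemLp f 2 (volume.restrict (Ioo b c)) := by
  obtain ⟨C, hC⟩ := (isCompact_Icc (a := b) (b := c)).exists_bound_of_continuousOn hf.continuousOn
  exact .of_bound hf.aestronglyMeasurable C ((ae_restrict_mem measurableSet_Ioo).mono
    fun x hx => hC x (Ioo_subset_Icc_self hx))

theorem rho_mul_integral_sq_le (T : TreeData d k) (hε : 0 < ε) (hε1 : ε < 1) {φ f : ℝ → ℂ}
    (hφ : Continuous φ) (hf : Continuous f) {w : Word k} {M X Y : ℝ} (hM : ∀ θ, ‖φ θ‖ ≤ M)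
    (hX : T.rho w * (T.edgeLen w * M ^ 2) ≤ X)
    (hY : T.rho w * (∫ θ in Ioo (T.edgeStart ε w) (T.edgeEnd ε w), ‖f θ‖ ^ 2) ≤ Y) :
    ‖(T.rho w : ℂ) * ∫ θ in Ioo (T.edgeStart ε w) (T.edgeEnd ε w), φ θ * f θ‖ ^ 2 ≤ X * Y := by
  have hρ := T.rho_pos w
  have hl := T.edgeLen_pos w
  have h1 := norm_integral_mul_sq_le hφ.aestronglyMeasurable
    (memLp_Ioo_of_continuous hf (T.edgeStart ε w) (T.edgeEnd ε w)) (.of_forall hM)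
  have hvol : volume.real (Ioo (T.edgeStart ε w) (T.edgeEnd ε w)) ≤ T.edgeLen w := by
    rw [Real.volume_real_Ioo_of_le (T.edgeStart_lt_edgeEnd hε hε1 w).le]
    linarith [T.edgeStart_nonneg hε w, T.edgeEnd_le hε w]
  rw [measureReal_restrict_apply_univ] at h1
  rw [norm_mul, mul_pow, Complex.norm_real, Real.norm_of_nonneg hρ.le]
  have hI : 0 ≤ ∫ θ in Ioo (T.edgeStart ε w) (T.edgeEnd ε w), ‖f θ‖ ^ 2 :=
    integral_nonneg fun _ => sq_nonneg _
  calc _ ≤ T.rho w ^ 2 * (T.edgeLen w * (M ^ 2 *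
        ∫ θ in Ioo (T.edgeStart ε w) (T.edgeEnd ε w), ‖f θ‖ ^ 2)) := by
        refine mul_le_mul_of_nonneg_left (h1.trans ?_) (sq_nonneg _)
        exact mul_le_mul_of_nonneg_right hvol (by positivity)
    _ = (T.rho w * (T.edgeLen w * M ^ 2)) *
        (T.rho w * ∫ θ in Ioo (T.edgeStart ε w) (T.edgeEnd ε w), ‖f θ‖ ^ 2) := by ring
    _ ≤ X * Y := mul_le_mul hX hY (by positivity) (le_trans (by positivity) hX)

theorem IsProfile.rho_mul_nodalDeriv_le (h : T.IsProfile ε ω u G a) (hε : 0 < ε) (hε1 : ε < 1)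
    {M : ℝ} (hM : ∀ x, |deriv ramp x| ≤ M) (w : Word k) :
    ‖(T.rho w : ℂ) * ∫ θ in Ioo (T.edgeStart ε w) (T.edgeEnd ε w),
        conj (T.nodalDeriv A B w θ) * T.profileDeriv ω a w θ‖ ^ 2 ≤
      (M ^ 2 * T.nodalEnergy A B w) * T.wordMass ε G w := by
  have hρ := T.rho_pos w
  have hl := T.edgeLen_pos w
  refine T.rho_mul_integral_sq_le hε hε1 (T.continuous_conj_nodalDeriv w)
    (T.continuous_profileDeriv ω a w) (M := ‖B w - A w‖ * (M / T.edgeLen w)) (fun θ => ?_) ?_ ?_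
  · rw [RCLike.norm_conj]
    exact T.norm_nodalDeriv_le hM w θ
  · have h1 : T.rho w * (T.edgeLen w * (‖B w - A w‖ * (M / T.edgeLen w)) ^ 2) =
        M ^ 2 * (T.rho w * ((T.edgeLen w)⁻¹ * ‖B w - A w‖ ^ 2)) := by field_simp
    rw [h1, nodalEnergy]
    gcongr
    exact le_add_of_nonneg_right (by positivity)
  · rw [← toReal_profileEnergy]
    exact (h.rho_mul_energy_le hε w).trans (T.pieceMass_edge_le_wordMass hε w)

theorem IsProfile.rho_mul_nodalFun_le (h : T.IsProfile ε ω u G a) (hε : 0 < ε) (hε1 : ε < 1)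
    (w : Word k) :
    ‖(T.rho w : ℂ) * ∫ θ in Ioo (T.edgeStart ε w) (T.edgeEnd ε w),
        conj (T.nodalFun A B w θ) * T.profile ω a w θ‖ ^ 2 ≤
      (2 * T.nodalEnergy A B w) * T.wordMass ε u w := by
  have hρ := T.rho_pos w
  have hl := T.edgeLen_pos w
  refine T.rho_mul_integral_sq_le hε hε1 (T.continuous_conj_nodalFun w)
    (T.continuous_profile ω a w) (M := √(2 * (‖A w‖ ^ 2 + ‖B w‖ ^ 2))) (fun θ => ?_) ?_ ?_
  · rw [RCLike.norm_conj]
    exact Real.le_sqrt_of_sq_le (T.norm_nodalFun_sq_le w θ)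
  · rw [Real.sq_sqrt (by positivity), nodalEnergy]
    have : 0 ≤ T.rho w * ((T.edgeLen w)⁻¹ * ‖B w - A w‖ ^ 2) := by positivity
    linarith
  · rw [← toReal_profileMass]
    exact (h.rho_mul_mass_le hε w).trans (T.pieceMass_edge_le_wordMass hε w)

/-- Cauchy-Schwarz on the inflated vertex, whose normalised volume is at most a multiple of `ε ρ*
ℓ`. The factor `ε` removes the vertices from the limit equation. -/
theorem norm_vert_sq_le (T : TreeData d k) {C : ℝ} (hε : 0 < ε)
    (hu : MemLp u 2 (T.inflatedMeasure ε)) (hCp : 0 < C) {w : Word k}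
    (hC : volume.real (T.piece ε (.vert w)) ≤ ε ^ d * (C * ε * (T.rho w * T.edgeLen w))) :
    ‖((ε ^ d)⁻¹ : ℝ) * (conj (B w) * ∫ x in T.piece ε (.vert w), u (.vert w, x))‖ ^ 2 ≤
      (C * ε * T.nodalEnergy A B w) * T.wordMass ε u w := by
  have := T.isFiniteMeasure_piece hε (.vert w)
  have hp := pow_pos hε d
  have hρ := T.rho_pos w
  have hl := T.edgeLen_pos w
  have h1 := norm_integral_mul_sq_le (φ := fun _ => conj (B w)) aestronglyMeasurable_const
    (hu.prodMk_left (.vert w)) (M := ‖B w‖) (.of_forall fun _ => by rw [RCLike.norm_conj])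
  rw [integral_const_mul, measureReal_restrict_apply_univ] at h1
  have hI : 0 ≤ ∫ x in T.piece ε (.vert w), ‖u (.vert w, x)‖ ^ 2 :=
    integral_nonneg fun _ => sq_nonneg _
  have hm : T.pieceMass ε u (.vert w) ≤ T.wordMass ε u w := T.pieceMass_vert_le_wordMass hε w
  rw [norm_mul, mul_pow, Complex.norm_real, Real.norm_of_nonneg (by positivity)]
  calc _ ≤ (ε ^ d)⁻¹ ^ 2 * ((ε ^ d * (C * ε * (T.rho w * T.edgeLen w))) *
        (‖B w‖ ^ 2 * ∫ x in T.piece ε (.vert w), ‖u (.vert w, x)‖ ^ 2)) := by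
        refine mul_le_mul_of_nonneg_left (h1.trans ?_) (sq_nonneg _)
        exact mul_le_mul_of_nonneg_right hC (by positivity)
    _ = (C * ε * (T.rho w * (T.edgeLen w * ‖B w‖ ^ 2))) * T.pieceMass ε u (.vert w) := by
        rw [pieceMass]; field_simp
    _ ≤ _ := by
        have hA0 : 0 ≤ (T.edgeLen w)⁻¹ * ‖B w - A w‖ ^ 2 + T.edgeLen w * ‖A w‖ ^ 2 := by positivity
        have h0 := T.nodalEnergy_nonneg (A := A) (B := B) w
        refine mul_le_mul ?_ hm (T.pieceMass_nonneg hε _) (by positivity)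
        rw [nodalEnergy]
        gcongr
        linarith

/-- The weak equation tested with an interpolated function. -/
theorem IsEigenpair.weak_nodal (hE : T.IsEigenpair ε (ω ^ 2) u G) (hP : T.IsProfile ε ω u G a)
    (hε : 0 < ε) (hε' : ε ≤ 1 / 16) (hA : A (Word.root k) = 0)
    (hAB : ∀ w i, A (Word.child i w) = B w) (hS : Summable (T.nodalEnergy A B)) :
    ∑' w, (T.rho w : ℂ) * (conj (B w) * T.profileDeriv ω a w (T.edgeEnd ε w) -
        conj (A w) * T.profileDeriv ω a w (T.edgeStart ε w)) =
      (ω ^ 2 : ℝ) * ∑' w, ((ε ^ d)⁻¹ : ℝ) *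
        (conj (B w) * ∫ x in T.piece ε (.vert w), u (.vert w, x)) := by
  obtain ⟨M, -, hM⟩ := exists_abs_deriv_ramp_le
  have hp := pow_pos hε d
  have hpc : ((ε ^ d : ℝ) : ℂ) ≠ 0 := by exact_mod_cast hp.ne'
  obtain ⟨h1, h2, h3, h4⟩ := hE.weak_axial (fun w => T.contDiff_nodalFun (A := A) (B := B) w)
    (T.memH10_nodalFun hε hε' hA hAB hS)
  have e1 : ∀ w, ∫ x in T.piece ε (.edge w),
      conj (deriv (T.nodalFun A B w) (x 0)) * G (.edge w, x) 0 =
      (ε ^ d : ℝ) * ((T.rho w : ℂ) * ∫ θ in Ioo (T.edgeStart ε w) (T.edgeEnd ε w),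
        conj (T.nodalDeriv A B w θ) * T.profileDeriv ω a w θ) := fun w => by
    rw [deriv_nodalFun, T.integral_edge_axial_mul hε w (c := fun θ => conj (T.nodalDeriv A B w θ))
      (F := fun x => G (.edge w, x) 0) (T.integrableOn_axial_mul hε (MemH10.memLp_grad_zero hP.mem.2.1 w)
        (T.continuous_conj_nodalDeriv w) fun θ => by
          rw [RCLike.norm_conj]; exact T.norm_nodalDeriv_le hM w θ), Complex.ofReal_mul, mul_assoc]
    congr 2
    exact integral_congr_ae ((hP.average_grad w).mono fun θ hθ => by simp only [hθ])
  have e2 : ∀ w, ∫ x in T.piece ε (.edge w), conj (T.nodalFun A B w (x 0)) * u (.edge w, x) =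
      (ε ^ d : ℝ) * ((T.rho w : ℂ) * ∫ θ in Ioo (T.edgeStart ε w) (T.edgeEnd ε w),
        conj (T.nodalFun A B w θ) * T.profile ω a w θ) := fun w => by
    rw [T.integral_edge_axial_mul hε w (c := fun θ => conj (T.nodalFun A B w θ))
      (F := fun x => u (.edge w, x)) (T.integrableOn_axial_mul hε (hP.mem.1.prodMk_left _)
        (T.continuous_conj_nodalFun w) fun θ => by
          rw [RCLike.norm_conj]; exact Real.le_sqrt_of_sq_le (T.norm_nodalFun_sq_le w θ)),
      Complex.ofReal_mul, mul_assoc]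
    congr 2
    exact integral_congr_ae ((hP.average w).mono fun θ hθ => by simp only [hθ])
  simp only [e1, e2] at h1 h2 h4
  have h1' := (summable_mul_left_iff hpc).1 h1
  have h2' := (summable_mul_left_iff hpc).1 h2
  -- The boundary terms are turned back into the two edge integrals, whose sums converge separately;
  -- the weak equation then accounts for what remains on the vertices.
  simp only [← T.integral_nodalFun_mul_profile hε hε' ω a, mul_sub]
  simp only [mul_left_comm (T.rho _ : ℂ) ((ω ^ 2 : ℝ) : ℂ)]
  rw [h1'.tsum_sub (h2'.mul_left _), tsum_mul_left, tsum_mul_left]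
  rw [tsum_mul_left, tsum_mul_left] at h4
  rw [sub_eq_iff_eq_add, Complex.ofReal_inv]
  refine mul_left_cancel₀ hpc (h4.trans ?_)
  field_simp
  ring

end

namespace IsLimit

variable {T} {ε ω : ℕ → ℝ} {u : ℕ → Piece k × EuclideanSpace ℝ (Fin (d + 1)) → ℂ}
  {G : ℕ → Piece k × EuclideanSpace ℝ (Fin (d + 1)) → EuclideanSpace ℂ (Fin (d + 1))}
  {a : ℕ → Word k → ℂ × ℂ} {Λ ωStar : ℝ} {aStar : Word k → ℂ × ℂ}

/-- The limit equation, tested with vertex data. -/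
theorem hasSum_nodal (h : T.IsLimit ε ω u G a Λ ωStar aStar) (hA : A (Word.root k) = 0)
    (hAB : ∀ w i, A (Word.child i w) = B w) (hS : Summable (T.nodalEnergy A B)) :
    HasSum (fun w => (T.rho w : ℂ) * (conj (B w) * T.profileDeriv ωStar aStar w (T.edgeLen w) -
      conj (A w) * T.profileDeriv ωStar aStar w 0)) 0 := by
  obtain ⟨M, hMp, hM⟩ := exists_abs_deriv_ramp_le
  obtain ⟨C, hCp, hC⟩ := T.exists_volume_vert_le
  have hε1 : ∀ n, ε n < 1 := fun n => (h.eps_le n).trans_lt (by norm_num)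
  -- The square root of mass plus energy is bounded in `ℓ²` uniformly in `n`; the nodal energy
  -- supplies the fixed `ℓ²` factor.
  set β : ℕ → Word k → ℝ := fun n w => √(T.wordMass (ε n) (u n) w + T.wordMass (ε n) (G n) w)
  have hm : ∀ n w, 0 ≤ T.wordMass (ε n) (u n) w := fun n w => T.wordMass_nonneg (h.eps_pos n) w
  have hg : ∀ n w, 0 ≤ T.wordMass (ε n) (G n) w := fun n w => T.wordMass_nonneg (h.eps_pos n) w
  have hβsq : ∀ n, (fun w => β n w ^ 2) =
      fun w => T.wordMass (ε n) (u n) w + T.wordMass (ε n) (G n) w := fun n =>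
    funext fun w => Real.sq_sqrt (add_nonneg (hm n w) (hg n w))
  have hβ : ∀ n, Summable fun w => β n w ^ 2 := fun n => by
    rw [hβsq]; exact (h.hasSum_mass n).summable.add (h.summable_energy n)
  have hβΛ : ∀ n, ∑' w, β n w ^ 2 ≤ 1 + Λ := fun n => by
    rw [hβsq, (h.hasSum_mass n).summable.tsum_add (h.summable_energy n), h.mass n]
    exact add_le_add le_rfl (h.energy n)
  have hα : ∀ K : ℝ, 0 ≤ K → Summable fun w => √(K * T.nodalEnergy A B w) ^ 2 := fun K hK => by
    refine (hS.mul_left K).congr fun w => ?_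
    rw [Real.sq_sqrt (mul_nonneg hK (T.nodalEnergy_nonneg w))]
  set W : ℝ := ωStar ^ 2 + 1
  set K : ℝ := 2 * M ^ 2 + 4 * W ^ 2
  have hK : 0 ≤ K := by positivity
  -- The boundary terms are rewritten as edge integrals, where Cauchy-Schwarz applies. Frequencies
  -- enter through `W`, which bounds `ω n ^ 2` for large `n`.
  have hle : ∀ᶠ n in atTop, ∀ w, ‖(T.rho w : ℂ) *
      (conj (B w) * T.profileDeriv (ω n) (a n) w (T.edgeEnd (ε n) w) -
        conj (A w) * T.profileDeriv (ω n) (a n) w (T.edgeStart (ε n) w))‖ ≤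
      √(K * T.nodalEnergy A B w) * β n w := by
    filter_upwards [(h.omega_lim.pow 2).eventually_le_const (lt_add_one (ωStar ^ 2))] with n hn w
    have h0 := T.nodalEnergy_nonneg (A := A) (B := B) w
    refine norm_le_sqrt_mul_sqrt (mul_nonneg hK h0) ?_
    have h1 := (h.profile n).rho_mul_nodalDeriv_le (A := A) (B := B) (h.eps_pos n) (hε1 n) hM w
    have h2 := (h.profile n).rho_mul_nodalFun_le (A := A) (B := B) (h.eps_pos n) (hε1 n) w
    rw [← T.integral_nodalFun_mul_profile (h.eps_pos n) (h.eps_le n), mul_sub, mul_left_comm]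
    generalize (T.rho w : ℂ) * ∫ θ in Ioo (T.edgeStart (ε n) w) (T.edgeEnd (ε n) w),
      conj (T.nodalDeriv A B w θ) * T.profileDeriv (ω n) (a n) w θ = x at h1 ⊢
    generalize (T.rho w : ℂ) * ∫ θ in Ioo (T.edgeStart (ε n) w) (T.edgeEnd (ε n) w),
      conj (T.nodalFun A B w θ) * T.profile (ω n) (a n) w θ = y at h2 ⊢
    have h3 : ‖x - (ω n ^ 2 : ℝ) * y‖ ≤ ‖x‖ + W * ‖y‖ := by
      refine (norm_sub_le _ _).trans ?_
      rw [norm_mul, Complex.norm_real, Real.norm_of_nonneg (sq_nonneg _)]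
      gcongr
    have h4 : ‖x - (ω n ^ 2 : ℝ) * y‖ ^ 2 ≤ 2 * ‖x‖ ^ 2 + 2 * W ^ 2 * ‖y‖ ^ 2 := by
      nlinarith [pow_le_pow_left₀ (norm_nonneg _) h3 2, sq_nonneg (‖x‖ - W * ‖y‖)]
    have h5 : W ^ 2 * ‖y‖ ^ 2 ≤ W ^ 2 * (2 * T.nodalEnergy A B w * T.wordMass (ε n) (u n) w) :=
      mul_le_mul_of_nonneg_left h2 (sq_nonneg _)
    have h6 : 0 ≤ M ^ 2 * T.nodalEnergy A B w * T.wordMass (ε n) (u n) w :=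
      mul_nonneg (by positivity) (hm n w)
    have h7 : 0 ≤ W ^ 2 * T.nodalEnergy A B w * T.wordMass (ε n) (G n) w :=
      mul_nonneg (by positivity) (hg n w)
    simp only [K]
    linarith
  obtain ⟨hs, hlim⟩ := tendsto_tsum_of_l2_bound (hα K hK) hβ hβΛ hle
    fun w => ((((h.tendsto_profileDeriv w (h.tendsto_edgeEnd w)).const_mul _).sub
      ((h.tendsto_profileDeriv w (h.tendsto_edgeStart w)).const_mul _)).const_mul _)
  have hvb : ∀ n w, ‖(((ε n ^ d)⁻¹ : ℝ) : ℂ) *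
      (conj (B w) * ∫ x in T.piece (ε n) (.vert w), u n (.vert w, x))‖ ^ 2 ≤
      (C * ε n * T.nodalEnergy A B w) * T.wordMass (ε n) (u n) w := fun n w =>
    T.norm_vert_sq_le (h.eps_pos n) (h.profile n).mem.1 hCp (hC (h.eps_pos n) w)
  -- The terms of the inflated vertices obey a domination of the same form, and each of them tends
  -- to zero because of its factor `ε`.
  obtain ⟨-, hlim'⟩ := tendsto_tsum_of_l2_bound (Λ := 1 + Λ) (t₀ := fun _ => 0)
    (t := fun n w => (((ε n ^ d)⁻¹ : ℝ) : ℂ) *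
      (conj (B w) * ∫ x in T.piece (ε n) (.vert w), u n (.vert w, x))) (hα C hCp.le) hβ hβΛ
    (.of_forall fun n w => by
      have h0 := T.nodalEnergy_nonneg (A := A) (B := B) w
      refine norm_le_sqrt_mul_sqrt (by positivity) ((hvb n w).trans ?_)
      refine mul_le_mul ?_ (le_add_of_nonneg_right (hg n w)) (hm n w) (by positivity)
      gcongr
      exact mul_le_of_le_one_right hCp.le (hε1 n).le)
    fun w => by
      have h0 := T.nodalEnergy_nonneg (A := A) (B := B) w
      have h1 : Tendsto (fun n => ‖(((ε n ^ d)⁻¹ : ℝ) : ℂ) *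
          (conj (B w) * ∫ x in T.piece (ε n) (.vert w), u n (.vert w, x))‖ ^ 2) atTop (𝓝 0) := by
        refine squeeze_zero (fun n => sq_nonneg _) (fun n => (hvb n w).trans ?_)
          (g := fun n => C * ε n * T.nodalEnergy A B w) ?_
        · have := h.eps_pos n
          refine mul_le_of_le_one_right (by positivity) ?_
          exact le_hasSum (h.hasSum_mass n) w fun _ _ => hm n _
        · simpa using (h.eps_lim.const_mul C).mul_const (T.nodalEnergy A B w)
      rw [tendsto_zero_iff_norm_tendsto_zero]
      have h2 := h1.sqrt
      simp only [Real.sqrt_sq (norm_nonneg _), Real.sqrt_zero] at h2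
      exact h2
  rw [tsum_zero] at hlim'
  have hω : Tendsto (fun n => ((ω n ^ 2 : ℝ) : ℂ)) atTop (𝓝 ((ωStar ^ 2 : ℝ) : ℂ)) :=
    (Complex.continuous_ofReal.tendsto _).comp (h.omega_lim.pow 2)
  have h1 := hω.mul hlim'
  rw [mul_zero] at h1
  rw [← tendsto_nhds_unique hlim (h1.congr fun n => ((h.eigen n).weak_nodal (h.profile n)
    (h.eps_pos n) (h.eps_le n) hA hAB hS).symm)]
  exact hs.hasSum

end IsLimit

end TreeData

/-! ### The weak equation and the Kirchhoff conditions on the metric tree -/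

theorem enorm_integral_inner_le {α : Type*} [MeasurableSpace α] {μ : Measure α} {f g : α → ℂ}
    (hf : MemLp f 2 μ) (hg : MemLp g 2 μ) :
    ‖∫ x, inner ℂ (f x) (g x) ∂μ‖ₑ ≤ eLpNorm f 2 μ * eLpNorm g 2 μ := by
  refine (enorm_integral_le_lintegral_enorm _).trans ?_
  rw [← eLpNorm_one_eq_lintegral_enorm]
  have := eLpNorm_le_eLpNorm_mul_eLpNorm_of_nnnorm (p := 2) (q := 2) (r := 1) hf.1 hg.1
    (fun x y => inner ℂ x y) 1 (.of_forall fun x => by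
      rw [one_mul]; exact nnnorm_inner_le_nnnorm _ _)
  simpa using this

theorem contDiff_oscSol (ω : ℝ) (c : ℂ × ℂ) {n : WithTop ℕ∞} : ContDiff ℝ n (oscSol ω c) :=
  (contDiff_const.mul (Complex.ofRealCLM.contDiff.comp
    (Real.contDiff_cos.comp (contDiff_const.mul contDiff_id)))).add
    (contDiff_const.mul (Complex.ofRealCLM.contDiff.comp (contDiff_sinSol ω)))

namespace TreeData

variable {d k : ℕ} (T : TreeData d k)

theorem contDiff_profile (ω : ℝ) (a : Word k → ℂ × ℂ) (w : Word k) {n : WithTop ℕ∞} :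
    ContDiff ℝ n (T.profile ω a w) :=
  (contDiff_oscSol ω (a w)).comp (contDiff_id.sub contDiff_const)

theorem hasSum_integral_treeMeasure {E : Type*} [NormedAddCommGroup E] [NormedSpace ℝ E]
    {F : Word k × ℝ → E} (hF : Integrable F T.treeMeasure) :
    HasSum (fun w => T.rho w • ∫ t in Icc 0 (T.edgeLen w), F (w, t)) (∫ q, F q ∂T.treeMeasure) := by
  rw [treeMeasure_eq] at hF ⊢
  have h := hasSum_integral_sumMeasure hF
  simp only [integral_smul_measure, ENNReal.toReal_ofReal (T.rho_pos _).le] at h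
  exact h

theorem ae_treeMeasure_iff {p : Word k × ℝ → Prop} : (∀ᵐ q ∂T.treeMeasure, p q) ↔
    ∀ w, ∀ᵐ t ∂volume.restrict (Icc 0 (T.edgeLen w)), p (w, t) := by
  rw [treeMeasure_eq, ae_sumMeasure_iff]
  exact forall_congr' fun w =>
    Measure.ae_ennreal_smul_measure_iff (ENNReal.ofReal_pos.2 (T.rho_pos w)).ne'

theorem memLp_restrict_of_treeMeasure {F : Word k × ℝ → ℂ} (hF : MemLp F 2 T.treeMeasure)
    (w : Word k) : MemLp (fun t => F (w, t)) 2 (volume.restrict (Icc 0 (T.edgeLen w))) := by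
  rw [treeMeasure_eq] at hF
  have h := (hF.prodMk_left w).smul_measure (c := (ENNReal.ofReal (T.rho w))⁻¹)
    (ENNReal.inv_ne_top.2 (ENNReal.ofReal_pos.2 (T.rho_pos w)).ne')
  rwa [smul_smul, ENNReal.inv_mul_cancel (ENNReal.ofReal_pos.2 (T.rho_pos w)).ne'
    ENNReal.ofReal_ne_top, one_smul] at h

/-- Fatou's lemma for the masses of functions on the inflated edges. -/
theorem memLp_of_tendsto {ε : ℕ → ℝ} {p : ℕ → Word k → ℝ → ℂ} {p₀ : Word k → ℝ → ℂ} {Λ : ℝ}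
    (hp : ∀ n w, Continuous (p n w)) (hp₀ : ∀ w, Continuous (p₀ w))
    (hs : ∀ w, Tendsto (fun n => T.edgeStart (ε n) w) atTop (𝓝 0))
    (he : ∀ w, Tendsto (fun n => T.edgeEnd (ε n) w) atTop (𝓝 (T.edgeLen w)))
    (hlim : ∀ w t, Tendsto (fun n => p n w t) atTop (𝓝 (p₀ w t)))
    (hle : ∀ n, ∑' w, ENNReal.ofReal (T.rho w) *
      ∫⁻ t in Ioo (T.edgeStart (ε n) w) (T.edgeEnd (ε n) w), ‖p n w t‖ₑ ^ 2 ≤ ENNReal.ofReal Λ) :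
    MemLp (fun q : Word k × ℝ => p₀ q.1 q.2) 2 T.treeMeasure := by
  refine memLp_two_iff.2 ⟨?_, ?_⟩
  · rw [treeMeasure_eq, aestronglyMeasurable_sumMeasure_iff]
    exact fun w => (hp₀ w).aestronglyMeasurable
  set F : ℕ → Word k × ℝ → ENNReal := fun n q =>
    (Ioo (T.edgeStart (ε n) q.1) (T.edgeEnd (ε n) q.1)).indicator (fun t => ‖p n q.1 t‖ₑ ^ 2) q.2
  have hF : ∀ n, AEMeasurable (F n) T.treeMeasure := fun n => by
    refine AEStronglyMeasurable.aemeasurable ?_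
    rw [treeMeasure_eq, aestronglyMeasurable_sumMeasure_iff]
    intro w
    change AEStronglyMeasurable ((Ioo (T.edgeStart (ε n) w) (T.edgeEnd (ε n) w)).indicator
      fun t => ‖p n w t‖ₑ ^ 2) _
    exact (((hp n w).measurable.enorm.pow_const 2).indicator measurableSet_Ioo).aestronglyMeasurable
  have hFle : ∀ n, ∫⁻ q, F n q ∂T.treeMeasure ≤ ENNReal.ofReal Λ := fun n => by
    refine le_trans ?_ (hle n)
    rw [treeMeasure_eq, lintegral_sumMeasure]
    refine ENNReal.tsum_le_tsum fun w => ?_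
    rw [lintegral_smul_measure, smul_eq_mul]
    simp only [F]
    rw [lintegral_indicator measurableSet_Ioo, Measure.restrict_restrict measurableSet_Ioo]
    gcongr
    exact inter_subset_left
  have hae : ∀ᵐ q ∂T.treeMeasure, ‖p₀ q.1 q.2‖ₑ ^ 2 ≤ liminf (fun n => F n q) atTop := by
    rw [ae_treeMeasure_iff]
    intro w
    rw [← restrict_Ioo_eq_restrict_Icc]
    filter_upwards [ae_restrict_mem measurableSet_Ioo] with t ht
    have h1 : Tendsto (fun n => ‖p n w t‖ₑ ^ 2) atTop (𝓝 (‖p₀ w t‖ₑ ^ 2)) :=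
      ENNReal.Tendsto.pow ((hlim w t).enorm)
    have h2 : Tendsto (fun n => F n (w, t)) atTop (𝓝 (‖p₀ w t‖ₑ ^ 2)) := by
      refine h1.congr' ?_
      filter_upwards [(hs w).eventually_lt_const ht.1, (he w).eventually_const_lt ht.2] with n h3 h4
      exact (indicator_of_mem (s := Ioo (T.edgeStart (ε n) w) (T.edgeEnd (ε n) w)) ⟨h3, h4⟩
        fun t => ‖p n w t‖ₑ ^ 2).symm
    exact h2.liminf_eq.ge
  refine ((lintegral_mono_ae hae).trans (lintegral_liminf_le' hF)).trans_lt
    (lt_of_le_of_lt (b := ENNReal.ofReal Λ) ?_ ENNReal.ofReal_lt_top)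
  exact liminf_le_of_frequently_le' (Frequently.of_forall hFle)

section TestFunction

variable {T} {f : Word k × ℝ → ℂ}

theorem IsC1Tree.continuousOn_treeDeriv (hf : T.IsC1Tree f) (w : Word k) :
    ContinuousOn (fun t => T.treeDeriv f (w, t)) (Icc 0 (T.edgeLen w)) :=
  (hf.contDiffOn w).continuousOn_derivWithin (uniqueDiffOn_Icc (T.edgeLen_pos w)) le_rfl

theorem IsC1Tree.hasDerivAt (hf : T.IsC1Tree f) (w : Word k) {t : ℝ}
    (ht : t ∈ Ioo 0 (T.edgeLen w)) :
    HasDerivAt (fun t => f (w, t)) (T.treeDeriv f (w, t)) t :=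
  (((hf.contDiffOn w).differentiableOn one_ne_zero t
    (Ioo_subset_Icc_self ht)).hasDerivWithinAt).hasDerivAt (Icc_mem_nhds ht.1 ht.2)

theorem summable_rho_mul_integral_sq {F : Word k × ℝ → ℂ} (hF : MemLp F 2 T.treeMeasure) :
    Summable fun w => T.rho w * ∫ t in Icc 0 (T.edgeLen w), ‖F (w, t)‖ ^ 2 :=
  (T.hasSum_integral_treeMeasure (hF.integrable_norm_pow two_ne_zero)).summable

/-- The vertex values of a test function of finite norm have finite energy. -/
theorem IsC1Tree.summable_nodalEnergy (hf : T.IsC1Tree f) (hs : Summable T.len)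
    (h1 : MemLp f 2 T.treeMeasure) (h2 : MemLp (T.treeDeriv f) 2 T.treeMeasure) :
    Summable (T.nodalEnergy (fun w => f (w, 0)) fun w => f (w, T.edgeLen w)) := by
  -- The finite radius bounds the length of every edge, so the factors `ℓ²` in the pointwise
  -- estimates can be replaced by a constant.
  set L := ∑' n, T.len n
  have hL : ∀ w : Word k, T.edgeLen w ≤ L := fun w => hs.le_tsum _ fun n _ => (T.len_pos n).le
  refine Summable.of_nonneg_of_le (fun w => T.nodalEnergy_nonneg w) (fun w => ?_)
    (((summable_rho_mul_integral_sq h1).mul_left 4).add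
      ((summable_rho_mul_integral_sq h2).mul_left (1 + 4 * L ^ 2)))
  have hl := T.edgeLen_pos w
  have hρ := T.rho_pos w
  have e : ∀ {F : Word k × ℝ → ℂ}, MemLp F 2 T.treeMeasure →
      ∫⁻ t in Ioo 0 (T.edgeLen w), ‖F (w, t)‖ₑ ^ 2 =
        ENNReal.ofReal (∫ t in Icc 0 (T.edgeLen w), ‖F (w, t)‖ ^ 2) := fun hF => by
    rw [restrict_Ioo_eq_restrict_Icc]
    exact (T.memLp_restrict_of_treeMeasure hF w).integral_sq_eq
  have hI : ∀ F : Word k × ℝ → ℂ, 0 ≤ ∫ t in Icc 0 (T.edgeLen w), ‖F (w, t)‖ ^ 2 := fun F =>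
    integral_nonneg fun _ => sq_nonneg _
  have hd := enorm_sub_sq_le_of_hasDerivAt (hf.contDiffOn w).continuousOn
    (fun t => hf.hasDerivAt w) (hf.continuousOn_treeDeriv w) (right_mem_Icc.2 hl.le)
    (left_mem_Icc.2 hl.le)
  rw [e h2, sub_zero, abs_of_pos hl, ← ENNReal.ofReal_mul hl.le, enorm_sq_eq_ofReal,
    ENNReal.ofReal_le_ofReal_iff (mul_nonneg hl.le (hI _))] at hd
  have hv : ∀ x ∈ Icc 0 (T.edgeLen w), T.edgeLen w * ‖f (w, x)‖ ^ 2 ≤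
      2 * (∫ t in Icc 0 (T.edgeLen w), ‖f (w, t)‖ ^ 2) +
        2 * (L ^ 2 * ∫ t in Icc 0 (T.edgeLen w), ‖T.treeDeriv f (w, t)‖ ^ 2) := fun x hx => by
    have h3 := length_mul_enorm_sq_le (hf.contDiffOn w).continuousOn
      (fun t => hf.hasDerivAt w) (hf.continuousOn_treeDeriv w) hx
    have hm := hI f
    have he := hI (T.treeDeriv f)
    rw [e h1, e h2, sub_zero, enorm_sq_eq_ofReal, ← ENNReal.ofReal_mul hl.le,
      ← ENNReal.ofReal_pow hl.le, ← ENNReal.ofReal_mul (sq_nonneg _), ENNReal_two_mul,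
      ENNReal_two_mul (ENNReal.ofReal (T.edgeLen w ^ 2 * _)),
      ← ENNReal.ofReal_mul zero_le_two, ← ENNReal.ofReal_mul zero_le_two,
      ← ENNReal.ofReal_add (by positivity) (by positivity),
      ENNReal.ofReal_le_ofReal_iff (by positivity)] at h3
    refine h3.trans ?_
    gcongr
    exact hL w
  have h3 := hv _ (left_mem_Icc.2 hl.le)
  have h4 := hv _ (right_mem_Icc.2 hl.le)
  have h5 : (T.edgeLen w)⁻¹ * ‖f (w, T.edgeLen w) - f (w, 0)‖ ^ 2 ≤
      ∫ t in Icc 0 (T.edgeLen w), ‖T.treeDeriv f (w, t)‖ ^ 2 := by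
    rwa [inv_mul_le_iff₀ hl]
  rw [nodalEnergy]
  calc _ ≤ T.rho w * (4 * (∫ t in Icc 0 (T.edgeLen w), ‖f (w, t)‖ ^ 2) +
        (1 + 4 * L ^ 2) * ∫ t in Icc 0 (T.edgeLen w), ‖T.treeDeriv f (w, t)‖ ^ 2) := by
        refine mul_le_mul_of_nonneg_left ?_ hρ.le
        linarith
    _ = _ := by ring

/-- Integration by parts for a test function and a profile. -/
theorem IsC1Tree.integral_treeDeriv_mul (hf : T.IsC1Tree f) (ω : ℝ) (a : Word k → ℂ × ℂ)
    (w : Word k) :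
    (∫ t in Icc 0 (T.edgeLen w), inner ℂ (T.treeDeriv f (w, t)) (T.profileDeriv ω a w t)) -
      (ω ^ 2 : ℝ) * ∫ t in Icc 0 (T.edgeLen w), inner ℂ (f (w, t)) (T.profile ω a w t) =
    conj (f (w, T.edgeLen w)) * T.profileDeriv ω a w (T.edgeLen w) -
      conj (f (w, 0)) * T.profileDeriv ω a w 0 := by
  have hl := T.edgeLen_pos w
  have hcf := Complex.continuous_conj.comp_continuousOn (hf.contDiffOn w).continuousOn
  have hcg := Complex.continuous_conj.comp_continuousOn (hf.continuousOn_treeDeriv w)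
  have hc1 : ContinuousOn (fun t => T.profileDeriv ω a w t * conj (T.treeDeriv f (w, t)))
      (Icc 0 (T.edgeLen w)) := (T.continuous_profileDeriv ω a w).continuousOn.mul hcg
  have hc2 : ContinuousOn (fun t => ((ω ^ 2 : ℝ) : ℂ) * (T.profile ω a w t * conj (f (w, t))))
      (Icc 0 (T.edgeLen w)) :=
    continuousOn_const.mul ((T.continuous_profile ω a w).continuousOn.mul hcf)
  have hi1 := hc1.intervalIntegrable_of_Icc hl.le (μ := volume)
  have hi2 := hc2.intervalIntegrable_of_Icc hl.le (μ := volume)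
  have h := intervalIntegral.integral_eq_sub_of_hasDerivAt_of_le hl.le
    (f := fun t => conj (f (w, t)) * T.profileDeriv ω a w t)
    (hcf.mul (T.continuous_profileDeriv ω a w).continuousOn)
    (fun t ht => by
      have h1 : HasDerivAt (fun t => conj (f (w, t))) (conj (T.treeDeriv f (w, t))) t :=
        (hf.hasDerivAt w ht).star
      refine (h1.mul (T.hasDerivAt_profileDeriv ω a w t)).congr_deriv ?_
      show _ = T.profileDeriv ω a w t * conj (T.treeDeriv f (w, t)) -
        ((ω ^ 2 : ℝ) : ℂ) * (T.profile ω a w t * conj (f (w, t)))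
      ring)
    (hi1.sub hi2)
  rw [intervalIntegral.integral_sub hi1 hi2, intervalIntegral.integral_const_mul,
    intervalIntegral.integral_of_le hl.le, intervalIntegral.integral_of_le hl.le,
    ← integral_Icc_eq_integral_Ioc, ← integral_Icc_eq_integral_Ioc] at h
  exact h

end TestFunction

namespace IsLimit

variable {T} {ε ω : ℕ → ℝ} {u : ℕ → Piece k × EuclideanSpace ℝ (Fin (d + 1)) → ℂ}
  {G : ℕ → Piece k × EuclideanSpace ℝ (Fin (d + 1)) → EuclideanSpace ℂ (Fin (d + 1))}
  {a : ℕ → Word k → ℂ × ℂ} {Λ ωStar : ℝ} {aStar : Word k → ℂ × ℂ}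

theorem memLp_profile (h : T.IsLimit ε ω u G a Λ ωStar aStar) :
    MemLp (fun q : Word k × ℝ => T.profile ωStar aStar q.1 q.2) 2 T.treeMeasure := by
  refine T.memLp_of_tendsto (Λ := 1) (fun n w => T.continuous_profile (ω n) (a n) w)
    (fun w => T.continuous_profile _ _ w) h.tendsto_edgeStart h.tendsto_edgeEnd
    (fun w t => h.tendsto_profile w tendsto_const_nhds) fun n => ?_
  rw [← h.mass n, ENNReal.ofReal_tsum_of_nonneg (fun w => T.wordMass_nonneg (h.eps_pos n) w)
    (h.hasSum_mass n).summable]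
  refine ENNReal.tsum_le_tsum fun w => ?_
  change _ * T.profileMass (ε n) (ω n) (a n) w ≤ _
  rw [← ENNReal.ofReal_toReal (T.profileMass_ne_top (ε n) (ω n) (a n) w),
    ← ENNReal.ofReal_mul (T.rho_pos w).le]
  exact ENNReal.ofReal_le_ofReal (((h.profile n).rho_mul_mass_le (h.eps_pos n) w).trans
    (T.pieceMass_edge_le_wordMass (h.eps_pos n) w))

theorem memLp_profileDeriv (h : T.IsLimit ε ω u G a Λ ωStar aStar) :
    MemLp (fun q : Word k × ℝ => T.profileDeriv ωStar aStar q.1 q.2) 2 T.treeMeasure := by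
  refine T.memLp_of_tendsto (Λ := Λ) (fun n w => T.continuous_profileDeriv (ω n) (a n) w)
    (fun w => T.continuous_profileDeriv _ _ w) h.tendsto_edgeStart h.tendsto_edgeEnd
    (fun w t => h.tendsto_profileDeriv w tendsto_const_nhds) fun n => ?_
  refine le_trans ?_ (ENNReal.ofReal_le_ofReal (h.energy n))
  rw [ENNReal.ofReal_tsum_of_nonneg (fun w => T.wordMass_nonneg (h.eps_pos n) w)
    (h.summable_energy n)]
  refine ENNReal.tsum_le_tsum fun w => ?_
  change _ * T.profileEnergy (ε n) (ω n) (a n) w ≤ _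
  rw [← ENNReal.ofReal_toReal (T.profileEnergy_ne_top (ε n) (ω n) (a n) w),
    ← ENNReal.ofReal_mul (T.rho_pos w).le]
  exact ENNReal.ofReal_le_ofReal (((h.profile n).rho_mul_energy_le (h.eps_pos n) w).trans
    (T.pieceMass_edge_le_wordMass (h.eps_pos n) w))

theorem isC1Tree (h : T.IsLimit ε ω u G a Λ ωStar aStar) :
    T.IsC1Tree fun q => T.profile ωStar aStar q.1 q.2 :=
  ⟨fun w => (T.contDiff_profile _ _ w).contDiffOn, h.profile_child_zero⟩

/-- The limit profile is itself a `C¹` function that vanishes at the root, and Fatou's lemma gives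
it finite norm. It serves as its own approximation. -/
theorem memH10Tree (h : T.IsLimit ε ω u G a Λ ωStar aStar) :
    T.MemH10Tree (fun q => T.profile ωStar aStar q.1 q.2)
      fun q => T.profileDeriv ωStar aStar q.1 q.2 := by
  have hae : (fun q : Word k × ℝ => T.profileDeriv ωStar aStar q.1 q.2) =ᵐ[T.treeMeasure]
      T.treeDeriv fun q => T.profile ωStar aStar q.1 q.2 := by
    refine T.ae_treeMeasure_iff.2 fun w => ?_
    filter_upwards [ae_restrict_mem measurableSet_Icc] with t ht
    exact ((T.hasDerivAt_profile ωStar aStar w t).hasDerivWithinAt.derivWithin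
      (uniqueDiffOn_Icc (T.edgeLen_pos w) t ht)).symm
  refine ⟨h.memLp_profile, h.memLp_profileDeriv, fun η hη => ⟨_, h.isC1Tree, h.profile_root_zero,
    h.memLp_profile, h.memLp_profileDeriv.ae_eq hae, by simpa using hη, ?_⟩⟩
  rw [eLpNorm_congr_ae (g := 0) (hae.mono fun q hq => by simp [hq])]
  simpa using hη

/-- The limit equation, tested with `C¹` functions. -/
theorem weak_of_isC1Tree (h : T.IsLimit ε ω u G a Λ ωStar aStar) (hs : Summable T.len)
    {f : Word k × ℝ → ℂ} (hf : T.IsC1Tree f) (hroot : f (Word.root k, 0) = 0)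
    (h1 : MemLp f 2 T.treeMeasure) (h2 : MemLp (T.treeDeriv f) 2 T.treeMeasure) :
    ∫ q, inner ℂ (T.treeDeriv f q) (T.profileDeriv ωStar aStar q.1 q.2) ∂T.treeMeasure =
      (ωStar ^ 2 : ℝ) * ∫ q, inner ℂ (f q) (T.profile ωStar aStar q.1 q.2) ∂T.treeMeasure := by
  have e1 := T.hasSum_integral_treeMeasure (h2.integrable_inner_two h.memLp_profileDeriv)
  have e2 := T.hasSum_integral_treeMeasure (h1.integrable_inner_two h.memLp_profile)
  -- After integration by parts against the limit profile, a test function enters only through its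
  -- values at the ends of the edges. The identity for vertex data therefore covers all `C¹` test
  -- functions.
  have e3 := h.hasSum_nodal (A := fun w => f (w, 0)) (B := fun w => f (w, T.edgeLen w)) hroot
    (fun w i => hf.continuous_vertex w i) (hf.summable_nodalEnergy hs h1 h2)
  have e4 := e1.sub (e2.mul_left ((ωStar ^ 2 : ℝ) : ℂ))
  refine sub_eq_zero.1 (HasSum.unique (e4.congr_fun fun w => ?_) e3)
  rw [← hf.integral_treeDeriv_mul]
  simp only [Complex.real_smul]
  ring

/-- The limit equation. -/
theorem weak (h : T.IsLimit ε ω u G a Λ ωStar aStar) (hs : Summable T.len) {v g : Word k × ℝ → ℂ}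
    (hv : T.MemH10Tree v g) :
    ∫ q, inner ℂ (g q) (T.profileDeriv ωStar aStar q.1 q.2) ∂T.treeMeasure =
      (ωStar ^ 2 : ℝ) * ∫ q, inner ℂ (v q) (T.profile ωStar aStar q.1 q.2) ∂T.treeMeasure := by
  obtain ⟨hv1, hv2, hv3⟩ := hv
  set P : Word k × ℝ → ℂ := fun q => T.profile ωStar aStar q.1 q.2
  set Q : Word k × ℝ → ℂ := fun q => T.profileDeriv ωStar aStar q.1 q.2
  have hP : MemLp P 2 T.treeMeasure := h.memLp_profile
  have hQ : MemLp Q 2 T.treeMeasure := h.memLp_profileDeriv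
  have hsub : ∀ {x y z : Word k × ℝ → ℂ}, MemLp x 2 T.treeMeasure → MemLp y 2 T.treeMeasure →
      MemLp z 2 T.treeMeasure → ∫ q, inner ℂ (x q) (z q) ∂T.treeMeasure =
        (∫ q, inner ℂ ((x - y) q) (z q) ∂T.treeMeasure) +
          ∫ q, inner ℂ (y q) (z q) ∂T.treeMeasure := fun hx hy hz => by
    rw [← integral_add ((hx.sub hy).integrable_inner_two hz) (hy.integrable_inner_two hz)]
    simp only [Pi.sub_apply, ← inner_add_left, sub_add_cancel]
  -- The two sides agree for the approximating `C¹` functions, so their difference is bounded by the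
  -- approximation error, here `1 / n`.
  have hle : ∀ n : ℕ, ‖(∫ q, inner ℂ (g q) (Q q) ∂T.treeMeasure) -
      (ωStar ^ 2 : ℝ) * ∫ q, inner ℂ (v q) (P q) ∂T.treeMeasure‖ₑ ≤ (n : ENNReal)⁻¹ *
        (eLpNorm Q 2 T.treeMeasure + ‖((ωStar ^ 2 : ℝ) : ℂ)‖ₑ * eLpNorm P 2 T.treeMeasure) := by
    intro n
    obtain ⟨f, hf, hroot, hf1, hf2, hvf, hgf⟩ := hv3 (n : ENNReal)⁻¹
      (ENNReal.inv_pos.2 (ENNReal.natCast_ne_top n))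
    have h1 := h.weak_of_isC1Tree hs hf hroot hf1 hf2
    rw [hsub hv2 hf2 hQ, hsub hv1 hf1 hP, mul_add]
    have h2 : ∀ x y z w : ℂ, y = w → x + y - (z + w) = x - z := fun x y z w hyw => by
      rw [hyw]; ring
    rw [h2 _ _ _ _ h1]
    refine (enorm_sub_le).trans ?_
    rw [mul_add, enorm_mul, mul_left_comm]
    gcongr
    · exact (enorm_integral_inner_le (hv2.sub hf2) hQ).trans (mul_le_mul_left hgf.le _)
    · exact (enorm_integral_inner_le (hv1.sub hf1) hP).trans (mul_le_mul_left hvf.le _)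
  have hlim := ENNReal.Tendsto.mul_const ENNReal.tendsto_inv_nat_nhds_zero
    (Or.inr (by have := hP.eLpNorm_ne_top; have := hQ.eLpNorm_ne_top; finiteness) :
      (0 : ENNReal) ≠ 0 ∨ eLpNorm Q 2 T.treeMeasure +
        ‖((ωStar ^ 2 : ℝ) : ℂ)‖ₑ * eLpNorm P 2 T.treeMeasure ≠ ⊤)
  rw [zero_mul] at hlim
  exact sub_eq_zero.1 (enorm_eq_zero.1 (le_antisymm (ge_of_tendsto' hlim hle) zero_le))

theorem isTreeEigenfunction (h : T.IsLimit ε ω u G a Λ ωStar aStar) (hk : 1 ≤ k)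
    (hs : Summable T.len) :
    T.IsTreeEigenfunction (ωStar ^ 2) fun q => T.profile ωStar aStar q.1 q.2 := by
  refine ⟨_, h.memH10Tree, fun h0 => ?_, fun v g hv => h.weak hs hv⟩
  obtain ⟨w, t, ht, hne⟩ := h.exists_profile_ne_zero hk hs
  exact hne (Measure.eqOn_Icc_of_ae_eq (μ := volume) (T.edgeLen_pos w).ne
    (T.ae_treeMeasure_iff.1 h0 w) (T.continuous_profile _ _ w).continuousOn continuousOn_const ht)

/-- Test with the vertex data that are `1` at `w` and `0` at all other vertices: `B` is `1` on the
edge that ends at `w`, and `A` is `1` on the edges that start there. Only the edges that meet at `w`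
contribute. -/
theorem kirchhoff (h : T.IsLimit ε ω u G a Λ ωStar aStar) :
    T.Kirchhoff fun q => T.profile ωStar aStar q.1 q.2 := by
  classical
  refine ⟨h.isC1Tree, fun w => ?_⟩
  have hinj : ∀ {i j : Fin k} {v : Word k}, Word.child i v = Word.child j w → v = w :=
    fun {i j v} hv => congrArg Prod.snd (@Word.child_injective k (i, v) (j, w) hv)
  set A : Word k → ℂ := fun v => if ∃ i, v = Word.child i w then 1 else 0
  set B : Word k → ℂ := fun v => if v = w then 1 else 0
  have hout : ∀ v ∉ range w.nbr, A v = 0 ∧ B v = 0 := fun v hv =>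
    ⟨if_neg fun ⟨i, hi⟩ => hv ⟨some i, hi.symm⟩, if_neg fun hi => hv ⟨none, hi.symm⟩⟩
  have h1 := h.hasSum_nodal (A := A) (B := B) (if_neg fun ⟨i, hi⟩ => Word.child_ne_root i w hi.symm)
    (fun v i => by
      by_cases hv : v = w
      · subst hv
        simp only [A, B, if_pos, if_pos (⟨i, rfl⟩ : ∃ j, Word.child i v = Word.child j v)]
      · rw [show A _ = 0 from if_neg fun ⟨j, hj⟩ => hv (hinj hj), show B v = 0 from if_neg hv])
    (summable_of_ne_finset_zero (s := Finset.univ.image w.nbr) fun v hv => by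
      obtain ⟨h2, h3⟩ := hout v fun ⟨j, hj⟩ => hv (Finset.mem_image.2 ⟨j, Finset.mem_univ _, hj⟩)
      simp [nodalEnergy, h2, h3])
  rw [← (Word.nbr_injective w).hasSum_iff fun v hv => by simp [hout v hv]] at h1
  have h2 := (hasSum_fintype _).unique h1
  -- The boundary terms of the integration by parts point out of the edges, that is, towards `w`,
  -- whereas the Kirchhoff sum uses derivatives away from `w`.
  rw [← neg_eq_zero, ← Finset.sum_neg_distrib] at h2
  rw [← h2]
  refine Finset.sum_congr rfl fun j _ => ?_
  have hl := T.edgeLen_pos (w.nbr j)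
  have hu := uniqueDiffOn_Icc hl 0 (left_mem_Icc.2 hl.le)
  have hA0 : A w = 0 := if_neg fun ⟨i, hi⟩ => Word.child_ne_self i w hi.symm
  have hB1 : B w = 1 := if_pos rfl
  cases j with
  | none =>
    have h3 : HasDerivAt (fun r => T.profile ωStar aStar w (T.edgeLen w - r))
        (-T.profileDeriv ωStar aStar w (T.edgeLen w)) 0 := by
      have := (T.hasDerivAt_profile ωStar aStar w (T.edgeLen w - 0)).comp_const_sub (T.edgeLen w) 0
      rwa [sub_zero] at this
    have h4 := h3.hasDerivWithinAt.derivWithin hu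
    simp only [Function.comp, Word.nbr, legPos] at h4 ⊢
    rw [h4, hA0, hB1]
    simp
  | some i =>
    have h4 := (T.hasDerivAt_profile ωStar aStar (Word.child i w) 0).hasDerivWithinAt.derivWithin hu
    have hA1 : A (Word.child i w) = 1 := if_pos ⟨i, rfl⟩
    have hB0 : B (Word.child i w) = 0 := if_neg (Word.child_ne_self i w)
    simp only [Function.comp, Word.nbr, legPos] at h4 ⊢
    rw [h4, hA1, hB0]
    simp

end IsLimit

theorem neg_iteratedDerivWithin_profile (ω : ℝ) (a : Word k → ℂ × ℂ) (w : Word k) {t : ℝ}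
    (ht : t ∈ Icc 0 (T.edgeLen w)) :
    -iteratedDerivWithin 2 (T.profile ω a w) (Icc 0 (T.edgeLen w)) t =
      (ω ^ 2 : ℝ) * T.profile ω a w t := by
  have h1 : deriv (T.profile ω a w) = T.profileDeriv ω a w :=
    funext fun θ => (T.hasDerivAt_profile ω a w θ).deriv
  rw [iteratedDerivWithin_eq_iteratedDeriv (uniqueDiffOn_Icc (T.edgeLen_pos w))
    (T.contDiff_profile ω a w).contDiffAt ht, iteratedDeriv_succ, iteratedDeriv_one, h1,
    (T.hasDerivAt_profileDeriv ω a w t).deriv]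
  ring

end TreeData

/-! ### Conclusion -/

theorem mainTheorem2 {d k : ℕ} (hd : 1 ≤ d) (hk : 1 ≤ k) (T : TreeData d k)
    (hradius : Summable T.len)
    (ψ : Option (Fin k) → Option (Fin k) → ℝ → ℝ) (hψ : T.IsSkeletonPartition ψ)
    (ε : ℕ → ℝ) (hε : ∀ n, 0 < ε n ∧ ε n < 1) (hε_lim : Tendsto ε atTop (𝓝 0))
    (u : ℕ → Piece k × EuclideanSpace ℝ (Fin (d + 1)) → ℂ)
    (lam : ℕ → ℝ) (lamStar : ℝ)
    (hu : ∀ n, T.IsEigenfunction (ε n) (lam n) (u n))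
    (hu_norm : ∀ n, eLpNorm (u n) 2 (T.inflatedMeasure (ε n)) =
      ENNReal.ofReal (ε n ^ ((d : ℝ) / 2)))
    (hlam : Tendsto lam atTop (𝓝 lamStar)) :
    (∀ n, ∃ p, T.IsProjection ψ (ε n) (u n) p) ∧
    ∃ (ns : ℕ → ℕ) (uStar : Word k × ℝ → ℂ), StrictMono ns ∧
      T.IsTreeEigenfunction lamStar uStar ∧
      T.Kirchhoff uStar ∧
      uStar (Word.root k, 0) = 0 ∧
      (∀ w, ContDiffOn ℝ 2 (fun t => uStar (w, t)) (Icc 0 (T.edgeLen w)) ∧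
        ∀ t ∈ Icc 0 (T.edgeLen w),
          -iteratedDerivWithin 2 (fun t => uStar (w, t)) (Icc 0 (T.edgeLen w)) t =
            lamStar * uStar (w, t)) ∧
      ∀ p : ℕ → Word k × ℝ → ℂ, (∀ n, T.IsProjection ψ (ε n) (u n) (p n)) →
        ∀ w, TendstoUniformlyOn (fun m t => p (ns m) (w, t)) (fun t => uStar (w, t)) atTop
          (Icc 0 (T.edgeLen w)) := by
  obtain ⟨h0, ns, G, a, aStar, hns, h⟩ := T.exists_isLimit hε hε_lim hu hu_norm hlam
  have hsq : √lamStar ^ 2 = lamStar := Real.sq_sqrt h0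
  refine ⟨fun n => ?_, ns, fun q => T.profile √lamStar aStar q.1 q.2, hns, ?_, h.kirchhoff,
    h.profile_root_zero, fun w => ⟨(T.contDiff_profile _ _ w).contDiffOn, fun t ht => ?_⟩,
    fun p hp w => h.tendstoUniformlyOn_projection hψ (fun n => hp (ns n)) w⟩
  -- Existence of the projection needs no smallness of `ε n`, so it is obtained for each `n`
  -- separately and not along the subsequence.
  · obtain ⟨-, G', hG', -⟩ := (hu n).exists_isEigenpair (hε n).1 (hu_norm n)
    obtain ⟨a', ha'⟩ := hG'.exists_isProfile (hε n).1 (hε n).2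
    exact ⟨_, T.isProjection_projection (hε n).1 (hε n).2 hψ
      (fun w => T.continuous_profile _ a' w) ha'.average⟩
  · have h1 := h.isTreeEigenfunction hk hradius
    rwa [hsq] at h1
  · have h1 := T.neg_iteratedDerivWithin_profile √lamStar aStar w ht
    rwa [hsq] at h1
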